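/- **Setting.** Let $(\phi_t,M)$ be a transitive topological Anosov flow on a closed $3$-manifold: a non-singular continuous flow with a dense orbit that is orbitally expansive and whose stable and unstable sets of orbits are the leaves of two transverse non-singular foliations. Let $\iota:(\Sigma,\partial\Sigma)\to(M,\Gamma)$ be a Birkhoff section: $\Sigma$ is a compact surface, $\iota$ is an immersion, each component of $\partial\Sigma$ covers a periodic orbit in the finite union $\Gamma=\iota(\partial\Sigma)$ of periodic orbits, $\iota$ embeds $\mathring\Sigma=\Sigma\setminus\partial\Sigma$ in $M\setminus\Gamma$ transversely to the flow, and for some $T>0$ every orbit segment $[x,\phi_T(x)]$ meets $\iota(\Sigma)$. We identify $\mathring\Sigma$ with its image, and let $P:\mathring\Sigma\to\mathring\Sigma$ be the first return map. *Almost-Anosov structure.* $P$ is pseudo-Anosov, with stretching factor $0<\lambda<1$ and with singularities only at the points obtained by collapsing the components of $\partial\Sigma$ (each of which is a $k$-prong, $k\ge 2$). Its transverse measured foliations give a translation atlas on $\mathring\Sigma$, in which the stable (unstable) leaves are horizontal (vertical), with flat metric $dx^2+dy^2$ and with $P$ of the form $(x,y)\mapsto(\pm\lambda x+c,\pm\lambda^{-1}y+d)$.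 Choose an orbital equivalence, equal to the identity on $\mathring\Sigma$, between $\phi_t$ on $M\setminus\Gamma$ and the suspension flow on $\mathring\Sigma\times\mathbb R/(z,t)\sim(P(z),t-1)$. Pull back by it the smooth atlas with coordinates $(x,y,t)$ and the vector field $\partial/\partial t$; this gives the smooth atlas $\mathcal D_\Gamma$ and the smooth vector field $X_\Gamma$ on $M\setminus\Gamma$ induced by the section. *Parameters.* Let $\gamma\subset\Gamma$ be one of the periodic orbits, of saddle type with orientable local invariant manifolds; that is, near $\gamma$ the flow is orbitally equivalent to the suspension of $\mathrm{diag}(\mu,\nu)$, $0<\mu<1<\nu$, near its periodic orbit. Orient a neighbourhood of $\gamma$ (the statement holds for both orientations). Let $p\ge1$ be the number of components of $\partial\Sigma$ that cover $\gamma$. Let $a,b$ be the basis of the first homology of a punctured tubular neighbourhood of $\gamma$ for which $a$ is the positive meridian and $b$ is a curve in the local unstable manifold isotopic there to the oriented orbit $\gamma$. If $\sigma$ is a simple closed curve in $\Sigma$ near $\gamma$ that bounds together with $\gamma$ an annulus in a collar of one of these $p$ components, then, for the orientation of $\sigma$ with $n\ge1$, $[\sigma]=na+mb$; the integers $n,m$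 are the linking number and the multiplicity at $\gamma$. Let $\mathbb D_1,\dots,\mathbb D_4$ be the closed quadrants of $\mathbb R^2$ in counterclockwise order, $\mathbb D_1=\{x,y\ge0\}$. **Proposition.** In every neighbourhood of $\gamma$ there is an open tubular neighbourhood $W$ of $\gamma$ with $W\cap\Gamma=\gamma$, divided by the local stable and unstable manifolds of $\gamma$ into four closed quadrants $W_1,\dots,W_4$, indexed in the positive cyclic order and with $W_4\cap W_1$ in the local stable manifold; and there are an open neighbourhood $U$ of $0\in\mathbb R^2$ and homeomorphisms $$\Pi_i:W_i\setminus\gamma\to\big((U\cap\mathbb D_i)\setminus\{0\}\big)\times\mathbb R/\mathbb Z,\qquad i=1,\dots,4,$$ which are smooth charts (near each point of $W_i\setminus\gamma$, $\Pi_i$ is the restriction of a chart of the maximal atlas of $\mathcal D_\Gamma$, the last coordinate being taken modulo $1$), such that: 1. $D\Pi_i(X_\Gamma)=X_{(\lambda,p,n)}$, where $X_{(\lambda,p,n)}(x,y,z)=\big(\log(\lambda)x,\,-\log(\lambda)y,\,\tfrac1{np}\big)$. 2. $\Pi_i$ sends each connected component of $\Sigma\cap(W_i\setminus\gamma)$ isometrically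 (for the flat metrics $dx^2+dy^2$) onto a surface $\big((U\cap\mathbb D_i)\setminus\{0\}\big)\times\{\tfrac k{np}\}$ with $k\in\{0,\dots,np-1\}$, and the union of these components is the preimage by $\Pi_i$ of all the $np$ planes $z=\tfrac k{np}$. 3. The set $(W_i\cap W_{i+1})\setminus\gamma$ (indices modulo $4$) is sent both by $\Pi_i$ and by $\Pi_{i+1}$ onto $(U\cap\ell_i)\times\mathbb R/\mathbb Z$, where $\ell_1=\{0\}\times(0,\infty)$, $\ell_2=(-\infty,0)\times\{0\}$, $\ell_3=\{0\}\times(-\infty,0)$, $\ell_4=(0,\infty)\times\{0\}$. On these sets $$\Pi_2\circ\Pi_1^{-1}(0,y,z)=(0,y,z),\quad \Pi_3\circ\Pi_2^{-1}(x,0,z)=(x,0,z),\quad \Pi_4\circ\Pi_3^{-1}(0,y,z)=(0,y,z),$$ $$\Pi_1\circ\Pi_4^{-1}(x,0,z)=\big(x,0,z+\tfrac mn\big).$$ -/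

import Mathlib

open Set Filter Topology
open scoped Manifold ContDiff

namespace BirkhoffNormalForm

/-! ### Topological Anosov flows -/

section Flows

variable {M : Type*} [MetricSpace M]

/-- Orbital expansivity; the increasing homeomorphisms of `ℝ` are the order isomorphisms. -/
def OrbitallyExpansive (φ : Flow ℝ M) : Prop :=
  ∀ ε > 0, ∃ α > 0, ∀ (x y : M) (h : ℝ ≃o ℝ), h 0 = 0 →
    (∀ t : ℝ, dist (φ (h t) y) (φ t x) ≤ α) → ∃ s : ℝ, |s| ≤ ε ∧ y = φ s x

/-- The stable set of the orbit of `x`. -/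
def stableSet (φ : Flow ℝ M) (x : M) : Set M :=
  {y | ∃ (s : ℝ) (h : ℝ ≃o ℝ), h 0 = 0 ∧
    Tendsto (fun t : ℝ => dist (φ (h t) y) (φ (t + s) x)) atTop (𝓝 0)}

/-- The unstable set of the orbit of `x`. -/
def unstableSet (φ : Flow ℝ M) (x : M) : Set M :=
  {y | ∃ (s : ℝ) (h : ℝ ≃o ℝ), h 0 = 0 ∧
    Tendsto (fun t : ℝ => dist (φ (h t) y) (φ (t + s) x)) atBot (𝓝 0)}

/-- The level sets of the coordinate `f` in the charts of `𝒜` (whose domains cover `M` and whose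
images are all of `ℝ³`) are the plaques of a non-singular two-dimensional foliation, and the leaf
of `x` is `L x`. -/
def IsFoliationBy (𝒜 : Set (OpenPartialHomeomorph M (ℝ × ℝ × ℝ))) (f : ℝ × ℝ × ℝ → ℝ)
    (L : M → Set M) : Prop :=
  (∀ e ∈ 𝒜, ∀ e' ∈ 𝒜, ∀ q ∈ e.source ∩ e'.source, ∃ V ∈ 𝓝 q, ∀ q₁ ∈ V, ∀ q₂ ∈ V,
    (f (e q₁) = f (e q₂) ↔ f (e' q₁) = f (e' q₂))) ∧
  ∀ x, L x = {y | Relation.EqvGen (fun q₁ q₂ => ∃ e ∈ 𝒜, q₁ ∈ e.source ∧ q₂ ∈ e.source ∧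
    f (e q₁) = f (e q₂)) x y}

/-- A topological Anosov flow: non-singular, orbitally expansive, and the stable and unstable sets
of its orbits are the leaves of two transverse foliations without singularities (in common
foliated charts `(x, y, z)` the stable plaques are `y = const`, the unstable ones `x = const`). -/
structure IsTopologicalAnosov (φ : Flow ℝ M) : Prop where
  nonsingular : ∀ x, ∃ t, φ t x ≠ x
  expansive : OrbitallyExpansive φ
  foliations : ∃ 𝒜 : Set (OpenPartialHomeomorph M (ℝ × ℝ × ℝ)),
    (∀ q, ∃ e ∈ 𝒜, q ∈ e.source) ∧ (∀ e ∈ 𝒜, e.target = univ) ∧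
    IsFoliationBy 𝒜 (fun v => v.2.1) (stableSet φ) ∧
    IsFoliationBy 𝒜 (fun v => v.1) (unstableSet φ)

/-- Transitivity: there is a dense orbit. -/
def IsTransitive (φ : Flow ℝ M) : Prop := ∃ x, Dense (φ.orbit x)

/-- The linear saddle flow on `ℝ² × ℝ/ℤ`: the suspension of `diag (exp (-α), exp β)`. -/
noncomputable def linearSaddle (α β t : ℝ) (v : ℝ × ℝ × UnitAddCircle) : ℝ × ℝ × UnitAddCircle :=
  (Real.exp (-α * t) * v.1, Real.exp (β * t) * v.2.1, v.2.2 + (t : UnitAddCircle))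

/-- `τ` is a local orbital equivalence, from a neighbourhood of `γ` onto
`(-1,1)² × ℝ/ℤ`, between `φ` and a linear saddle flow with positive eigenvalues, taking `γ` to
`0 × ℝ/ℤ`. Thus `γ` is of saddle type with orientable local invariant manifolds
`W^s_loc = {y = 0}` and `W^u_loc = {x = 0}` in the coordinates `τ = (x, y, z)`.
The chart `τ` also orients a neighbourhood of `γ`. -/
structure IsSaddleChart (φ : Flow ℝ M) (γ : Set M)
    (τ : OpenPartialHomeomorph M (ℝ × ℝ × UnitAddCircle)) : Prop where
  target_eq : τ.target = {v | v.1 ∈ Ioo (-1 : ℝ) 1 ∧ v.2.1 ∈ Ioo (-1 : ℝ) 1}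
  orbit_subset : γ ⊆ τ.source
  mem_orbit_iff : ∀ q ∈ τ.source, q ∈ γ ↔ ((τ q).1 = 0 ∧ (τ q).2.1 = 0)
  orbits : ∃ α > 0, ∃ β > 0, ∀ q : M, ∀ T > 0, (∀ t ∈ Icc 0 T, φ t q ∈ τ.source) →
    ∃ h : ℝ → ℝ, h 0 = 0 ∧ ContinuousOn h (Icc 0 T) ∧ StrictMonoOn h (Icc 0 T) ∧
      ∀ t ∈ Icc 0 T, τ (φ t q) = linearSaddle α β (h t) (τ q)

/-- `W` is an open tubular neighbourhood of the closed curve `γ`. -/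
def IsTubularNhd (W γ : Set M) : Prop :=
  ∃ T : OpenPartialHomeomorph M (ℝ × ℝ × UnitAddCircle), T.source = W ∧ T.target = univ ∧
    γ = {q ∈ W | (T q).1 = 0 ∧ (T q).2.1 = 0}

end Flows

/-! ### Birkhoff sections and their combinatorial parameters -/

section Sections

variable {M : Type*} [MetricSpace M]
  {S : Type*} [TopologicalSpace S] [ChartedSpace (EuclideanHalfSpace 2) S]

/-- The boundary of the surface `S`. -/
abbrev bdry (S : Type*) [TopologicalSpace S] [ChartedSpace (EuclideanHalfSpace 2) S] : Set S :=
  ModelWithCorners.boundary (I := 𝓡∂ 2) S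

/-- The interior of the surface `S`. -/
abbrev intr (S : Type*) [TopologicalSpace S] [ChartedSpace (EuclideanHalfSpace 2) S] : Set S :=
  ModelWithCorners.interior (I := 𝓡∂ 2) S

/-- A Birkhoff section `ι : (S, ∂S) → (M, Γ)`, where `Γ = ι (∂S)`. -/
structure IsBirkhoffSection (φ : Flow ℝ M) (ι : S → M) : Prop where
  continuous : Continuous ι
  immersion : ∀ x, ∃ V ∈ 𝓝 x, InjOn ι V
  periodic : ∀ x ∈ bdry S, ∃ T > 0, φ T (ι x) = ι x
  covering : ∀ x ∈ bdry S,
    ∃ h : MapsTo ι (connectedComponentIn (bdry S) x) (φ.orbit (ι x)), IsCoveringMap (h.restrict ι _ _)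
  interior_compl : ∀ x ∈ intr S, ι x ∉ ι '' bdry S
  embedding : IsEmbedding (fun u : intr S => ι u)
  transverse : ∀ u : intr S, ∃ V : Set (intr S), IsOpen V ∧ u ∈ V ∧ ∃ δ > 0,
    IsOpenEmbedding (fun p : V × Ioo (-δ) δ => φ (p.2 : ℝ) (ι (p.1 : intr S)))
  meets : ∃ T > 0, ∀ x, ∃ t ∈ Icc 0 T, φ t x ∈ range ι

/-- The periodic orbits that make up `Γ`. -/
def boundaryOrbits (φ : Flow ℝ M) (ι : S → M) : Set (Set M) :=
  {γ | ∃ x ∈ bdry S, γ = φ.orbit (ι x)}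

/-- The components of `∂S` that cover `γ`. -/
def componentsOver (ι : S → M) (γ : Set M) : Set (Set S) :=
  {C | ∃ x ∈ bdry S, ι x ∈ γ ∧ C = connectedComponentIn (bdry S) x}

/-- The number `p (γ, S)` of boundary components at `γ`. -/
noncomputable def numComponents (ι : S → M) (γ : Set M) : ℕ := (componentsOver ι γ).ncard

/-- The closed curve `s ↦ (exp (2πins) / 2, m s)` in `τ`-coordinates. It represents
`n a + m b`, with `a` the meridian (positively oriented for `τ`) and `b` the longitude (a curve in
the local unstable manifold isotopic there to the oriented orbit `γ`). -/
noncomputable def modelLoop (τ : OpenPartialHomeomorph M (ℝ × ℝ × UnitAddCircle)) (n : ℕ) (m : ℤ)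
    (s : UnitAddCircle) : M :=
  τ.symm ((((AddCircle.toCircle s : Circle) : ℂ) ^ n).re / 2,
    (((AddCircle.toCircle s : Circle) : ℂ) ^ n).im / 2, m • s)

/-- `n` and `m` are the linking number and the multiplicity at `γ`: for some collar `c` of a
component `C` of `∂S` over `γ`, the curve `σ = ι (c (r, ·))`, which bounds with `γ` a band near `γ`,
is homotopic to `n a + m b` in the punctured tubular neighbourhood. (Its fundamental group is
`ℤ²`, so that homotopic means homologous.) The orientation of `σ` as boundary
of the band co-oriented by the flow is the one for which `n ≥ 1`. -/
def HasLinkingMultiplicity (ι : S → M) (γ : Set M)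
    (τ : OpenPartialHomeomorph M (ℝ × ℝ × UnitAddCircle)) (n : ℕ) (m : ℤ) : Prop :=
  1 ≤ n ∧ ∃ C ∈ componentsOver ι γ, ∃ c : Ico (0 : ℝ) 1 × UnitAddCircle → S,
    IsOpenEmbedding c ∧ c '' {q | (q.1 : ℝ) = 0} = C ∧
    ∃ r : Ico (0 : ℝ) 1, 0 < (r : ℝ) ∧ (∀ q, q.1 ≤ r → ι (c q) ∈ τ.source) ∧
    ∃ F : unitInterval × UnitAddCircle → M, Continuous F ∧ (∀ q, F q ∈ τ.source \ γ) ∧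
      (∀ s, F (0, s) = ι (c (r, s))) ∧ ∀ s, F (1, s) = modelLoop τ n m s

end Sections

/-! ### Pseudo-Anosov first return maps -/

/-- Near `x`, and up to signs and translations, `f` is `g` composed with `diag (l, l⁻¹)`. -/
def LocallyAffine {X : Type*} [TopologicalSpace X] (l : ℝ) (f g : X → ℝ × ℝ) (x : X) : Prop :=
  ∃ ε δ c d : ℝ, (ε = 1 ∨ ε = -1) ∧ (δ = 1 ∨ δ = -1) ∧
    ∀ᶠ x' in 𝓝 x, f x' = (ε * (l * (g x').1) + c, δ * (l⁻¹ * (g x').2) + d)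

theorem LocallyAffine.contDiffAt {X : Type*} [TopologicalSpace X] {l : ℝ} {g : X → ℝ × ℝ}
    {e : OpenPartialHomeomorph X (ℝ × ℝ)} {x : X} (h : LocallyAffine l g e x) (hx : x ∈ e.source) :
    ContDiffAt ℝ ∞ (g ∘ e.symm) (e x) := by
  obtain ⟨ε, δ, c, d, -, -, h⟩ := h
  have h1 : ContDiff ℝ ∞ (fun v : ℝ × ℝ => (ε * (l * v.1) + c, δ * (l⁻¹ * v.2) + d)) := by
    fun_prop
  refine h1.contDiffAt.congr_of_eventuallyEq ?_
  have h2 : Tendsto e.symm (𝓝 (e x)) (𝓝 x) := by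
    simpa [e.left_inv hx] using (e.continuousAt_symm (e.map_source hx)).tendsto
  filter_upwards [h2.eventually h, e.open_target.mem_nhds (e.map_source hx)] with v hv hv'
  simp only [Function.comp_apply, hv, e.right_inv hv']

theorem LocallyAffine.symm {X : Type*} [TopologicalSpace X] {l : ℝ} (hl : l ≠ 0)
    {f g : X → ℝ × ℝ} {x : X} (h : LocallyAffine l f g x) : LocallyAffine l⁻¹ g f x := by
  obtain ⟨ε, δ, c, d, hε, hδ, h⟩ := h
  refine ⟨ε, δ, -ε * l⁻¹ * c, -δ * l * d, hε, hδ, ?_⟩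
  filter_upwards [h] with v hv
  rw [hv]
  ext
  · rcases hε with rfl | rfl <;> field_simp <;> ring
  · rcases hδ with rfl | rfl <;> field_simp <;> ring

section PseudoAnosov

variable {S : Type*} [TopologicalSpace S] [ChartedSpace (EuclideanHalfSpace 2) S]

/-- The atlas `A` of the interior of `S` has a `k`-prong at the point obtained by collapsing the
boundary component `C`: some `ψ` identifies a neighbourhood of that point in the collapsed surface
with a disk in `ℂ`, and the charts of `A` are, up to signs and translations, the branches
of `ψ ^ (k / 2)`. -/
def HasProngAt (A : Set (OpenPartialHomeomorph (intr S) (ℝ × ℝ))) (C : Set S) (k : ℕ) : Prop :=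
  ∃ (N : Set S) (ψ : S → ℂ) (ρ : ℝ), IsOpen N ∧ C ⊆ N ∧ N ∩ bdry S = C ∧ 0 < ρ ∧
    ContinuousOn ψ N ∧ (∀ x ∈ N, ψ x = 0 ↔ x ∈ C) ∧ InjOn ψ (N \ C) ∧
    ψ '' N = Metric.ball 0 ρ ∧
    ∀ e ∈ A, ∀ u ∈ e.source, (u : S) ∈ N → ∃ w : intr S → ℂ, ContinuousAt w u ∧
      (∀ᶠ u' in 𝓝 u, w u' ^ 2 = ψ u' ^ k) ∧
      LocallyAffine 1 e (fun u' => ((w u').re, (w u').im)) u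

/-- The data that make the homeomorphism `P` of the interior of `S` a pseudo-Anosov map
(after collapsing each boundary component to a point), with singularities only at the
collapsed points. The two transverse measured foliations are recorded by
the translation atlas in which they are the horizontal (stable) and vertical (unstable) lines
with transverse measures `|dy|` and `|dx|`; the flat metric is `dx² + dy²`. -/
structure PseudoAnosovAtlas (P : intr S ≃ₜ intr S) where
  /-- the stretching factor -/
  lam : ℝ
  lam_pos : 0 < lam
  lam_lt_one : lam < 1
  /-- the translation atlas -/
  charts : Set (OpenPartialHomeomorph (intr S) (ℝ × ℝ))
  cover : ∀ u, ∃ e ∈ charts, u ∈ e.source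
  transition : ∀ e ∈ charts, ∀ e' ∈ charts, ∀ u ∈ e.source ∩ e'.source, LocallyAffine 1 e' e u
  affine : ∀ e ∈ charts, ∀ e' ∈ charts, ∀ u ∈ e.source, P u ∈ e'.source →
    LocallyAffine lam (fun u' => e' (P u')) e u
  prong : ∀ x ∈ bdry S, ∃ k ≥ 2, HasProngAt charts (connectedComponentIn (bdry S) x) k

end PseudoAnosov

/-! ### Suspensions -/

section Suspension

variable {X : Type*} [TopologicalSpace X]

/-- The identification `(z, t) ∼ (P z, t - 1)` on `X × ℝ`. -/
def suspSetoid (P : X ≃ₜ X) : Setoid (X × ℝ) where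
  r a b := ∃ k : ℤ, b = ((P ^ k) a.1, a.2 - k)
  iseqv :=
    { refl := fun a => ⟨0, by simp⟩
      symm := by
        rintro a _ ⟨k, rfl⟩
        refine ⟨-k, Prod.ext ?_ ?_⟩
        · simp only [zpow_neg]
          exact ((P ^ k).symm_apply_apply a.1).symm
        · simp
      trans := by
        rintro a _ _ ⟨k, rfl⟩ ⟨l, rfl⟩
        refine ⟨l + k, Prod.ext ?_ ?_⟩
        · simp only [zpow_add]
          rfl
        · push_cast
          ring }

/-- The phase space of the suspension of `P`. -/
def Susp (P : X ≃ₜ X) : Type _ := Quotient (suspSetoid P)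

instance (P : X ≃ₜ X) : TopologicalSpace (Susp P) :=
  inferInstanceAs (TopologicalSpace (Quotient (suspSetoid P)))

/-- The projection `X × ℝ → Susp P`. -/
def Susp.mk (P : X ≃ₜ X) (a : X × ℝ) : Susp P := Quotient.mk (suspSetoid P) a

/-- The suspension flow, generated by `∂/∂t`. -/
def Susp.flow (P : X ≃ₜ X) (t : ℝ) : Susp P → Susp P :=
  Quotient.map (fun a => (a.1, a.2 + t)) (by
    rintro a _ ⟨k, rfl⟩
    exact ⟨k, by simp; ring⟩)

theorem Susp.mk_eq_mk {P : X ≃ₜ X} {a b : X × ℝ} :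
    Susp.mk P a = Susp.mk P b ↔ ∃ k : ℤ, b = ((P ^ k) a.1, a.2 - k) :=
  Quotient.eq (r := suspSetoid P)

theorem Susp.continuous_mk (P : X ≃ₜ X) : Continuous (Susp.mk P) := continuous_quotient_mk'

theorem Susp.isOpenMap_mk (P : X ≃ₜ X) : IsOpenMap (Susp.mk P) := by
  intro V hV
  have h : Susp.mk P ⁻¹' (Susp.mk P '' V) =
      ⋃ k : ℤ, (fun a : X × ℝ => ((P ^ k) a.1, a.2 - (k : ℝ))) ⁻¹' V := by
    ext a
    simp only [mem_preimage, mem_image, mem_iUnion]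
    constructor
    · rintro ⟨b, hb, hab⟩
      obtain ⟨k, rfl⟩ := Susp.mk_eq_mk.1 hab.symm
      exact ⟨k, hb⟩
    · rintro ⟨k, hk⟩
      exact ⟨_, hk, (Susp.mk_eq_mk.2 ⟨k, rfl⟩).symm⟩
  have : IsOpen (Susp.mk P ⁻¹' (Susp.mk P '' V)) := by
    rw [h]
    refine isOpen_iUnion fun k => hV.preimage ?_
    exact ((P ^ k).continuous.comp continuous_fst).prodMk (continuous_snd.sub continuous_const)
  exact this

theorem Susp.injOn_mk (P : X ≃ₜ X) (t₀ : ℝ) :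
    InjOn (Susp.mk P) (univ ×ˢ Ioo (t₀ - 1 / 2) (t₀ + 1 / 2)) := by
  rintro a ⟨-, ha⟩ b ⟨-, hb⟩ hab
  obtain ⟨k, rfl⟩ := Susp.mk_eq_mk.1 hab
  have h1 : (k : ℝ) < 1 := by linarith [ha.2, hb.1]
  have h2 : (-1 : ℝ) < k := by linarith [ha.1, hb.2]
  have h3 : k < 1 := by exact_mod_cast h1
  have h4 : -1 < k := by exact_mod_cast h2
  obtain rfl : k = 0 := by omega
  simp

/-- The projection `X × ℝ → Susp P` restricted to `X × (t₀ - 1/2, t₀ + 1/2)`. -/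
noncomputable def Susp.tube (P : X ≃ₜ X) (a₀ : X × ℝ) :
    OpenPartialHomeomorph (X × ℝ) (Susp P) :=
  haveI : Nonempty (X × ℝ) := ⟨a₀⟩
  OpenPartialHomeomorph.ofContinuousOpen
    ((Susp.injOn_mk P a₀.2).toPartialEquiv (Susp.mk P) _)
    (Susp.continuous_mk P).continuousOn (Susp.isOpenMap_mk P) (isOpen_univ.prod isOpen_Ioo)

theorem Susp.tube_symm_mk (P : X ≃ₜ X) (a₀ a : X × ℝ)
    (ha : a.2 ∈ Ioo (a₀.2 - 1 / 2) (a₀.2 + 1 / 2)) : (Susp.tube P a₀).symm (Susp.mk P a) = a :=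
  (Susp.tube P a₀).left_inv (x := a) ⟨mem_univ _, ha⟩

end Suspension

/-! ### The almost-Anosov structure induced by a Birkhoff section -/

section AlmostAnosov

variable {M : Type*} [MetricSpace M]
  {S : Type*} [TopologicalSpace S] [ChartedSpace (EuclideanHalfSpace 2) S]

/-- The choices from which a Birkhoff section `ι` induces an almost-Anosov structure: the
foliations that make the first return map `P` pseudo-Anosov, and an orbital equivalence `H` from
the flow on `M \ Γ` to the suspension of `P` that is the identity on the section. -/
structure AlmostAnosovData (φ : Flow ℝ M) (ι : S → M) where
  /-- the first return map -/
  P : intr S ≃ₜ intr S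
  first_return : ∀ u : intr S, ∃ t > 0, φ t (ι u) = ι (P u) ∧ ∀ s ∈ Ioo 0 t, φ s (ι u) ∉ range ι
  /-- the pseudo-Anosov structure -/
  pA : PseudoAnosovAtlas P
  /-- the orbital equivalence with the suspension -/
  H : ↥(ι '' bdry S)ᶜ ≃ₜ Susp P
  section_eq : ∀ u, (H.symm (Susp.mk P (u, 0)) : M) = ι u
  orbits : ∀ u, ∃ h : ℝ ≃o ℝ, ∀ t, (H.symm (Susp.mk P (u, t)) : M) = φ (h t) (ι u)

namespace AlmostAnosovData

variable {φ : Flow ℝ M} {ι : S → M} (D : AlmostAnosovData φ ι)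

/-- `M \ Γ`, to be endowed with the smooth structure induced by `D`. -/
def Space (_ : AlmostAnosovData φ ι) : Type _ := ↥(ι '' bdry S)ᶜ

instance : TopologicalSpace D.Space := inferInstanceAs (TopologicalSpace ↥(ι '' bdry S)ᶜ)

/-- The inclusion of `M \ Γ` in `M`. -/
def val (q : D.Space) : M := Subtype.val (p := (· ∈ (ι '' bdry S)ᶜ)) q

/-- The orbital equivalence `H`. -/
def toSusp : D.Space ≃ₜ Susp D.P := D.H

/-- The flow-box chart `(x, y, t)` near the point `(z, t) = a₀` of the suspension: `(x, y)` are the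
coordinates of `z` in the chart `e` of the translation atlas. -/
noncomputable def flowBox (e : OpenPartialHomeomorph (intr S) (ℝ × ℝ)) (a₀ : intr S × ℝ) :
    OpenPartialHomeomorph D.Space (ℝ × ℝ × ℝ) :=
  (D.toSusp.toOpenPartialHomeomorph.trans (Susp.tube D.P a₀).symm).trans
    ((e.prod (OpenPartialHomeomorph.refl ℝ)).trans
      (Homeomorph.prodAssoc ℝ ℝ ℝ).toOpenPartialHomeomorph)

theorem mem_flowBox_source {e : OpenPartialHomeomorph (intr S) (ℝ × ℝ)} {a₀ : intr S × ℝ}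
    {q : D.Space} : q ∈ (D.flowBox e a₀).source ↔ ∃ a : intr S × ℝ,
      D.toSusp q = Susp.mk D.P a ∧ a.1 ∈ e.source ∧
      a.2 ∈ Ioo (a₀.2 - 1 / 2) (a₀.2 + 1 / 2) := by
  have ht : (Susp.tube D.P a₀).target =
      Susp.mk D.P '' (univ ×ˢ Ioo (a₀.2 - 1 / 2) (a₀.2 + 1 / 2)) := rfl
  simp only [flowBox, OpenPartialHomeomorph.trans_source, mem_inter_iff, mem_preimage,
    OpenPartialHomeomorph.symm_source, ht]
  constructor
  · rintro ⟨⟨-, a, ⟨-, ha⟩, haq⟩, hq⟩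
    have haq' : Susp.mk D.P a = D.toSusp q := haq
    have h1 := hq.1
    simp only [OpenPartialHomeomorph.coe_trans, Function.comp_apply,
      Homeomorph.toOpenPartialHomeomorph_apply, ← haq', Susp.tube_symm_mk D.P a₀ a ha] at h1
    exact ⟨a, haq'.symm, h1.1, ha⟩
  · rintro ⟨a, haq, hae, ha⟩
    refine ⟨⟨mem_univ _, a, ⟨mem_univ _, ha⟩, haq.symm⟩, ?_, mem_univ _⟩
    simp only [OpenPartialHomeomorph.coe_trans, Function.comp_apply,
      Homeomorph.toOpenPartialHomeomorph_apply, haq, Susp.tube_symm_mk D.P a₀ a ha]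
    exact ⟨hae, mem_univ _⟩

theorem flowBox_apply {e : OpenPartialHomeomorph (intr S) (ℝ × ℝ)} {a₀ a : intr S × ℝ}
    {q : D.Space} (haq : D.toSusp q = Susp.mk D.P a)
    (ha : a.2 ∈ Ioo (a₀.2 - 1 / 2) (a₀.2 + 1 / 2)) :
    D.flowBox e a₀ q = ((e a.1).1, (e a.1).2, a.2) := by
  simp only [flowBox, OpenPartialHomeomorph.coe_trans, Function.comp_apply,
      Homeomorph.toOpenPartialHomeomorph_apply, haq, Susp.tube_symm_mk D.P a₀ a ha]
  rfl

/-- A point of `X × ℝ` over `H q`. -/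
noncomputable def lift (q : D.Space) : intr S × ℝ := Quotient.out (s := suspSetoid D.P) (D.toSusp q)

theorem mk_lift (q : D.Space) : Susp.mk D.P (D.lift q) = D.toSusp q := Quotient.out_eq _

/-- The smooth atlas `𝒟_Γ` of `M \ Γ`, consisting of all flow-box charts over the translation
atlas. -/
noncomputable instance : ChartedSpace (ℝ × ℝ × ℝ) D.Space where
  atlas := {f | ∃ e ∈ D.pA.charts, ∃ a₀, f = D.flowBox e a₀}
  chartAt q := D.flowBox (D.pA.cover (D.lift q).1).choose (D.lift q)
  mem_chart_source q := D.mem_flowBox_source.2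
    ⟨D.lift q, (D.mk_lift q).symm, (D.pA.cover (D.lift q).1).choose_spec.2, by simp⟩
  chart_mem_atlas q := ⟨_, (D.pA.cover (D.lift q).1).choose_spec.1, _, rfl⟩

theorem affine_zpow_nat (k : ℕ) : ∀ e ∈ D.pA.charts, ∀ e' ∈ D.pA.charts, ∀ u ∈ e.source,
    (D.P ^ k) u ∈ e'.source → LocallyAffine (D.pA.lam ^ k) (fun u' => e' ((D.P ^ k) u')) e u := by
  induction k with
  | zero =>
    intro e he e' he' u hu hu'
    simpa using D.pA.transition e he e' he' u ⟨hu, by simpa using hu'⟩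
  | succ k ih =>
    intro e he e' he' u hu hu'
    obtain ⟨f, hf, hfu⟩ := D.pA.cover ((D.P ^ k) u)
    have hP : ∀ v, (D.P ^ (k + 1)) v = D.P ((D.P ^ k) v) := fun v => by rw [pow_succ']; rfl
    rw [hP] at hu'
    obtain ⟨ε, δ, c, d, hε, hδ, h⟩ := ih e he f hf u hu hfu
    obtain ⟨ε', δ', c', d', hε', hδ', h'⟩ := D.pA.affine f hf e' he' _ hfu hu'
    refine ⟨ε' * ε, δ' * δ, ε' * D.pA.lam * c + c', δ' * D.pA.lam⁻¹ * d + d', ?_, ?_, ?_⟩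
    · rcases hε with rfl | rfl <;> rcases hε' with rfl | rfl <;> simp
    · rcases hδ with rfl | rfl <;> rcases hδ' with rfl | rfl <;> simp
    · filter_upwards [h, (D.P ^ k).continuous.continuousAt.eventually h'] with v hv hv'
      rw [hP, hv', hv, pow_succ, mul_inv]
      ext <;> ring

theorem affine_zpow (k : ℤ) {e e' : OpenPartialHomeomorph (intr S) (ℝ × ℝ)}
    (he : e ∈ D.pA.charts) (he' : e' ∈ D.pA.charts) {u : intr S} (hu : u ∈ e.source)
    (hu' : (D.P ^ k) u ∈ e'.source) :
    ∃ l, LocallyAffine l (fun u' => e' ((D.P ^ k) u')) e u := by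
  obtain ⟨k, rfl | rfl⟩ := k.eq_nat_or_neg
  · simp only [zpow_natCast] at hu' ⊢
    exact ⟨_, D.affine_zpow_nat k e he e' he' u hu hu'⟩
  · simp only [zpow_neg, zpow_natCast] at hu' ⊢
    have h0 : ∀ v, (D.P ^ k) ((D.P ^ k)⁻¹ v) = v := fun v => (D.P ^ k).apply_symm_apply v
    have h := (D.affine_zpow_nat k e' he' e he _ hu' (by rwa [h0])).symm
      (pow_ne_zero k D.pA.lam_pos.ne')
    obtain ⟨ε, δ, c, d, hε, hδ, h⟩ := h
    refine ⟨(D.pA.lam ^ k)⁻¹, ε, δ, c, d, hε, hδ, ?_⟩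
    filter_upwards [((D.P ^ k)⁻¹).continuous.continuousAt.eventually h] with v hv
    rw [hv, h0]

theorem contDiffAt_transition {e e' : OpenPartialHomeomorph (intr S) (ℝ × ℝ)}
    (he : e ∈ D.pA.charts) (he' : e' ∈ D.pA.charts) {a₀ b₀ : intr S × ℝ} {q : D.Space}
    (hq : q ∈ (D.flowBox e a₀).source) (hq' : q ∈ (D.flowBox e' b₀).source) :
    ContDiffAt ℝ ∞ (D.flowBox e' b₀ ∘ (D.flowBox e a₀).symm) (D.flowBox e a₀ q) := by
  obtain ⟨a, ha, hae, haI⟩ := D.mem_flowBox_source.1 hq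
  obtain ⟨b, hb, hbe, hbI⟩ := D.mem_flowBox_source.1 hq'
  obtain ⟨k, rfl⟩ := Susp.mk_eq_mk.1 (ha.symm.trans hb)
  rw [D.flowBox_apply ha haI]
  obtain ⟨l, hl⟩ := D.affine_zpow k he he' hae hbe
  have h1 : ContDiffAt ℝ ∞ (fun v : ℝ × ℝ × ℝ =>
      (((fun u' => e' ((D.P ^ k) u')) ∘ e.symm) (v.1, v.2.1), v.2.2 - (k : ℝ)))
      ((e a.1).1, (e a.1).2, a.2) := by
    refine ContDiffAt.prodMk ?_ (by fun_prop)
    exact ContDiffAt.comp (𝕜 := ℝ) (g := (fun u' => e' ((D.P ^ k) u')) ∘ e.symm)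
      (f := fun v : ℝ × ℝ × ℝ => (v.1, v.2.1)) _ (hl.contDiffAt hae) (by fun_prop)
  have h2 : ContDiff ℝ ∞ (fun w : (ℝ × ℝ) × ℝ => (w.1.1, w.1.2, w.2)) := by fun_prop
  refine (h2.contDiffAt.comp _ h1).congr_of_eventuallyEq ?_
  have h3 : ContinuousAt (fun v : ℝ × ℝ × ℝ => (D.P ^ k) (e.symm (v.1, v.2.1)))
      ((e a.1).1, (e a.1).2, a.2) := by
    refine ((D.P ^ k).continuous.continuousAt).comp ?_
    exact ContinuousAt.comp (g := e.symm) (f := fun v : ℝ × ℝ × ℝ => (v.1, v.2.1))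
      (e.continuousAt_symm (e.map_source hae)) (by fun_prop)
  have h4 : ContinuousAt (fun v : ℝ × ℝ × ℝ => v.2.2 - (k : ℝ))
      ((e a.1).1, (e a.1).2, a.2) := by fun_prop
  have h3' := h3.preimage_mem_nhds (t := e'.source)
    (e'.open_source.mem_nhds (by simpa [e.left_inv hae] using hbe))
  have h4' := h4.preimage_mem_nhds (isOpen_Ioo.mem_nhds hbI)
  filter_upwards [h3', h4'] with v hv3 hv4
  have hv : D.toSusp ((D.flowBox e a₀).symm v) = Susp.mk D.P (e.symm (v.1, v.2.1), v.2.2) :=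
    D.toSusp.apply_symm_apply _
  exact D.flowBox_apply (hv.trans (Susp.mk_eq_mk.2 ⟨k, rfl⟩)) hv4

instance : IsManifold 𝓘(ℝ, ℝ × ℝ × ℝ) ∞ D.Space := by
  refine isManifold_of_contDiffOn _ _ _ ?_
  rintro _ _ ⟨e, he, a₀, rfl⟩ ⟨e', he', b₀, rfl⟩
  simp only [modelWithCornersSelf_coe, modelWithCornersSelf_coe_symm, Function.comp_id,
    Function.id_comp, preimage_id, range_id, inter_univ]
  intro v hv
  have h1 := hv
  rw [OpenPartialHomeomorph.trans_source] at h1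
  have h2 := D.contDiffAt_transition he he' (q := (D.flowBox e a₀).symm v)
    ((D.flowBox e a₀).map_target h1.1) h1.2
  rw [(D.flowBox e a₀).right_inv h1.1] at h2
  exact h2.contDiffWithinAt

/-- The flow of `X_Γ`: the suspension flow carried to `M \ Γ`. -/
def flow (t : ℝ) (q : D.Space) : D.Space := D.toSusp.symm (Susp.flow D.P t (D.toSusp q))

theorem flow_zero (q : D.Space) : D.flow 0 q = q := by
  obtain ⟨a, ha⟩ : ∃ a, Susp.mk D.P a = D.toSusp q := ⟨_, D.mk_lift q⟩
  have h : Susp.flow D.P 0 (Susp.mk D.P a) = Susp.mk D.P (a.1, a.2 + 0) := rfl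
  rw [flow, ← ha, h, add_zero, ha, Homeomorph.symm_apply_apply]

/-- The smooth vector field `X_Γ` on `M \ Γ`: the velocity at time `0` of its flow (recall that
`D.flow 0 q = q`). -/
noncomputable def vectorField (q : D.Space) : TangentSpace 𝓘(ℝ, ℝ × ℝ × ℝ) q :=
  show ℝ × ℝ × ℝ from
    mfderiv 𝓘(ℝ, ℝ) 𝓘(ℝ, ℝ × ℝ × ℝ) (fun t : ℝ => D.flow t q) 0 (1 : ℝ)

end AlmostAnosovData

end AlmostAnosov

/-! ### The normal form -/

/-- The affine vector field `X_(λ,p,n)` on `ℝ² × ℝ/ℤ`, in the coordinates `(x, y, z)`. -/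
noncomputable def affineField (lam : ℝ) (p n : ℕ) (v : ℝ × ℝ × ℝ) : ℝ × ℝ × ℝ :=
  (Real.log lam * v.1, -Real.log lam * v.2.1, 1 / ((n : ℝ) * (p : ℝ)))

/-- The closed quadrants `𝔻₁, …, 𝔻₄` of the plane, in counterclockwise order, indexed from `0`. -/
def quadrant : Fin 4 → Set (ℝ × ℝ)
  | 0 => {v | 0 ≤ v.1 ∧ 0 ≤ v.2}
  | 1 => {v | v.1 ≤ 0 ∧ 0 ≤ v.2}
  | 2 => {v | v.1 ≤ 0 ∧ v.2 ≤ 0}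
  | 3 => {v | 0 ≤ v.1 ∧ v.2 ≤ 0}

/-- The open half-axis between the quadrants `i` and `i + 1`. -/
def halfAxis : Fin 4 → Set (ℝ × ℝ)
  | 0 => {v | v.1 = 0 ∧ 0 < v.2}
  | 1 => {v | v.1 < 0 ∧ v.2 = 0}
  | 2 => {v | v.1 = 0 ∧ v.2 < 0}
  | 3 => {v | 0 < v.1 ∧ v.2 = 0}

/-- The projection `ℝ³ → ℝ² × ℝ/ℤ`. -/
def toCyl (v : ℝ × ℝ × ℝ) : ℝ × ℝ × UnitAddCircle := (v.1, v.2.1, (v.2.2 : UnitAddCircle))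

/-- The punctured quadrant `W_i \ γ`: the part of `W \ γ` in the `i`-th of the four regions cut out
by the local invariant manifolds of `γ`, which are the coordinate planes of the saddle chart `τ`. -/
def puncturedQuadrant {M : Type*} [MetricSpace M]
    (τ : OpenPartialHomeomorph M (ℝ × ℝ × UnitAddCircle)) (W γ : Set M) (i : Fin 4) : Set M :=
  {q ∈ W | ((τ q).1, (τ q).2.1) ∈ quadrant i} \ γ

end BirkhoffNormalForm

open BirkhoffNormalForm

set_option linter.unusedSectionVars false

namespace BirkhoffNormalForm

/-! ### Degrees of circle maps -/

theorem exists_real_lift {E : Type*} [NormedAddCommGroup E] [NormedSpace ℝ E]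
    {f : E → UnitAddCircle} (hf : Continuous f) :
    ∃ F : E → ℝ, Continuous F ∧ ∀ v, (F v : UnitAddCircle) = f v := by
  obtain ⟨r, hr⟩ := QuotientAddGroup.mk_surjective (f 0)
  obtain ⟨F, hF, -⟩ := (AddCircle.isCoveringMap_coe (1 : ℝ)).existsUnique_continuousMap_lifts
    (A := E) ⟨f, hf⟩ 0 r hr
  exact ⟨F, F.continuous, fun v => congrFun hF.2 v⟩

theorem coe_eq_coe_iff_int {a b : ℝ} : (a : UnitAddCircle) = b ↔ ∃ k : ℤ, a = b + k := by
  rw [← sub_eq_zero, ← AddCircle.coe_sub, AddCircle.coe_eq_zero_iff]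
  constructor
  · rintro ⟨k, hk⟩
    exact ⟨k, by simp at hk; linarith⟩
  · rintro ⟨k, hk⟩
    exact ⟨k, by simp [hk]⟩

theorem exists_int_const {E : Type*} [TopologicalSpace E] [PreconnectedSpace E] [Nonempty E]
    {F G : E → ℝ} (hF : Continuous F) (hG : Continuous G)
    (h : ∀ v, (F v : UnitAddCircle) = G v) : ∃ k : ℤ, ∀ v, F v = G v + k := by
  have h1 : ∀ v, ∃ k : ℤ, F v - G v = k := fun v => by
    obtain ⟨k, hk⟩ := coe_eq_coe_iff_int.1 (h v)
    exact ⟨k, by linarith⟩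
  choose k hk using h1
  have hkc : Continuous k := by
    have : Continuous fun v => ((k v : ℤ) : ℝ) := by
      simp only [← hk]
      exact hF.sub hG
    exact (Int.isClosedEmbedding_coe_real.isEmbedding.continuous_iff).2 this
  obtain ⟨v₀⟩ := ‹Nonempty E›
  refine ⟨k v₀, fun v => ?_⟩
  rw [← PreconnectedSpace.constant ‹_› hkc (x := v) (y := v₀)]
  linarith [hk v]

/-- The circle map `f` has degree `d`. -/
def HasDegree (f : UnitAddCircle → UnitAddCircle) (d : ℤ) : Prop :=
  ∃ F : ℝ → ℝ, Continuous F ∧ (∀ s : ℝ, (F s : UnitAddCircle) = f s) ∧ ∀ s, F (s + 1) = F s + d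

theorem exists_hasDegree {E : Type*} [NormedAddCommGroup E] [NormedSpace ℝ E]
    {G : E × UnitAddCircle → UnitAddCircle} (hG : Continuous G) :
    ∃ d : ℤ, ∀ a, HasDegree (fun s => G (a, s)) d := by
  obtain ⟨F, hF, hFG⟩ := exists_real_lift (E := E × ℝ) (f := fun v => G (v.1, (v.2 : UnitAddCircle)))
    (hG.comp (continuous_fst.prodMk ((AddCircle.continuous_mk' 1).comp continuous_snd)))
  obtain ⟨d, hd⟩ := exists_int_const (F := fun v : E × ℝ => F (v.1, v.2 + 1)) (G := F)
    (hF.comp (by fun_prop)) hF (fun v => by simp [hFG])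
  exact ⟨d, fun a => ⟨fun s => F (a, s), hF.comp (by fun_prop), fun s => hFG (a, s),
    fun s => hd (a, s)⟩⟩

theorem exists_hasDegree_of_continuous {f : UnitAddCircle → UnitAddCircle} (hf : Continuous f) :
    ∃ d : ℤ, HasDegree f d := by
  obtain ⟨d, hd⟩ := exists_hasDegree (E := ℝ) (G := fun v => f v.2) (hf.comp continuous_snd)
  exact ⟨d, hd 0⟩

theorem HasDegree.unique {f : UnitAddCircle → UnitAddCircle} {d e : ℤ} (hd : HasDegree f d)
    (he : HasDegree f e) : d = e := by
  obtain ⟨F, hF, hFf, hF1⟩ := hd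
  obtain ⟨G, hG, hGf, hG1⟩ := he
  obtain ⟨k, hk⟩ := exists_int_const hF hG (fun v => by rw [hFf, hGf])
  have h1 := hk 0
  have h2 := hk (0 + 1)
  rw [hF1, hG1] at h2
  exact_mod_cast (by linarith : (d : ℝ) = e)

theorem HasDegree.continuous {f : UnitAddCircle → UnitAddCircle} {d : ℤ} (h : HasDegree f d) :
    Continuous f := by
  obtain ⟨F, hF, hFf, -⟩ := h
  refine (QuotientAddGroup.isQuotientMap_mk (N := AddSubgroup.zmultiples (1 : ℝ))).continuous_iff.2 ?_
  refine ((AddCircle.continuous_mk' 1).comp hF).congr fun s => ?_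
  exact hFf s

theorem hasDegree_const (a : UnitAddCircle) : HasDegree (fun _ => a) 0 := by
  obtain ⟨r, rfl⟩ := QuotientAddGroup.mk_surjective a
  exact ⟨fun _ => r, continuous_const, fun _ => rfl, fun _ => by simp⟩

theorem hasDegree_id : HasDegree (fun s => s) 1 :=
  ⟨id, continuous_id, fun _ => rfl, fun _ => by simp⟩

theorem hasDegree_zsmul (d : ℤ) : HasDegree (fun s => d • s) d :=
  ⟨fun s => d * s, by fun_prop, fun s => by
    dsimp only
    rw [← AddCircle.coe_zsmul]
    simp, fun s => by ring⟩

theorem HasDegree.nsmul {f : UnitAddCircle → UnitAddCircle} {d : ℤ} (hf : HasDegree f d) (n : ℕ) :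
    HasDegree (fun s => n • f s) (n * d) := by
  obtain ⟨F, hF, hFf, hF1⟩ := hf
  refine ⟨fun s => n * F s, by fun_prop, fun s => ?_, fun s => by simp only [hF1]; push_cast; ring⟩
  dsimp only
  rw [← hFf, ← AddCircle.coe_nsmul]
  simp

theorem HasDegree.comp {f g : UnitAddCircle → UnitAddCircle} {d e : ℤ} (hf : HasDegree f d)
    (hg : HasDegree g e) : HasDegree (fun s => f (g s)) (d * e) := by
  obtain ⟨F, hF, hFf, hF1⟩ := hf
  obtain ⟨G, hG, hGg, hG1⟩ := hg
  have h : ∀ (k : ℤ) s, F (s + k) = F s + k * d := by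
    intro k
    induction k using Int.induction_on with
    | zero => simp
    | succ k ih =>
      intro s
      push_cast at ih ⊢
      rw [← add_assoc, hF1, ih]
      ring
    | pred k ih =>
      intro s
      have h1 := hF1 (s + ((-(k : ℤ) - 1 : ℤ) : ℝ))
      have h2 := ih s
      push_cast at h1 h2 ⊢
      rw [show s + (-(k : ℝ) - 1) + 1 = s + -(k : ℝ) by ring, h2] at h1
      linarith
  exact ⟨fun s => F (G s), hF.comp hG, fun s => by rw [hFf, hGg],
    fun s => by simp only [hG1, h]; push_cast; ring⟩

/-- Homotopy invariance of the degree, for homotopies parametrized by a convex set. -/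
theorem HasDegree.of_convex {E : Type*} [NormedAddCommGroup E] [NormedSpace ℝ E] {J : Set E}
    (hJ : Convex ℝ J) {G : E × UnitAddCircle → UnitAddCircle} (hG : ContinuousOn G (J ×ˢ univ))
    {a b : E} (ha : a ∈ J) (hb : b ∈ J) {d : ℤ} (h : HasDegree (fun s => G (a, s)) d) :
    HasDegree (fun s => G (b, s)) d := by
  let c : ℝ → ℝ := fun s => max 0 (min 1 s)
  have hc : Continuous c := by fun_prop
  have hl : ∀ s, AffineMap.lineMap a b (c s) ∈ J := fun s =>
    hJ.segment_subset ha hb (by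
      rw [segment_eq_image_lineMap]
      exact ⟨c s, ⟨le_max_left _ _, max_le zero_le_one (min_le_left _ _)⟩, rfl⟩)
  have hG' : Continuous fun v : ℝ × UnitAddCircle => G (AffineMap.lineMap a b (c v.1), v.2) := by
    refine hG.comp_continuous ?_ (fun v => ⟨hl _, mem_univ _⟩)
    refine Continuous.prodMk ?_ continuous_snd
    exact AffineMap.lineMap_continuous.comp (hc.comp continuous_fst)
  obtain ⟨e, he⟩ := exists_hasDegree hG'
  have h0 := he 0
  have h1 := he 1
  simp only [c] at h0 h1
  norm_num at h0 h1
  rwa [h.unique h0]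

/-- Homotopy invariance of the degree. -/
theorem HasDegree.of_unitInterval {G : unitInterval × UnitAddCircle → UnitAddCircle}
    (hG : Continuous G) {a b : unitInterval} {d : ℤ} (h : HasDegree (fun s => G (a, s)) d) :
    HasDegree (fun s => G (b, s)) d := by
  have := HasDegree.of_convex (convex_univ (𝕜 := ℝ) (E := ℝ)) (a := a) (b := b) (d := d)
    (G := fun v => G (projIcc 0 1 zero_le_one v.1, v.2))
    (hG.comp ((continuous_projIcc.comp continuous_fst).prodMk continuous_snd)).continuousOn
    (mem_univ _) (mem_univ _) (by simpa using h)
  simpa using this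

/-- The degree of a loop in `J × ℝ/ℤ`, seen through a map to the circle. -/
theorem HasDegree.of_loop {E : Type*} [NormedAddCommGroup E] [NormedSpace ℝ E] {J : Set E}
    (hJ : Convex ℝ J) {G : E × UnitAddCircle → UnitAddCircle} (hG : ContinuousOn G (J ×ˢ univ))
    {a : E} (ha : a ∈ J) {d e : ℤ} (h : HasDegree (fun s => G (a, s)) d)
    {ρ : UnitAddCircle → E} (hρ : Continuous ρ) (hρJ : ∀ s, ρ s ∈ J) {f : UnitAddCircle → UnitAddCircle}
    (hf : HasDegree f e) : HasDegree (fun s => G (ρ s, f s)) (d * e) := by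
  have hl : ∀ t ∈ Icc (0 : ℝ) 1, ∀ s, AffineMap.lineMap a (ρ s) t ∈ J := fun t ht s =>
    hJ.segment_subset ha (hρJ s) (by rw [segment_eq_image_lineMap]; exact ⟨t, ht, rfl⟩)
  have := HasDegree.of_convex (convex_Icc (0 : ℝ) 1) (a := 0) (b := 1) (d := d * e)
    (G := fun v => G (AffineMap.lineMap a (ρ v.2) v.1, f v.2)) ?_ (by simp) (by simp)
    (by simpa using h.comp hf)
  · simpa using this
  · refine hG.comp (Continuous.continuousOn ?_) (fun v hv => ⟨hl _ hv.1 _, mem_univ _⟩)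
    refine Continuous.prodMk ?_ (hf.continuous.comp continuous_snd)
    simp only [AffineMap.lineMap_apply_module]
    fun_prop

/-- The degree of a linear loop in the torus. -/
theorem HasDegree.of_torus {G : UnitAddCircle × UnitAddCircle → UnitAddCircle} (hG : Continuous G)
    {d e : ℤ} (hd : HasDegree (fun s => G (s, 0)) d) (he : HasDegree (fun s => G (0, s)) e)
    (a b : ℤ) : HasDegree (fun s => G (a • s, b • s)) (a * d + b * e) := by
  obtain ⟨F, hF, hFG⟩ := exists_real_lift (E := ℝ × ℝ)
    (f := fun v => G ((v.1 : UnitAddCircle), (v.2 : UnitAddCircle)))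
    (hG.comp (((AddCircle.continuous_mk' 1).comp continuous_fst).prodMk
      ((AddCircle.continuous_mk' 1).comp continuous_snd)))
  obtain ⟨d', hd'⟩ := exists_int_const (F := fun v : ℝ × ℝ => F (v.1 + 1, v.2)) (G := F)
    (hF.comp (by fun_prop)) hF (fun v => by simp [hFG])
  obtain ⟨e', he'⟩ := exists_int_const (F := fun v : ℝ × ℝ => F (v.1, v.2 + 1)) (G := F)
    (hF.comp (by fun_prop)) hF (fun v => by simp [hFG])
  have h1 : HasDegree (fun s => G (s, 0)) d' :=
    ⟨fun s => F (s, 0), hF.comp (by fun_prop), fun s => by simp [hFG], fun s => hd' (s, 0)⟩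
  have h2 : HasDegree (fun s => G (0, s)) e' :=
    ⟨fun s => F (0, s), hF.comp (by fun_prop), fun s => by simp [hFG], fun s => he' (0, s)⟩
  obtain rfl := hd.unique h1
  obtain rfl := he.unique h2
  have h3 : ∀ (k : ℤ) (v : ℝ × ℝ), F (v.1 + k, v.2) = F v + k * d := by
    intro k
    induction k using Int.induction_on with
    | zero => simp
    | succ k ih =>
      intro v
      have h1 := hd' (v.1 + k, v.2)
      have h2 := ih v
      push_cast at h1 h2 ⊢
      simp only [← add_assoc] at h1 ⊢
      rw [h1, h2]
      ring
    | pred k ih =>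
      intro v
      have h1 := hd' (v.1 + ((-(k : ℤ) - 1 : ℤ) : ℝ), v.2)
      have h2 := ih v
      push_cast at h1 h2 ⊢
      simp only [show v.1 + (-(k : ℝ) - 1) + 1 = v.1 + -(k : ℝ) by ring, h2] at h1
      linarith
  have h4 : ∀ (k : ℤ) (v : ℝ × ℝ), F (v.1, v.2 + k) = F v + k * e := by
    intro k
    induction k using Int.induction_on with
    | zero => simp
    | succ k ih =>
      intro v
      have h1 := he' (v.1, v.2 + k)
      have h2 := ih v
      push_cast at h1 h2 ⊢
      simp only [← add_assoc] at h1 ⊢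
      rw [h1, h2]
      ring
    | pred k ih =>
      intro v
      have h1 := he' (v.1, v.2 + ((-(k : ℤ) - 1 : ℤ) : ℝ))
      have h2 := ih v
      push_cast at h1 h2 ⊢
      simp only [show v.2 + (-(k : ℝ) - 1) + 1 = v.2 + -(k : ℝ) by ring, h2] at h1
      linarith
  refine ⟨fun s => F (a * s, b * s), hF.comp (by fun_prop), fun s => ?_, fun s => ?_⟩
  · dsimp only
    rw [hFG, ← AddCircle.coe_zsmul, ← AddCircle.coe_zsmul]
    simp
  · have h5 := h3 a (a * s, b * s + b)
    have h6 := h4 b (a * s, b * s)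
    dsimp only at h5 h6 ⊢
    rw [mul_add, mul_add, mul_one, mul_one, h5, h6]
    push_cast
    ring

/-- The argument of a complex number, in turns. -/
noncomputable def turn (ζ : ℂ) : UnitAddCircle :=
  AddCircle.equivAddCircle (2 * Real.pi) 1 (by positivity) one_ne_zero (Complex.arg ζ : Real.Angle)

theorem continuousAt_turn {ζ : ℂ} (h : ζ ≠ 0) : ContinuousAt turn ζ := by
  have h1 : Continuous (AddCircle.equivAddCircle (2 * Real.pi) 1 (by positivity) one_ne_zero) :=
    (AddCircle.homeomorphAddCircle (2 * Real.pi) 1 (by positivity) one_ne_zero).continuous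
  exact h1.continuousAt.comp (Complex.continuousAt_arg_coe_angle h)

theorem turn_mul {ζ ξ : ℂ} (h : ζ ≠ 0) (h' : ξ ≠ 0) : turn (ζ * ξ) = turn ζ + turn ξ := by
  rw [turn, Complex.arg_mul_coe_angle h h']
  exact map_add _ _ _

theorem turn_pow {ζ : ℂ} (h : ζ ≠ 0) (n : ℕ) : turn (ζ ^ n) = n • turn ζ := by
  induction n with
  | zero =>
    simp only [pow_zero, zero_smul, turn, Complex.arg_one]
    exact map_zero _
  | succ n ih => rw [pow_succ, turn_mul (pow_ne_zero n h) h, ih, succ_nsmul]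

theorem turn_ofReal_mul {r : ℝ} (h : 0 < r) (ζ : ℂ) : turn (r * ζ) = turn ζ := by
  simp only [turn, Complex.arg_real_mul ζ h]

theorem turn_toCircle (s : UnitAddCircle) : turn (AddCircle.toCircle s : Circle) = s := by
  induction s using QuotientAddGroup.induction_on with
  | H s =>
    have h : ((Complex.arg (Circle.exp (2 * Real.pi / 1 * s)) : ℝ) : Real.Angle) =
        ((2 * Real.pi * s : ℝ) : Real.Angle) := by
      have h1 := Complex.arg_cos_add_sin_mul_I_coe_angle ((2 * Real.pi * s : ℝ) : Real.Angle)
      rw [← h1]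
      simp [Circle.coe_exp, Complex.exp_mul_I]
    rw [AddCircle.toCircle_apply_mk, turn, h]
    refine (AddCircle.equivAddCircle_apply_mk (2 * Real.pi) 1 _ _ (2 * Real.pi * s)).trans ?_
    congr 1
    field_simp

/-- Two loops in the punctured plane that are never at an angle of a quarter turn or more have the
same degree. -/
theorem HasDegree.turn_congr {f g : UnitAddCircle → ℂ} (hf : Continuous f) (hg : Continuous g)
    (h : ∀ s, 0 < (f s).re * (g s).re + (f s).im * (g s).im) {d : ℤ}
    (hd : HasDegree (fun s => turn (f s)) d) : HasDegree (fun s => turn (g s)) d := by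
  have := HasDegree.of_convex (convex_Icc (0 : ℝ) 1) (a := 0) (b := 1) (d := d)
    (G := fun v => turn ((1 - v.1 : ℝ) * f v.2 + (v.1 : ℝ) * g v.2)) ?_ (by simp) (by simp)
    (by simpa using hd)
  · simpa using this
  · rintro ⟨t, s⟩ ⟨ht, -⟩
    have hne : ((1 - t : ℝ) : ℂ) * f s + (t : ℝ) * g s ≠ 0 := by
      intro h0
      have hre := congrArg Complex.re h0
      have him := congrArg Complex.im h0
      simp at hre him
      have hp := h s
      have hh : (1 - t) * ((f s).re ^ 2 + (f s).im ^ 2) +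
          t * ((f s).re * (g s).re + (f s).im * (g s).im) = 0 := by
        linear_combination (f s).re * hre + (f s).im * him
      have hff : 0 < (f s).re ^ 2 + (f s).im ^ 2 := by
        by_contra hcon
        have h1 : (f s).re = 0 := by nlinarith [sq_nonneg (f s).re, sq_nonneg (f s).im]
        have h2 : (f s).im = 0 := by nlinarith [sq_nonneg (f s).re, sq_nonneg (f s).im]
        simp [h1, h2] at hp
      rcases ht.1.eq_or_lt with h0 | h0
      · simp only at h0
        subst h0
        linarith
      · have h01 := ht.2
        simp only at h0 h01
        nlinarith [mul_nonneg (sub_nonneg.2 h01) hff.le, mul_pos h0 hp]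
    have hc : Continuous fun v : ℝ × UnitAddCircle =>
      ((1 - v.1 : ℝ) : ℂ) * f v.2 + (v.1 : ℝ) * g v.2 := by fun_prop
    exact (ContinuousAt.comp (x := (t, s)) (continuousAt_turn hne) hc.continuousAt).continuousWithinAt


/-! ### The flow near a saddle orbit -/

section SaddleFlow

variable {M : Type*} [MetricSpace M]

/-- The box of size `δ` in a saddle chart. -/
def saddleBox (τ : OpenPartialHomeomorph M (ℝ × ℝ × UnitAddCircle)) (δ : ℝ) : Set M :=
  {q | q ∈ τ.source ∧ |(τ q).1| < δ ∧ |(τ q).2.1| < δ}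

variable {φ : Flow ℝ M} {γ : Set M} {τ : OpenPartialHomeomorph M (ℝ × ℝ × UnitAddCircle)}

theorem saddleBox_mono {δ δ' : ℝ} (h : δ ≤ δ') : saddleBox τ δ ⊆ saddleBox τ δ' :=
  fun _ hq => ⟨hq.1, hq.2.1.trans_le h, hq.2.2.trans_le h⟩

theorem isOpen_saddleBox (δ : ℝ) : IsOpen (saddleBox τ δ) := by
  have : saddleBox τ δ = τ.source ∩ τ ⁻¹' {v | |v.1| < δ ∧ |v.2.1| < δ} := rfl
  rw [this]
  exact τ.isOpen_inter_preimage
    ((isOpen_lt (f := fun v : ℝ × ℝ × UnitAddCircle => |v.1|) (by fun_prop) continuous_const).inter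
      (isOpen_lt (f := fun v : ℝ × ℝ × UnitAddCircle => |v.2.1|) (by fun_prop) continuous_const))

namespace IsSaddleChart

theorem mem_target (hτ : IsSaddleChart φ γ τ) {v : ℝ × ℝ × UnitAddCircle} :
    v ∈ τ.target ↔ |v.1| < 1 ∧ |v.2.1| < 1 := by
  rw [hτ.target_eq, mem_ofPred_eq, mem_Ioo, mem_Ioo, abs_lt, abs_lt]

theorem abs_lt_one (hτ : IsSaddleChart φ γ τ) {q : M} (hq : q ∈ τ.source) :
    |(τ q).1| < 1 ∧ |(τ q).2.1| < 1 := hτ.mem_target.1 (τ.map_source hq)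

theorem subset_saddleBox (hτ : IsSaddleChart φ γ τ) {δ : ℝ} (hδ : 0 < δ) : γ ⊆ saddleBox τ δ := by
  intro q hq
  have h := (hτ.mem_orbit_iff q (hτ.orbit_subset hq)).1 hq
  exact ⟨hτ.orbit_subset hq, by simp [h.1, hδ], by simp [h.2, hδ]⟩

theorem eq_image (hτ : IsSaddleChart φ γ τ) :
    γ = τ.symm '' {v | v.1 = 0 ∧ v.2.1 = 0} := by
  ext q
  constructor
  · intro hq
    exact ⟨τ q, (hτ.mem_orbit_iff q (hτ.orbit_subset hq)).1 hq, τ.left_inv (hτ.orbit_subset hq)⟩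
  · rintro ⟨v, hv, rfl⟩
    have hvt : v ∈ τ.target := hτ.mem_target.2 (by simp [hv.1, hv.2])
    refine (hτ.mem_orbit_iff _ (τ.map_target hvt)).2 ?_
    rwa [τ.right_inv hvt]

theorem isCompact_core : IsCompact {v : ℝ × ℝ × UnitAddCircle | v.1 = 0 ∧ v.2.1 = 0} := by
  have : {v : ℝ × ℝ × UnitAddCircle | v.1 = 0 ∧ v.2.1 = 0} = {0} ×ˢ {0} ×ˢ univ := by
    ext v
    simp
  rw [this]
  exact isCompact_singleton.prod (isCompact_singleton.prod isCompact_univ)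

theorem core_subset_target (hτ : IsSaddleChart φ γ τ) :
    {v : ℝ × ℝ × UnitAddCircle | v.1 = 0 ∧ v.2.1 = 0} ⊆ τ.target := fun v hv =>
  hτ.mem_target.2 (by simp [hv.1, hv.2])

theorem isCompact_orbit (hτ : IsSaddleChart φ γ τ) : IsCompact γ := by
  rw [hτ.eq_image]
  exact isCompact_core.image_of_continuousOn (τ.continuousOn_symm.mono hτ.core_subset_target)

theorem exists_saddleBox_subset (hτ : IsSaddleChart φ γ τ) {O : Set M} (hO : IsOpen O)
    (hγ : γ ⊆ O) : ∃ δ, 0 < δ ∧ δ < 1 ∧ saddleBox τ δ ⊆ O := by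
  have h1 := τ.isOpen_inter_preimage_symm hO
  obtain ⟨ε, hε, h2⟩ := isCompact_core.exists_thickening_subset_open h1 (fun v hv =>
    ⟨hτ.core_subset_target hv, hγ (by rw [hτ.eq_image]; exact ⟨v, hv, rfl⟩)⟩)
  refine ⟨min ε (1 / 2), lt_min hε (by norm_num),
    (min_le_right _ _).trans_lt (by norm_num), fun q hq => ?_⟩
  have h3 : τ q ∈ Metric.thickening ε {v : ℝ × ℝ × UnitAddCircle | v.1 = 0 ∧ v.2.1 = 0} := by
    rw [Metric.mem_thickening_iff]
    refine ⟨(0, 0, (τ q).2.2), by simp, ?_⟩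
    simp only [Prod.dist_eq, Real.dist_eq, sub_zero, dist_self]
    have h4 := min_le_left ε (1 / 2)
    exact max_lt (by linarith [hq.2.1]) (max_lt (by linarith [hq.2.2]) hε)
  have := (h2 h3).2
  rwa [mem_preimage, τ.left_inv hq.1] at this

/-- The reversed flow, in the chart with exchanged stable and unstable coordinates. -/
theorem exists_reverse (hτ : IsSaddleChart φ γ τ) :
    ∃ τ' : OpenPartialHomeomorph M (ℝ × ℝ × UnitAddCircle), IsSaddleChart φ.reverse γ τ' ∧
      τ'.source = τ.source ∧ ∀ q, τ' q = ((τ q).2.1, (τ q).1, -(τ q).2.2) := by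
  let s : (ℝ × ℝ × UnitAddCircle) ≃ₜ (ℝ × ℝ × UnitAddCircle) :=
    { toFun := fun v => (v.2.1, v.1, -v.2.2)
      invFun := fun v => (v.2.1, v.1, -v.2.2)
      left_inv := fun v => by simp
      right_inv := fun v => by simp
      continuous_toFun := by fun_prop
      continuous_invFun := by fun_prop }
  have hs : ∀ q, (τ.trans s.toOpenPartialHomeomorph) q = ((τ q).2.1, (τ q).1, -(τ q).2.2) :=
    fun _ => rfl
  have hso : (τ.trans s.toOpenPartialHomeomorph).source = τ.source := by simp
  refine ⟨τ.trans s.toOpenPartialHomeomorph, ⟨?_, by rw [hso]; exact hτ.orbit_subset, ?_, ?_⟩,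
    hso, hs⟩
  · ext v
    simp only [OpenPartialHomeomorph.trans_target, Homeomorph.toOpenPartialHomeomorph_target,
      univ_inter, mem_preimage, mem_ofPred_eq]
    rw [hτ.target_eq]
    exact and_comm
  · intro q hq
    rw [hso] at hq
    rw [hτ.mem_orbit_iff q hq, hs]
    exact and_comm
  · obtain ⟨α, hα, β, hβ, h⟩ := hτ.orbits
    refine ⟨β, hβ, α, hα, fun q T hT hq => ?_⟩
    rw [hso] at hq
    obtain ⟨g, hg0, hgc, hgm, hg⟩ := h (φ (-T) q) T hT (fun t ht => by
      rw [← φ.map_add]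
      have := hq (T - t) ⟨by linarith [ht.2], by linarith [ht.1]⟩
      rwa [Flow.reverse_apply, show -(T - t) = t + -T by ring] at this)
    have hmaps : MapsTo (fun t => T - t) (Icc 0 T) (Icc 0 T) := fun t ht =>
      ⟨by linarith [ht.2], by linarith [ht.1]⟩
    refine ⟨fun t => g T - g (T - t), by simp, ?_, ?_, ?_⟩
    · exact continuousOn_const.sub (hgc.comp (by fun_prop) hmaps)
    · intro a ha b hb hab
      have := hgm (hmaps hb) (hmaps ha) (by simp only; linarith)
      simp only at this ⊢
      linarith
    · intro t ht
      have h1 := hg T ⟨hT.le, le_rfl⟩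
      have h2 := hg (T - t) (hmaps ht)
      rw [← φ.map_add] at h1 h2
      rw [show T - t + -T = -t by ring] at h2
      rw [show T + -T = (0 : ℝ) by ring, φ.map_zero_apply] at h1
      rw [hs, hs, Flow.reverse_apply, h2, h1]
      simp only [linearSaddle, ← mul_assoc, ← Real.exp_add]
      refine Prod.ext ?_ (Prod.ext ?_ ?_)
      · simp only
        congr 2
        ring
      · simp only
        congr 2
        ring
      · simp only [AddCircle.coe_sub]
        abel

theorem coord_sign (hτ : IsSaddleChart φ γ τ) {q : M} {T : ℝ} (hT : 0 ≤ T)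
    (hq : ∀ t ∈ Icc 0 T, φ t q ∈ τ.source) :
    ∃ a > 0, ∃ b > 0, (τ (φ T q)).1 = a * (τ q).1 ∧ (τ (φ T q)).2.1 = b * (τ q).2.1 := by
  obtain ⟨α, hα, β, hβ, h⟩ := hτ.orbits
  rcases hT.eq_or_lt with rfl | hT
  · exact ⟨1, one_pos, 1, one_pos, by simp⟩
  · obtain ⟨g, -, -, -, hg⟩ := h q T hT hq
    rw [hg T ⟨hT.le, le_rfl⟩]
    exact ⟨_, Real.exp_pos _, _, Real.exp_pos _, rfl, rfl⟩

theorem continuous_linearSaddle (α β : ℝ) (v : ℝ × ℝ × UnitAddCircle) :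
    Continuous fun t => linearSaddle α β t v := by
  unfold linearSaddle
  have : Continuous fun t : ℝ => (t : UnitAddCircle) := AddCircle.continuous_mk' 1
  fun_prop

theorem eq_zero_of_forward (hτ : IsSaddleChart φ γ τ) (hns : ∀ x, ∃ t, φ t x ≠ x) {δ : ℝ}
    (hδ : δ < 1) {q : M} (hq : ∀ t, 0 ≤ t → φ t q ∈ saddleBox τ δ) : (τ q).2.1 = 0 := by
  by_contra hy
  obtain ⟨α, hα, β, hβ, h⟩ := hτ.orbits
  let g : ℝ → ℝ := fun t => Real.log ((τ (φ t q)).2.1 / (τ q).2.1) / β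
  have hg : ∀ T, 0 < T → StrictMonoOn g (Icc 0 T) ∧
      ∀ t ∈ Icc 0 T, τ (φ t q) = linearSaddle α β (g t) (τ q) := by
    intro T hT
    obtain ⟨k, -, -, hkm, hk⟩ := h q T hT (fun t ht => (hq t ht.1).1)
    have : ∀ t ∈ Icc 0 T, g t = k t := by
      intro t ht
      simp only [g, hk t ht, linearSaddle]
      rw [mul_div_cancel_right₀ _ hy, Real.log_exp]
      field_simp
    refine ⟨hkm.congr (fun t ht => (this t ht).symm), fun t ht => ?_⟩
    rw [hk t ht, this t ht]
  have hmono : Monotone fun t => g (max 0 t) := by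
    intro a b hab
    have h1 : 0 < max 0 b + 1 := by positivity
    have h2 : max 0 a ≤ max 0 b := max_le_max le_rfl hab
    exact (hg _ h1).1.monotoneOn ⟨le_max_left _ _, by linarith⟩ ⟨le_max_left _ _, by linarith⟩ h2
  have hform : ∀ t, 0 ≤ t → τ (φ t q) = linearSaddle α β (g t) (τ q) := fun t ht =>
    (hg (t + 1) (by linarith)).2 t ⟨ht, by linarith⟩
  have hg0 : g 0 = 0 := by
    simp only [g, φ.map_zero_apply]
    rw [div_self hy]
    simp
  have hbdd : BddAbove (range fun t => g (max 0 t)) := by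
    refine ⟨Real.log (δ / |(τ q).2.1|) / β, ?_⟩
    rintro _ ⟨t, rfl⟩
    have h1 := hform (max 0 t) (le_max_left _ _)
    have h2 := (hq (max 0 t) (le_max_left _ _)).2.2
    rw [h1] at h2
    simp only [linearSaddle, abs_mul, Real.abs_exp] at h2
    have h3 : Real.exp (β * g (max 0 t)) < δ / |(τ q).2.1| := by
      rw [lt_div_iff₀ (abs_pos.2 hy)]
      exact h2
    have h4 := Real.log_lt_log (Real.exp_pos _) h3
    rw [Real.log_exp] at h4
    simp only
    rw [le_div_iff₀ hβ]
    linarith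
  have hlim := tendsto_atTop_ciSup hmono hbdd
  set L := ⨆ t, g (max 0 t)
  have hL0 : 0 ≤ L := by
    have := le_ciSup hbdd 0
    simpa [hg0] using this
  have hev : (fun t => τ (φ t q)) =ᶠ[atTop] fun t => linearSaddle α β (g (max 0 t)) (τ q) := by
    filter_upwards [eventually_ge_atTop 0] with t ht
    rw [max_eq_right ht, hform t ht]
  have hconv : Tendsto (fun t => τ (φ t q)) atTop (𝓝 (linearSaddle α β L (τ q))) :=
    (((continuous_linearSaddle α β (τ q)).tendsto L).comp hlim).congr' hev.symm
  have hmem : linearSaddle α β L (τ q) ∈ τ.target := by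
    rw [hτ.mem_target]
    constructor
    · have h1 := (hτ.abs_lt_one (hq 0 le_rfl).1).1
      rw [φ.map_zero_apply] at h1
      simp only [linearSaddle, abs_mul, Real.abs_exp]
      have h2 : Real.exp (-α * L) ≤ 1 := Real.exp_le_one_iff.2 (by nlinarith)
      nlinarith [abs_nonneg (τ q).1]
    · refine lt_of_le_of_lt ?_ hδ
      have h1 : Tendsto (fun t => |(τ (φ t q)).2.1|) atTop
          (𝓝 |(linearSaddle α β L (τ q)).2.1|) :=
        ((continuous_abs.comp (continuous_fst.comp continuous_snd)).tendsto _).comp hconv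
      refine le_of_tendsto h1 ?_
      filter_upwards [eventually_ge_atTop 0] with t ht
      exact (hq t ht).2.2.le
  have hconv' : Tendsto (fun t => φ t q) atTop (𝓝 (τ.symm (linearSaddle α β L (τ q)))) := by
    refine ((τ.continuousAt_symm hmem).tendsto.comp hconv).congr' ?_
    filter_upwards [eventually_ge_atTop 0] with t ht
    exact τ.left_inv (hq t ht).1
  obtain ⟨s, hs⟩ := hns (τ.symm (linearSaddle α β L (τ q)))
  refine hs (tendsto_nhds_unique ?_ (hconv'.comp (tendsto_atTop_add_const_left atTop s tendsto_id)))
  refine (((φ.continuous_toFun s).tendsto _).comp hconv').congr fun t => ?_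
  simp [φ.map_add]

theorem eq_zero_of_backward (hτ : IsSaddleChart φ γ τ) (hns : ∀ x, ∃ t, φ t x ≠ x) {δ : ℝ}
    (hδ : δ < 1) {q : M} (hq : ∀ t, t ≤ 0 → φ t q ∈ saddleBox τ δ) : (τ q).1 = 0 := by
  obtain ⟨τ', hτ', hs, h⟩ := hτ.exists_reverse
  have := hτ'.eq_zero_of_forward (fun x => ?_) hδ (q := q) (fun t ht => ?_)
  · rwa [h] at this
  · obtain ⟨t, ht⟩ := hns x
    exact ⟨-t, by rwa [Flow.reverse_apply, neg_neg]⟩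
  · obtain ⟨h1, h2, h3⟩ := hq (-t) (by linarith)
    exact ⟨by rwa [hs], by rwa [h], by rwa [h]⟩

/-- Orbits stay in a box until they leave through the unstable sides. -/
theorem stay [CompactSpace M] (hτ : IsSaddleChart φ γ τ) {q : M} (hq : q ∈ τ.source) {a : ℝ}
    (ha : a < 1) (hya : |(τ q).2.1| ≤ a) {T : ℝ}
    (h : (τ q).2.1 = 0 ∨ ∀ t ∈ Icc 0 T,
      (∀ s ∈ Icc 0 t, φ s q ∈ τ.source ∧ |(τ (φ s q)).1| ≤ |(τ q).1| ∧ |(τ (φ s q)).2.1| ≤ a) →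
      |(τ (φ t q)).2.1| ≠ a) :
    ∀ t ∈ Icc 0 T, φ t q ∈ τ.source ∧ |(τ (φ t q)).1| ≤ |(τ q).1| ∧ |(τ (φ t q)).2.1| ≤ a := by
  have hK : IsClosed {q' | q' ∈ τ.source ∧ |(τ q').1| ≤ |(τ q).1| ∧ |(τ q').2.1| ≤ a} := by
    have h1 : {q' | q' ∈ τ.source ∧ |(τ q').1| ≤ |(τ q).1| ∧ |(τ q').2.1| ≤ a} =
        τ.symm '' (Icc (-|(τ q).1|) |(τ q).1| ×ˢ Icc (-a) a ×ˢ univ) := by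
      ext q'
      simp only [mem_ofPred_eq, abs_le (b := |(τ q).1|), abs_le (b := a)]
      constructor
      · rintro ⟨h1, h2, h3⟩
        exact ⟨τ q', ⟨h2, h3, mem_univ _⟩, τ.left_inv h1⟩
      · rintro ⟨v, ⟨h1, h2, -⟩, rfl⟩
        have hv : v ∈ τ.target := hτ.mem_target.2
          ⟨(abs_le.2 h1).trans_lt (hτ.abs_lt_one hq).1, (abs_le.2 h2).trans_lt ha⟩
        rw [τ.right_inv hv]
        exact ⟨τ.map_target hv, h1, h2⟩
    rw [h1]
    refine IsCompact.isClosed (IsCompact.image_of_continuousOn ?_ (τ.continuousOn_symm.mono ?_))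
    · exact isCompact_Icc.prod (isCompact_Icc.prod isCompact_univ)
    · rintro v ⟨h1, h2, -⟩
      exact hτ.mem_target.2
        ⟨(abs_le.2 h1).trans_lt (hτ.abs_lt_one hq).1, (abs_le.2 h2).trans_lt ha⟩
  have hflow : Continuous fun t => φ t q := φ.continuous continuous_id continuous_const
  refine fun t ht => IsClosed.Icc_subset_of_forall_mem_nhdsGT_of_Icc_subset
    (s := {t | φ t q ∈ τ.source ∧ |(τ (φ t q)).1| ≤ |(τ q).1| ∧ |(τ (φ t q)).2.1| ≤ a})
    ((hK.preimage hflow).inter isClosed_Icc) ?_ ?_ ht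
  · rw [mem_ofPred_eq, φ.map_zero_apply]
    exact ⟨hq, le_rfl, hya⟩
  · intro t ht hsub
    have ht' := hsub ⟨ht.1, le_rfl⟩
    have hsrc : ∀ᶠ s in 𝓝 t, φ s q ∈ τ.source :=
      hflow.continuousAt.eventually (τ.open_source.mem_nhds ht'.1)
    obtain ⟨ε, hε, hball⟩ := Metric.eventually_nhds_iff.1 hsrc
    have key : ∀ s, t < s → s < t + ε → φ s q ∈ τ.source ∧ |(τ (φ s q)).1| ≤ |(τ q).1| ∧
        ((τ q).2.1 = 0 → (τ (φ s q)).2.1 = 0) := by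
      intro s hts hs
      have hall : ∀ r ∈ Icc 0 s, φ r q ∈ τ.source := by
        intro r hr
        rcases le_or_gt r t with hrt | hrt
        · exact (hsub ⟨hr.1, hrt⟩).1
        · refine hball ?_
          rw [Real.dist_eq, abs_lt]
          constructor <;> linarith [hr.2]
      have hs0 : 0 < s := by linarith [ht.1]
      obtain ⟨α, hα, β, hβ, horb⟩ := hτ.orbits
      obtain ⟨g, hg0, -, hgm, hg⟩ := horb q s hs0 hall
      have hgs : 0 < g s := by
        have := hgm ⟨le_rfl, hs0.le⟩ ⟨hs0.le, le_rfl⟩ hs0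
        rwa [hg0] at this
      refine ⟨hall s ⟨hs0.le, le_rfl⟩, ?_, fun h0 => ?_⟩
      · rw [hg s ⟨hs0.le, le_rfl⟩]
        simp only [linearSaddle, abs_mul, Real.abs_exp]
        have h2 : Real.exp (-α * g s) ≤ 1 := Real.exp_le_one_iff.2 (by nlinarith)
        nlinarith [abs_nonneg (τ q).1]
      · rw [hg s ⟨hs0.le, le_rfl⟩]
        simp [linearSaddle, h0]
    have hya' : (τ q).2.1 = 0 ∨ ∀ᶠ s in 𝓝 t, |(τ (φ s q)).2.1| ≤ a := by
      rcases h with h | h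
      · exact Or.inl h
      · right
        have hlt : |(τ (φ t q)).2.1| < a :=
          lt_of_le_of_ne ht'.2.2 (h t ⟨ht.1, ht.2.le⟩ fun s hs => hsub hs)
        have hc : ContinuousAt (fun s => |(τ (φ s q)).2.1|) t := by
          have h1 : ContinuousAt (fun s => τ (φ s q)) t :=
            ContinuousAt.comp (g := τ) (f := fun s => φ s q) (τ.continuousAt ht'.1)
              hflow.continuousAt
          exact (continuous_abs.comp (continuous_fst.comp continuous_snd)).continuousAt.comp h1
        filter_upwards [hc.eventually (gt_mem_nhds hlt)] with s hs using le_of_lt hs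
    have hup : ∀ᶠ s in 𝓝[>] t, t < s ∧ s < t + ε := by
      filter_upwards [Ioo_mem_nhdsGT (show t < t + ε by linarith)] with s hs using hs
    rcases hya' with h0 | h0
    · filter_upwards [hup] with s hs
      obtain ⟨h1, h2, h3⟩ := key s hs.1 hs.2
      refine ⟨h1, h2, ?_⟩
      rw [h3 h0, abs_zero]
      exact (abs_nonneg _).trans hya
    · filter_upwards [hup, nhdsWithin_le_nhds h0] with s hs hs'
      obtain ⟨h1, h2, h3⟩ := key s hs.1 hs.2
      exact ⟨h1, h2, hs'⟩

theorem forward_of_eq_zero [CompactSpace M] (hτ : IsSaddleChart φ γ τ) {δ : ℝ} {q : M}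
    (hq : q ∈ saddleBox τ δ) (hy : (τ q).2.1 = 0) {t : ℝ} (ht : 0 ≤ t) :
    φ t q ∈ saddleBox τ δ := by
  have hδ : 0 < δ := (abs_nonneg _).trans_lt hq.2.1
  have := hτ.stay hq.1 (a := 0) (by norm_num) (by simp [hy]) (T := t) (Or.inl hy) t ⟨ht, le_rfl⟩
  exact ⟨this.1, this.2.1.trans_lt hq.2.1, this.2.2.trans_lt hδ⟩

theorem backward_of_eq_zero [CompactSpace M] (hτ : IsSaddleChart φ γ τ) {δ : ℝ} {q : M}
    (hq : q ∈ saddleBox τ δ) (hx : (τ q).1 = 0) {t : ℝ} (ht : t ≤ 0) :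
    φ t q ∈ saddleBox τ δ := by
  obtain ⟨τ', hτ', hs, h⟩ := hτ.exists_reverse
  have := hτ'.forward_of_eq_zero (q := q) (δ := δ)
    ⟨by rw [hs]; exact hq.1, by rw [h]; exact hq.2.2, by rw [h]; exact hq.2.1⟩ (by rw [h]; exact hx)
    (t := -t) (by linarith)
  rw [Flow.reverse_apply, neg_neg] at this
  exact ⟨by rw [← hs]; exact this.1, by simpa [h] using this.2.2, by simpa [h] using this.2.1⟩

/-- The hyperbolic passage of an orbit near the saddle orbit. -/
theorem passage [CompactSpace M] (hτ : IsSaddleChart φ γ τ) (hns : ∀ x, ∃ t, φ t x ≠ x) {q : M}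
    (hq : q ∈ τ.source) (hy : (τ q).2.1 ≠ 0) {a : ℝ} (ha : a < 1) (hya : |(τ q).2.1| ≤ a) :
    ∃ t, 0 ≤ t ∧ (∀ s ∈ Icc 0 t, φ s q ∈ τ.source ∧ |(τ (φ s q)).1| ≤ |(τ q).1| ∧
      |(τ (φ s q)).2.1| ≤ a) ∧ |(τ (φ t q)).2.1| = a := by
  by_contra hcon
  push Not at hcon
  have hall : ∀ t, 0 ≤ t → φ t q ∈ saddleBox τ ((max |(τ q).1| a + 1) / 2) := by
    intro t ht
    have h1 := hτ.stay hq ha hya (T := t) (Or.inr fun s hs h => hcon s hs.1 h) t ⟨ht, le_rfl⟩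
    have h2 := le_max_left |(τ q).1| a
    have h3 := le_max_right |(τ q).1| a
    have h4 : max |(τ q).1| a < 1 := max_lt (hτ.abs_lt_one hq).1 ha
    exact ⟨h1.1, by linarith [h1.2.1], by linarith [h1.2.2]⟩
  refine hy (hτ.eq_zero_of_forward hns ?_ hall)
  have h4 : max |(τ q).1| a < 1 := max_lt (hτ.abs_lt_one hq).1 ha
  linarith

theorem exists_saddleBox_flow (hτ : IsSaddleChart φ γ τ) (hγ : ∀ t, ∀ q ∈ γ, φ t q ∈ γ)
    {O : Set M} (hO : IsOpen O) (hγO : γ ⊆ O) (T : ℝ) :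
    ∃ δ, 0 < δ ∧ δ < 1 ∧ ∀ q ∈ saddleBox τ δ, ∀ t ∈ Icc (-T) T, φ t q ∈ O := by
  have hopen : IsOpen {q | ∀ t ∈ Icc (-T) T, φ t q ∈ O} := by
    rw [isOpen_iff_mem_nhds]
    intro q hq
    refine isCompact_Icc.eventually_forall_of_forall_eventually fun t ht => ?_
    have hc : Continuous fun z : M × ℝ => φ z.2 z.1 := φ.continuous continuous_snd continuous_fst
    exact hc.continuousAt.eventually (hO.mem_nhds (hq t ht))
  obtain ⟨δ, h0, h1, h2⟩ := hτ.exists_saddleBox_subset hopen (fun q hq t _ => hγO (hγ t q hq))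
  exact ⟨δ, h0, h1, h2⟩

end IsSaddleChart

end SaddleFlow


/-! ### Planar domains -/

theorem not_between_of_injOn {E : Type*} [AddCommGroup E] [Module ℝ E] [TopologicalSpace E]
    [IsTopologicalAddGroup E] [ContinuousSMul ℝ E] {K : Set E}
    (hK : Convex ℝ K) {G : E → ℝ} (hG : ContinuousOn G K) (hi : InjOn G K) {a b c : E} (ha : a ∈ K)
    (hb : b ∈ K) (hc : c ∈ K) (hn : b ∉ segment ℝ a c) : ¬ (G a ≤ G b ∧ G b ≤ G c) := by
  intro h
  have hs := hK.segment_subset ha hc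
  have hcon : IsPreconnected (G '' segment ℝ a c) :=
    ((convex_segment a c).isPreconnected).image G (hG.mono hs)
  obtain ⟨p, hp, hpb⟩ := hcon.ordConnected.out ⟨a, left_mem_segment ℝ a c, rfl⟩
    ⟨c, right_mem_segment ℝ a c, rfl⟩ h
  exact hn (hi (hs hp) hb hpb ▸ hp)

/-- There is no continuous injection of a square into the circle. -/
theorem not_injOn_square {s : ℝ} (hs : 0 < s) {g : ℝ × ℝ → UnitAddCircle}
    (hg : ContinuousOn g (Icc 0 s ×ˢ Icc 0 s)) : ¬ InjOn g (Icc 0 s ×ˢ Icc 0 s) := by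
  intro hi
  let c : ℝ → ℝ := fun t => max 0 (min s t)
  have hc : Continuous c := by fun_prop
  have hcm : ∀ t, c t ∈ Icc 0 s := fun t => ⟨le_max_left _ _, max_le hs.le (min_le_left _ _)⟩
  have hcs : ∀ t ∈ Icc 0 s, c t = t := fun t ht => by
    simp only [c, min_eq_right ht.2, max_eq_right ht.1]
  obtain ⟨G, hG, hGg⟩ := exists_real_lift (E := ℝ × ℝ) (f := fun v => g (c v.1, c v.2))
    (hg.comp_continuous (by fun_prop) fun v => ⟨hcm _, hcm _⟩)
  have hinj : InjOn G (Icc 0 s ×ˢ Icc 0 s) := by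
    intro v hv w hw hvw
    have := congrArg (fun r : ℝ => (r : UnitAddCircle)) hvw
    simp only [hGg, hcs _ hv.1, hcs _ hv.2, hcs _ hw.1, hcs _ hw.2] at this
    exact hi hv hw this
  have hK : Convex ℝ (Icc 0 s ×ˢ Icc 0 s : Set (ℝ × ℝ)) := (convex_Icc 0 s).prod (convex_Icc 0 s)
  have key := fun {a b c : ℝ × ℝ} => not_between_of_injOn hK hG.continuousOn hinj (a := a) (b := b) (c := c)
  have h0 : ((0, 0) : ℝ × ℝ) ∈ (Icc 0 s ×ˢ Icc 0 s : Set (ℝ × ℝ)) := by simp [hs.le]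
  have h1 : ((s, 0) : ℝ × ℝ) ∈ (Icc 0 s ×ˢ Icc 0 s : Set (ℝ × ℝ)) := by simp [hs.le]
  have h2 : ((0, s) : ℝ × ℝ) ∈ (Icc 0 s ×ˢ Icc 0 s : Set (ℝ × ℝ)) := by simp [hs.le]
  have n0 : ((0, 0) : ℝ × ℝ) ∉ segment ℝ ((s, 0) : ℝ × ℝ) (0, s) := by
    rintro ⟨a, b, ha, hb, hab, h⟩
    simp only [Prod.smul_mk, smul_eq_mul, Prod.mk_add_mk, Prod.mk.injEq] at h
    nlinarith [h.1, h.2]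
  have n1 : ((s, 0) : ℝ × ℝ) ∉ segment ℝ ((0, 0) : ℝ × ℝ) (0, s) := by
    rintro ⟨a, b, ha, hb, hab, h⟩
    simp only [Prod.smul_mk, smul_eq_mul, Prod.mk_add_mk, Prod.mk.injEq] at h
    nlinarith [h.1, h.2]
  have n2 : ((0, s) : ℝ × ℝ) ∉ segment ℝ ((0, 0) : ℝ × ℝ) (s, 0) := by
    rintro ⟨a, b, ha, hb, hab, h⟩
    simp only [Prod.smul_mk, smul_eq_mul, Prod.mk_add_mk, Prod.mk.injEq] at h
    nlinarith [h.1, h.2]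
  have n0' : ((0, 0) : ℝ × ℝ) ∉ segment ℝ ((0, s) : ℝ × ℝ) (s, 0) := by rwa [segment_symm]
  have n1' : ((s, 0) : ℝ × ℝ) ∉ segment ℝ ((0, s) : ℝ × ℝ) (0, 0) := by rwa [segment_symm]
  have n2' : ((0, s) : ℝ × ℝ) ∉ segment ℝ ((s, 0) : ℝ × ℝ) (0, 0) := by rwa [segment_symm]
  have k1 := key h1 h0 h2 n0
  have k2 := key h2 h0 h1 n0'
  have k3 := key h0 h1 h2 n1
  have k4 := key h2 h1 h0 n1'
  have k5 := key h0 h2 h1 n2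
  have k6 := key h1 h2 h0 n2'
  generalize G (0, 0) = a at k1 k2 k3 k4 k5 k6
  generalize G (s, 0) = b at k1 k2 k3 k4 k5 k6
  generalize G (0, s) = d at k1 k2 k3 k4 k5 k6
  rcases le_total a b with h | h <;> rcases le_total a d with h' | h' <;>
    rcases le_total b d with h'' | h'' <;>
    first
    | exact k1 ⟨h, h'⟩
    | exact k2 ⟨h', h⟩
    | exact k3 ⟨h, h''⟩
    | exact k4 ⟨h'', h⟩
    | exact k5 ⟨h', h''⟩
    | exact k6 ⟨h'', h'⟩

/-- An open set of the half plane contains squares. -/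
theorem exists_square {O : Set (EuclideanHalfSpace 2)} (hO : IsOpen O) {y : EuclideanHalfSpace 2}
    (hy : y ∈ O) : ∃ s > 0, ∃ j : ℝ × ℝ → EuclideanHalfSpace 2,
      ContinuousOn j (Icc 0 s ×ˢ Icc 0 s) ∧ InjOn j (Icc 0 s ×ˢ Icc 0 s) ∧
      MapsTo j (Icc 0 s ×ˢ Icc 0 s) O := by
  let j : ℝ × ℝ → EuclideanHalfSpace 2 := fun v =>
    ⟨WithLp.toLp 2 ![y.1 0 + |v.1|, y.1 1 + v.2], by
      have := y.2
      simp only [Matrix.cons_val_zero]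
      positivity⟩
  have hj : Continuous j := by
    refine Continuous.subtype_mk ?_ _
    refine (PiLp.continuous_toLp 2 _).comp ?_
    refine continuous_pi fun i => ?_
    fin_cases i
    · simp only [Fin.zero_eta, Matrix.cons_val_zero]
      fun_prop
    · simp only [Fin.mk_one, Matrix.cons_val_one]
      fun_prop
  have hj0 : j (0, 0) = y := by
    refine Subtype.ext ?_
    ext i
    fin_cases i <;> simp [j]
  have h1 : j ⁻¹' O ∈ 𝓝 ((0, 0) : ℝ × ℝ) := (hO.preimage hj).mem_nhds (by rwa [mem_preimage, hj0])
  obtain ⟨ε, hε, h2⟩ := Metric.mem_nhds_iff.1 h1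
  refine ⟨ε / 2, by positivity, j, hj.continuousOn, ?_, ?_⟩
  · rintro v ⟨hv1, -⟩ w ⟨hw1, -⟩ hvw
    have h3 : (j v).1 0 = (j w).1 0 := by rw [hvw]
    have h4 : (j v).1 1 = (j w).1 1 := by rw [hvw]
    simp only [j, Matrix.cons_val_zero, Matrix.cons_val_one, abs_of_nonneg hv1.1,
      abs_of_nonneg hw1.1] at h3 h4
    exact Prod.ext (by linarith) (by linarith)
  · rintro v ⟨hv1, hv2⟩
    refine h2 ?_
    rw [mem_ball_iff_norm, Prod.norm_def]
    simp only [Prod.fst_sub, Prod.snd_sub, sub_zero, Real.norm_eq_abs, abs_of_nonneg hv1.1,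
      abs_of_nonneg hv2.1]
    exact max_lt (by linarith [hv1.2]) (by linarith [hv2.2])

theorem toCircle_ne_zero (s : UnitAddCircle) : ((AddCircle.toCircle s : Circle) : ℂ) ≠ 0 :=
  Circle.coe_ne_zero _

theorem continuous_toCircle_coe :
    Continuous fun s : UnitAddCircle => ((AddCircle.toCircle s : Circle) : ℂ) :=
  continuous_subtype_val.comp AddCircle.continuous_toCircle

/-- A boundary point of the half plane has no planar neighbourhood. -/
theorem halfSpace_ne_zero (G : OpenPartialHomeomorph ℂ (EuclideanHalfSpace 2)) {z₀ : ℂ}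
    (hz : z₀ ∈ G.source) : (G z₀).1 0 ≠ 0 := by
  intro h0
  obtain ⟨O, hO, hOG⟩ := isOpen_induced_iff.1 G.open_target
  have hyO : (G z₀).1 ∈ O := by
    have : G z₀ ∈ Subtype.val ⁻¹' O := by rw [hOG]; exact G.map_source hz
    exact this
  obtain ⟨ε, hε, hB⟩ := Metric.mem_nhds_iff.1 (hO.mem_nhds hyO)
  let y : EuclideanSpace ℝ (Fin 2) := (G z₀).1
  let B : Set (EuclideanSpace ℝ (Fin 2)) := {v | 0 ≤ v 0} ∩ Metric.ball y ε
  have hBt : ∀ v : EuclideanHalfSpace 2, v.1 ∈ B → v ∈ G.target := by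
    intro v hv
    rw [← hOG]
    exact hB hv.2
  have hBconv : Convex ℝ B := by
    refine Convex.inter ?_ (convex_ball _ _)
    intro v hv w hw a b ha hb _
    simp only [mem_ofPred_eq] at hv hw ⊢
    simp only [PiLp.add_apply, PiLp.smul_apply, smul_eq_mul]
    positivity
  -- a small circle about `z₀`
  have hO1 : G.source ∩ G ⁻¹' (Subtype.val ⁻¹' Metric.ball y ε) ∈ 𝓝 z₀ :=
    (G.isOpen_inter_preimage (Metric.isOpen_ball.preimage continuous_subtype_val)).mem_nhds
      ⟨hz, Metric.mem_ball_self hε⟩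
  obtain ⟨δ, hδ, hδO⟩ := Metric.mem_nhds_iff.1 hO1
  let l : UnitAddCircle → ℂ := fun s => z₀ + (δ / 2 : ℝ) * ((AddCircle.toCircle s : Circle) : ℂ)
  have hlc : Continuous l := by
    have := continuous_toCircle_coe
    fun_prop
  have hl : ∀ s, l s ∈ G.source ∧ (G (l s)).1 ∈ Metric.ball y ε := by
    intro s
    have : l s ∈ Metric.ball z₀ δ := by
      simp only [l, mem_ball_iff_norm, add_sub_cancel_left, norm_mul, Circle.norm_coe, mul_one,
        Complex.norm_real, Real.norm_eq_abs]
      rw [abs_of_pos (by positivity)]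
      linarith
    exact hδO this
  have hlz : ∀ s, l s ≠ z₀ := by
    intro s h
    have : ((δ / 2 : ℝ) : ℂ) * ((AddCircle.toCircle s : Circle) : ℂ) = 0 := by
      simpa [l] using h
    rcases mul_eq_zero.1 this with h | h
    · norm_cast at h
      linarith
    · exact toCircle_ne_zero s h
  let e₀ : EuclideanSpace ℝ (Fin 2) := y + (ε / 2) • EuclideanSpace.single 0 1
  have he₀ : e₀ ∈ B := by
    constructor
    · simp only [mem_ofPred_eq, e₀, PiLp.add_apply, PiLp.smul_apply]
      simp only [y, h0, zero_add, PiLp.single_apply, if_true, smul_eq_mul, mul_one]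
      positivity
    · simp only [e₀, mem_ball_iff_norm, add_sub_cancel_left, norm_smul]
      simp only [Real.norm_eq_abs, PiLp.norm_single, norm_one, mul_one]
      rw [abs_of_pos (by positivity)]
      linarith
  let h : ℝ × UnitAddCircle → EuclideanSpace ℝ (Fin 2) :=
    fun v => AffineMap.lineMap (G (l v.2)).1 e₀ v.1
  have hGl : Continuous fun s => (G (l s)).1 :=
    continuous_subtype_val.comp (G.continuousOn.comp_continuous hlc fun s => (hl s).1)
  have hhc : Continuous h := by
    simp only [h, AffineMap.lineMap_apply_module]
    exact ((continuous_const.sub continuous_fst).smul (hGl.comp continuous_snd)).add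
      (continuous_fst.smul continuous_const)
  have hhB : ∀ v ∈ Icc (0 : ℝ) 1 ×ˢ (univ : Set UnitAddCircle), h v ∈ B := by
    rintro ⟨t, s⟩ ⟨ht, -⟩
    refine hBconv.segment_subset ⟨(G (l s)).2, (hl s).2⟩ he₀ ?_
    rw [segment_eq_image_lineMap]
    exact ⟨t, ht, rfl⟩
  have hhy : ∀ v ∈ Icc (0 : ℝ) 1 ×ˢ (univ : Set UnitAddCircle), h v ≠ y := by
    rintro ⟨t, s⟩ ⟨ht, -⟩ hcon
    have h2 : h (t, s) 0 = 0 := by rw [hcon]; exact h0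
    simp only [h, AffineMap.lineMap_apply_module, PiLp.add_apply, PiLp.smul_apply, smul_eq_mul] at h2
    have he0 : e₀ 0 = ε / 2 := by simp [e₀, y, h0]
    rw [he0] at h2
    have h3 : 0 ≤ (G (l s)).1 0 := (G (l s)).2
    have h4 : t = 0 := by
      have h5 := ht.1
      have h6 := ht.2
      simp only at h5 h6
      by_contra hne
      have : 0 < t := lt_of_le_of_ne h5 (Ne.symm hne)
      nlinarith [mul_nonneg (sub_nonneg.2 h6) h3, mul_pos this hε]
    subst h4
    have h7 : G (l s) = G z₀ := Subtype.ext (by simpa [h] using hcon)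
    exact hlz s (G.injOn (hl s).1 hz h7)
  let j : EuclideanSpace ℝ (Fin 2) → ℂ := fun v =>
    G.symm ⟨WithLp.toLp 2 ![|v 0|, v 1], by simp⟩
  have hjB : ∀ v : EuclideanHalfSpace 2, j v.1 = G.symm v := by
    intro v
    simp only [j]
    congr 1
    refine Subtype.ext ?_
    ext i
    fin_cases i
    · simp [abs_of_nonneg v.2]
    · simp
  have hjc : ContinuousOn j B := by
    refine G.continuousOn_symm.comp (Continuous.continuousOn ?_) ?_
    · refine Continuous.subtype_mk ?_ _
      refine (PiLp.continuous_toLp 2 _).comp (continuous_pi fun i => ?_)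
      fin_cases i
      · simp only [Fin.zero_eta, Matrix.cons_val_zero]
        fun_prop
      · simp only [Fin.mk_one, Matrix.cons_val_one]
        fun_prop
    · intro v hv
      refine hBt _ ?_
      convert hv using 1
      ext i
      fin_cases i
      · simp [abs_of_nonneg (show 0 ≤ v 0 from hv.1)]
      · simp
  have hjz : ∀ v ∈ B, v ≠ y → j v - z₀ ≠ 0 := by
    intro v hv hvy hcon
    have h1 := hjB ⟨v, hv.1⟩
    simp only at h1
    rw [sub_eq_zero, h1] at hcon
    refine hvy ?_
    have h2 := G.right_inv (hBt ⟨v, hv.1⟩ hv)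
    rw [hcon] at h2
    exact (congrArg Subtype.val h2).symm
  have hcont : ContinuousOn (fun v => turn (j (h v) - z₀)) (Icc (0 : ℝ) 1 ×ˢ univ) := by
    intro v hv
    have h1 : ContinuousWithinAt (fun v => j (h v) - z₀) (Icc (0 : ℝ) 1 ×ˢ univ) v :=
      ((hjc _ (hhB v hv)).comp hhc.continuousWithinAt hhB).sub continuousWithinAt_const
    exact ContinuousAt.comp_continuousWithinAt (f := fun v => j (h v) - z₀) (g := turn)
      (continuousAt_turn (hjz _ (hhB v hv) (hhy v hv))) h1
  have hd0 : HasDegree (fun s => turn (j (h (0, s)) - z₀)) 1 := by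
    have : (fun s => turn (j (h (0, s)) - z₀)) = fun s => s := by
      funext s
      have : j (h (0, s)) = l s := by
        simp only [h, AffineMap.lineMap_apply_zero]
        rw [hjB, G.left_inv (hl s).1]
      rw [this]
      simp only [l, add_sub_cancel_left]
      rw [turn_ofReal_mul (by positivity), turn_toCircle]
    rw [this]
    exact hasDegree_id
  have hd1 := HasDegree.of_convex (convex_Icc (0 : ℝ) 1) hcont (by simp) (b := 1) (by simp) hd0
  have hd2 : HasDegree (fun s => turn (j (h (1, s)) - z₀)) 0 := by
    simp only [h, AffineMap.lineMap_apply_one]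
    exact hasDegree_const _
  exact one_ne_zero (hd1.unique hd2)

/-! ### Boundary components of a Birkhoff section -/

section Boundary

variable {M : Type*} [MetricSpace M]
  {S : Type*} [TopologicalSpace S] [ChartedSpace (EuclideanHalfSpace 2) S]
  {φ : Flow ℝ M} {ι : S → M}

theorem mem_bdry_iff {x : S} : x ∈ bdry S ↔ (chartAt (EuclideanHalfSpace 2) x x).1 0 = 0 := by
  have : x ∈ bdry S ↔ extChartAt (𝓡∂ 2) x x ∈ frontier (range (𝓡∂ 2)) := Iff.rfl
  rw [this, frontier_range_modelWithCornersEuclideanHalfSpace]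
  exact eq_comm

theorem mem_intr_or_mem_bdry (x : S) : x ∈ intr S ∨ x ∈ bdry S :=
  ModelWithCorners.isInteriorPoint_or_isBoundaryPoint x

theorem notMem_bdry_of_mem_intr {x : S} (h : x ∈ intr S) : x ∉ bdry S :=
  fun h' => (ModelWithCorners.disjoint_interior_boundary (I := 𝓡∂ 2) (M := S)).le_bot ⟨h, h'⟩

/-- A boundary point of a surface has no planar neighbourhood. -/
theorem notMem_bdry_of_planar (g : OpenPartialHomeomorph ℂ S) {z₀ : ℂ} (hz : z₀ ∈ g.source) :
    g z₀ ∉ bdry S := by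
  rw [mem_bdry_iff]
  exact halfSpace_ne_zero (g.trans (chartAt (EuclideanHalfSpace 2) (g z₀)))
    (by rw [OpenPartialHomeomorph.trans_source]; exact ⟨hz, mem_chart_source _ _⟩)

theorem exists_polar : ∃ e : OpenPartialHomeomorph ℂ (Ico (0 : ℝ) 1 × UnitAddCircle),
    e.target = {q | 0 < (q.1 : ℝ)} := by
  let f : ℂ → Ico (0 : ℝ) 1 × UnitAddCircle := fun ζ =>
    (if h : ‖ζ‖ < 1 then ⟨‖ζ‖, norm_nonneg _, h⟩ else ⟨0, by simp⟩, turn ζ)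
  have hf : ∀ ζ, ‖ζ‖ < 1 → ((f ζ).1 : ℝ) = ‖ζ‖ := fun ζ h => by simp [f, h]
  refine ⟨⟨⟨⟨f, fun q => ((q.1 : ℝ) : ℂ) * ((AddCircle.toCircle q.2 : Circle) : ℂ),
    {ζ | ζ ≠ 0 ∧ ‖ζ‖ < 1}, {q | 0 < (q.1 : ℝ)}, ?_, ?_, ?_, ?_⟩, ?_, ?_⟩, ?_, ?_⟩, rfl⟩
  · rintro ζ ⟨h1, h2⟩
    simp only [mem_ofPred_eq, hf ζ h2]
    exact norm_pos_iff.2 h1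
  · rintro q hq
    simp only [mem_ofPred_eq] at hq ⊢
    refine ⟨mul_ne_zero (by exact_mod_cast hq.ne') (toCircle_ne_zero _), ?_⟩
    simp only [norm_mul, Circle.norm_coe, mul_one, Complex.norm_real, Real.norm_eq_abs,
      abs_of_pos hq]
    exact q.1.2.2
  · rintro ζ ⟨h1, h2⟩
    simp only [hf ζ h2]
    have h3 : ((AddCircle.toCircle (f ζ).2 : Circle) : ℂ) = ζ / ‖ζ‖ := by
      have h4 : turn ζ = turn (ζ / ‖ζ‖) := by
        rw [div_eq_inv_mul, ← Complex.ofReal_inv, turn_ofReal_mul (inv_pos.2 (norm_pos_iff.2 h1))]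
      have h5 : ‖ζ / ‖ζ‖‖ = 1 := by
        rw [norm_div, Complex.norm_real, norm_norm, div_self (norm_ne_zero_iff.2 h1)]
      obtain ⟨s, hs⟩ := (AddCircle.homeomorphCircle (T := (1 : ℝ)) one_ne_zero).surjective
        ⟨ζ / ‖ζ‖, mem_sphere_zero_iff_norm.2 h5⟩
      have hs' : ((AddCircle.toCircle s : Circle) : ℂ) = ζ / ‖ζ‖ := by
        have := congrArg (fun z : Circle => (z : ℂ)) hs
        simpa [AddCircle.homeomorphCircle_apply] using this
      have h6 : (f ζ).2 = s := by
        change turn ζ = s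
        rw [h4, ← hs', turn_toCircle]
      rw [h6, hs']
    rw [h3, mul_div_cancel₀]
    exact_mod_cast norm_ne_zero_iff.2 h1
  · rintro q hq
    simp only [mem_ofPred_eq] at hq
    have h1 : ‖((q.1 : ℝ) : ℂ) * ((AddCircle.toCircle q.2 : Circle) : ℂ)‖ = q.1 := by
      simp only [norm_mul, Circle.norm_coe, mul_one, Complex.norm_real, Real.norm_eq_abs,
        abs_of_pos hq]
    refine Prod.ext (Subtype.ext ?_) ?_
    · rw [hf _ (by rw [h1]; exact q.1.2.2), h1]
    · simp only [f]
      rw [turn_ofReal_mul hq, turn_toCircle]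
  · refine ContinuousOn.prodMk ?_ ?_
    · rw [Topology.IsInducing.subtypeVal.continuousOn_iff]
      exact continuous_norm.continuousOn.congr fun ζ hζ => hf ζ hζ.2
    · exact fun ζ hζ => (continuousAt_turn hζ.1).continuousWithinAt
  · have := continuous_toCircle_coe
    exact Continuous.continuousOn (by fun_prop)
  · exact (isOpen_ne).inter (isOpen_lt continuous_norm continuous_const)
  · exact isOpen_lt continuous_const (by fun_prop)

theorem IsOpenEmbedding.collar_notMem_bdry {c : Ico (0 : ℝ) 1 × UnitAddCircle → S}
    (hc : IsOpenEmbedding c) {q : Ico (0 : ℝ) 1 × UnitAddCircle} (hq : 0 < (q.1 : ℝ)) :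
    c q ∉ bdry S := by
  obtain ⟨e, he⟩ := exists_polar
  have : Nonempty (Ico (0 : ℝ) 1 × UnitAddCircle) := ⟨q⟩
  have hqt : q ∈ e.target := by rw [he]; exact hq
  have := notMem_bdry_of_planar (e.trans (hc.toOpenPartialHomeomorph c)) (z₀ := e.symm q)
    (by simpa using e.map_target hqt)
  simpa [e.right_inv hqt] using this

theorem isPreconnected_orbit (x : M) : IsPreconnected (φ.orbit x) := by
  rw [Flow.orbit_eq_range]
  exact isPreconnected_range (φ.continuous continuous_id continuous_const)

theorem orbit_eq_of_mem {x y : M} (h : y ∈ φ.orbit x) : φ.orbit y = φ.orbit x := by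
  obtain ⟨t, rfl⟩ := h
  ext z
  constructor
  · rintro ⟨s, rfl⟩
    exact ⟨s + t, φ.map_add _ _ _⟩
  · rintro ⟨s, rfl⟩
    refine ⟨s - t, ?_⟩
    change φ (s - t) (φ t x) = φ s x
    rw [← φ.map_add, sub_add_cancel]

namespace IsBirkhoffSection

theorem image_component (hι : IsBirkhoffSection φ ι) {x : S} (hx : x ∈ bdry S) :
    ι '' connectedComponentIn (bdry S) x = φ.orbit (ι x) := by
  obtain ⟨h, hc⟩ := hι.covering x hx
  have hopen := hc.isOpenMap.isOpen_range
  have hclosed : IsClosed (range (h.restrict ι _ _)) := by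
    rw [← isOpen_compl_iff, isOpen_iff_mem_nhds]
    intro y hy
    obtain ⟨-, U, hyU, hU, -, H, -⟩ := hc y
    filter_upwards [hU.mem_nhds hyU] with z hz
    rintro ⟨e, rfl⟩
    have h1 := (H ⟨e, hz⟩).2.2
    exact hy ⟨_, h1⟩
  have : PreconnectedSpace (φ.orbit (ι x)) :=
    isPreconnected_iff_preconnectedSpace.1 (isPreconnected_orbit _)
  have huniv : range (h.restrict ι _ _) = univ := by
    refine IsClopen.eq_univ ⟨hclosed, hopen⟩ ⟨_, ⟨x, mem_connectedComponentIn hx⟩, rfl⟩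
  refine Subset.antisymm h.image_subset fun y hy => ?_
  obtain ⟨e, he⟩ := (huniv ▸ mem_univ (⟨y, hy⟩ : φ.orbit (ι x)) : _ ∈ range _)
  exact ⟨e, e.2, congrArg Subtype.val he⟩

variable {γ : Set M}

theorem eq_orbit {x : S} (hγ : γ ∈ boundaryOrbits φ ι) (hx : ι x ∈ γ) : γ = φ.orbit (ι x) := by
  obtain ⟨x₀, -, rfl⟩ := hγ
  exact (orbit_eq_of_mem hx).symm

theorem image_componentsOver (hι : IsBirkhoffSection φ ι) (hγ : γ ∈ boundaryOrbits φ ι)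
    {C : Set S} (hC : C ∈ componentsOver ι γ) : ι '' C = γ := by
  obtain ⟨x, hx, hxγ, rfl⟩ := hC
  rw [hι.image_component hx, ← eq_orbit hγ hxγ]

theorem orbit_subset_image (hι : IsBirkhoffSection φ ι) (hγ : γ ∈ boundaryOrbits φ ι) :
    γ ⊆ ι '' bdry S := by
  obtain ⟨x, hx, rfl⟩ := hγ
  rw [← hι.image_component hx]
  exact image_mono (connectedComponentIn_subset _ _)

theorem preimage_orbit (hι : IsBirkhoffSection φ ι) (hγ : γ ∈ boundaryOrbits φ ι) :
    ι ⁻¹' γ = ⋃₀ componentsOver ι γ := by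
  ext x
  constructor
  · intro hx
    rcases mem_intr_or_mem_bdry x with h | h
    · exact absurd (hι.orbit_subset_image hγ hx) (hι.interior_compl x h)
    · exact ⟨_, ⟨x, h, hx, rfl⟩, mem_connectedComponentIn h⟩
  · rintro ⟨C, hC, hx⟩
    rw [mem_preimage, ← hι.image_componentsOver hγ hC]
    exact ⟨x, hx, rfl⟩

theorem nonempty_of_mem_componentsOver {C : Set S} (hC : C ∈ componentsOver ι γ) : C.Nonempty := by
  obtain ⟨x, hx, -, rfl⟩ := hC
  exact ⟨x, mem_connectedComponentIn hx⟩

theorem subset_bdry_of_mem_componentsOver {C : Set S} (hC : C ∈ componentsOver ι γ) :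
    C ⊆ bdry S := by
  obtain ⟨x, hx, -, rfl⟩ := hC
  exact connectedComponentIn_subset _ _

theorem componentsOver_eq_of_mem {C C' : Set S} (hC : C ∈ componentsOver ι γ)
    (hC' : C' ∈ componentsOver ι γ) {x : S} (hx : x ∈ C) (hx' : x ∈ C') : C = C' := by
  obtain ⟨y, -, -, rfl⟩ := hC
  obtain ⟨y', -, -, rfl⟩ := hC'
  rw [connectedComponentIn_eq hx, connectedComponentIn_eq hx']

theorem orbit_invariant (hγ : γ ∈ boundaryOrbits φ ι) (t : ℝ) : ∀ q ∈ γ, φ t q ∈ γ := by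
  obtain ⟨x, -, rfl⟩ := hγ
  exact fun q hq => φ.mem_orbit_of_mem_orbit t hq

theorem not_isOpen_component {τ : OpenPartialHomeomorph M (ℝ × ℝ × UnitAddCircle)}
    (hι : IsBirkhoffSection φ ι) (hγ : γ ∈ boundaryOrbits φ ι) (hτ : IsSaddleChart φ γ τ)
    {C : Set S} (hC : C ∈ componentsOver ι γ) : ¬ IsOpen C := by
  intro hopen
  obtain ⟨x, hx⟩ := nonempty_of_mem_componentsOver hC
  obtain ⟨V, hV, hinj⟩ := hι.immersion x
  let e := chartAt (EuclideanHalfSpace 2) x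
  have hO : IsOpen (e.source ∩ (C ∩ interior V)) :=
    e.open_source.inter (hopen.inter isOpen_interior)
  have hO' := e.isOpen_image_of_subset_source hO inter_subset_left
  have hxO : x ∈ e.source ∩ (C ∩ interior V) :=
    ⟨mem_chart_source _ _, hx, mem_interior_iff_mem_nhds.2 hV⟩
  obtain ⟨s, hs, j, hjc, hji, hjm⟩ := exists_square hO' ⟨x, hxO, rfl⟩
  have hback : ∀ v ∈ Icc 0 s ×ˢ Icc 0 s, j v ∈ e.target ∧ e.symm (j v) ∈ C ∩ interior V := by
    intro v hv
    obtain ⟨x', hx', hx'v⟩ := hjm hv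
    rw [← hx'v, e.left_inv hx'.1]
    exact ⟨e.map_source hx'.1, hx'.2⟩
  have hCγ : ∀ x' ∈ C, ι x' ∈ γ := fun x' hx' => by
    rw [← hι.image_componentsOver hγ hC]
    exact ⟨x', hx', rfl⟩
  refine not_injOn_square hs (g := fun v => (τ (ι (e.symm (j v)))).2.2) ?_ ?_
  · have h1 : ContinuousOn (fun v => ι (e.symm (j v))) (Icc 0 s ×ˢ Icc 0 s) :=
      hι.continuous.comp_continuousOn (e.continuousOn_symm.comp hjc fun v hv => (hback v hv).1)
    have h2 := τ.continuousOn.comp h1 fun v hv => hτ.orbit_subset (hCγ _ (hback v hv).2.1)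
    exact (continuous_snd.comp continuous_snd).comp_continuousOn h2
  · intro v hv w hw hvw
    have h1 := hCγ _ (hback v hv).2.1
    have h2 := hCγ _ (hback w hw).2.1
    have h3 := (hτ.mem_orbit_iff _ (hτ.orbit_subset h1)).1 h1
    have h4 := (hτ.mem_orbit_iff _ (hτ.orbit_subset h2)).1 h2
    have h5 : τ (ι (e.symm (j v))) = τ (ι (e.symm (j w))) :=
      Prod.ext (by rw [h3.1, h4.1]) (Prod.ext (by rw [h3.2, h4.2]) hvw)
    have h6 := τ.injOn (hτ.orbit_subset h1) (hτ.orbit_subset h2) h5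
    have h7 := hinj (interior_subset (hback v hv).2.2) (interior_subset (hback w hw).2.2) h6
    exact hji hv hw (e.symm.injOn (hback v hv).1 (hback w hw).1 h7)

end IsBirkhoffSection

end Boundary


/-! ### The ends of the interior of the section -/

section Ends

variable {S : Type*} [TopologicalSpace S] [ChartedSpace (EuclideanHalfSpace 2) S]

/-- A chart of the interior of `S` near the end `C`, with values in a punctured disk, such that the
charts of `A` are the branches of its power `k / 2`. -/
structure EndChart (A : Set (OpenPartialHomeomorph (intr S) (ℝ × ℝ))) (C : Set S) where
  k : ℕ
  k_pos : 0 < k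
  e : OpenPartialHomeomorph (intr S) ℂ
  ρ : ℝ
  ρ_pos : 0 < ρ
  target_eq : e.target = {ζ | ζ ≠ 0 ∧ ‖ζ‖ < ρ}
  near : ∀ r > 0, ∃ O : Set S, IsOpen O ∧ C ⊆ O ∧ (∀ x ∈ O, x ∉ C → x ∈ intr S) ∧
    ∀ u : intr S, (u : S) ∈ O → u ∈ e.source ∧ ‖e u‖ < r
  shrink : ∀ O : Set S, IsOpen O → C ⊆ O → ∃ r > 0, ∀ u ∈ e.source, ‖e u‖ < r → (u : S) ∈ O
  coord : ∀ u ∈ e.source, ∀ f ∈ A, u ∈ f.source → ∃ w : intr S → ℂ, map w (𝓝 u) = 𝓝 (w u) ∧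
    (∀ᶠ u' in 𝓝 u, w u' ^ 2 = e u' ^ k) ∧ LocallyAffine 1 f (fun u' => ((w u').re, (w u').im)) u

theorem map_nhds_of_locallyAffine {X : Type*} [TopologicalSpace X] {f : X → ℝ × ℝ} {w : X → ℂ}
    {x : X} (hf : map f (𝓝 x) = 𝓝 (f x))
    (h : LocallyAffine 1 f (fun x' => ((w x').re, (w x').im)) x) : map w (𝓝 x) = 𝓝 (w x) := by
  obtain ⟨ε, δ, c, d, hε, hδ, h⟩ := h
  have hε2 : ε * ε = 1 := by rcases hε with rfl | rfl <;> norm_num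
  have hδ2 : δ * δ = 1 := by rcases hδ with rfl | rfl <;> norm_num
  let B : (ℝ × ℝ) ≃ₜ ℂ :=
    { toFun := fun v => ⟨ε * (v.1 - c), δ * (v.2 - d)⟩
      invFun := fun ζ => (ε * ζ.re + c, δ * ζ.im + d)
      left_inv := fun v => Prod.ext (by simp only; linear_combination (v.1 - c) * hε2)
        (by simp only; linear_combination (v.2 - d) * hδ2)
      right_inv := fun ζ => Complex.ext (by simp only; linear_combination ζ.re * hε2)
        (by simp only; linear_combination ζ.im * hδ2)
      continuous_toFun := by
        simp only [Complex.mk_eq_add_mul_I]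
        fun_prop
      continuous_invFun := by fun_prop }
  have hw : w =ᶠ[𝓝 x] fun x' => B (f x') := by
    filter_upwards [h] with x' hx'
    rw [hx']
    refine Complex.ext ?_ ?_
    · change (w x').re = ε * (ε * (1 * (w x').re) + c - c)
      linear_combination -(w x').re * hε2
    · change (w x').im = δ * (δ * (1⁻¹ * (w x').im) + d - d)
      linear_combination -(w x').im * hδ2
  rw [Filter.map_congr hw, hw.eq_of_nhds]
  change map (B ∘ f) (𝓝 x) = _
  rw [← Filter.map_map, hf, B.map_nhds_eq]

theorem pow_hasStrictDerivAt {k : ℕ} (z : ℂ) :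
    HasStrictDerivAt (fun z : ℂ => z ^ k) (k * z ^ (k - 1)) z := by
  exact hasStrictDerivAt_pow k z

theorem map_nhds_of_pow {X : Type*} [TopologicalSpace X] {ψ w : X → ℂ} {x : X} {k : ℕ}
    (hk : 0 < k) (hψ : ContinuousAt ψ x) (hψ0 : ψ x ≠ 0) (hw : map w (𝓝 x) = 𝓝 (w x))
    (h : ∀ᶠ x' in 𝓝 x, w x' ^ 2 = ψ x' ^ k) : map ψ (𝓝 x) = 𝓝 (ψ x) := by
  have hw0 : w x ≠ 0 := by
    intro h0
    have := h.self_of_nhds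
    rw [h0] at this
    exact pow_ne_zero k hψ0 (by simpa using this.symm)
  have h1 : map (fun z : ℂ => z ^ k) (map ψ (𝓝 x)) = 𝓝 (ψ x ^ k) := by
    rw [Filter.map_map, ← h.self_of_nhds,
      ← (pow_hasStrictDerivAt (k := 2) (w x)).map_nhds_eq (by simpa using hw0), ← hw,
      Filter.map_map]
    exact (Filter.map_congr h).symm
  have hd := pow_hasStrictDerivAt (k := k) (ψ x)
  have hd0 : (k : ℂ) * ψ x ^ (k - 1) ≠ 0 :=
    mul_ne_zero (by exact_mod_cast hk.ne') (pow_ne_zero _ hψ0)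
  have h2 : map (hd.localInverse _ _ _ hd0) (map (fun z : ℂ => z ^ k) (map ψ (𝓝 x))) =
      map ψ (𝓝 x) := by
    rw [Filter.map_map]
    conv_rhs => rw [← Filter.map_id (f := map ψ (𝓝 x))]
    refine Filter.map_congr ?_
    exact (hψ.tendsto : map ψ (𝓝 x) ≤ 𝓝 (ψ x)) (hd.eventually_left_inverse hd0)
  rw [← h2, h1]
  have h3 := (hd.to_localInverse hd0).map_nhds_eq (inv_ne_zero hd0)
  rw [h3, (hd.eventually_left_inverse hd0).self_of_nhds]

theorem isPreconnected_punctured_ball (m : ℝ) : IsPreconnected {ζ : ℂ | ζ ≠ 0 ∧ ‖ζ‖ < m} := by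
  have : {ζ : ℂ | ζ ≠ 0 ∧ ‖ζ‖ < m} =
      (fun v : ℝ × UnitAddCircle => (v.1 : ℂ) * ((AddCircle.toCircle v.2 : Circle) : ℂ)) ''
        (Ioo 0 m ×ˢ univ) := by
    ext ζ
    constructor
    · rintro ⟨h1, h2⟩
      obtain ⟨s, hs⟩ := (AddCircle.homeomorphCircle (T := (1 : ℝ)) one_ne_zero).surjective
        ⟨ζ / ‖ζ‖, mem_sphere_zero_iff_norm.2 (by
          rw [norm_div, Complex.norm_real, norm_norm, div_self (norm_ne_zero_iff.2 h1)])⟩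
      have hs' : ((AddCircle.toCircle s : Circle) : ℂ) = ζ / ‖ζ‖ := by
        have := congrArg (fun z : Circle => (z : ℂ)) hs
        simpa [AddCircle.homeomorphCircle_apply] using this
      refine ⟨(‖ζ‖, s), ⟨⟨norm_pos_iff.2 h1, h2⟩, mem_univ _⟩, ?_⟩
      simp only [hs']
      rw [mul_div_cancel₀]
      exact_mod_cast norm_ne_zero_iff.2 h1
    · rintro ⟨⟨r, s⟩, ⟨⟨h1, h2⟩, -⟩, rfl⟩
      simp only at h1 h2
      refine ⟨mul_ne_zero (by exact_mod_cast h1.ne') (toCircle_ne_zero _), ?_⟩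
      simpa only [norm_mul, Circle.norm_coe, mul_one, Complex.norm_real, Real.norm_eq_abs,
        abs_of_pos h1] using h2
  rw [this]
  refine (isPreconnected_Ioo.prod isPreconnected_univ).image _ (Continuous.continuousOn ?_)
  have := continuous_toCircle_coe
  fun_prop

theorem HasProngAt.nonempty_endChart [CompactSpace S] [T2Space S]
    {A : Set (OpenPartialHomeomorph (intr S) (ℝ × ℝ))} {C : Set S} {k : ℕ} (hk : 0 < k)
    (hcov : ∀ u, ∃ e ∈ A, u ∈ e.source) (hC : IsCompact C) (hCo : ¬ IsOpen C)
    (h : HasProngAt A C k) : Nonempty (EndChart A C) := by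
  obtain ⟨N, ψ, ρ, hN, hCN, hNb, hρ, hψc, hψ0, hψi, hψN, hA⟩ := h
  have hNC : ∀ x ∈ N, x ∉ C → x ∈ intr S := fun x hx hxC =>
    (mem_intr_or_mem_bdry x).resolve_right fun hb => hxC (hNb ▸ ⟨hx, hb⟩)
  have huC : ∀ u : intr S, (u : S) ∉ C := fun u hu =>
    notMem_bdry_of_mem_intr u.2 (hNb ▸ hu : (u : S) ∈ N ∩ bdry S).2
  have hcoord : ∀ u : intr S, (u : S) ∈ N → ∀ f ∈ A, u ∈ f.source → ∃ w : intr S → ℂ,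
      map w (𝓝 u) = 𝓝 (w u) ∧ (∀ᶠ u' in 𝓝 u, w u' ^ 2 = ψ (u' : S) ^ k) ∧
      LocallyAffine 1 f (fun u' => ((w u').re, (w u').im)) u := by
    intro u hu f hf huf
    obtain ⟨w, -, hw, hl⟩ := hA f hf u huf hu
    exact ⟨w, map_nhds_of_locallyAffine (f.map_nhds_eq huf) hl, hw, hl⟩
  have hψat : ∀ x ∈ N, ContinuousAt ψ x := fun x hx => hψc.continuousAt (hN.mem_nhds hx)
  have hmap : ∀ u : intr S, (u : S) ∈ N → map (fun u' : intr S => ψ u') (𝓝 u) = 𝓝 (ψ u) := by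
    intro u hu
    obtain ⟨f, hf, huf⟩ := hcov u
    obtain ⟨w, hw, hw2, -⟩ := hcoord u hu f hf huf
    have hc : ContinuousAt (fun u' : intr S => ψ u') u :=
      ContinuousAt.comp (g := ψ) (hψat u hu) continuous_subtype_val.continuousAt
    exact map_nhds_of_pow hk hc (fun h0 => huC u ((hψ0 u hu).1 h0)) hw hw2
  have hsrc : IsOpen {u : intr S | (u : S) ∈ N} := hN.preimage continuous_subtype_val
  have hinj : InjOn (fun u : intr S => ψ u) {u : intr S | (u : S) ∈ N} := fun u hu v hv huv =>
    Subtype.ext (hψi ⟨hu, huC u⟩ ⟨hv, huC v⟩ huv)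
  have himg : (fun u : intr S => ψ u) '' {u : intr S | (u : S) ∈ N} = {ζ | ζ ≠ 0 ∧ ‖ζ‖ < ρ} := by
    ext ζ
    constructor
    · rintro ⟨u, hu, rfl⟩
      refine ⟨fun h0 => huC u ((hψ0 u hu).1 h0), ?_⟩
      have : ψ u ∈ Metric.ball 0 ρ := hψN ▸ ⟨u, hu, rfl⟩
      simpa using this
    · rintro ⟨h1, h2⟩
      obtain ⟨x, hx, rfl⟩ : ζ ∈ ψ '' N := by rw [hψN]; simpa using h2
      exact ⟨⟨x, hNC x hx fun hxC => h1 ((hψ0 x hx).2 hxC)⟩, hx, rfl⟩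
  have hne : Nonempty (intr S) := by
    have : ((ρ / 2 : ℝ) : ℂ) ∈ {ζ : ℂ | ζ ≠ 0 ∧ ‖ζ‖ < ρ} := by
      refine ⟨by exact_mod_cast (by positivity : (ρ / 2) ≠ 0), ?_⟩
      rw [Complex.norm_real, Real.norm_eq_abs, abs_of_pos (by positivity)]
      linarith
    rw [← himg] at this
    obtain ⟨u, -, -⟩ := this
    exact ⟨u⟩
  let e : OpenPartialHomeomorph (intr S) ℂ := OpenPartialHomeomorph.ofContinuousOpenRestrict
    (hinj.toPartialEquiv (fun u : intr S => ψ u) _)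
    (fun u hu => (ContinuousAt.comp (g := ψ) (hψat u hu)
      continuous_subtype_val.continuousAt).continuousWithinAt)
    (by
      rw [isOpenMap_iff_nhds_le]
      rintro ⟨u, hu⟩
      change 𝓝 (ψ u) ≤ map ((fun u' : intr S => ψ u') ∘ Subtype.val) (𝓝 ⟨u, hu⟩)
      rw [← Filter.map_map, map_nhds_subtype_coe_eq_nhds hu (hsrc.mem_nhds hu), hmap u hu]) hsrc
  have hes : e.source = {u : intr S | (u : S) ∈ N} := rfl
  have hee : ∀ u, e u = ψ (u : S) := fun _ => rfl
  have het : e.target = {ζ | ζ ≠ 0 ∧ ‖ζ‖ < ρ} := himg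
  have hnear : ∀ r > 0, ∃ O : Set S, IsOpen O ∧ C ⊆ O ∧ O ⊆ N ∧ ∀ x ∈ O, ‖ψ x‖ < r := by
    intro r hr
    refine ⟨N ∩ ψ ⁻¹' Metric.ball 0 r, hψc.isOpen_inter_preimage hN Metric.isOpen_ball,
      fun x hx => ⟨hCN hx, ?_⟩, inter_subset_left, fun x hx => by simpa using hx.2⟩
    simp [(hψ0 x (hCN hx)).2 hx, hr]
  refine ⟨⟨k, hk, e, ρ, hρ, het, ?_, ?_, fun u hu f hf huf => hcoord u hu f hf huf⟩⟩
  · intro r hr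
    obtain ⟨O, h1, h2, h3, h4⟩ := hnear r hr
    exact ⟨O, h1, h2, fun x hx => hNC x (h3 hx), fun u hu => ⟨h3 hu, h4 u hu⟩⟩
  · intro O hO hCO
    obtain ⟨K, hK, hCK, hKN⟩ := exists_compact_between hC (hN.inter hO) (subset_inter hCN hCO)
    have hF : IsCompact (ψ '' (K \ interior K)) :=
      (hK.diff isOpen_interior).image_of_continuousOn
        (hψc.mono fun x hx => (hKN hx.1).1)
    have h0F : (ψ '' (K \ interior K))ᶜ ∈ 𝓝 (0 : ℂ) := by
      refine hF.isClosed.isOpen_compl.mem_nhds ?_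
      rintro ⟨x, hx, hx0⟩
      exact hx.2 (hCK ((hψ0 x (hKN hx.1).1).1 hx0))
    obtain ⟨m₀, hm₀, hm₀F⟩ := Metric.mem_nhds_iff.1 h0F
    let m := min m₀ ρ
    have hm : 0 < m := lt_min hm₀ hρ
    have hAt : {ζ : ℂ | ζ ≠ 0 ∧ ‖ζ‖ < m} ⊆ e.target := by
      rw [het]
      exact fun ζ hζ => ⟨hζ.1, hζ.2.trans_le (min_le_right _ _)⟩
    have hpre : IsPreconnected ((fun ζ => (e.symm ζ : S)) '' {ζ : ℂ | ζ ≠ 0 ∧ ‖ζ‖ < m}) :=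
      (isPreconnected_punctured_ball m).image _
        (continuous_subtype_val.comp_continuousOn (e.continuousOn_symm.mono hAt))
    have hmem : ∀ x ∈ N, x ∉ C → ‖ψ x‖ < m →
        x ∈ (fun ζ => (e.symm ζ : S)) '' {ζ : ℂ | ζ ≠ 0 ∧ ‖ζ‖ < m} := by
      intro x hx hxC hxm
      have hxe : (⟨x, hNC x hx hxC⟩ : intr S) ∈ e.source := hx
      refine ⟨ψ x, ⟨fun h0 => hxC ((hψ0 x hx).1 h0), hxm⟩, ?_⟩
      have := e.left_inv hxe
      exact congrArg Subtype.val this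
    have hsub : (fun ζ => (e.symm ζ : S)) '' {ζ : ℂ | ζ ≠ 0 ∧ ‖ζ‖ < m} ⊆ interior K := by
      refine hpre.subset_left_of_subset_union isOpen_interior hK.isClosed.isOpen_compl ?_ ?_ ?_
      · exact (disjoint_compl_right).mono_left interior_subset
      · rintro _ ⟨ζ, hζ, rfl⟩
        by_contra hcon
        simp only [mem_union, mem_compl_iff, not_or, not_not] at hcon
        have h1 : ψ (e.symm ζ : S) = ζ := e.right_inv (hAt hζ)
        have h2 : ζ ∈ Metric.ball (0 : ℂ) m₀ := by
          simpa using hζ.2.trans_le (min_le_left _ _)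
        exact hm₀F h2 ⟨_, ⟨hcon.2, hcon.1⟩, h1⟩
      · obtain ⟨O', hO', hCO', hO'N, hO'm⟩ := hnear m hm
        have : ¬ (interior K ∩ O' ⊆ C) := fun hsub => hCo (by
          rw [Subset.antisymm (subset_inter hCK hCO') hsub]
          exact isOpen_interior.inter hO')
        obtain ⟨x, hx, hxC⟩ := not_subset.1 this
        exact ⟨x, hmem x (hO'N hx.2) hxC (hO'm x hx.2), hx.1⟩
    refine ⟨m, hm, fun u hu hum => ?_⟩
    exact (hKN (interior_subset (hsub (hmem u hu (huC u) hum)))).2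

end Ends

section FamilyOfEnds

variable {M : Type*} [MetricSpace M]
  {S : Type*} [TopologicalSpace S] [ChartedSpace (EuclideanHalfSpace 2) S]
  [CompactSpace S] [T2Space S] {φ : Flow ℝ M} {ι : S → M} {γ : Set M}
  {τ : OpenPartialHomeomorph M (ℝ × ℝ × UnitAddCircle)} {P : intr S ≃ₜ intr S}

namespace IsBirkhoffSection

theorem exists_isolating (pA : PseudoAnosovAtlas P) {C : Set S} (hC : C ∈ componentsOver ι γ) :
    ∃ N : Set S, IsOpen N ∧ C ⊆ N ∧ N ∩ bdry S = C := by
  obtain ⟨x, hx, -, rfl⟩ := hC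
  obtain ⟨k, -, N, ψ, ρ, hN, hCN, hNb, -⟩ := pA.prong x hx
  exact ⟨N, hN, hCN, hNb⟩

theorem isCompact_preimage (hι : IsBirkhoffSection φ ι) (hτ : IsSaddleChart φ γ τ) :
    IsCompact (ι ⁻¹' γ) :=
  (hτ.isCompact_orbit.isClosed.preimage hι.continuous).isCompact

theorem isCompact_of_mem_componentsOver (hι : IsBirkhoffSection φ ι)
    (hγ : γ ∈ boundaryOrbits φ ι) (hτ : IsSaddleChart φ γ τ) (pA : PseudoAnosovAtlas P)
    {C : Set S} (hC : C ∈ componentsOver ι γ) : IsCompact C := by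
  have : C = ι ⁻¹' γ \ ⋃ C' : {C' // C' ∈ componentsOver ι γ ∧ C' ≠ C},
      (exists_isolating pA C'.2.1).choose := by
    ext x
    constructor
    · intro hx
      refine ⟨by rw [hι.preimage_orbit hγ]; exact ⟨C, hC, hx⟩, ?_⟩
      simp only [mem_iUnion, not_exists]
      intro C' hxC'
      have h1 := (exists_isolating pA C'.2.1).choose_spec.2.2
      have h2 : x ∈ C'.1 := h1 ▸ ⟨hxC', subset_bdry_of_mem_componentsOver hC hx⟩
      exact C'.2.2 (componentsOver_eq_of_mem C'.2.1 hC h2 hx)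
    · rintro ⟨hx, hx'⟩
      rw [hι.preimage_orbit hγ] at hx
      obtain ⟨C', hC', hxC'⟩ := hx
      by_cases h : C' = C
      · exact h ▸ hxC'
      · refine absurd (mem_iUnion.2 ⟨⟨C', hC', h⟩, ?_⟩) hx'
        exact (exists_isolating pA hC').choose_spec.2.1 hxC'
  rw [this]
  exact (hι.isCompact_preimage hτ).diff
    (isOpen_iUnion fun C' => (exists_isolating pA C'.2.1).choose_spec.1)

theorem finite_componentsOver (hι : IsBirkhoffSection φ ι)
    (hγ : γ ∈ boundaryOrbits φ ι) (hτ : IsSaddleChart φ γ τ) (pA : PseudoAnosovAtlas P) :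
    Finite (componentsOver ι γ) := by
  obtain ⟨t, ht⟩ := (hι.isCompact_preimage hτ).elim_finite_subcover
    (fun C : componentsOver ι γ => (exists_isolating pA C.2).choose)
    (fun C => (exists_isolating pA C.2).choose_spec.1) (by
      rw [hι.preimage_orbit hγ]
      rintro x ⟨C, hC, hx⟩
      exact mem_iUnion.2 ⟨⟨C, hC⟩, (exists_isolating pA hC).choose_spec.2.1 hx⟩)
  refine Finite.of_finite_univ (t.finite_toSet.subset fun C _ => ?_)
  obtain ⟨x, hx⟩ := nonempty_of_mem_componentsOver C.2
  have hxK : x ∈ ι ⁻¹' γ := by rw [hι.preimage_orbit hγ]; exact ⟨C, C.2, hx⟩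
  obtain ⟨C', hC', hxC'⟩ := mem_iUnion₂.1 (ht hxK)
  have h1 : x ∈ C'.1 := by
    rw [← (exists_isolating pA C'.2).choose_spec.2.2]
    exact ⟨hxC', subset_bdry_of_mem_componentsOver C.2 hx⟩
  rw [Subtype.ext (componentsOver_eq_of_mem C.2 C'.2 hx h1)]
  exact hC'

theorem nonempty_endChart (hι : IsBirkhoffSection φ ι)
    (hγ : γ ∈ boundaryOrbits φ ι) (hτ : IsSaddleChart φ γ τ) (pA : PseudoAnosovAtlas P)
    {C : Set S} (hC : C ∈ componentsOver ι γ) : Nonempty (EndChart pA.charts C) := by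
  have h1 := hι.isCompact_of_mem_componentsOver hγ hτ pA hC
  have h2 := hι.not_isOpen_component hγ hτ hC
  obtain ⟨x, hx, -, rfl⟩ := hC
  obtain ⟨k, hk, h⟩ := pA.prong x hx
  exact h.nonempty_endChart (by omega) pA.cover h1 h2

end IsBirkhoffSection

/-- The punctured neighbourhood of size `η` of an end. -/
def EndChart.disk {A : Set (OpenPartialHomeomorph (intr S) (ℝ × ℝ))} {C : Set S}
    (E : EndChart A C) (η : ℝ) : Set (intr S) :=
  {u | u ∈ E.e.source ∧ ‖E.e u‖ ^ E.k < η ^ 2}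

theorem EndChart.disk_mono {A : Set (OpenPartialHomeomorph (intr S) (ℝ × ℝ))} {C : Set S}
    (E : EndChart A C) {η η' : ℝ} (h0 : 0 ≤ η) (h : η ≤ η') : E.disk η ⊆ E.disk η' :=
  fun _ hu => ⟨hu.1, hu.2.trans_le (pow_le_pow_left₀ h0 h 2)⟩

theorem EndChart.isOpen_disk {A : Set (OpenPartialHomeomorph (intr S) (ℝ × ℝ))} {C : Set S}
    (E : EndChart A C) (η : ℝ) : IsOpen (E.disk η) :=
  E.e.isOpen_inter_preimage (s := {ζ : ℂ | ‖ζ‖ ^ E.k < η ^ 2})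
    (isOpen_lt (by fun_prop) continuous_const)

theorem EndChart.eventually_disk {A : Set (OpenPartialHomeomorph (intr S) (ℝ × ℝ))} {C : Set S}
    (E : EndChart A C) {O : Set S} (hO : IsOpen O) (hC : C ⊆ O) :
    ∀ᶠ η in 𝓝[>] (0 : ℝ), ∀ u ∈ E.disk η, (u : S) ∈ O := by
  obtain ⟨r, hr, h⟩ := E.shrink O hO hC
  have h1 : Tendsto (fun η : ℝ => η ^ 2) (𝓝[>] 0) (𝓝 0) := by
    have : Tendsto (fun η : ℝ => η ^ 2) (𝓝 0) (𝓝 (0 ^ 2)) := (continuous_pow 2).tendsto 0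
    simpa using this.mono_left nhdsWithin_le_nhds
  filter_upwards [h1.eventually (gt_mem_nhds (pow_pos hr E.k))] with η hη u hu
  exact h u hu.1 (lt_of_pow_lt_pow_left₀ E.k hr.le (hu.2.trans hη))

variable {A : Set (OpenPartialHomeomorph (intr S) (ℝ × ℝ))}
  (E : ∀ C : componentsOver ι γ, EndChart A (C : Set S))

/-- The disks of size `η` lie over small neighbourhoods of the orbit. -/
theorem eventually_disk_image [Finite (componentsOver ι γ)] (hι : IsBirkhoffSection φ ι)
    (hγ : γ ∈ boundaryOrbits φ ι) {O : Set M} (hO : IsOpen O) (hγO : γ ⊆ O) :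
    ∀ᶠ η in 𝓝[>] (0 : ℝ), ∀ C, ∀ u ∈ (E C).disk η, ι u ∈ O := by
  rw [eventually_all]
  intro C
  refine (E C).eventually_disk (O := ι ⁻¹' O) (hO.preimage hι.continuous) fun x hx => hγO ?_
  rw [← hι.image_componentsOver hγ C.2]
  exact ⟨x, hx, rfl⟩

/-- Interior points of the section near the orbit lie in small disks. -/
theorem exists_saddleBox_disk (hι : IsBirkhoffSection φ ι)
    (hγ : γ ∈ boundaryOrbits φ ι) (hτ : IsSaddleChart φ γ τ) {η : ℝ} (hη : 0 < η) :
    ∃ δ, 0 < δ ∧ δ < 1 ∧ ∀ u : intr S, ι u ∈ saddleBox τ δ → ∃ C, u ∈ (E C).disk η := by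
  have h1 : ∀ C : componentsOver ι γ, ∃ O : Set S, IsOpen O ∧ (C : Set S) ⊆ O ∧ ∀ u : intr S, (u : S) ∈ O →
      u ∈ (E C).disk η := by
    intro C
    have hr : 0 < min 1 (η ^ 2) := lt_min one_pos (by positivity)
    obtain ⟨O, hO, hCO, -, h⟩ := (E C).near _ hr
    refine ⟨O, hO, hCO, fun u hu => ⟨(h u hu).1, ?_⟩⟩
    have h2 := (h u hu).2
    calc ‖(E C).e u‖ ^ (E C).k ≤ ‖(E C).e u‖ ^ 1 :=
          pow_le_pow_of_le_one (norm_nonneg _) (h2.le.trans (min_le_left _ _)) (E C).k_pos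
      _ < η ^ 2 := by
          rw [pow_one]
          exact h2.trans_le (min_le_right _ _)
  choose O hO hCO hOd using h1
  have hcl : IsClosed (ι '' (⋃ C, O C)ᶜ) :=
    ((isOpen_iUnion hO).isClosed_compl.isCompact.image hι.continuous).isClosed
  obtain ⟨δ, h0, h1, h2⟩ := hτ.exists_saddleBox_subset hcl.isOpen_compl (by
    rintro q hq ⟨x, hx, rfl⟩
    have hx' : x ∈ ι ⁻¹' γ := hq
    rw [hι.preimage_orbit hγ] at hx'
    obtain ⟨C, hC, hxC⟩ := hx'
    exact hx (mem_iUnion.2 ⟨⟨C, hC⟩, hCO ⟨C, hC⟩ hxC⟩))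
  refine ⟨δ, h0, h1, fun u hu => ?_⟩
  have h3 : (u : S) ∈ ⋃ C, O C := by
    by_contra hcon
    exact h2 hu ⟨u, hcon, rfl⟩
  obtain ⟨C, hC⟩ := mem_iUnion.1 h3
  exact ⟨C, hOd C u hC⟩

/-- Small disks at different ends are disjoint. -/
theorem eventually_disk_disjoint [Finite (componentsOver ι γ)] (hι : IsBirkhoffSection φ ι)
    (hγ : γ ∈ boundaryOrbits φ ι) (hτ : IsSaddleChart φ γ τ) (pA : PseudoAnosovAtlas P) :
    ∀ᶠ η in 𝓝[>] (0 : ℝ), ∀ C C', ∀ u, u ∈ (E C).disk η → u ∈ (E C').disk η → C = C' := by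
  rw [eventually_all]
  intro C
  rw [eventually_all]
  intro C'
  by_cases h : C = C'
  · exact Eventually.of_forall fun _ _ _ _ => h
  have hdis : Disjoint (C : Set S) (C' : Set S) := by
    rw [Set.disjoint_left]
    intro x hx hx'
    exact h (Subtype.ext (IsBirkhoffSection.componentsOver_eq_of_mem C.2 C'.2 hx hx'))
  obtain ⟨O, O', hO, hO', hCO, hCO', hOO⟩ :=
    SeparatedNhds.of_isCompact_isCompact
      (hι.isCompact_of_mem_componentsOver hγ hτ pA C.2) (hι.isCompact_of_mem_componentsOver hγ hτ pA C'.2) hdis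
  filter_upwards [(E C).eventually_disk hO hCO, (E C').eventually_disk hO' hCO'] with η h1 h2 u hu hu'
  exact absurd (h2 u hu') (Set.disjoint_left.1 hOO (h1 u hu))

end FamilyOfEnds


/-! ### The complement of the boundary orbits -/

section Interior

variable {S : Type*} [TopologicalSpace S] [ChartedSpace (EuclideanHalfSpace 2) S]

theorem exists_halfSpace_chart : ∃ e : OpenPartialHomeomorph ℂ (EuclideanHalfSpace 2),
    e.target = {x | 0 < x.1 0} := by
  have hc : Continuous fun ζ : ℂ => (⟨WithLp.toLp 2 ![|ζ.re|, ζ.im], by simp⟩ : EuclideanHalfSpace 2) := by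
    refine Continuous.subtype_mk ?_ _
    refine (PiLp.continuous_toLp 2 _).comp (continuous_pi fun i => ?_)
    fin_cases i
    · simp only [Fin.zero_eta, Matrix.cons_val_zero]
      fun_prop
    · simp only [Fin.mk_one, Matrix.cons_val_one]
      fun_prop
  refine ⟨⟨⟨⟨fun ζ => ⟨WithLp.toLp 2 ![|ζ.re|, ζ.im], by simp⟩, fun x => ⟨x.1 0, x.1 1⟩,
    {ζ | 0 < ζ.re}, {x | 0 < x.1 0}, ?_, ?_, ?_, ?_⟩, ?_, ?_⟩, ?_, ?_⟩, rfl⟩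
  · intro ζ hζ
    simpa using hζ.ne'
  · exact fun x hx => hx
  · intro ζ hζ
    exact Complex.ext (by simpa using (show 0 < ζ.re from hζ).le) (by simp)
  · intro x hx
    refine Subtype.ext ?_
    ext i
    fin_cases i
    · simpa using (show 0 < x.1 0 from hx).le
    · simp
  · exact hc.continuousOn
  · refine Continuous.continuousOn ?_
    simp only [Complex.mk_eq_add_mul_I]
    have h0 : Continuous fun x : EuclideanHalfSpace 2 => x.1 := continuous_subtype_val
    fun_prop
  · exact isOpen_lt continuous_const Complex.continuous_re
  · have h0 : Continuous fun x : EuclideanHalfSpace 2 => x.1 := continuous_subtype_val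
    exact isOpen_lt continuous_const (by fun_prop)

theorem isOpen_intr : IsOpen (intr S) := by
  rw [isOpen_iff_mem_nhds]
  intro x hx
  obtain ⟨g, hg⟩ := exists_halfSpace_chart
  let e := chartAt (EuclideanHalfSpace 2) x
  have hxt : e x ∈ g.target := by
    rw [hg]
    have h1 : (e x).1 0 ≠ 0 := fun h => notMem_bdry_of_mem_intr hx (mem_bdry_iff.2 h)
    exact lt_of_le_of_ne (e x).2 h1.symm
  have hO : e.source ∩ e ⁻¹' g.target ∈ 𝓝 x :=
    (e.isOpen_inter_preimage g.open_target).mem_nhds ⟨mem_chart_source _ _, hxt⟩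
  filter_upwards [hO] with y hy
  refine (mem_intr_or_mem_bdry y).resolve_right ?_
  have h2 : (g.trans e.symm) (g.symm (e y)) = y := by
    simp [g.right_inv hy.2, e.left_inv hy.1]
  rw [← h2]
  refine notMem_bdry_of_planar (g.trans e.symm) ?_
  simp [g.map_target hy.2, g.right_inv hy.2, e.map_source hy.1]

theorem isClosed_bdry : IsClosed (bdry S) := by
  have : bdry S = (intr S)ᶜ := (ModelWithCorners.compl_interior (I := 𝓡∂ 2) (M := S)).symm
  rw [this]
  exact isOpen_intr.isClosed_compl

end Interior

namespace AlmostAnosovData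

variable {M : Type*} [MetricSpace M]
  {S : Type*} [TopologicalSpace S] [ChartedSpace (EuclideanHalfSpace 2) S]
  {φ : Flow ℝ M} {ι : S → M} (D : AlmostAnosovData φ ι)

/-- The point of `M \ Γ` with suspension coordinates `(u, t)`. -/
def pt (u : intr S) (t : ℝ) : M := (D.H.symm (Susp.mk D.P (u, t)) : M)

theorem pt_zero (u : intr S) : D.pt u 0 = ι u := D.section_eq u

theorem pt_notMem (u : intr S) (t : ℝ) : D.pt u t ∉ ι '' bdry S :=
  (D.H.symm (Susp.mk D.P (u, t))).2

theorem pt_eq_pt {u v : intr S} {t s : ℝ} :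
    D.pt u t = D.pt v s ↔ ∃ k : ℤ, v = (D.P ^ k) u ∧ s = t - k := by
  constructor
  · intro h
    obtain ⟨k, hk⟩ := Susp.mk_eq_mk.1 (D.H.symm.injective (Subtype.ext h))
    exact ⟨k, congrArg Prod.fst hk, congrArg Prod.snd hk⟩
  · rintro ⟨k, rfl, rfl⟩
    exact congrArg (fun z => (D.H.symm z : M)) (Susp.mk_eq_mk.2 ⟨k, rfl⟩)

theorem pt_zpow (u : intr S) (t : ℝ) (k : ℤ) : D.pt ((D.P ^ k) u) (t - k) = D.pt u t :=
  (D.pt_eq_pt.2 ⟨k, rfl, rfl⟩).symm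

theorem pt_map (u : intr S) (t : ℝ) : D.pt (D.P u) (t - 1) = D.pt u t := by
  simpa using D.pt_zpow u t 1

theorem pt_one (u : intr S) : D.pt u 1 = ι (D.P u) := by
  rw [← D.pt_map, sub_self, D.pt_zero]

theorem exists_rep {q : M} (hq : q ∉ ι '' bdry S) : ∃ u, ∃ t ∈ Ico (0 : ℝ) 1, D.pt u t = q := by
  obtain ⟨⟨u, t⟩, hut⟩ : ∃ a, Susp.mk D.P a = D.H ⟨q, hq⟩ := Quotient.exists_rep _
  have h : D.pt u t = q := by
    rw [pt, hut, Homeomorph.symm_apply_apply]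
  refine ⟨(D.P ^ ⌊t⌋) u, t - ⌊t⌋, ⟨by linarith [Int.floor_le t], by linarith [Int.lt_floor_add_one t]⟩, ?_⟩
  rw [D.pt_zpow, h]

theorem rep_unique {u v : intr S} {t s : ℝ} (ht : t ∈ Ico (0 : ℝ) 1) (hs : s ∈ Ico (0 : ℝ) 1)
    (h : D.pt u t = D.pt v s) : u = v ∧ t = s := by
  obtain ⟨k, rfl, rfl⟩ := D.pt_eq_pt.1 h
  have h1 : (k : ℝ) < 1 := by linarith [ht.2, hs.1]
  have h2 : (-1 : ℝ) < k := by linarith [ht.1, hs.2]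
  have h3 : k < 1 := by exact_mod_cast h1
  have h4 : -1 < k := by exact_mod_cast h2
  obtain rfl : k = 0 := by omega
  simp

theorem continuous_pt : Continuous fun a : intr S × ℝ => D.pt a.1 a.2 :=
  continuous_subtype_val.comp (D.H.symm.continuous.comp (Susp.continuous_mk D.P))

theorem pt_mem_range_iff {u : intr S} {t : ℝ} : D.pt u t ∈ range ι ↔ ∃ k : ℤ, t = k := by
  constructor
  · rintro ⟨x, hx⟩
    rcases mem_intr_or_mem_bdry x with h | h
    · obtain ⟨k, -, hk⟩ := D.pt_eq_pt.1 ((hx.symm.trans (D.pt_zero ⟨x, h⟩).symm))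
      exact ⟨k, by linarith⟩
    · exact absurd ⟨x, h, hx⟩ (D.pt_notMem u t)
  · rintro ⟨k, rfl⟩
    refine ⟨(D.P ^ k) u, ?_⟩
    rw [← D.pt_zero, ← D.pt_zpow u k k, sub_self]

theorem isClosed_image_bdry [CompactSpace S] (hι : IsBirkhoffSection φ ι) :
    IsClosed (ι '' bdry S) := (isClosed_bdry.isCompact.image hι.continuous).isClosed

theorem isOpenMap_pt [CompactSpace S] (hι : IsBirkhoffSection φ ι) :
    IsOpenMap fun a : intr S × ℝ => D.pt a.1 a.2 :=
  (isClosed_image_bdry hι).isOpen_compl.isOpenMap_subtype_val.comp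
    (D.H.symm.isOpenMap.comp (Susp.isOpenMap_mk D.P))

theorem exists_time (u : intr S) :
    ∃ h : ℝ ≃o ℝ, h 0 = 0 ∧ ∀ t, D.pt u t = φ (h t) (ι u) := by
  obtain ⟨h, hh⟩ := D.orbits u
  refine ⟨h.trans (OrderIso.addRight (-h 0)), by simp, fun t => ?_⟩
  have h0 : φ (h 0) (ι u) = ι u := by rw [← hh 0, D.section_eq]
  have h1 : φ (-h 0) (ι u) = ι u := by
    conv_lhs => rw [← h0]
    rw [← φ.map_add, neg_add_cancel, φ.map_zero_apply]
  simp only [OrderIso.trans_apply, OrderIso.addRight_apply]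
  rw [φ.map_add, h1, ← hh t]
  rfl

theorem exists_return_bound (hι : IsBirkhoffSection φ ι) :
    ∃ T > 0, ∀ u, ∀ h : ℝ ≃o ℝ, h 0 = 0 → (∀ t, D.pt u t = φ (h t) (ι u)) → h 1 ≤ T := by
  obtain ⟨T, hT, hm⟩ := hι.meets
  refine ⟨T, hT, fun u h h0 hh => ?_⟩
  by_contra! hcon
  obtain ⟨t, ht, hr⟩ := hm (φ ((h 1 - T) / 2) (ι u))
  rw [← φ.map_add] at hr
  have h1 : D.pt u (h.symm (t + (h 1 - T) / 2)) ∈ range ι := by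
    rw [hh, OrderIso.apply_symm_apply]
    exact hr
  obtain ⟨k, hk⟩ := D.pt_mem_range_iff.1 h1
  have h2 : 0 < h.symm (t + (h 1 - T) / 2) := by
    rw [← h.lt_iff_lt, h0, OrderIso.apply_symm_apply]
    linarith [ht.1]
  have h3 : h.symm (t + (h 1 - T) / 2) < 1 := by
    rw [← h.lt_iff_lt, OrderIso.apply_symm_apply]
    linarith [ht.2]
  rw [hk] at h2 h3
  norm_cast at h2 h3
  omega

/-- Points with suspension time in `[0, 1]` are reached from the section in bounded time. -/
theorem exists_time_bound (hι : IsBirkhoffSection φ ι) :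
    ∃ T > 0, ∀ u, ∀ t ∈ Icc (0 : ℝ) 1, ∃ s ∈ Icc 0 T, D.pt u t = φ s (ι u) := by
  obtain ⟨T, hT, h⟩ := D.exists_return_bound hι
  refine ⟨T, hT, fun u t ht => ?_⟩
  obtain ⟨k, hk0, hk⟩ := D.exists_time u
  refine ⟨k t, ⟨?_, (k.monotone ht.2).trans (h u k hk0 hk)⟩, hk t⟩
  rw [← hk0]
  exact k.monotone ht.1

variable {γ : Set M} {τ : OpenPartialHomeomorph M (ℝ × ℝ × UnitAddCircle)}

/-- Near the orbit, the points with suspension time in `[0, 1]` are near the orbit, in the same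
quadrant as the point of the section. -/
theorem exists_box_forward (hι : IsBirkhoffSection φ ι) (hγ : γ ∈ boundaryOrbits φ ι)
    (hτ : IsSaddleChart φ γ τ) {O : Set M} (hO : IsOpen O) (hγO : γ ⊆ O) :
    ∃ δ, 0 < δ ∧ δ < 1 ∧ ∀ u : intr S, ι u ∈ saddleBox τ δ → ∀ t ∈ Icc (0 : ℝ) 1, D.pt u t ∈ O ∧
      ∃ a > 0, ∃ b > 0, (τ (D.pt u t)).1 = a * (τ (ι u)).1 ∧
        (τ (D.pt u t)).2.1 = b * (τ (ι u)).2.1 := by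
  obtain ⟨T, hT, h⟩ := D.exists_time_bound hι
  obtain ⟨δ, h0, h1, h2⟩ := hτ.exists_saddleBox_flow (IsBirkhoffSection.orbit_invariant hγ)
    (hO.inter τ.open_source) (subset_inter hγO hτ.orbit_subset) T
  refine ⟨δ, h0, h1, fun u hu t ht => ?_⟩
  obtain ⟨s, hs, hst⟩ := h u t ht
  rw [hst]
  refine ⟨(h2 _ hu s ⟨by linarith [hs.1], hs.2⟩).1, hτ.coord_sign hs.1 fun r hr => ?_⟩
  exact (h2 _ hu r ⟨by linarith [hr.1], hr.2.trans hs.2⟩).2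

theorem exists_box_backward (hι : IsBirkhoffSection φ ι) (hγ : γ ∈ boundaryOrbits φ ι)
    (hτ : IsSaddleChart φ γ τ) {O : Set M} (hO : IsOpen O) (hγO : γ ⊆ O) :
    ∃ δ, 0 < δ ∧ δ < 1 ∧ ∀ u : intr S, ∀ t ∈ Icc (0 : ℝ) 1, D.pt u t ∈ saddleBox τ δ → ι u ∈ O := by
  obtain ⟨T, hT, h⟩ := D.exists_time_bound hι
  obtain ⟨δ, h0, h1, h2⟩ := hτ.exists_saddleBox_flow (IsBirkhoffSection.orbit_invariant hγ)
    hO hγO T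
  refine ⟨δ, h0, h1, fun u t ht hu => ?_⟩
  obtain ⟨s, hs, hst⟩ := h u t ht
  have := h2 _ hu (-s) ⟨by linarith [hs.2], by linarith [hs.1]⟩
  rwa [hst, ← φ.map_add, neg_add_cancel, φ.map_zero_apply] at this

end AlmostAnosovData

/-! ### Flat coordinates at the ends -/

theorem LocallyAffine.trans {X : Type*} [TopologicalSpace X] {l l' : ℝ} {f g h : X → ℝ × ℝ} {x : X}
    (h1 : LocallyAffine l f g x) (h2 : LocallyAffine l' g h x) : LocallyAffine (l * l') f h x := by
  obtain ⟨ε, δ, c, d, hε, hδ, h1⟩ := h1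
  obtain ⟨ε', δ', c', d', hε', hδ', h2⟩ := h2
  refine ⟨ε * ε', δ * δ', ε * l * c' + c, δ * l⁻¹ * d' + d, ?_, ?_, ?_⟩
  · rcases hε with rfl | rfl <;> rcases hε' with rfl | rfl <;> simp
  · rcases hδ with rfl | rfl <;> rcases hδ' with rfl | rfl <;> simp
  · filter_upwards [h1, h2] with y hy hy'
    rw [hy, hy', mul_inv]
    ext <;> ring

theorem LocallyAffine.comp {X Y : Type*} [TopologicalSpace X] [TopologicalSpace Y] {l : ℝ}
    {f g : Y → ℝ × ℝ} {p : X → Y} {x : X} (h : LocallyAffine l f g (p x)) (hp : ContinuousAt p x) :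
    LocallyAffine l (f ∘ p) (g ∘ p) x := by
  obtain ⟨ε, δ, c, d, hε, hδ, h⟩ := h
  exact ⟨ε, δ, c, d, hε, hδ, hp.eventually h⟩

namespace EndChart

variable {S : Type*} [TopologicalSpace S] [ChartedSpace (EuclideanHalfSpace 2) S]
  {A : Set (OpenPartialHomeomorph (intr S) (ℝ × ℝ))} {C : Set S} (E : EndChart A C)

/-- The distance to the unstable prongs. -/
noncomputable def X (u : intr S) : ℝ := √((‖E.e u‖ ^ E.k + (E.e u ^ E.k).re) / 2)

/-- The distance to the stable prongs. -/
noncomputable def Y (u : intr S) : ℝ := √((‖E.e u‖ ^ E.k - (E.e u ^ E.k).re) / 2)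

theorem X_nonneg (u : intr S) : 0 ≤ E.X u := Real.sqrt_nonneg _

theorem Y_nonneg (u : intr S) : 0 ≤ E.Y u := Real.sqrt_nonneg _

theorem X_eq {u : intr S} {w : ℂ} (h : w ^ 2 = E.e u ^ E.k) : E.X u = |w.re| := by
  have h1 : ‖E.e u‖ ^ E.k = ‖w‖ ^ 2 := by rw [← norm_pow, ← h, norm_pow]
  rw [X, ← h, h1, ← Real.sqrt_sq_eq_abs, Complex.sq_norm, Complex.normSq_apply]
  congr 1
  simp [pow_two]

theorem Y_eq {u : intr S} {w : ℂ} (h : w ^ 2 = E.e u ^ E.k) : E.Y u = |w.im| := by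
  have h1 : ‖E.e u‖ ^ E.k = ‖w‖ ^ 2 := by rw [← norm_pow, ← h, norm_pow]
  rw [Y, ← h, h1, ← Real.sqrt_sq_eq_abs, Complex.sq_norm, Complex.normSq_apply]
  congr 1
  simp [pow_two]

theorem X_sq_add_Y_sq (u : intr S) : E.X u ^ 2 + E.Y u ^ 2 = ‖E.e u‖ ^ E.k := by
  obtain ⟨w, hw⟩ := IsAlgClosed.exists_pow_nat_eq (E.e u ^ E.k) (n := 2) two_pos
  rw [E.X_eq hw, E.Y_eq hw, sq_abs, sq_abs, ← norm_pow, ← hw, norm_pow, Complex.sq_norm,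
    Complex.normSq_apply]
  ring

theorem ne_zero {u : intr S} (hu : u ∈ E.e.source) : E.e u ≠ 0 := by
  have := E.e.map_source hu
  rw [E.target_eq] at this
  exact this.1

end EndChart


/-! ### The first return map in flat coordinates -/

section Scaling

variable {S : Type*} [TopologicalSpace S] [ChartedSpace (EuclideanHalfSpace 2) S]

theorem PseudoAnosovAtlas.exists_affine_along_ray {P : intr S ≃ₜ intr S} (pA : PseudoAnosovAtlas P)
    {C C' : Set S} (E : EndChart pA.charts C) (E' : EndChart pA.charts C') {σ : ℝ → intr S}
    {v₀ : ℝ} (hv₀ : 0 < v₀) (hσ : ContinuousAt σ v₀) (hs : σ v₀ ∈ E.e.source)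
    (hs' : P (σ v₀) ∈ E'.e.source) {ϖ : ℂ} (hϖ : ϖ ≠ 0) {k : ℕ}
    (h : ∀ᶠ v in 𝓝 v₀, E.e (σ v) ^ E.k = ((v : ℂ) ^ k * ϖ) ^ 2) :
    ∃ ε δ : ℝ, (ε = 1 ∨ ε = -1) ∧ (δ = 1 ∨ δ = -1) ∧ ∃ c : ℂ, ∀ᶠ v : ℝ in 𝓝 v₀,
      E'.e (P (σ v)) ^ E'.k =
        ((⟨ε * (pA.lam * ϖ.re), δ * (pA.lam⁻¹ * ϖ.im)⟩ : ℂ) * (v : ℂ) ^ k + c) ^ 2 := by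
  obtain ⟨f₁, hf₁, hu₁⟩ := pA.cover (σ v₀)
  obtain ⟨f₂, hf₂, hu₂⟩ := pA.cover (P (σ v₀))
  obtain ⟨w₁, hw₁, hw₁2, hl₁⟩ := E.coord _ hs f₁ hf₁ hu₁
  obtain ⟨w₂, -, hw₂2, hl₂⟩ := E'.coord _ hs' f₂ hf₂ hu₂
  have hl := (((hl₂.symm one_ne_zero).comp (p := P) P.continuous.continuousAt).trans
    (pA.affine f₁ hf₁ f₂ hf₂ _ hu₁ hu₂)).trans hl₁
  simp only [inv_one, one_mul, mul_one] at hl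
  obtain ⟨ε, δ, c, d, hε, hδ, hl⟩ := hl
  have hP : ContinuousAt (fun v => P (σ v)) v₀ := P.continuous.continuousAt.comp hσ
  have hv0 : ∀ᶠ v : ℝ in 𝓝 v₀, 0 < v := lt_mem_nhds hv₀
  let g : ℝ → ℂ := fun v => w₁ (σ v) / ((v : ℂ) ^ k * ϖ)
  have hg2 : ∀ᶠ v in 𝓝 v₀, g v ^ 2 = 1 := by
    filter_upwards [hσ.eventually hw₁2, h, hv0] with v h1 h2 h3
    have h4 : (v : ℂ) ^ k * ϖ ≠ 0 := mul_ne_zero (pow_ne_zero _ (by exact_mod_cast h3.ne')) hϖ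
    simp only [g, div_pow, h1, h2]
    exact div_self (pow_ne_zero 2 h4)
  have hw₁c : ContinuousAt w₁ (σ v₀) := hw₁.le
  have hgc : ContinuousAt g v₀ := by
    refine (hw₁c.comp hσ).div (by fun_prop) ?_
    exact mul_ne_zero (pow_ne_zero _ (by exact_mod_cast hv₀.ne')) hϖ
  have hg : ∃ s : ℝ, (s = 1 ∨ s = -1) ∧ ∀ᶠ v in 𝓝 v₀, g v = s := by
    have h0 := hg2.self_of_nhds
    rcases mul_self_eq_one_iff.1 ((pow_two _).symm.trans h0) with h1 | h1
    · refine ⟨1, Or.inl rfl, ?_⟩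
      filter_upwards [hg2, hgc.eventually (Metric.ball_mem_nhds _ one_pos)] with v h2 h3
      rcases mul_self_eq_one_iff.1 ((pow_two _).symm.trans h2) with h4 | h4
      · simp [h4]
      · rw [h1, h4] at h3
        norm_num [dist_eq_norm] at h3
    · refine ⟨-1, Or.inr rfl, ?_⟩
      filter_upwards [hg2, hgc.eventually (Metric.ball_mem_nhds _ one_pos)] with v h2 h3
      rcases mul_self_eq_one_iff.1 ((pow_two _).symm.trans h2) with h4 | h4
      · rw [h1, h4] at h3
        norm_num [dist_eq_norm] at h3
      · simp [h4]
  obtain ⟨s, hs1, hgs⟩ := hg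
  refine ⟨ε * s, δ * s, ?_, ?_, ⟨c, d⟩, ?_⟩
  · rcases hε with rfl | rfl <;> rcases hs1 with rfl | rfl <;> simp
  · rcases hδ with rfl | rfl <;> rcases hs1 with rfl | rfl <;> simp
  · filter_upwards [hgs, hP.eventually hw₂2, hσ.eventually hl, hv0] with v h1 h2 h3 h4
    have h5 : (v : ℂ) ^ k * ϖ ≠ 0 := mul_ne_zero (pow_ne_zero _ (by exact_mod_cast h4.ne')) hϖ
    have h6 : w₁ (σ v) = s * ((v : ℂ) ^ k * ϖ) := by
      rw [← h1]
      exact (div_mul_cancel₀ _ h5).symm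
    have h7 : w₁ (σ v) = (⟨s * v ^ k * ϖ.re, s * v ^ k * ϖ.im⟩ : ℂ) := by
      rw [h6, ← Complex.ofReal_pow, ← mul_assoc, ← Complex.ofReal_mul]
      refine Complex.ext ?_ ?_
      · rw [Complex.re_ofReal_mul]
      · rw [Complex.im_ofReal_mul]
    rw [← h2]
    congr 1
    simp only [Function.comp_apply, Prod.mk.injEq, h7] at h3
    rw [← Complex.ofReal_pow]
    refine Complex.ext ?_ ?_
    · rw [h3.1, Complex.add_re, Complex.re_mul_ofReal]
      ring
    · rw [h3.2, Complex.add_im, Complex.im_mul_ofReal]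
      ring

end Scaling

namespace AlmostAnosovData

variable {M : Type*} [MetricSpace M] [CompactSpace M]
  {S : Type*} [TopologicalSpace S] [ChartedSpace (EuclideanHalfSpace 2) S]
  [CompactSpace S] [T2Space S]
  {φ : Flow ℝ M} {ι : S → M} (D : AlmostAnosovData φ ι)
  {γ : Set M} {τ : OpenPartialHomeomorph M (ℝ × ℝ × UnitAddCircle)}
  (E : ∀ C : componentsOver ι γ, EndChart D.pA.charts (C : Set S))

theorem eventually_map_disk [Finite (componentsOver ι γ)] (hι : IsBirkhoffSection φ ι)
    (hγ : γ ∈ boundaryOrbits φ ι) (hτ : IsSaddleChart φ γ τ) {η₀ : ℝ} (hη₀ : 0 < η₀) :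
    ∀ᶠ η in 𝓝[>] (0 : ℝ), ∀ C, ∀ u ∈ (E C).disk η,
      (∃ C', D.P u ∈ (E C').disk η₀) ∧ ∃ C', D.P.symm u ∈ (E C').disk η₀ := by
  obtain ⟨δ₀, hδ₀, -, h0⟩ := exists_saddleBox_disk E hι hγ hτ hη₀
  obtain ⟨T, hT, hT'⟩ := D.exists_time_bound hι
  obtain ⟨δ₁, hδ₁, -, h1⟩ := hτ.exists_saddleBox_flow (IsBirkhoffSection.orbit_invariant hγ)
    (isOpen_saddleBox (τ := τ) δ₀) (hτ.subset_saddleBox hδ₀) T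
  filter_upwards [eventually_disk_image E hι hγ (isOpen_saddleBox (τ := τ) δ₁)
    (hτ.subset_saddleBox hδ₁)] with η hη C u hu
  have hu1 := hη C u hu
  constructor
  · obtain ⟨s, hs, hs'⟩ := hT' u 1 ⟨zero_le_one, le_rfl⟩
    refine h0 _ ?_
    rw [← D.pt_one, hs']
    exact h1 _ hu1 s ⟨by linarith [hs.1], hs.2⟩
  · obtain ⟨s, hs, hs'⟩ := hT' (D.P.symm u) 1 ⟨zero_le_one, le_rfl⟩
    refine h0 _ ?_
    rw [D.pt_one, Homeomorph.apply_symm_apply] at hs'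
    have := h1 _ hu1 (-s) ⟨by linarith [hs.2], by linarith [hs.1]⟩
    rwa [hs', ← φ.map_add, neg_add_cancel, φ.map_zero_apply] at this

theorem eventually_scaling [Finite (componentsOver ι γ)] (hι : IsBirkhoffSection φ ι)
    (hγ : γ ∈ boundaryOrbits φ ι) (hτ : IsSaddleChart φ γ τ) :
    ∀ᶠ η in 𝓝[>] (0 : ℝ), ∀ C C', ∀ u ∈ (E C).disk η, D.P u ∈ (E C').disk η →
      (E C').X (D.P u) = D.pA.lam * (E C).X u ∧ (E C').Y (D.P u) = D.pA.lam⁻¹ * (E C).Y u := by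
  obtain ⟨η₀, hdis, hη₀⟩ := ((eventually_disk_disjoint E hι hγ hτ D.pA).and
    self_mem_nhdsWithin).exists
  have hη₀ : 0 < η₀ := hη₀
  filter_upwards [D.eventually_map_disk E hι hγ hτ hη₀, self_mem_nhdsWithin,
    mem_nhdsWithin_of_mem_nhds (gt_mem_nhds hη₀)] with η hmap hη hηη₀ C C' u hu hu'
  have hη : 0 < η := hη
  replace hu' := (E C').disk_mono hη.le (le_of_lt hηη₀) hu'
  have hζ0 : (E C).e u ≠ 0 := (E C).ne_zero hu.1
  set ζ := (E C).e u with hζ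
  obtain ⟨ϖ, hϖ⟩ := IsAlgClosed.exists_pow_nat_eq (ζ ^ (E C).k) (n := 2) two_pos
  have hϖ0 : ϖ ≠ 0 := by
    rintro rfl
    exact pow_ne_zero (E C).k hζ0 (by simpa using hϖ.symm)
  -- the ray
  have hζρ : ‖ζ‖ < (E C).ρ := by
    have := (E C).e.map_source hu.1
    rw [(E C).target_eq] at this
    exact this.2
  obtain ⟨b, hb1, hb⟩ : ∃ b > 1, b ^ 2 * ‖ζ‖ < (E C).ρ ∧ (b ^ 2 * ‖ζ‖) ^ (E C).k < η ^ 2 := by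
    have h1 : ∀ᶠ b : ℝ in 𝓝 1, b ^ 2 * ‖ζ‖ < (E C).ρ := by
      refine ContinuousAt.eventually_lt (by fun_prop) continuousAt_const (by simpa using hζρ)
    have h2 : ∀ᶠ b : ℝ in 𝓝 1, (b ^ 2 * ‖ζ‖) ^ (E C).k < η ^ 2 := by
      refine ContinuousAt.eventually_lt (by fun_prop) continuousAt_const (by simpa using hu.2)
    obtain ⟨b, hb, hb'⟩ := (((h1.and h2).filter_mono nhdsWithin_le_nhds).and
      (self_mem_nhdsWithin (a := (1 : ℝ)) (s := Ioi (1 : ℝ)))).exists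
    exact ⟨b, hb', hb⟩
  have hnorm : ∀ v : ℝ, ‖(v : ℂ) ^ 2 * ζ‖ = v ^ 2 * ‖ζ‖ := fun v => by
    rw [norm_mul, norm_pow, Complex.norm_real, Real.norm_eq_abs, sq_abs]
  have htgt : ∀ v ∈ Ioo 0 b, (v : ℂ) ^ 2 * ζ ∈ (E C).e.target := by
    intro v hv
    rw [(E C).target_eq]
    refine ⟨mul_ne_zero (pow_ne_zero _ (by exact_mod_cast hv.1.ne')) hζ0, ?_⟩
    rw [hnorm]
    refine lt_of_le_of_lt ?_ hb.1
    exact mul_le_mul_of_nonneg_right (pow_le_pow_left₀ hv.1.le hv.2.le 2) (norm_nonneg _)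
  let σ : ℝ → intr S := fun v => (E C).e.symm ((v : ℂ) ^ 2 * ζ)
  have hσe : ∀ v ∈ Ioo 0 b, (E C).e (σ v) = (v : ℂ) ^ 2 * ζ := fun v hv =>
    (E C).e.right_inv (htgt v hv)
  have hσs : ∀ v ∈ Ioo 0 b, σ v ∈ (E C).e.source := fun v hv => (E C).e.map_target (htgt v hv)
  have hσk : ∀ v ∈ Ioo 0 b, (E C).e (σ v) ^ (E C).k = ((v : ℂ) ^ (E C).k * ϖ) ^ 2 := by
    intro v hv
    rw [hσe v hv, mul_pow, mul_pow, hϖ]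
    ring
  have hσd : ∀ v ∈ Ioo 0 b, σ v ∈ (E C).disk η := by
    intro v hv
    refine ⟨hσs v hv, ?_⟩
    rw [hσe v hv, hnorm]
    refine lt_of_le_of_lt ?_ hb.2
    exact pow_le_pow_left₀ (by positivity) (mul_le_mul_of_nonneg_right
      (pow_le_pow_left₀ hv.1.le hv.2.le 2) (norm_nonneg _)) _
  have hσc : ContinuousOn σ (Ioo 0 b) :=
    (E C).e.continuousOn_symm.comp (by fun_prop) htgt
  have hσ1 : σ 1 = u := by
    simp only [σ, Complex.ofReal_one, one_pow, one_mul]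
    exact (E C).e.left_inv hu.1
  have h1b : (1 : ℝ) ∈ Ioo 0 b := ⟨one_pos, hb1⟩
  have hPσ : ∀ v ∈ Ioo 0 b, D.P (σ v) ∈ (E C').disk η₀ := by
    have hpre : IsPreconnected ((fun v => D.P (σ v)) '' Ioo 0 b) :=
      isPreconnected_Ioo.image _ (D.P.continuous.comp_continuousOn hσc)
    have := hpre.subset_left_of_subset_union (u := (E C').disk η₀)
      (v := ⋃ C'' : {C'' // C'' ≠ C'}, (E C'').disk η₀) ((E C').isOpen_disk η₀)
      (isOpen_iUnion fun C'' => (E C'').isOpen_disk η₀) ?_ ?_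
      (show ((fun v => D.P (σ v)) '' Ioo 0 b ∩ (E C').disk η₀).Nonempty from
        ⟨D.P u, ⟨1, h1b, congrArg D.P hσ1⟩, hu'⟩)
    · exact fun v hv => this ⟨v, hv, rfl⟩
    · rw [Set.disjoint_left]
      intro x hx hx'
      obtain ⟨C'', hC''⟩ := mem_iUnion.1 hx'
      exact C''.2 (hdis _ _ x hC'' hx)
    · rintro _ ⟨v, hv, rfl⟩
      obtain ⟨C'', hC''⟩ := (hmap C (σ v) (hσd v hv)).1
      by_cases h : C'' = C'
      · exact Or.inl (h ▸ hC'')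
      · exact Or.inr (mem_iUnion.2 ⟨⟨C'', h⟩, hC''⟩)
  -- the analytic function along the ray
  let f : ℝ → ℂ := fun v => (E C').e (D.P (σ v)) ^ (E C').k
  have hloc : ∀ v₀ ∈ Ioo 0 b, ∃ ε δ : ℝ, (ε = 1 ∨ ε = -1) ∧ (δ = 1 ∨ δ = -1) ∧ ∃ c : ℂ,
      f =ᶠ[𝓝 v₀] fun v : ℝ =>
        ((⟨ε * (D.pA.lam * ϖ.re), δ * (D.pA.lam⁻¹ * ϖ.im)⟩ : ℂ) * (v : ℂ) ^ (E C).k + c) ^ 2 :=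
    fun v₀ hv₀ => D.pA.exists_affine_along_ray (E C) (E C') hv₀.1
      (hσc.continuousAt (isOpen_Ioo.mem_nhds hv₀)) (hσs v₀ hv₀) (hPσ v₀ hv₀).1 hϖ0
      (by filter_upwards [isOpen_Ioo.mem_nhds hv₀] with v hv using hσk v hv)
  have hpoly : ∀ A c : ℂ, AnalyticOnNhd ℝ (fun v : ℝ => (A * (v : ℂ) ^ (E C).k + c) ^ 2) univ := by
    intro A c v _
    have h1 : AnalyticAt ℝ (fun v : ℝ => (v : ℂ)) v := Complex.ofRealCLM.analyticAt v
    fun_prop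
  have hfan : AnalyticOnNhd ℝ f (Ioo 0 b) := by
    intro v hv
    obtain ⟨ε, δ, -, -, c, h⟩ := hloc v hv
    exact (hpoly _ _ v (mem_univ _)).congr h.symm
  obtain ⟨ε, δ, hε, hδ, c, h1⟩ := hloc 1 h1b
  set A : ℂ := ⟨ε * (D.pA.lam * ϖ.re), δ * (D.pA.lam⁻¹ * ϖ.im)⟩ with hA
  have hfeq := hfan.eqOn_of_preconnected_of_eventuallyEq ((hpoly A c).mono (subset_univ _))
    isPreconnected_Ioo h1b h1
  have hlim1 : Tendsto f (𝓝[>] 0) (𝓝 (c ^ 2)) := by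
    have h2 : Tendsto (fun v : ℝ => (A * (v : ℂ) ^ (E C).k + c) ^ 2) (𝓝 0)
        (𝓝 ((A * ((0 : ℝ) : ℂ) ^ (E C).k + c) ^ 2)) :=
      Continuous.tendsto (by fun_prop) 0
    rw [Complex.ofReal_zero, zero_pow (E C).k_pos.ne', mul_zero, zero_add] at h2
    refine (h2.mono_left nhdsWithin_le_nhds).congr' ?_
    filter_upwards [Ioo_mem_nhdsGT (one_pos.trans hb1)] with v hv
    exact (hfeq hv).symm
  have hlim2 : Tendsto f (𝓝[>] 0) (𝓝 0) := by
    rw [Metric.tendsto_nhds]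
    intro r hr
    obtain ⟨η₁, hη₁⟩ : ∃ η₁ : ℝ, 0 < η₁ ∧ η₁ ≤ η₀ ∧ η₁ ^ 2 < r := by
      refine ⟨min η₀ (√r / 2), by positivity, min_le_left _ _, ?_⟩
      calc (min η₀ (√r / 2)) ^ 2 ≤ (√r / 2) ^ 2 :=
            pow_le_pow_left₀ (by positivity) (min_le_right _ _) 2
        _ < r := by rw [div_pow, Real.sq_sqrt hr.le]; linarith
    obtain ⟨η₂, h2, hη₂⟩ := ((D.eventually_map_disk E hι hγ hτ hη₁.1).and
      self_mem_nhdsWithin).exists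
    have hη₂ : 0 < η₂ := hη₂
    have h3 : ∀ᶠ v : ℝ in 𝓝 0, (v ^ 2 * ‖ζ‖) ^ (E C).k < η₂ ^ 2 := by
      refine ContinuousAt.eventually_lt (by fun_prop) continuousAt_const ?_
      simp only [ne_eq, OfNat.ofNat_ne_zero, not_false_eq_true, zero_pow, zero_mul,
        zero_pow (E C).k_pos.ne']
      positivity
    filter_upwards [Ioo_mem_nhdsGT (one_pos.trans hb1), mem_nhdsWithin_of_mem_nhds h3] with v hv hv3
    have h4 : σ v ∈ (E C).disk η₂ := ⟨hσs v hv, by rw [hσe v hv, hnorm]; exact hv3⟩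
    obtain ⟨C'', hC''⟩ := (h2 C _ h4).1
    obtain rfl := hdis C'' C' _ ((E C'').disk_mono hη₁.1.le hη₁.2.1 hC'') (hPσ v hv)
    rw [dist_zero_right]
    simp only [f]
    rw [norm_pow]
    exact hC''.2.trans hη₁.2.2
  have hc : c = 0 := by
    have := tendsto_nhds_unique hlim1 hlim2
    exact pow_eq_zero_iff two_ne_zero |>.1 this
  have hf1 : A ^ 2 = (E C').e (D.P u) ^ (E C').k := by
    have := hfeq h1b
    simp only [f, hσ1, hc, Complex.ofReal_one, one_pow, mul_one, add_zero] at this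
    exact this.symm
  have hlam := D.pA.lam_pos
  rw [(E C').X_eq hf1, (E C').Y_eq hf1, (E C).X_eq hϖ, (E C).Y_eq hϖ]
  constructor
  · rw [hA, abs_mul, abs_mul, abs_of_pos hlam]
    rcases hε with rfl | rfl <;> simp
  · rw [hA, abs_mul, abs_mul, abs_of_pos (inv_pos.2 hlam)]
    rcases hδ with rfl | rfl <;> simp

end AlmostAnosovData


/-! ### The section and the local invariant manifolds -/

theorem zpow_mem_of_invariant {X : Type*} [TopologicalSpace X] {P : X ≃ₜ X} {A : Set X}
    (hA : ∀ u ∈ A, P u ∈ A) {u : X} (hu : u ∈ A) {k : ℤ} (hk : 0 ≤ k) : (P ^ k) u ∈ A := by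
  obtain ⟨k, rfl⟩ := Int.eq_ofNat_of_zero_le hk
  rw [zpow_natCast]
  clear hk
  induction k with
  | zero => exact hu
  | succ k ih =>
    rw [pow_succ']
    exact hA _ ih

theorem zpow_mem_of_invariant_symm {X : Type*} [TopologicalSpace X] {P : X ≃ₜ X} {A : Set X}
    (hA : ∀ u ∈ A, P.symm u ∈ A) {u : X} (hu : u ∈ A) {k : ℤ} (hk : k ≤ 0) : (P ^ k) u ∈ A := by
  have h := zpow_mem_of_invariant (P := P⁻¹) hA hu (k := -k) (by omega)
  rwa [inv_zpow', neg_neg] at h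

theorem eq_zero_of_pow_mul_le {l a b : ℝ} (hl0 : 0 < l) (hl : l < 1) (ha : 0 ≤ a)
    (h : ∀ j : ℕ, l⁻¹ ^ j * a ≤ b) : a = 0 := by
  by_contra hne
  have hpos : 0 < a := lt_of_le_of_ne ha (Ne.symm hne)
  obtain ⟨j, hj⟩ := pow_unbounded_of_one_lt (b / a) ((one_lt_inv₀ hl0).2 hl)
  rw [div_lt_iff₀ hpos] at hj
  linarith [h j]

namespace AlmostAnosovData

variable {M : Type*} [MetricSpace M] [CompactSpace M]
  {S : Type*} [TopologicalSpace S] [ChartedSpace (EuclideanHalfSpace 2) S]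
  [CompactSpace S] [T2Space S]
  {φ : Flow ℝ M} {ι : S → M} (D : AlmostAnosovData φ ι)
  {γ : Set M} {τ : OpenPartialHomeomorph M (ℝ × ℝ × UnitAddCircle)}
  (E : ∀ C : componentsOver ι γ, EndChart D.pA.charts (C : Set S))

theorem pt_int (u : intr S) (k : ℤ) : D.pt u k = ι ((D.P ^ k) u) := by
  rw [← D.pt_zpow u k k, sub_self, D.pt_zero]

theorem pt_eq_pt_floor (u : intr S) (t : ℝ) :
    D.pt u t = D.pt ((D.P ^ ⌊t⌋) u) (t - ⌊t⌋) := (D.pt_zpow u t _).symm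

theorem flow_mem_of_forall_pt {O : Set M} {u : intr S} (h : ∀ t, 0 ≤ t → D.pt u t ∈ O) {t : ℝ}
    (ht : 0 ≤ t) : φ t (ι u) ∈ O := by
  obtain ⟨k, hk0, hk⟩ := D.exists_time u
  have := h (k.symm t) (by rw [← k.le_iff_le, hk0, k.apply_symm_apply]; exact ht)
  rwa [hk, k.apply_symm_apply] at this

theorem flow_mem_of_forall_pt_neg {O : Set M} {u : intr S} (h : ∀ t, t ≤ 0 → D.pt u t ∈ O) {t : ℝ}
    (ht : t ≤ 0) : φ t (ι u) ∈ O := by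
  obtain ⟨k, hk0, hk⟩ := D.exists_time u
  have := h (k.symm t) (by rw [← k.le_iff_le, hk0, k.apply_symm_apply]; exact ht)
  rwa [hk, k.apply_symm_apply] at this

theorem eventually_Y_eq_zero_iff [Finite (componentsOver ι γ)] (hι : IsBirkhoffSection φ ι)
    (hns : ∀ x, ∃ t, φ t x ≠ x) (hγ : γ ∈ boundaryOrbits φ ι) (hτ : IsSaddleChart φ γ τ) :
    ∀ᶠ η in 𝓝[>] (0 : ℝ), ∀ C, ∀ u ∈ (E C).disk η,
      ((E C).Y u = 0 ↔ (τ (ι u)).2.1 = 0) ∧ ((E C).X u = 0 ↔ (τ (ι u)).1 = 0) := by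
  obtain ⟨δa, hδa, -, hbox⟩ := D.exists_box_forward hι hγ hτ (isOpen_saddleBox (τ := τ) (1 / 2))
    (hτ.subset_saddleBox (by norm_num))
  obtain ⟨η₀, hsc, hη₀⟩ := ((D.eventually_scaling E hι hγ hτ).and self_mem_nhdsWithin).exists
  have hη₀ : 0 < η₀ := hη₀
  obtain ⟨η₂, ⟨⟨hmap, himg⟩, h20⟩, hη₂⟩ := (((D.eventually_map_disk E hι hγ hτ hη₀).and
    (eventually_disk_image E hι hγ (isOpen_saddleBox (τ := τ) δa) (hτ.subset_saddleBox hδa))).and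
    ((gt_mem_nhds hη₀).filter_mono nhdsWithin_le_nhds)).and self_mem_nhdsWithin |>.exists
  have hη₂ : 0 < η₂ := hη₂
  have h20 : η₂ < η₀ := h20
  have hsub : ∀ C, (E C).disk η₂ ⊆ (E C).disk η₀ := fun C => (E C).disk_mono hη₂.le h20.le
  obtain ⟨δb, hδb, -, hdisk⟩ := exists_saddleBox_disk E hι hγ hτ hη₂
  have hl0 := D.pA.lam_pos
  have hl1 := D.pA.lam_lt_one
  filter_upwards [eventually_disk_image E hι hγ (isOpen_saddleBox (τ := τ) δb)
    (hτ.subset_saddleBox hδb), self_mem_nhdsWithin,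
    (gt_mem_nhds hη₂).filter_mono nhdsWithin_le_nhds] with η himg' hη hηη₂ C u hu
  have hη : 0 < η := hη
  have huD : u ∈ (E C).disk η₂ := (E C).disk_mono hη.le (le_of_lt hηη₂) hu
  have hbound : ∀ C, ∀ v ∈ (E C).disk η₂, (E C).X v ≤ η₂ ∧ (E C).Y v ≤ η₂ := by
    intro C v hv
    have h1 := (E C).X_sq_add_Y_sq v
    have h2 := hv.2
    constructor
    · refine abs_le_of_sq_le_sq' ?_ hη₂.le |>.2
      nlinarith [sq_nonneg ((E C).Y v)]
    · refine abs_le_of_sq_le_sq' ?_ hη₂.le |>.2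
      nlinarith [sq_nonneg ((E C).X v)]
  have hptbox : ∀ v : intr S, (∃ C, v ∈ (E C).disk η₂) → ∀ t ∈ Icc (0 : ℝ) 1,
      D.pt v t ∈ saddleBox τ (1 / 2) := by
    rintro v ⟨C, hv⟩ t ht
    exact (hbox v (himg C v hv) t ht).1
  constructor
  · constructor
    · intro hY
      refine hτ.eq_zero_of_forward hns (δ := 1 / 2) (by norm_num) fun t ht => ?_
      refine D.flow_mem_of_forall_pt (fun t ht => ?_) ht
      have hinv : (D.P ^ ⌊t⌋) u ∈ {v | ∃ C, v ∈ (E C).disk η₂ ∧ (E C).Y v = 0} := by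
        refine zpow_mem_of_invariant (A := {v | ∃ C, v ∈ (E C).disk η₂ ∧ (E C).Y v = 0}) ?_
          ⟨C, huD, hY⟩ (Int.floor_nonneg.2 ht)
        rintro v ⟨C, hv, hv0⟩
        obtain ⟨C', hC'⟩ := (hmap C v hv).1
        obtain ⟨h1, h2⟩ := hsc C C' v (hsub C hv) hC'
        rw [hv0, mul_zero] at h2
        refine ⟨C', ⟨hC'.1, ?_⟩, h2⟩
        rw [← (E C').X_sq_add_Y_sq, h1, h2]
        have h3 := (E C).X_sq_add_Y_sq v
        have h4 : (D.pA.lam * (E C).X v) ^ 2 ≤ (E C).X v ^ 2 :=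
          pow_le_pow_left₀ (mul_nonneg hl0.le ((E C).X_nonneg v))
            (mul_le_of_le_one_left ((E C).X_nonneg v) hl1.le) 2
        rw [hv0] at h3
        linarith [hv.2]
      rw [D.pt_eq_pt_floor]
      obtain ⟨C', hC', -⟩ := hinv
      exact hptbox _ ⟨C', hC'⟩ _ ⟨by linarith [Int.floor_le t], by linarith [Int.lt_floor_add_one t]⟩
    · intro hy
      refine eq_zero_of_pow_mul_le (b := η₂) hl0 hl1 ((E C).Y_nonneg u) fun j => ?_
      have hbx : ∀ k : ℤ, 0 ≤ k → ι ((D.P ^ k) u) ∈ saddleBox τ δb := by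
        intro k hk
        obtain ⟨h, h0, hh⟩ := D.exists_time u
        rw [← D.pt_int, hh]
        refine hτ.forward_of_eq_zero (himg' C u hu) hy ?_
        rw [← h0]
        exact h.monotone (by exact_mod_cast hk)
      have : ∃ C', (D.P ^ (j : ℤ)) u ∈ (E C').disk η₂ ∧
          (E C').Y ((D.P ^ (j : ℤ)) u) = D.pA.lam⁻¹ ^ j * (E C).Y u := by
        induction j with
        | zero => exact ⟨C, huD, by simp⟩
        | succ j ih =>
          obtain ⟨C₁, hC₁, hY₁⟩ := ih
          obtain ⟨C₂, hC₂⟩ := hdisk _ (hbx (j + 1) (by omega))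
          refine ⟨C₂, by exact_mod_cast hC₂, ?_⟩
          have hP : (D.P ^ ((j + 1 : ℕ) : ℤ)) u = D.P ((D.P ^ (j : ℤ)) u) := by
            push_cast
            rw [add_comm, zpow_add, zpow_one]
            rfl
          have hC₂' : D.P ((D.P ^ (j : ℤ)) u) ∈ (E C₂).disk η₂ := by
            rw [← hP]
            exact_mod_cast hC₂
          rw [hP, (hsc C₁ C₂ _ (hsub _ hC₁) (hsub _ hC₂')).2, hY₁]
          ring
      obtain ⟨C', hC', hY⟩ := this
      rw [← hY]
      exact (hbound C' _ hC').2
  · constructor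
    · intro hX
      refine hτ.eq_zero_of_backward hns (δ := 1 / 2) (by norm_num) fun t ht => ?_
      refine D.flow_mem_of_forall_pt_neg (fun t ht => ?_) ht
      have hinv : (D.P ^ ⌊t⌋) u ∈ {v | ∃ C, v ∈ (E C).disk η₂ ∧ (E C).X v = 0} := by
        refine zpow_mem_of_invariant_symm (A := {v | ∃ C, v ∈ (E C).disk η₂ ∧ (E C).X v = 0})
          ?_ ⟨C, huD, hX⟩ ?_
        · rintro v ⟨C, hv, hv0⟩
          obtain ⟨C', hC'⟩ := (hmap C v hv).2
          obtain ⟨h1, h2⟩ := hsc C' C (D.P.symm v) hC' (by simpa using hsub C hv)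
          simp only [Homeomorph.apply_symm_apply] at h1 h2
          rw [hv0] at h1
          have h1' : (E C').X (D.P.symm v) = 0 := by
            rcases mul_eq_zero.1 h1.symm with h | h
            · exact absurd h hl0.ne'
            · exact h
          have h2' : (E C').Y (D.P.symm v) = D.pA.lam * (E C).Y v := by
            rw [h2]
            field_simp
          refine ⟨C', ⟨hC'.1, ?_⟩, h1'⟩
          rw [← (E C').X_sq_add_Y_sq, h1', h2']
          have h3 := (E C).X_sq_add_Y_sq v
          have h4 : (D.pA.lam * (E C).Y v) ^ 2 ≤ (E C).Y v ^ 2 :=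
            pow_le_pow_left₀ (mul_nonneg hl0.le ((E C).Y_nonneg v))
              (mul_le_of_le_one_left ((E C).Y_nonneg v) hl1.le) 2
          rw [hv0] at h3
          linarith [hv.2]
        · have := Int.floor_le t
          have h5 : ((⌊t⌋ : ℤ) : ℝ) ≤ 0 := this.trans ht
          exact_mod_cast h5
      rw [D.pt_eq_pt_floor]
      obtain ⟨C', hC', -⟩ := hinv
      exact hptbox _ ⟨C', hC'⟩ _ ⟨by linarith [Int.floor_le t], by linarith [Int.lt_floor_add_one t]⟩
    · intro hx
      refine eq_zero_of_pow_mul_le (b := η₂) hl0 hl1 ((E C).X_nonneg u) fun j => ?_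
      have hbx : ∀ k : ℤ, k ≤ 0 → ι ((D.P ^ k) u) ∈ saddleBox τ δb := by
        intro k hk
        obtain ⟨h, h0, hh⟩ := D.exists_time u
        rw [← D.pt_int, hh]
        refine hτ.backward_of_eq_zero (himg' C u hu) hx ?_
        rw [← h0]
        exact h.monotone (by exact_mod_cast hk)
      have : ∃ C', (D.P ^ (-(j : ℤ))) u ∈ (E C').disk η₂ ∧
          (E C').X ((D.P ^ (-(j : ℤ))) u) = D.pA.lam⁻¹ ^ j * (E C).X u := by
        induction j with
        | zero => exact ⟨C, huD, by simp⟩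
        | succ j ih =>
          obtain ⟨C₁, hC₁, hX₁⟩ := ih
          obtain ⟨C₂, hC₂⟩ := hdisk _ (hbx (-((j + 1 : ℕ) : ℤ)) (by omega))
          refine ⟨C₂, hC₂, ?_⟩
          have hP : (D.P ^ (-(j : ℤ))) u = D.P ((D.P ^ (-((j + 1 : ℕ) : ℤ))) u) := by
            have : -(j : ℤ) = 1 + -((j + 1 : ℕ) : ℤ) := by push_cast; ring
            rw [this, zpow_add, zpow_one]
            rfl
          rw [hP] at hC₁ hX₁
          have h1 := (hsc C₂ C₁ _ (hsub _ hC₂) (hsub _ hC₁)).1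
          rw [hX₁] at h1
          rw [pow_succ, mul_comm _ D.pA.lam⁻¹, mul_assoc, h1]
          field_simp
      obtain ⟨C', hC', hX⟩ := this
      rw [← hX]
      exact (hbound C' _ hC').1

/-- The section crosses the local invariant manifolds. -/
theorem exists_crossing (D : AlmostAnosovData φ ι) (hι : IsBirkhoffSection φ ι) (hγ : γ ∈ boundaryOrbits φ ι)
    (hτ : IsSaddleChart φ γ τ) : ∃ δ, 0 < δ ∧ ∀ u : intr S, ι u ∈ saddleBox τ δ →
      ((τ (ι u)).1 = 0 → ∀ N ∈ 𝓝 u, ∀ s : ℝ, s ≠ 0 → ∃ u' ∈ N, 0 < s * (τ (ι u')).1) ∧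
      ((τ (ι u)).2.1 = 0 → ∀ N ∈ 𝓝 u, ∀ s : ℝ, s ≠ 0 → ∃ u' ∈ N, 0 < s * (τ (ι u')).2.1) := by
  obtain ⟨δ, hδ, -, hbox⟩ := D.exists_box_forward hι hγ hτ τ.open_source hτ.orbit_subset
  refine ⟨δ, hδ, fun u hu => ?_⟩
  have hbO : IsOpen {u' : intr S | ι u' ∈ saddleBox τ δ} :=
    (isOpen_saddleBox δ).preimage (hι.continuous.comp continuous_subtype_val)
  have key : ∀ N ∈ 𝓝 u, ∃ O : Set M, IsOpen O ∧ D.pt u (1 / 2) ∈ O ∧ O ⊆ τ.source ∧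
      ∀ q ∈ O, ∃ u' ∈ N, ∃ a > 0, ∃ b > 0, (τ q).1 = a * (τ (ι u')).1 ∧
        (τ q).2.1 = b * (τ (ι u')).2.1 := by
    intro N hN
    obtain ⟨N', hN'N, hN'o, huN'⟩ := mem_nhds_iff.1 (inter_mem hN (hbO.mem_nhds hu))
    refine ⟨_, D.isOpenMap_pt hι _ (hN'o.prod (isOpen_Ioo (a := (0 : ℝ)) (b := 1))),
      ⟨(u, 1 / 2), ⟨huN', by norm_num, by norm_num⟩, rfl⟩, ?_, ?_⟩
    · rintro _ ⟨⟨v, t⟩, ⟨hv, ht⟩, rfl⟩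
      exact (hbox v (hN'N hv).2 t ⟨ht.1.le, ht.2.le⟩).1
    · rintro _ ⟨⟨v, t⟩, ⟨hv, ht⟩, rfl⟩
      exact ⟨v, (hN'N hv).1, (hbox v (hN'N hv).2 t ⟨ht.1.le, ht.2.le⟩).2⟩
  obtain ⟨a₀, ha₀, b₀, hb₀, hxa, hyb⟩ := (hbox u hu (1 / 2) ⟨by norm_num, by norm_num⟩).2
  have hopen : ∀ O : Set M, IsOpen O → D.pt u (1 / 2) ∈ O → O ⊆ τ.source →
      ∀ᶠ v in 𝓝 (τ (D.pt u (1 / 2))), ∃ q ∈ O, τ q = v := by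
    intro O hO hq hOτ
    exact (τ.isOpen_image_of_subset_source hO hOτ).mem_nhds ⟨_, hq, rfl⟩
  constructor
  · intro h0 N hN s hs
    obtain ⟨O, hO, hq, hOτ, h⟩ := key N hN
    have h1 : ContinuousAt (fun r : ℝ => ((r * s, (τ (D.pt u (1 / 2))).2) : ℝ × ℝ × UnitAddCircle)) 0 := by
      fun_prop
    have h2 : ((0 * s, (τ (D.pt u (1 / 2))).2) : ℝ × ℝ × UnitAddCircle) = τ (D.pt u (1 / 2)) :=
      Prod.ext (by rw [hxa, h0]; simp) rfl
    have h3 := h1.tendsto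
    rw [h2] at h3
    obtain ⟨r, ⟨q', hq', hv⟩, hr⟩ := (((h3.eventually (hopen O hO hq hOτ)).filter_mono
      nhdsWithin_le_nhds).and (self_mem_nhdsWithin (a := (0 : ℝ)) (s := Ioi (0 : ℝ)))).exists
    obtain ⟨u', hu', a, ha, b, hb, hx, -⟩ := h q' hq'
    refine ⟨u', hu', ?_⟩
    rw [hv] at hx
    simp only at hx
    have hr : 0 < r := hr
    have h4 : 0 < a * (s * (τ (ι u')).1) := by
      have : a * (s * (τ (ι u')).1) = r * (s * s) := by linear_combination -s * hx
      rw [this]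
      exact mul_pos hr (mul_self_pos.2 hs)
    exact (mul_pos_iff_of_pos_left ha).1 h4
  · intro h0 N hN s hs
    obtain ⟨O, hO, hq, hOτ, h⟩ := key N hN
    have h1 : ContinuousAt (fun r : ℝ => (((τ (D.pt u (1 / 2))).1, r * s,
        (τ (D.pt u (1 / 2))).2.2) : ℝ × ℝ × UnitAddCircle)) 0 := by
      fun_prop
    have h2 : (((τ (D.pt u (1 / 2))).1, 0 * s, (τ (D.pt u (1 / 2))).2.2) :
        ℝ × ℝ × UnitAddCircle) = τ (D.pt u (1 / 2)) :=
      Prod.ext rfl (Prod.ext (by simp only; rw [hyb, h0]; simp) rfl)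
    have h3 := h1.tendsto
    rw [h2] at h3
    obtain ⟨r, ⟨q', hq', hv⟩, hr⟩ := (((h3.eventually (hopen O hO hq hOτ)).filter_mono
      nhdsWithin_le_nhds).and (self_mem_nhdsWithin (a := (0 : ℝ)) (s := Ioi (0 : ℝ)))).exists
    obtain ⟨u', hu', a, ha, b, hb, -, hy⟩ := h q' hq'
    refine ⟨u', hu', ?_⟩
    rw [hv] at hy
    simp only at hy
    have hr : 0 < r := hr
    have h4 : 0 < b * (s * (τ (ι u')).2.1) := by
      have : b * (s * (τ (ι u')).2.1) = r * (s * s) := by linear_combination -s * hy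
      rw [this]
      exact mul_pos hr (mul_self_pos.2 hs)
    exact (mul_pos_iff_of_pos_left hb).1 h4

end AlmostAnosovData


/-! ### Roots of flat coordinates -/

theorem exists_sign_of_isPreconnected {X : Type*} [TopologicalSpace X] {K : Set X}
    (hK : IsPreconnected K) {a : X → ℝ} (ha : ContinuousOn a K) (h0 : ∀ x ∈ K, a x ≠ 0) :
    ∃ s : ℝ, (s = 1 ∨ s = -1) ∧ ∀ x ∈ K, 0 < s * a x := by
  by_cases h : ∃ x ∈ K, 0 < a x
  · obtain ⟨x, hx, hpos⟩ := h
    refine ⟨1, Or.inl rfl, fun y hy => ?_⟩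
    rw [one_mul]
    by_contra hcon
    obtain ⟨z, hz, hz0⟩ := hK.intermediate_value hy hx ha ⟨not_lt.1 hcon, hpos.le⟩
    exact h0 z hz hz0
  · push Not at h
    exact ⟨-1, Or.inr rfl, fun x hx => by linarith [lt_of_le_of_ne (h x hx) (h0 x hx)]⟩

theorem sign_mul_abs_of_pos {s a b : ℝ} (hs : s = 1 ∨ s = -1) (h : 0 < s * a * b) :
    (SignType.sign a : ℝ) * |b| = s * b := by
  rcases lt_trichotomy a 0 with ha | rfl | ha
  · rw [sign_neg ha]
    rcases hs with rfl | rfl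
    · have hb : b < 0 := by nlinarith
      simp [abs_of_neg hb]
    · have hb : 0 < b := by nlinarith
      simp [abs_of_pos hb]
  · simp at h
  · rw [sign_pos ha]
    rcases hs with rfl | rfl
    · have hb : 0 < b := by nlinarith
      simp [abs_of_pos hb]
    · have hb : b < 0 := by nlinarith
      simp [abs_of_neg hb]

/-- A function with the zeros of a linear coordinate, both signs of which occur near each of its
zeros, has up to sign the signs of that coordinate. -/
theorem eventually_sign_mul_abs {X : Type*} [TopologicalSpace X] (g : OpenPartialHomeomorph X ℂ)
    (L : ℂ →L[ℝ] ℝ) {a : X → ℝ} (ha : ContinuousOn a g.source)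
    (h0 : ∀ x ∈ g.source, a x = 0 ↔ L (g x) = 0) {x : X} (hx : x ∈ g.source)
    (hcr : a x = 0 → ∀ N ∈ 𝓝 x, ∀ s : ℝ, s ≠ 0 → ∃ x' ∈ N, 0 < s * a x') :
    ∃ ε : ℝ, (ε = 1 ∨ ε = -1) ∧
      ∀ᶠ x' in 𝓝 x, (SignType.sign (a x') : ℝ) * |L (g x')| = ε * L (g x') := by
  have hsrc : g.source ∈ 𝓝 x := g.open_source.mem_nhds hx
  by_cases hax : a x = 0
  · obtain ⟨r, hr, hball⟩ := Metric.mem_nhds_iff.1 (g.open_target.mem_nhds (g.map_source hx))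
    have key : ∀ t : ℝ, ∃ s : ℝ, (s = 1 ∨ s = -1) ∧ ∀ x' ∈ g.source, g x' ∈ Metric.ball (g x) r →
        0 < t * L (g x') → 0 < s * a x' := by
      intro t
      have hconv : Convex ℝ (Metric.ball (g x) r ∩ {ζ | 0 < t * L ζ}) :=
        (convex_ball _ _).inter (convex_halfSpace_gt (f := fun ζ => t * L ζ)
          ⟨fun a b => by simp [mul_add], fun c a => by
            rw [map_smul, smul_eq_mul, smul_eq_mul]
            ring⟩ 0)
      obtain ⟨s, hs, h⟩ := exists_sign_of_isPreconnected hconv.isPreconnected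
        (a := fun ζ => a (g.symm ζ))
        (ha.comp (g.continuousOn_symm.mono fun ζ hζ => hball hζ.1) fun ζ hζ =>
          g.map_target (hball hζ.1)) (by
          intro ζ hζ hcon
          rw [h0 _ (g.map_target (hball hζ.1)), g.right_inv (hball hζ.1)] at hcon
          have : 0 < t * L ζ := hζ.2
          rw [hcon, mul_zero] at this
          exact lt_irrefl _ this)
      refine ⟨s, hs, fun x' hx' hb hL => ?_⟩
      have := h (g x') ⟨hb, hL⟩
      rwa [g.left_inv hx'] at this
    obtain ⟨s, hs, hpos⟩ := key 1
    obtain ⟨s', hs', hneg⟩ := key (-1)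
    have hN : g.source ∩ g ⁻¹' Metric.ball (g x) r ∈ 𝓝 x :=
      inter_mem hsrc ((g.continuousAt hx).preimage_mem_nhds (Metric.ball_mem_nhds _ hr))
    have hss : s' = -s := by
      by_contra hne
      have hs'' : s' = s := by
        rcases hs with rfl | rfl <;> rcases hs' with rfl | rfl <;> first | rfl | norm_num at hne
      obtain ⟨x', hx', hlt⟩ := hcr hax _ hN (-s) (by rcases hs with rfl | rfl <;> norm_num)
      have hLne : L (g x') ≠ 0 := fun h => by
        rw [← h0 x' hx'.1] at h
        simp [h] at hlt
      rcases lt_or_gt_of_ne hLne with h | h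
      · have := hneg x' hx'.1 hx'.2 (by linarith)
        rw [hs''] at this
        linarith
      · have := hpos x' hx'.1 hx'.2 (by linarith)
        linarith
    refine ⟨s, hs, ?_⟩
    filter_upwards [hN] with x' hx'
    rcases lt_trichotomy (L (g x')) 0 with h | h | h
    · have h1 := hneg x' hx'.1 hx'.2 (by linarith)
      rw [hss] at h1
      exact sign_mul_abs_of_pos hs (by nlinarith)
    · simp [h]
    · have h1 := hpos x' hx'.1 hx'.2 (by linarith)
      exact sign_mul_abs_of_pos hs (mul_pos h1 h)
  · have hLx : L (g x) ≠ 0 := fun h => hax ((h0 x hx).2 h)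
    have hac : ContinuousAt a x := ha.continuousAt hsrc
    have hLc : ContinuousAt (fun x' => L (g x')) x :=
      L.continuous.continuousAt.comp (g.continuousAt hx)
    have hε : ∃ ε : ℝ, (ε = 1 ∨ ε = -1) ∧ 0 < ε * a x * L (g x) := by
      rcases lt_or_gt_of_ne (mul_ne_zero hax hLx) with h | h
      · exact ⟨-1, Or.inr rfl, by linarith⟩
      · exact ⟨1, Or.inl rfl, by linarith⟩
    obtain ⟨ε, hε, hpos⟩ := hε
    refine ⟨ε, hε, ?_⟩
    have hc : ContinuousAt (fun x' => ε * a x' * L (g x')) x :=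
      (continuousAt_const.mul hac).mul hLc
    filter_upwards [hc.eventually (lt_mem_nhds hpos)] with x' h
    exact sign_mul_abs_of_pos hε h

theorem exists_openPartialHomeomorph_of_locallyAffine {X : Type*} [TopologicalSpace X]
    (f : OpenPartialHomeomorph X (ℝ × ℝ)) {w : X → ℂ} {x : X} (hx : x ∈ f.source)
    (h : LocallyAffine 1 f (fun x' => ((w x').re, (w x').im)) x) :
    ∃ g : OpenPartialHomeomorph X ℂ, x ∈ g.source ∧ ∀ x' ∈ g.source, g x' = w x' := by
  obtain ⟨ε, δ, c, d, hε, hδ, h⟩ := h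
  have hε2 : ε * ε = 1 := by rcases hε with rfl | rfl <;> norm_num
  have hδ2 : δ * δ = 1 := by rcases hδ with rfl | rfl <;> norm_num
  let B : (ℝ × ℝ) ≃ₜ ℂ :=
    { toFun := fun v => ⟨ε * (v.1 - c), δ * (v.2 - d)⟩
      invFun := fun ζ => (ε * ζ.re + c, δ * ζ.im + d)
      left_inv := fun v => Prod.ext (by simp only; linear_combination (v.1 - c) * hε2)
        (by simp only; linear_combination (v.2 - d) * hδ2)
      right_inv := fun ζ => Complex.ext (by simp only; linear_combination ζ.re * hε2)
        (by simp only; linear_combination ζ.im * hδ2)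
      continuous_toFun := by
        simp only [Complex.mk_eq_add_mul_I]
        fun_prop
      continuous_invFun := by fun_prop }
  obtain ⟨O, hO, hOo, hxO⟩ := eventually_nhds_iff.1 h
  refine ⟨(f.restrOpen O hOo).transHomeomorph B, ⟨hx, hxO⟩, fun x' hx' => ?_⟩
  have h1 : f x' = _ := hO x' hx'.2
  change B (f x') = w x'
  rw [h1]
  refine Complex.ext ?_ ?_
  · change ε * (ε * (1 * (w x').re) + c - c) = (w x').re
    linear_combination (w x').re * hε2
  · change δ * (δ * (1⁻¹ * (w x').im) + d - d) = (w x').im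
    linear_combination (w x').im * hδ2

theorem exists_pow_eq_of_pos {k : ℕ} (hk : 0 < k) {c : ℝ} (hc : 0 < c) :
    ∃ r > 0, r ^ k = c :=
  ⟨c ^ ((k : ℝ)⁻¹), by positivity, Real.rpow_inv_natCast_pow hc.le hk.ne'⟩

theorem isPreconnected_punctured_disk {k : ℕ} (hk : 0 < k) {c : ℝ} (hc : 0 < c) :
    IsPreconnected {ζ : ℂ | ζ ≠ 0 ∧ ‖ζ‖ ^ k < c} := by
  obtain ⟨r, hr, rfl⟩ := exists_pow_eq_of_pos hk hc
  have : {ζ : ℂ | ζ ≠ 0 ∧ ‖ζ‖ ^ k < r ^ k} = {ζ : ℂ | ζ ≠ 0 ∧ ‖ζ‖ < r} := by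
    ext ζ
    simp only [mem_ofPred_eq, pow_lt_pow_iff_left₀ (norm_nonneg ζ) hr.le hk.ne']
  rw [this]
  exact isPreconnected_punctured_ball r

theorem isPreconnected_source {X : Type*} [TopologicalSpace X] {k : ℕ} (hk : 0 < k) {c : ℝ}
    (hc : 0 < c) (e : OpenPartialHomeomorph X ℂ) (he : e.target = {ζ | ζ ≠ 0 ∧ ‖ζ‖ ^ k < c}) :
    IsPreconnected e.source := by
  rw [← e.symm_image_target_eq_source]
  refine IsPreconnected.image ?_ _ e.continuousOn_symm
  rw [he]
  exact isPreconnected_punctured_disk hk hc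

theorem exists_root_of_sq_eq {X : Type*} [TopologicalSpace X] {k : ℕ} (hk : 0 < k) {c : ℝ}
    (hc : 0 < c) (e : OpenPartialHomeomorph X ℂ) (he : e.target = {ζ | ζ ≠ 0 ∧ ‖ζ‖ ^ k < c})
    {Q : X → ℂ} (hQ : ContinuousOn Q e.source) (h : ∀ x ∈ e.source, Q x ^ 2 = e x ^ k) :
    ∃ n : ℕ, 0 < n ∧ k = 2 * n ∧ ∃ ψ : OpenPartialHomeomorph X ℂ, ψ.source = e.source ∧
      ψ.target = e.target ∧ ∀ x ∈ e.source, ψ x ^ n = Q x := by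
  have he0 : ∀ x ∈ e.source, e x ≠ 0 := fun x hx => by
    have := e.map_source hx
    rw [he] at this
    exact this.1
  have hQ0 : ∀ x ∈ e.source, Q x ≠ 0 := fun x hx h0 => by
    have := h x hx
    rw [h0] at this
    exact pow_ne_zero k (he0 x hx) (by simpa using this.symm)
  obtain ⟨r, hr, hrk⟩ := exists_pow_eq_of_pos hk (half_pos hc)
  have hct : ∀ s : UnitAddCircle, (r : ℂ) * ((AddCircle.toCircle s : Circle) : ℂ) ∈ e.target := by
    intro s
    rw [he]
    refine ⟨mul_ne_zero (by exact_mod_cast hr.ne') (toCircle_ne_zero s), ?_⟩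
    rw [norm_mul, Circle.norm_coe, mul_one, Complex.norm_real, Real.norm_eq_abs, abs_of_pos hr, hrk]
    linarith
  let σ : UnitAddCircle → X := fun s => e.symm ((r : ℂ) * ((AddCircle.toCircle s : Circle) : ℂ))
  have hσs : ∀ s, σ s ∈ e.source := fun s => e.map_target (hct s)
  have hσc : Continuous σ := by
    refine e.continuousOn_symm.comp_continuous ?_ hct
    have := continuous_toCircle_coe
    fun_prop
  have hσe : ∀ s, e (σ s) = (r : ℂ) * ((AddCircle.toCircle s : Circle) : ℂ) := fun s =>
    e.right_inv (hct s)
  have hfc : Continuous fun s => turn (Q (σ s)) := continuous_iff_continuousAt.2 fun s =>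
    ContinuousAt.comp (g := turn) (continuousAt_turn (hQ0 _ (hσs s)))
      (hQ.comp_continuous hσc hσs).continuousAt
  obtain ⟨d, hd⟩ := exists_hasDegree_of_continuous hfc
  have hd2 := hd.nsmul 2
  have hk2 : HasDegree (fun s => 2 • turn (Q (σ s))) k := by
    have : (fun s => 2 • turn (Q (σ s))) = fun s => ((k : ℕ) : ℤ) • s := by
      funext s
      rw [← turn_pow (hQ0 _ (hσs s)), h _ (hσs s), turn_pow (he0 _ (hσs s)), hσe,
        turn_ofReal_mul hr, turn_toCircle, natCast_zsmul]
    rw [this]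
    exact hasDegree_zsmul _
  have hdk := hd2.unique hk2
  obtain ⟨n, rfl⟩ : ∃ n : ℕ, d = n := ⟨d.toNat, by omega⟩
  have hkn : k = 2 * n := by exact_mod_cast hdk.symm
  have hn : 0 < n := by omega
  have hg2 : ∀ x ∈ e.source, Q x = e x ^ n ∨ Q x = -e x ^ n := fun x hx => by
    rw [← sq_eq_sq_iff_eq_or_eq_neg, h x hx, hkn]
    ring
  have hgr : ∀ x ∈ e.source, (Q x / e x ^ n).re ≠ 0 := fun x hx => by
    have := pow_ne_zero n (he0 x hx)
    rcases hg2 x hx with h | h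
    · rw [h, div_self this]; norm_num
    · rw [h, neg_div, div_self this]; norm_num
  obtain ⟨s, hs, hspos⟩ := exists_sign_of_isPreconnected (isPreconnected_source hk hc e he)
    (a := fun x => (Q x / e x ^ n).re)
    (Complex.continuous_re.comp_continuousOn (hQ.div (e.continuousOn.pow n) fun x hx =>
      pow_ne_zero n (he0 x hx))) hgr
  have hgs : ∀ x ∈ e.source, Q x = s * e x ^ n := fun x hx => by
    have h1 := hspos x hx
    have := pow_ne_zero n (he0 x hx)
    rcases hg2 x hx with h | h
    · rw [h, div_self this] at h1
      rcases hs with rfl | rfl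
      · simpa using h
      · norm_num at h1
    · rw [h, neg_div, div_self this] at h1
      rcases hs with rfl | rfl
      · norm_num at h1
      · simpa using h
  obtain ⟨b, hb⟩ := IsAlgClosed.exists_pow_nat_eq (s : ℂ) hn
  have hbn : ‖b‖ = 1 := by
    rw [← pow_eq_one_iff_of_nonneg (norm_nonneg b) hn.ne', ← norm_pow, hb]
    rcases hs with rfl | rfl <;> simp
  have hb0 : b ≠ 0 := norm_ne_zero_iff.1 (by rw [hbn]; exact one_ne_zero)
  refine ⟨n, hn, hkn, e.transHomeomorph (Homeomorph.mulLeft₀ b hb0), rfl, ?_, ?_⟩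
  · have : (e.transHomeomorph (Homeomorph.mulLeft₀ b hb0)).target =
        (Homeomorph.mulLeft₀ b hb0).symm ⁻¹' e.target := rfl
    rw [this, he]
    ext ζ
    simp [hbn, hb0]
  · intro x hx
    change (b * e x) ^ n = Q x
    rw [mul_pow, hb, hgs x hx]

theorem exists_root {X : Type*} [TopologicalSpace X] {k : ℕ} (hk : 0 < k) {c : ℝ}
    (hc : 0 < c) (e : OpenPartialHomeomorph X ℂ) (he : e.target = {ζ | ζ ≠ 0 ∧ ‖ζ‖ ^ k < c})
    {Q : X → ℂ} (hQ : ContinuousOn Q e.source)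
    (h : ∀ x ∈ e.source, (∀ᶠ x' in 𝓝 x, Q x' ^ 2 = e x' ^ k) ∨
      ∀ᶠ x' in 𝓝 x, Q x' ^ 2 = (starRingEnd ℂ) (e x' ^ k)) :
    ∃ n : ℕ, 0 < n ∧ k = 2 * n ∧ ∃ ψ : OpenPartialHomeomorph X ℂ, ψ.source = e.source ∧
      ψ.target = e.target ∧ ∀ x ∈ e.source, ψ x ^ n = Q x := by
  let A : Set X := {x | ∀ᶠ x' in 𝓝 x, Q x' ^ 2 = e x' ^ k}
  let B : Set X := {x | ∀ᶠ x' in 𝓝 x, Q x' ^ 2 = (starRingEnd ℂ) (e x' ^ k)}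
  have hA : IsOpen A := isOpen_setOfPred_eventually_nhds
  have hB : IsOpen B := isOpen_setOfPred_eventually_nhds
  have hdis : e.source ∩ (A ∩ B) = ∅ := by
    rw [eq_empty_iff_forall_notMem]
    rintro x ⟨hx, hxA, hxB⟩
    have hx0 : e x ≠ 0 := by
      have := e.map_source hx
      rw [he] at this
      exact this.1
    have h1 : ∀ᶠ x' in 𝓝 x, (e x' ^ k).im = 0 := by
      filter_upwards [hxA, hxB] with x' h1 h2
      exact Complex.conj_eq_iff_im.1 (h2.symm.trans h1)
    have h2 : map (fun x' => e x' ^ k) (𝓝 x) = 𝓝 (e x ^ k) := by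
      have : (fun x' => e x' ^ k) = (fun z : ℂ => z ^ k) ∘ e := rfl
      rw [this, ← Filter.map_map, e.map_nhds_eq hx]
      exact (pow_hasStrictDerivAt (e x)).map_nhds_eq
        (mul_ne_zero (by exact_mod_cast hk.ne') (pow_ne_zero _ hx0))
    have h3 : ∀ᶠ ζ in 𝓝 (e x ^ k), ζ.im = 0 := by
      rw [← h2]
      exact h1
    have h4 : Tendsto (fun t : ℝ => e x ^ k + t * Complex.I) (𝓝 0) (𝓝 (e x ^ k)) := by
      have : Continuous fun t : ℝ => e x ^ k + t * Complex.I := by fun_prop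
      simpa using this.tendsto 0
    obtain ⟨t, ht, ht0⟩ := (((h4.eventually h3).filter_mono nhdsWithin_le_nhds).and
      (self_mem_nhdsWithin (a := (0 : ℝ)) (s := Ioi (0 : ℝ)))).exists
    have h5 := h3.self_of_nhds
    simp only [Complex.add_im, h5, Complex.mul_im, Complex.ofReal_re, Complex.I_im, mul_one,
      Complex.ofReal_im, zero_mul, add_zero, zero_add] at ht
    exact (ne_of_gt ht0) ht
  rcases (isPreconnected_iff_subset_of_disjoint.1 (isPreconnected_source hk hc e he)) A B hA hB
    (fun x hx => h x hx) hdis with hsub | hsub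
  · exact exists_root_of_sq_eq hk hc e he hQ fun x hx => (hsub hx).self_of_nhds
  · have ht : (e.transHomeomorph Complex.conjCLE.toHomeomorph).target =
        {ζ | ζ ≠ 0 ∧ ‖ζ‖ ^ k < c} := by
      have : (e.transHomeomorph Complex.conjCLE.toHomeomorph).target =
        Complex.conjCLE.toHomeomorph.symm ⁻¹' e.target := rfl
      rw [this, he]
      ext ζ
      change (starRingEnd ℂ) ζ ≠ 0 ∧ ‖(starRingEnd ℂ) ζ‖ ^ k < c ↔ _
      simp
    obtain ⟨n, hn, hkn, ψ, h1, h2, h3⟩ := exists_root_of_sq_eq hk hc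
      (e.transHomeomorph Complex.conjCLE.toHomeomorph) ht hQ fun x hx => by
        change Q x ^ 2 = (starRingEnd ℂ) (e x) ^ k
        rw [← map_pow]
        exact (hsub hx).self_of_nhds
    exact ⟨n, hn, hkn, ψ, h1, by rw [h2, ht, he], h3⟩


/-! ### The normal form of the section near the orbit -/

section NormalForm

variable {M : Type*} [MetricSpace M] [CompactSpace M]
  {S : Type*} [TopologicalSpace S] [ChartedSpace (EuclideanHalfSpace 2) S]
  [CompactSpace S] [T2Space S]
  {φ : Flow ℝ M} {ι : S → M}

/-- A flat coordinate `Q` on a neighbourhood of the ends over `γ` in the section, whose quadrants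
are cut out by the local invariant manifolds, and in which the first return map is linear. -/
structure SectionCoord (D : AlmostAnosovData φ ι) (γ : Set M)
    (τ : OpenPartialHomeomorph M (ℝ × ℝ × UnitAddCircle)) where
  η : ℝ
  η_pos : 0 < η
  Q : intr S → ℂ
  n : componentsOver ι γ → ℕ
  n_pos : ∀ C, 0 < n C
  ψ : componentsOver ι γ → OpenPartialHomeomorph (intr S) ℂ
  target_eq : ∀ C, (ψ C).target = {ζ | ζ ≠ 0 ∧ ‖ζ‖ ^ n C < η}
  disjoint : ∀ C C' u, u ∈ (ψ C).source → u ∈ (ψ C').source → C = C'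
  pow_eq : ∀ C, ∀ u ∈ (ψ C).source, ψ C u ^ n C = Q u
  sign_re : ∀ C, ∀ u ∈ (ψ C).source, SignType.sign (Q u).re = SignType.sign (τ (ι u)).1
  sign_im : ∀ C, ∀ u ∈ (ψ C).source, SignType.sign (Q u).im = SignType.sign (τ (ι u)).2.1
  map_eq : ∀ C C', ∀ u ∈ (ψ C).source, D.P u ∈ (ψ C').source →
    Q (D.P u) = ⟨D.pA.lam * (Q u).re, D.pA.lam⁻¹ * (Q u).im⟩
  map_mem : ∃ r > 0, r ≤ η ∧ ∀ C, ∀ u ∈ (ψ C).source, ‖Q u‖ < r →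
    (∃ C', D.P u ∈ (ψ C').source) ∧ ∃ C', D.P.symm u ∈ (ψ C').source
  near : ∀ r > 0, ∃ δ, 0 < δ ∧ δ < 1 ∧ ∀ u : intr S, ι u ∈ saddleBox τ δ →
    ∃ C, u ∈ (ψ C).source ∧ ‖Q u‖ < r
  image : ∀ O : Set M, IsOpen O → γ ⊆ O → ∃ r > 0, ∀ C, ∀ u ∈ (ψ C).source, ‖Q u‖ < r → ι u ∈ O
  shrink : ∀ C : componentsOver ι γ, ∀ O : Set S, IsOpen O → (C : Set S) ⊆ O →
    ∃ r > 0, ∀ u ∈ (ψ C).source, ‖Q u‖ < r → (u : S) ∈ O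
  nearC : ∀ C : componentsOver ι γ, ∀ r > 0, ∃ O : Set S, IsOpen O ∧ (C : Set S) ⊆ O ∧
    ∀ u : intr S, (u : S) ∈ O → u ∈ (ψ C).source ∧ ‖Q u‖ < r
  affine : ∀ C, ∀ u ∈ (ψ C).source, ∀ f ∈ D.pA.charts, u ∈ f.source →
    LocallyAffine 1 f (fun u' => ((Q u').re, (Q u').im)) u

variable {γ : Set M} {τ : OpenPartialHomeomorph M (ℝ × ℝ × UnitAddCircle)}

/-- The flat coordinate at an end, with the signs of the saddle coordinates. -/
noncomputable def EndChart.signedCoord {A : Set (OpenPartialHomeomorph (intr S) (ℝ × ℝ))} {C : Set S}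
    (E : EndChart A C) (ι : S → M) (τ : OpenPartialHomeomorph M (ℝ × ℝ × UnitAddCircle))
    (u : intr S) : ℂ :=
  ⟨(SignType.sign (τ (ι u)).1 : ℝ) * E.X u, (SignType.sign (τ (ι u)).2.1 : ℝ) * E.Y u⟩

theorem sign_sign_mul {a b : ℝ} (hb : 0 ≤ b) (h : b = 0 ↔ a = 0) :
    SignType.sign ((SignType.sign a : ℝ) * b) = SignType.sign a := by
  rcases lt_trichotomy a 0 with ha | rfl | ha
  · have : 0 < b := lt_of_le_of_ne hb fun h' => ha.ne (h.1 h'.symm)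
    rw [sign_neg ha, SignType.coe_neg_one, neg_one_mul]
    exact sign_neg (neg_neg_of_pos this)
  · simp
  · have : 0 < b := lt_of_le_of_ne hb fun h' => ha.ne' (h.1 h'.symm)
    rw [sign_pos ha, SignType.coe_one, one_mul]
    exact sign_pos this

theorem EndChart.norm_sq_signedCoord {A : Set (OpenPartialHomeomorph (intr S) (ℝ × ℝ))} {C : Set S}
    (E : EndChart A C) {u : intr S} (hx : E.X u = 0 ↔ (τ (ι u)).1 = 0)
    (hy : E.Y u = 0 ↔ (τ (ι u)).2.1 = 0) : ‖E.signedCoord ι τ u‖ ^ 2 = ‖E.e u‖ ^ E.k := by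
  have key : ∀ a b : ℝ, (b = 0 ↔ a = 0) → ((SignType.sign a : ℝ) * b) * ((SignType.sign a : ℝ) * b)
      = b ^ 2 := by
    intro a b h
    rcases lt_trichotomy a 0 with ha | rfl | ha
    · simp [sign_neg ha]; ring
    · simp [h.2 rfl]
    · simp [sign_pos ha]; ring
  rw [Complex.sq_norm, Complex.normSq_apply, ← E.X_sq_add_Y_sq, signedCoord]
  simp only
  rw [key _ _ hx, key _ _ hy]

theorem AlmostAnosovData.nonempty_sectionCoord (D : AlmostAnosovData φ ι)
    (hι : IsBirkhoffSection φ ι)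
    (hns : ∀ x, ∃ t, φ t x ≠ x) (hγ : γ ∈ boundaryOrbits φ ι) (hτ : IsSaddleChart φ γ τ) :
    Nonempty (SectionCoord D γ τ) := by
  have hfin := hι.finite_componentsOver hγ hτ D.pA
  have hE : ∀ C : componentsOver ι γ, Nonempty (EndChart D.pA.charts (C : Set S)) := fun C =>
    hι.nonempty_endChart hγ hτ D.pA C.2
  let E : ∀ C : componentsOver ι γ, EndChart D.pA.charts (C : Set S) := fun C => (hE C).some
  obtain ⟨δc, hδc, hcross⟩ := D.exists_crossing hι hγ hτ
  obtain ⟨δf, hδf, -, hfwd⟩ := D.exists_box_forward hι hγ hτ τ.open_source hτ.orbit_subset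
  have hρ : ∀ᶠ η in 𝓝[>] (0 : ℝ), ∀ C, η ^ 2 < (E C).ρ ^ (E C).k := by
    rw [eventually_all]
    intro C
    have : ∀ᶠ η : ℝ in 𝓝 0, η ^ 2 < (E C).ρ ^ (E C).k := by
      refine ContinuousAt.eventually_lt (by fun_prop) continuousAt_const ?_
      simpa using pow_pos (E C).ρ_pos _
    exact this.filter_mono nhdsWithin_le_nhds
  obtain ⟨η, ⟨⟨⟨⟨hdis, hsc⟩, hzero⟩, himg⟩, hρ⟩, hη⟩ :=
    ((((eventually_disk_disjoint E hι hγ hτ D.pA).and (D.eventually_scaling E hι hγ hτ)).and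
    (D.eventually_Y_eq_zero_iff E hι hns hγ hτ)).and (eventually_disk_image E hι hγ
    (isOpen_saddleBox (τ := τ) (min δc δf)) (hτ.subset_saddleBox (lt_min hδc hδf)))).and hρ
    |>.and self_mem_nhdsWithin |>.exists
  have hη : 0 < η := hη
  have hη2 : 0 < η ^ 2 := by positivity
  let e : ∀ C, OpenPartialHomeomorph (intr S) ℂ := fun C =>
    (E C).e.restrOpen ((E C).disk η) ((E C).isOpen_disk η)
  have hes : ∀ C, (e C).source = (E C).disk η := fun C =>
    inter_eq_right.2 fun u hu => hu.1
  have het : ∀ C, (e C).target = {ζ | ζ ≠ 0 ∧ ‖ζ‖ ^ (E C).k < η ^ 2} := by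
    intro C
    rw [← (e C).image_source_eq_target, hes]
    ext ζ
    constructor
    · rintro ⟨u, hu, rfl⟩
      exact ⟨(E C).ne_zero hu.1, hu.2⟩
    · rintro ⟨h1, h2⟩
      have h3 : ζ ∈ (E C).e.target := by
        rw [(E C).target_eq]
        exact ⟨h1, lt_of_pow_lt_pow_left₀ (E C).k (E C).ρ_pos.le (h2.trans (hρ C))⟩
      refine ⟨(E C).e.symm ζ, ⟨(E C).e.map_target h3, ?_⟩, (E C).e.right_inv h3⟩
      rw [(E C).e.right_inv h3]
      exact h2
  have hsrc : ∀ C, ∀ u ∈ (E C).disk η, ι u ∈ τ.source := fun C u hu => (himg C u hu).1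
  have hτc : ∀ C, ∀ u ∈ (E C).disk η, ContinuousAt (fun u' : intr S => τ (ι u')) u := fun C u hu =>
    ContinuousAt.comp (g := τ) (τ.continuousAt (hsrc C u hu))
      (hι.continuous.comp continuous_subtype_val).continuousAt
  -- the local form of the signed coordinate
  have hloc : ∀ C, ∀ u ∈ (E C).disk η, ∀ f ∈ D.pA.charts, u ∈ f.source →
      ∃ g : OpenPartialHomeomorph (intr S) ℂ, u ∈ g.source ∧
        (∀ᶠ u' in 𝓝 u, g u' ^ 2 = (E C).e u' ^ (E C).k) ∧
        LocallyAffine 1 f (fun u' => ((g u').re, (g u').im)) u ∧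
        ∃ ε δ : ℝ, (ε = 1 ∨ ε = -1) ∧ (δ = 1 ∨ δ = -1) ∧ ∀ᶠ u' in 𝓝 u,
          (E C).signedCoord ι τ u' = ⟨ε * (g u').re, δ * (g u').im⟩ := by
    intro C u hu f hf huf
    obtain ⟨w, -, hw2, hl⟩ := (E C).coord u hu.1 f hf huf
    obtain ⟨g, hug, hgw⟩ := exists_openPartialHomeomorph_of_locallyAffine f huf hl
    have hgw' : ∀ᶠ u' in 𝓝 u, g u' = w u' := by
      filter_upwards [g.open_source.mem_nhds hug] with u' hu' using hgw u' hu'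
    have hg2 : ∀ᶠ u' in 𝓝 u, g u' ^ 2 = (E C).e u' ^ (E C).k := by
      filter_upwards [hgw', hw2] with u' h1 h2
      rw [h1, h2]
    obtain ⟨O, hO, hOo, huO⟩ := eventually_nhds_iff.1
      (hg2.and (((E C).isOpen_disk η).mem_nhds hu))
    let g' := g.restrOpen O hOo
    have hx : ∃ ε : ℝ, (ε = 1 ∨ ε = -1) ∧ ∀ᶠ x' : intr S in 𝓝 u,
        (SignType.sign (τ (ι x')).1 : ℝ) * |Complex.reCLM (g' x')| = ε * Complex.reCLM (g' x') := by
      refine eventually_sign_mul_abs g' Complex.reCLM (a := fun u' : intr S => (τ (ι u')).1)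
        ?_ ?_ ⟨hug, huO⟩ ?_
      · intro x hx
        exact (continuous_fst.continuousAt.comp (hτc C x (hO x hx.2).2)).continuousWithinAt
      · intro x hx
        rw [← (hzero C x (hO x hx.2).2).2, (E C).X_eq (hO x hx.2).1, abs_eq_zero]
        rfl
      · intro h0
        exact (hcross u (saddleBox_mono (min_le_left _ _) (himg C u hu))).1 h0
    have hy : ∃ ε : ℝ, (ε = 1 ∨ ε = -1) ∧ ∀ᶠ x' : intr S in 𝓝 u,
        (SignType.sign (τ (ι x')).2.1 : ℝ) * |Complex.imCLM (g' x')| = ε * Complex.imCLM (g' x') := by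
      refine eventually_sign_mul_abs g' Complex.imCLM (a := fun u' : intr S => (τ (ι u')).2.1)
        ?_ ?_ ⟨hug, huO⟩ ?_
      · intro x hx
        have : Continuous fun v : ℝ × ℝ × UnitAddCircle => v.2.1 := by fun_prop
        exact (this.continuousAt.comp (hτc C x (hO x hx.2).2)).continuousWithinAt
      · intro x hx
        rw [← (hzero C x (hO x hx.2).2).1, (E C).Y_eq (hO x hx.2).1, abs_eq_zero]
        rfl
      · intro h0
        exact (hcross u (saddleBox_mono (min_le_left _ _) (himg C u hu))).2 h0
    obtain ⟨ε, hε, hx⟩ := hx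
    obtain ⟨δ, hδ, hy⟩ := hy
    refine ⟨g, hug, hg2, ?_, ε, δ, hε, hδ, ?_⟩
    · obtain ⟨a, b, c, d, ha, hb, h⟩ := hl
      refine ⟨a, b, c, d, ha, hb, ?_⟩
      filter_upwards [h, hgw'] with u' h1 h2
      rw [h1, h2]
    · filter_upwards [hx, hy, hg2] with u' h1 h2 h3
      rw [EndChart.signedCoord, (E C).X_eq h3, (E C).Y_eq h3]
      exact Complex.ext h1 h2
  have hcont : ∀ C, ContinuousOn ((E C).signedCoord ι τ) (e C).source := by
    intro C u hu
    rw [hes] at hu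
    obtain ⟨f, hf, huf⟩ := D.pA.cover u
    obtain ⟨g, hug, -, -, ε, δ, -, -, h⟩ := hloc C u hu f hf huf
    refine ContinuousAt.continuousWithinAt (ContinuousAt.congr ?_ (EventuallyEq.symm h))
    have : Continuous fun ζ : ℂ => (⟨ε * ζ.re, δ * ζ.im⟩ : ℂ) := by
      simp only [Complex.mk_eq_add_mul_I]
      fun_prop
    exact this.continuousAt.comp (g.continuousAt hug)
  have hroot : ∀ C, ∃ n : ℕ, 0 < n ∧ (E C).k = 2 * n ∧ ∃ ψ : OpenPartialHomeomorph (intr S) ℂ,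
      ψ.source = (e C).source ∧ ψ.target = (e C).target ∧
      ∀ u ∈ (e C).source, ψ u ^ n = (E C).signedCoord ι τ u := by
    intro C
    refine exists_root (E C).k_pos hη2 (e C) (het C) (hcont C) fun u hu => ?_
    rw [hes] at hu
    obtain ⟨f, hf, huf⟩ := D.pA.cover u
    obtain ⟨g, hug, hg2, -, ε, δ, hε, hδ, h⟩ := hloc C u hu f hf huf
    have key : (∀ z : ℂ, (⟨ε * z.re, δ * z.im⟩ : ℂ) ^ 2 = z ^ 2) ∨
        ∀ z : ℂ, (⟨ε * z.re, δ * z.im⟩ : ℂ) ^ 2 = (starRingEnd ℂ) (z ^ 2) := by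
      rcases hε with rfl | rfl <;> rcases hδ with rfl | rfl
      · left; intro z; simp
      · right; intro z
        rw [map_pow]; congr 1; exact Complex.ext (by simp) (by simp)
      · right; intro z
        rw [map_pow, ← neg_sq ((starRingEnd ℂ) z)]; congr 1; exact Complex.ext (by simp) (by simp)
      · left; intro z
        rw [← neg_sq z]; congr 1; exact Complex.ext (by simp) (by simp)
    rcases key with hk | hk
    · left
      filter_upwards [h, hg2] with u' h1 h2
      change (E C).signedCoord ι τ u' ^ 2 = (E C).e u' ^ (E C).k
      rw [h1, hk, h2]
    · right
      filter_upwards [h, hg2] with u' h1 h2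
      change (E C).signedCoord ι τ u' ^ 2 = (starRingEnd ℂ) ((E C).e u' ^ (E C).k)
      rw [h1, hk, h2]
  choose n hn hkn ψ hψs hψt hψ using hroot
  have hψd : ∀ C, (ψ C).source = (E C).disk η := fun C => (hψs C).trans (hes C)
  classical
  let Q : intr S → ℂ := fun u =>
    if h : ∃ C, u ∈ (ψ C).source then (E h.choose).signedCoord ι τ u else 0
  have hdis' : ∀ C C' u, u ∈ (ψ C).source → u ∈ (ψ C').source → C = C' := by
    intro C C' u h1 h2
    rw [hψd] at h1 h2
    exact hdis C C' u h1 h2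
  have hQ : ∀ C, ∀ u ∈ (ψ C).source, Q u = (E C).signedCoord ι τ u := by
    intro C u hu
    have h : ∃ C, u ∈ (ψ C).source := ⟨C, hu⟩
    simp only [Q, dif_pos h]
    rw [hdis' _ _ u h.choose_spec hu]
  have hQn : ∀ C, ∀ u ∈ (ψ C).source, ‖Q u‖ ^ 2 = ‖(E C).e u‖ ^ (E C).k := by
    intro C u hu
    have hz := hzero C u (hψd C ▸ hu)
    rw [hQ C u hu, (E C).norm_sq_signedCoord hz.2 hz.1]
  have hdiskQ : ∀ C, ∀ u ∈ (ψ C).source, ∀ r, ‖Q u‖ < r → u ∈ (E C).disk r := by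
    intro C u hu r hr
    refine ⟨(hψd C ▸ hu : u ∈ (E C).disk η).1, ?_⟩
    rw [← hQn C u hu]
    exact pow_lt_pow_left₀ hr (norm_nonneg _) two_ne_zero
  have hQdisk : ∀ C, ∀ r, 0 < r → r ≤ η → ∀ u ∈ (E C).disk r, u ∈ (ψ C).source ∧ ‖Q u‖ < r := by
    intro C r hr hrη u hu
    have h1 : u ∈ (ψ C).source := by
      rw [hψd]
      exact (E C).disk_mono hr.le hrη hu
    refine ⟨h1, lt_of_pow_lt_pow_left₀ 2 hr.le ?_⟩
    rw [hQn C u h1]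
    exact hu.2
  refine ⟨⟨η, hη, Q, n, hn, ψ, ?_, hdis', ?_, ?_, ?_, ?_, ?_, ?_, ?_, ?_, ?_, ?_⟩⟩
  · intro C
    rw [hψt, het, hkn]
    ext ζ
    simp only [mem_ofPred_eq, mul_comm 2 (n C), pow_mul]
    rw [pow_lt_pow_iff_left₀ (by positivity) hη.le two_ne_zero]
  · intro C u hu
    rw [hψ C u (hψs C ▸ hu), hQ C u hu]
  · intro C u hu
    rw [hQ C u hu]
    exact sign_sign_mul ((E C).X_nonneg u) (hzero C u (hψd C ▸ hu)).2
  · intro C u hu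
    rw [hQ C u hu]
    exact sign_sign_mul ((E C).Y_nonneg u) (hzero C u (hψd C ▸ hu)).1
  · intro C C' u hu hu'
    rw [hQ C u hu, hQ C' _ hu']
    have h1 := hsc C C' u (hψd C ▸ hu) (hψd C' ▸ hu')
    obtain ⟨a, ha, b, hb, h2, h3⟩ := (hfwd u (saddleBox_mono (min_le_right _ _)
      (himg C u (hψd C ▸ hu))) 1 ⟨zero_le_one, le_rfl⟩).2
    rw [D.pt_one] at h2 h3
    simp only [EndChart.signedCoord, h1.1, h1.2, h2, h3, sign_mul, sign_pos ha, sign_pos hb,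
      one_mul]
    exact Complex.ext (by simp only; ring) (by simp only; ring)
  · obtain ⟨r, hr, hr0⟩ := ((D.eventually_map_disk E hι hγ hτ hη).and self_mem_nhdsWithin).exists
    have hr0 : 0 < r := hr0
    refine ⟨min r η, lt_min hr0 hη, min_le_right _ _, fun C u hu hur => ?_⟩
    obtain ⟨⟨C₁, h1⟩, C₂, h2⟩ := hr C u (hdiskQ C u hu r (hur.trans_le (min_le_left _ _)))
    exact ⟨⟨C₁, by rwa [hψd]⟩, C₂, by rwa [hψd]⟩
  · intro r hr
    obtain ⟨δ, h0, h1, h2⟩ := exists_saddleBox_disk E hι hγ hτ (lt_min hr hη)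
    refine ⟨δ, h0, h1, fun u hu => ?_⟩
    obtain ⟨C, hC⟩ := h2 u hu
    have := hQdisk C _ (lt_min hr hη) (min_le_right _ _) u hC
    exact ⟨C, this.1, this.2.trans_le (min_le_left _ _)⟩
  · intro O hO hγO
    obtain ⟨r, hr, hr0⟩ := ((eventually_disk_image E hι hγ hO hγO).and self_mem_nhdsWithin).exists
    exact ⟨r, hr0, fun C u hu hur => hr C u (hdiskQ C u hu r hur)⟩
  · intro C O hO hCO
    obtain ⟨r, hr, hr0⟩ := (((E C).eventually_disk hO hCO).and self_mem_nhdsWithin).exists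
    exact ⟨r, hr0, fun u hu hur => hr u (hdiskQ C u hu r hur)⟩
  · intro C r hr
    have hr' : 0 < min r η := lt_min hr hη
    obtain ⟨b, hb, hbk⟩ := exists_pow_eq_of_pos (E C).k_pos (c := (min r η) ^ 2) (by positivity)
    obtain ⟨O, hO, hCO, -, h⟩ := (E C).near b hb
    refine ⟨O, hO, hCO, fun u hu => ?_⟩
    have h1 : u ∈ (E C).disk (min r η) := ⟨(h u hu).1, by
      rw [← hbk]
      exact pow_lt_pow_left₀ (h u hu).2 (norm_nonneg _) (E C).k_pos.ne'⟩
    have := hQdisk C _ hr' (min_le_right _ _) u h1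
    exact ⟨this.1, this.2.trans_le (min_le_left _ _)⟩
  · intro C u hu f hf huf
    obtain ⟨g, hug, -, ⟨a, b, c, d, ha, hb, hl⟩, ε, δ, hε, hδ, h⟩ :=
      hloc C u (hψd C ▸ hu) f hf huf
    refine ⟨a * ε, b * δ, c, d, ?_, ?_, ?_⟩
    · rcases ha with rfl | rfl <;> rcases hε with rfl | rfl <;> simp
    · rcases hb with rfl | rfl <;> rcases hδ with rfl | rfl <;> simp
    · filter_upwards [hl, h, (ψ C).open_source.mem_nhds hu] with u' h1 h2 h3
      rw [h1, hQ C u' h3, h2]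
      have h4 : ε * ε = 1 := by rcases hε with rfl | rfl <;> norm_num
      have h5 : δ * δ = 1 := by rcases hδ with rfl | rfl <;> norm_num
      ext
      · simp only
        linear_combination (-a * (g u').re) * h4
      · simp only
        linear_combination (-b * 1⁻¹ * (g u').im) * h5

end NormalForm


/-! ### The linking number -/

theorem exists_toCircle_eq {ζ : ℂ} (h : ζ ≠ 0) :
    ∃ s : UnitAddCircle, ζ = ‖ζ‖ * ((AddCircle.toCircle s : Circle) : ℂ) := by
  obtain ⟨s, hs⟩ := (AddCircle.homeomorphCircle (T := (1 : ℝ)) one_ne_zero).surjective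
    ⟨ζ / ‖ζ‖, mem_sphere_zero_iff_norm.2 (by
      rw [norm_div, Complex.norm_real, norm_norm, div_self (norm_ne_zero_iff.2 h)])⟩
  have hs' : ((AddCircle.toCircle s : Circle) : ℂ) = ζ / ‖ζ‖ := by
    have := congrArg (fun z : Circle => (z : ℂ)) hs
    simpa [AddCircle.homeomorphCircle_apply] using this
  refine ⟨s, ?_⟩
  rw [hs', mul_div_cancel₀]
  exact_mod_cast norm_ne_zero_iff.2 h

theorem norm_mul_toCircle_turn {ζ : ℂ} (h : ζ ≠ 0) :
    ‖ζ‖ * ((AddCircle.toCircle (turn ζ) : Circle) : ℂ) = ζ := by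
  obtain ⟨s, hs⟩ := exists_toCircle_eq h
  have : turn ζ = s := by
    rw [hs, turn_ofReal_mul (norm_pos_iff.2 h), turn_toCircle]
  rw [this, ← hs]

/-- A loop that is a core of an annulus in each of two coordinate systems has degree `± 1`. -/
theorem isUnit_degree_of_annulus {Y : Type*} [TopologicalSpace Y] {r : ℝ}
    {g : ℂ → Y} (hg : ContinuousOn g {ζ | ζ ≠ 0 ∧ ‖ζ‖ < r}) {κ : Y → UnitAddCircle}
    (hκ : ContinuousOn κ (g '' {ζ | ζ ≠ 0 ∧ ‖ζ‖ < r})) {ψ : UnitAddCircle → ℂ} (hψ : Continuous ψ)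
    (hψr : ∀ s, ψ s ≠ 0 ∧ ‖ψ s‖ < r) (h : ∀ s, κ (g (ψ s)) = s) {d : ℤ}
    (hd : HasDegree (fun s => turn (ψ s)) d) : d = 1 ∨ d = -1 := by
  let G : ℝ × UnitAddCircle → UnitAddCircle := fun v =>
    κ (g (v.1 * ((AddCircle.toCircle v.2 : Circle) : ℂ)))
  have hmem : ∀ v ∈ Ioo 0 r ×ˢ (univ : Set UnitAddCircle),
      (v.1 : ℂ) * ((AddCircle.toCircle v.2 : Circle) : ℂ) ∈ {ζ : ℂ | ζ ≠ 0 ∧ ‖ζ‖ < r} := by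
    rintro v ⟨h1, -⟩
    refine ⟨mul_ne_zero (by exact_mod_cast h1.1.ne') (toCircle_ne_zero _), ?_⟩
    rw [norm_mul, Circle.norm_coe, mul_one, Complex.norm_real, Real.norm_eq_abs, abs_of_pos h1.1]
    exact h1.2
  have hc : Continuous fun v : ℝ × UnitAddCircle =>
      (v.1 : ℂ) * ((AddCircle.toCircle v.2 : Circle) : ℂ) := by
    have := continuous_toCircle_coe
    fun_prop
  have hG : ContinuousOn G (Ioo 0 r ×ˢ univ) :=
    hκ.comp (hg.comp hc.continuousOn hmem) fun v hv => ⟨_, hmem v hv, rfl⟩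
  have hnorm : ∀ s, ‖ψ s‖ ∈ Ioo 0 r := fun s => ⟨norm_pos_iff.2 (hψr s).1, (hψr s).2⟩
  have hGa : Continuous fun s => G (‖ψ 0‖, s) :=
    hG.comp_continuous (by fun_prop) fun s => ⟨hnorm 0, mem_univ _⟩
  obtain ⟨e, he⟩ := exists_hasDegree_of_continuous hGa
  have h1 := HasDegree.of_loop (convex_Ioo 0 r) hG (hnorm 0) he (ρ := fun s => ‖ψ s‖)
    (by fun_prop) hnorm hd
  have h2 : (fun s => G (‖ψ s‖, turn (ψ s))) = fun s => s := by
    funext s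
    simp only [G]
    rw [norm_mul_toCircle_turn (hψr s).1, h]
  rw [h2] at h1
  exact Int.eq_one_or_neg_one_of_mul_eq_one' (h1.unique hasDegree_id) |>.imp And.right And.right

section Linking

variable {M : Type*} [MetricSpace M] [CompactSpace M]
  {S : Type*} [TopologicalSpace S] [ChartedSpace (EuclideanHalfSpace 2) S]
  [CompactSpace S] [T2Space S]
  {φ : Flow ℝ M} {ι : S → M} {γ : Set M} {τ : OpenPartialHomeomorph M (ℝ × ℝ × UnitAddCircle)}

theorem SectionCoord.ne_zero {D : AlmostAnosovData φ ι} (N : SectionCoord D γ τ)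
    {C : componentsOver ι γ} {u : intr S} (hu : u ∈ (N.ψ C).source) : N.ψ C u ≠ 0 := by
  have := (N.ψ C).map_source hu
  rw [N.target_eq] at this
  exact this.1

theorem SectionCoord.Q_ne_zero {D : AlmostAnosovData φ ι} (N : SectionCoord D γ τ)
    {C : componentsOver ι γ} {u : intr S} (hu : u ∈ (N.ψ C).source) : N.Q u ≠ 0 := by
  rw [← N.pow_eq C u hu]
  exact pow_ne_zero _ (N.ne_zero hu)

theorem SectionCoord.continuousOn {D : AlmostAnosovData φ ι} (N : SectionCoord D γ τ)
    (C : componentsOver ι γ) : ContinuousOn N.Q (N.ψ C).source :=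
  ((N.ψ C).continuousOn.pow (N.n C)).congr fun u hu => (N.pow_eq C u hu).symm

theorem modelLoop_mem (hτ : IsSaddleChart φ γ τ) (n : ℕ) (m : ℤ) (s : UnitAddCircle) :
    ((((AddCircle.toCircle s : Circle) : ℂ) ^ n).re / 2,
    (((AddCircle.toCircle s : Circle) : ℂ) ^ n).im / 2, m • s) ∈ τ.target := by
  rw [hτ.mem_target]
  have h : ‖((AddCircle.toCircle s : Circle) : ℂ) ^ n‖ = 1 := by rw [norm_pow, Circle.norm_coe, one_pow]
  have h1 := Complex.abs_re_le_norm (((AddCircle.toCircle s : Circle) : ℂ) ^ n)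
  have h2 := Complex.abs_im_le_norm (((AddCircle.toCircle s : Circle) : ℂ) ^ n)
  rw [h] at h1 h2
  constructor
  · rw [abs_div, abs_two]
    linarith
  · rw [abs_div, abs_two]
    linarith

theorem coord_ne_zero (hτ : IsSaddleChart φ γ τ) {q : M} (hq : q ∈ τ.source \ γ) :
    (⟨(τ q).1, (τ q).2.1⟩ : ℂ) ≠ 0 := fun h =>
  hq.2 ((hτ.mem_orbit_iff q hq.1).2 ⟨congrArg Complex.re h, congrArg Complex.im h⟩)

theorem continuousOn_turn_coord (hτ : IsSaddleChart φ γ τ) :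
    ContinuousOn (fun q => turn ⟨(τ q).1, (τ q).2.1⟩) (τ.source \ γ) := by
  intro q hq
  have h1 : ContinuousAt (fun q => (⟨(τ q).1, (τ q).2.1⟩ : ℂ)) q := by
    have h2 := τ.continuousAt hq.1
    have h3 : Continuous fun v : ℝ × ℝ × UnitAddCircle => (⟨v.1, v.2.1⟩ : ℂ) := by
      simp only [Complex.mk_eq_add_mul_I]
      fun_prop
    exact h3.continuousAt.comp h2
  exact (ContinuousAt.comp (g := turn) (f := fun q => (⟨(τ q).1, (τ q).2.1⟩ : ℂ))
    (continuousAt_turn (coord_ne_zero hτ hq)) h1).continuousWithinAt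

/-- The loops in the section parallel to a boundary component. -/
theorem SectionCoord.exists_collar_loop {D : AlmostAnosovData φ ι} (N : SectionCoord D γ τ)
    (hι : IsBirkhoffSection φ ι) (hγ : γ ∈ boundaryOrbits φ ι) (hτ : IsSaddleChart φ γ τ)
    {n : ℕ} {m : ℤ} (h : HasLinkingMultiplicity ι γ τ n m) :
    ∃ C, N.n C = n ∧ ∀ δ, 0 < δ → ∃ u : UnitAddCircle → intr S, Continuous u ∧
      (∀ s, ι (u s) ∈ saddleBox τ δ ∧ u s ∈ (N.ψ C).source) ∧
      ∀ G : M → UnitAddCircle, ContinuousOn G (τ.source \ γ) → ∀ d,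
        HasDegree (fun s => G (modelLoop τ n m s)) d → HasDegree (fun s => G (ι (u s))) d := by
  obtain ⟨hn, C, hC, c, hc, hcC, r, hr, hrτ, F, hF, hFτ, hF0, hF1⟩ := h
  have hci : ∀ q : Ico (0 : ℝ) 1 × UnitAddCircle, 0 < (q.1 : ℝ) → c q ∈ intr S := fun q hq =>
    (mem_intr_or_mem_bdry _).resolve_right (BirkhoffNormalForm.IsOpenEmbedding.collar_notMem_bdry hc hq)
  have hcγ : ∀ q : Ico (0 : ℝ) 1 × UnitAddCircle, 0 < (q.1 : ℝ) → ι (c q) ∉ γ := fun q hq hmem =>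
    hι.interior_compl _ (hci q hq) (hι.orbit_subset_image hγ hmem)
  -- small loops of the collar
  have hsmall : ∀ O : Set S, IsOpen O → C ⊆ O → ∃ r₀ > 0, r₀ ≤ (r : ℝ) ∧
      ∀ q : Ico (0 : ℝ) 1 × UnitAddCircle, (q.1 : ℝ) < r₀ → c q ∈ O := by
    intro O hO hCO
    have h0 : ∀ᶠ a : Ico (0 : ℝ) 1 in 𝓝 ⟨0, by simp⟩, ∀ s ∈ (univ : Set UnitAddCircle),
        c (a, s) ∈ O := by
      refine isCompact_univ.eventually_forall_of_forall_eventually fun s _ => ?_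
      refine hc.continuous.continuousAt.eventually (hO.mem_nhds (hCO ?_))
      rw [← hcC]
      exact ⟨_, rfl, rfl⟩
    obtain ⟨ε, hε, hball⟩ := Metric.eventually_nhds_iff.1 h0
    refine ⟨min ε r, lt_min hε hr, min_le_right _ _, fun q hq => ?_⟩
    refine hball (y := q.1) ?_ q.2 (mem_univ _)
    rw [Subtype.dist_eq, Real.dist_eq, sub_zero, abs_of_nonneg q.1.2.1]
    exact hq.trans_le (min_le_left _ _)
  -- the loops are homotopic to the model
  have hdeg : ∀ r' : Ico (0 : ℝ) 1, 0 < (r' : ℝ) → r' ≤ r → ∀ G : M → UnitAddCircle,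
      ContinuousOn G (τ.source \ γ) → ∀ d,
        HasDegree (fun s => G (modelLoop τ n m s)) d → HasDegree (fun s => G (ι (c (r', s)))) d := by
    intro r' hr' hrr G hG d hd
    have h1 : HasDegree (fun s => G (ι (c (r, s)))) d := by
      have := HasDegree.of_unitInterval (G := fun v => G (F v)) (a := 1) (b := 0) (d := d)
        (hG.comp_continuous hF hFτ) (by simpa only [hF1] using hd)
      simpa only [hF0] using this
    have hr1 : ∀ a : ℝ, max 0 (min a r) ∈ Ico (0 : ℝ) 1 := fun a =>
      ⟨le_max_left _ _, max_lt one_pos ((min_le_right _ _).trans_lt r.2.2)⟩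
    have h2 := HasDegree.of_convex (convex_Ioc (0 : ℝ) r) (a := r) (b := r') (d := d)
      (G := fun v => G (ι (c (⟨max 0 (min v.1 r), hr1 v.1⟩, v.2)))) ?_ ⟨hr, le_rfl⟩ ⟨hr', hrr⟩ ?_
    · have e1 : ∀ s, c (⟨max 0 (min (r' : ℝ) r), hr1 r'⟩, s) = c (r', s) := fun s => by
        congr
        rw [min_eq_left (by exact_mod_cast hrr), max_eq_right hr'.le]
      simpa only [e1] using h2
    · refine hG.comp (Continuous.continuousOn ?_) ?_
      · refine hι.continuous.comp (hc.continuous.comp (Continuous.prodMk ?_ continuous_snd))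
        exact Continuous.subtype_mk (by fun_prop) _
      · rintro v ⟨hv, -⟩
        have e1 : max 0 (min v.1 (r : ℝ)) = v.1 := by
          rw [min_eq_left hv.2, max_eq_right hv.1.le]
        refine ⟨hrτ _ ?_, hcγ _ ?_⟩
        · rw [← Subtype.coe_le_coe]
          simp only [e1]
          exact hv.2
        · simp only [e1]
          exact hv.1
    · have e1 : ∀ s, c (⟨max 0 (min (r : ℝ) r), hr1 r⟩, s) = c (r, s) := fun s => by
        congr
        rw [min_self, max_eq_right hr.le]
      simpa only [e1] using h1
  refine ⟨⟨C, hC⟩, ?_, fun δ hδ => ?_⟩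
  · -- the degree in the flat coordinate
    have hcO : IsOpen (range c) := hc.isOpen_range
    obtain ⟨ρ₀, hρ₀, hρ₀'⟩ := N.shrink ⟨C, hC⟩ (range c) hcO
      (hcC.symm.subset.trans (image_subset_range _ _))
    have hnp := N.n_pos ⟨C, hC⟩
    set n' := N.n ⟨C, hC⟩ with hn'
    set ψ := N.ψ ⟨C, hC⟩ with hψ
    obtain ⟨ρ, hρ, hρn⟩ := exists_pow_eq_of_pos hnp (lt_min hρ₀ N.η_pos)
    have htgt : {ζ : ℂ | ζ ≠ 0 ∧ ‖ζ‖ < ρ} ⊆ ψ.target := by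
      rintro ζ ⟨h1, h2⟩
      rw [hψ, N.target_eq]
      refine ⟨h1, lt_of_lt_of_le ?_ (min_le_right ρ₀ N.η)⟩
      rw [← hρn]
      exact pow_lt_pow_left₀ h2 (norm_nonneg _) hnp.ne'
    obtain ⟨O₁, hO₁, hCO₁, hO₁'⟩ := N.nearC ⟨C, hC⟩ (min ρ₀ N.η) (lt_min hρ₀ N.η_pos)
    obtain ⟨r₀, hr₀, hr₀r, hr₀O⟩ := hsmall O₁ hO₁ hCO₁
    let r' : Ico (0 : ℝ) 1 := ⟨r₀ / 2, by linarith, by linarith [r.2.2]⟩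
    have hr'0 : 0 < (r' : ℝ) := half_pos hr₀
    have hr'r : r' ≤ r := Subtype.coe_le_coe.1 (show r₀ / 2 ≤ r by linarith)
    let u : UnitAddCircle → intr S := fun s => ⟨c (r', s), hci _ hr'0⟩
    have hu : Continuous u := Continuous.subtype_mk (hc.continuous.comp (by fun_prop)) _
    have huO : ∀ s, u s ∈ ψ.source ∧ ‖N.Q (u s)‖ < min ρ₀ N.η := fun s =>
      hO₁' (u s) (hr₀O _ (show r₀ / 2 < r₀ by linarith))
    have hψc : Continuous fun s => ψ (u s) :=
      ψ.continuousOn.comp_continuous hu fun s => (huO s).1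
    have hψ0 : ∀ s, ψ (u s) ≠ 0 := fun s => N.ne_zero (huO s).1
    have hψρ : ∀ s, ‖ψ (u s)‖ < ρ := fun s => by
      refine lt_of_pow_lt_pow_left₀ n' hρ.le ?_
      rw [hρn, ← norm_pow, N.pow_eq _ _ (huO s).1]
      exact (huO s).2
    obtain ⟨d, hd⟩ := exists_hasDegree_of_continuous (f := fun s => turn (ψ (u s)))
      (continuous_iff_continuousAt.2 fun s =>
        ContinuousAt.comp (g := turn) (continuousAt_turn (hψ0 s)) hψc.continuousAt)
    let c' := hc.toOpenPartialHomeomorph c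
    have hc's : c'.source = univ := rfl
    have hc't : c'.target = range c := hc.toOpenPartialHomeomorph_target c
    have hd1 : d = 1 ∨ d = -1 := by
      refine isUnit_degree_of_annulus (r := ρ) (g := fun ζ => (ψ.symm ζ : S))
        (κ := fun x => (c'.symm x).2) ?_ ?_ hψc (fun s => ⟨hψ0 s, hψρ s⟩) (fun s => ?_) hd
      · exact continuous_subtype_val.comp_continuousOn (ψ.continuousOn_symm.mono htgt)
      · refine continuous_snd.comp_continuousOn (c'.continuousOn_symm.mono ?_)
        rintro _ ⟨ζ, hζ, rfl⟩
        rw [hc't]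
        refine hρ₀' _ (ψ.map_target (htgt hζ)) ?_
        rw [← N.pow_eq _ _ (ψ.map_target (htgt hζ)), ← hψ, ψ.right_inv (htgt hζ), norm_pow]
        refine lt_of_lt_of_le ?_ (min_le_left ρ₀ N.η)
        rw [← hρn]
        exact pow_lt_pow_left₀ hζ.2 (norm_nonneg _) hnp.ne'
      · rw [ψ.left_inv (huO s).1]
        exact congrArg Prod.snd (c'.left_inv (mem_univ (r', s)))
    have hdn : HasDegree (fun s => turn (⟨(τ (ι (u s))).1, (τ (ι (u s))).2.1⟩ : ℂ)) n := by
      refine hdeg r' hr'0 hr'r (fun q => turn ⟨(τ q).1, (τ q).2.1⟩) (continuousOn_turn_coord hτ) n ?_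
      have : (fun s => turn (⟨(τ (modelLoop τ n m s)).1, (τ (modelLoop τ n m s)).2.1⟩ : ℂ)) =
          fun s => (n : ℤ) • s := by
        funext s
        rw [modelLoop, τ.right_inv (modelLoop_mem hτ n m s)]
        have e1 : (⟨(((AddCircle.toCircle s : Circle) : ℂ) ^ n).re / 2,
            (((AddCircle.toCircle s : Circle) : ℂ) ^ n).im / 2⟩ : ℂ) =
            ((1 / 2 : ℝ) : ℂ) * ((AddCircle.toCircle s : Circle) : ℂ) ^ n := by
          refine Complex.ext ?_ ?_
          · rw [Complex.re_ofReal_mul]; ring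
          · rw [Complex.im_ofReal_mul]; ring
        rw [e1, turn_ofReal_mul (by norm_num), turn_pow (toCircle_ne_zero s), turn_toCircle,
          natCast_zsmul]
      rw [this]
      exact hasDegree_zsmul _
    have hus : ∀ s, ι (u s) ∈ τ.source \ γ := fun s =>
      ⟨hrτ _ hr'r, hcγ _ hr'0⟩
    have hQc : Continuous fun s => N.Q (u s) :=
      (N.continuousOn ⟨C, hC⟩).comp_continuous hu fun s => (huO s).1
    have hτu : Continuous fun s => (⟨(τ (ι (u s))).1, (τ (ι (u s))).2.1⟩ : ℂ) := by
      have h1 : Continuous fun s => τ (ι (u s)) :=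
        τ.continuousOn.comp_continuous (hι.continuous.comp (continuous_subtype_val.comp hu))
          fun s => (hus s).1
      have h2 : Continuous fun v : ℝ × ℝ × UnitAddCircle => (⟨v.1, v.2.1⟩ : ℂ) := by
        simp only [Complex.mk_eq_add_mul_I]
        fun_prop
      exact h2.comp h1
    have hdQ : HasDegree (fun s => turn (N.Q (u s))) n := by
      refine HasDegree.turn_congr hτu hQc (fun s => ?_) hdn
      have h1 := N.sign_re _ _ (huO s).1
      have h2 := N.sign_im _ _ (huO s).1
      have h3 := N.Q_ne_zero (huO s).1
      have key : ∀ a b : ℝ, SignType.sign b = SignType.sign a → 0 ≤ a * b ∧ (b ≠ 0 → 0 < a * b) := by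
        intro a b hab
        rcases lt_trichotomy a 0 with ha | rfl | ha
        · rw [sign_neg ha, sign_eq_neg_one_iff] at hab
          exact ⟨(mul_pos_of_neg_of_neg ha hab).le, fun _ => mul_pos_of_neg_of_neg ha hab⟩
        · rw [sign_zero, sign_eq_zero_iff] at hab
          simp [hab]
        · rw [sign_pos ha, sign_eq_one_iff] at hab
          exact ⟨(mul_pos ha hab).le, fun _ => mul_pos ha hab⟩
      have hx := key _ _ h1
      have hy := key _ _ h2
      by_cases h4 : (N.Q (u s)).re = 0
      · have h5 : (N.Q (u s)).im ≠ 0 := fun h5 => h3 (Complex.ext h4 h5)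
        have := hy.2 h5
        simp only
        linarith [hx.1]
      · have := hx.2 h4
        simp only
        linarith [hy.1]
    have hdψ : HasDegree (fun s => turn (N.Q (u s))) (n' * d) := by
      have := hd.nsmul n'
      refine (funext fun s => ?_ : (fun s => n' • turn (ψ (u s))) = fun s => turn (N.Q (u s))) ▸ this
      rw [← turn_pow (hψ0 s), N.pow_eq _ _ (huO s).1]
    have h1 := hdQ.unique hdψ
    rcases hd1 with rfl | rfl
    · rw [mul_one] at h1
      exact_mod_cast h1.symm
    · rw [mul_neg, mul_one] at h1
      omega
  · obtain ⟨O₁, hO₁, hCO₁, hO₁'⟩ := N.nearC ⟨C, hC⟩ 1 one_pos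
    have hO₂ : IsOpen (O₁ ∩ ι ⁻¹' saddleBox τ δ) :=
      hO₁.inter ((isOpen_saddleBox δ).preimage hι.continuous)
    obtain ⟨r₀, hr₀, hr₀r, hr₀O⟩ := hsmall _ hO₂ fun x hx => ⟨hCO₁ hx, hτ.subset_saddleBox hδ (by
      rw [← hι.image_componentsOver hγ hC]; exact ⟨x, hx, rfl⟩)⟩
    let r' : Ico (0 : ℝ) 1 := ⟨r₀ / 2, by linarith, by linarith [r.2.2]⟩
    have hr'0 : 0 < (r' : ℝ) := half_pos hr₀
    have hr'r : r' ≤ r := Subtype.coe_le_coe.1 (show r₀ / 2 ≤ r by linarith)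
    have hlt : (r' : ℝ) < r₀ := show r₀ / 2 < r₀ by linarith
    refine ⟨fun s => ⟨c (r', s), hci _ hr'0⟩,
      Continuous.subtype_mk (hc.continuous.comp (by fun_prop)) _,
      fun s => ⟨(hr₀O (r', s) hlt).2, (hO₁' ⟨c (r', s), hci _ hr'0⟩ (hr₀O (r', s) hlt).1).1⟩,
      hdeg r' hr'0 hr'r⟩

end Linking


/-! ### Branches of the roots over the closed quadrants -/

/-- The closed quadrants as subsets of `ℂ`. -/
def cquad (j : Fin 4) : Set ℂ := {v | (v.re, v.im) ∈ quadrant j}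

theorem isClosed_cquad (j : Fin 4) : IsClosed (cquad j) := by
  fin_cases j
  · exact (isClosed_le continuous_const Complex.continuous_re).inter
      (isClosed_le continuous_const Complex.continuous_im)
  · exact (isClosed_le Complex.continuous_re continuous_const).inter
      (isClosed_le continuous_const Complex.continuous_im)
  · exact (isClosed_le Complex.continuous_re continuous_const).inter
      (isClosed_le Complex.continuous_im continuous_const)
  · exact (isClosed_le continuous_const Complex.continuous_re).inter
      (isClosed_le Complex.continuous_im continuous_const)

theorem exists_mem_cquad (v : ℂ) : ∃ j, v ∈ cquad j := by
  rcases le_total 0 v.re with h1 | h1 <;> rcases le_total 0 v.im with h2 | h2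
  · exact ⟨0, h1, h2⟩
  · exact ⟨3, h1, h2⟩
  · exact ⟨1, h1, h2⟩
  · exact ⟨2, h1, h2⟩

theorem cquad_of_sign {v w : ℂ} {j : Fin 4} (h : v ∈ cquad j)
    (h1 : SignType.sign w.re = SignType.sign v.re)
    (h2 : SignType.sign w.im = SignType.sign v.im) : w ∈ cquad j := by
  have key : ∀ a b : ℝ, SignType.sign a = SignType.sign b → (0 ≤ b → 0 ≤ a) ∧ (b ≤ 0 → a ≤ 0) := by
    intro a b hab
    constructor
    · intro hb
      have : 0 ≤ SignType.sign b := sign_nonneg_iff.2 hb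
      rw [← hab] at this
      exact sign_nonneg_iff.1 this
    · intro hb
      have : SignType.sign b ≤ 0 := sign_nonpos_iff.2 hb
      rw [← hab] at this
      exact sign_nonpos_iff.1 this
  fin_cases j
  · exact ⟨(key _ _ h1).1 h.1, (key _ _ h2).1 h.2⟩
  · exact ⟨(key _ _ h1).2 h.1, (key _ _ h2).1 h.2⟩
  · exact ⟨(key _ _ h1).2 h.1, (key _ _ h2).2 h.2⟩
  · exact ⟨(key _ _ h1).1 h.1, (key _ _ h2).2 h.2⟩

theorem rotate_mem {v : ℂ} {j : Fin 4} (h : v ∈ cquad j) :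
    0 ≤ (v * (-Complex.I) ^ (j : ℕ)).re ∧ 0 ≤ (v * (-Complex.I) ^ (j : ℕ)).im := by
  fin_cases j
  · have : 0 ≤ v.re ∧ 0 ≤ v.im := h
    simpa using this
  · have : 0 ≤ v.im ∧ v.re ≤ 0 := ⟨h.2, h.1⟩
    simpa using this
  · have : v.re ≤ 0 ∧ v.im ≤ 0 := h
    simpa using this
  · have h3 : (-Complex.I) ^ 3 = Complex.I := by
      rw [pow_succ, neg_sq, Complex.I_sq]; ring
    have : v.im ≤ 0 ∧ 0 ≤ v.re := ⟨h.2, h.1⟩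
    simpa [h3] using this

/-- The branch over the quadrant `j` of the root of order `n`, normalised to be positive on the
positive half-axis and continued counterclockwise. -/
noncomputable def quadRoot (n : ℕ) (j : Fin 4) (v : ℂ) : ℂ :=
  (v * (-Complex.I) ^ (j : ℕ)) ^ ((n : ℂ)⁻¹) *
    Complex.exp (Real.pi / 2 * Complex.I * (j : ℕ) * (n : ℂ)⁻¹)

theorem quadRoot_pow {n : ℕ} (hn : 0 < n) (j : Fin 4) (v : ℂ) : quadRoot n j v ^ n = v := by
  have hn' : (n : ℂ) ≠ 0 := by exact_mod_cast hn.ne'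
  have h1 : Complex.exp (Real.pi / 2 * Complex.I * (j : ℕ) * (n : ℂ)⁻¹) ^ n =
      Complex.I ^ (j : ℕ) := by
    rw [← Complex.exp_nat_mul, show (n : ℂ) * (Real.pi / 2 * Complex.I * (j : ℕ) * (n : ℂ)⁻¹) =
      (j : ℕ) * (Real.pi / 2 * Complex.I) by field_simp, Complex.exp_nat_mul,
      Complex.exp_pi_div_two_mul_I]
  rw [quadRoot, mul_pow, Complex.cpow_nat_inv_pow _ hn.ne', h1, mul_assoc, ← mul_pow]
  simp

theorem quadRoot_ne_zero {n : ℕ} (hn : 0 < n) (j : Fin 4) {v : ℂ} (hv : v ≠ 0) :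
    quadRoot n j v ≠ 0 := fun h => hv (by rw [← quadRoot_pow hn j v, h, zero_pow hn.ne'])

theorem continuousOn_quadRoot (n : ℕ) (j : Fin 4) :
    ContinuousOn (quadRoot n j) (cquad j \ {0}) := by
  intro v hv
  refine ContinuousAt.continuousWithinAt ?_
  refine ContinuousAt.mul (ContinuousAt.cpow (by fun_prop) continuousAt_const ?_) continuousAt_const
  rw [Complex.mem_slitPlane_iff]
  obtain ⟨h1, h2⟩ := rotate_mem hv.1
  rcases h1.eq_or_lt with h3 | h3
  · refine Or.inr fun h4 => hv.2 ?_
    have h5 : v * (-Complex.I) ^ (j : ℕ) = 0 := Complex.ext h3.symm h4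
    rcases mul_eq_zero.1 h5 with h | h
    · exact h
    · exact absurd h (pow_ne_zero _ (neg_ne_zero.2 Complex.I_ne_zero))
  · exact Or.inl h3

theorem cpow_ofReal_mul_I {r : ℝ} (hr : 0 < r) (c : ℂ) :
    (r * Complex.I) ^ c = (r : ℂ) ^ c * Complex.exp (Real.pi / 2 * Complex.I * c) := by
  have hr' : (r : ℂ) ≠ 0 := by exact_mod_cast hr.ne'
  rw [Complex.cpow_def_of_ne_zero (mul_ne_zero hr' Complex.I_ne_zero),
    Complex.cpow_def_of_ne_zero hr', Complex.log_ofReal_mul hr Complex.I_ne_zero, Complex.log_I,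
    Complex.ofReal_log hr.le, add_mul, Complex.exp_add]

theorem exists_halfAxis {v : ℂ} (hv : v ≠ 0) {j : Fin 4} (h : v ∈ cquad j)
    (h' : v ∈ cquad (j + 1)) : ∃ r : ℝ, 0 < r ∧ v * (-Complex.I) ^ (j : ℕ) = r * Complex.I := by
  obtain ⟨h1, h2⟩ := rotate_mem h
  have h3 : (v * (-Complex.I) ^ (j : ℕ)).re = 0 := by
    refine le_antisymm ?_ h1
    have h4 := (rotate_mem h').2
    have h5 : (-Complex.I) ^ ((j + 1 : Fin 4) : ℕ) = (-Complex.I) ^ (j : ℕ) * (-Complex.I) := by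
      fin_cases j
      · simp
      · simp [pow_succ]
      · simp [pow_succ]
      · change (-Complex.I) ^ 0 = (-Complex.I) ^ 3 * (-Complex.I)
        have h4 : (-Complex.I) ^ 4 = 1 := by
          rw [neg_pow, Complex.I_pow_four]
          norm_num
        rw [← pow_succ, pow_zero]
        exact h4.symm
    rw [h5, ← mul_assoc] at h4
    simpa using h4
  refine ⟨(v * (-Complex.I) ^ (j : ℕ)).im, lt_of_le_of_ne h2 fun h4 => ?_, ?_⟩
  · have h5 : v * (-Complex.I) ^ (j : ℕ) = 0 := Complex.ext h3 h4.symm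
    rcases mul_eq_zero.1 h5 with h | h
    · exact hv h
    · exact absurd h (pow_ne_zero _ (neg_ne_zero.2 Complex.I_ne_zero))
  · exact Complex.ext (by simp [h3]) (by simp)

theorem quadRoot_succ (n : ℕ) {j : Fin 4} (hj : j ≠ 3) {v : ℂ} (hv : v ≠ 0)
    (h : v ∈ cquad j) (h' : v ∈ cquad (j + 1)) : quadRoot n (j + 1) v = quadRoot n j v := by
  obtain ⟨r, hr, hvr⟩ := exists_halfAxis hv h h'
  have h1 : ((j + 1 : Fin 4) : ℕ) = j + 1 := by
    fin_cases j <;> simp at hj ⊢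
  rw [quadRoot, quadRoot, h1, pow_succ, ← mul_assoc, hvr, cpow_ofReal_mul_I hr,
    show (r : ℂ) * Complex.I * -Complex.I = r by
      rw [mul_neg, mul_assoc, Complex.I_mul_I]; ring, mul_assoc ((r : ℂ) ^ (n : ℂ)⁻¹),
    ← Complex.exp_add]
  congr 2
  push_cast
  ring

theorem quadRoot_last (n : ℕ) {v : ℂ} (hv : v ≠ 0) (h : v ∈ cquad 3) (h' : v ∈ cquad 0) :
    quadRoot n 3 v = Complex.exp (2 * Real.pi * Complex.I * (n : ℂ)⁻¹) * quadRoot n 0 v := by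
  obtain ⟨r, hr, hvr⟩ := exists_halfAxis hv h h'
  have h3 : (-Complex.I) ^ 3 = Complex.I := by
    rw [pow_succ, neg_sq, Complex.I_sq]; ring
  have h1 : v = r := by
    have : v * (-Complex.I) ^ 3 = r * Complex.I := hvr
    rw [h3] at this
    exact mul_right_cancel₀ Complex.I_ne_zero this
  have e3 : ((3 : Fin 4) : ℕ) = 3 := rfl
  have e0 : ((0 : Fin 4) : ℕ) = 0 := rfl
  rw [quadRoot, quadRoot, e3, e0, h3, h1, cpow_ofReal_mul_I hr, pow_zero, mul_one, mul_assoc,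
    ← Complex.exp_add]
  simp only [Nat.cast_zero, mul_zero, zero_mul, Complex.exp_zero, mul_one, Nat.cast_ofNat]
  rw [mul_comm]
  congr 2
  ring

/-- The linear map that the first return map becomes. -/
noncomputable def linMap (l : ℝ) (v : ℂ) : ℂ := ⟨l * v.re, l⁻¹ * v.im⟩

theorem linMap_mem {l : ℝ} (hl : 0 < l) {v : ℂ} {j : Fin 4} : linMap l v ∈ cquad j ↔ v ∈ cquad j := by
  have key : ∀ l : ℝ, 0 < l → ∀ a : ℝ, SignType.sign (l * a) = SignType.sign a := fun l hl a => by
    rw [sign_mul, sign_pos hl, one_mul]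
  constructor
  · exact fun h => cquad_of_sign h (key l hl v.re).symm (key l⁻¹ (inv_pos.2 hl) v.im).symm
  · exact fun h => cquad_of_sign h (key l hl v.re) (key l⁻¹ (inv_pos.2 hl) v.im)

theorem linMap_ne_zero {l : ℝ} (hl : 0 < l) {v : ℂ} (hv : v ≠ 0) : linMap l v ≠ 0 := fun h =>
  hv (Complex.ext ((mul_eq_zero.1 (congrArg Complex.re h)).resolve_left hl.ne')
    ((mul_eq_zero.1 (congrArg Complex.im h)).resolve_left (inv_pos.2 hl).ne'))

theorem linMap_mul {l l' : ℝ} (v : ℂ) : linMap l (linMap l' v) = linMap (l * l') v :=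
  Complex.ext (by simp [linMap, mul_assoc]) (by simp [linMap]; ring)

theorem isPreconnected_cquad (j : Fin 4) (r : ℝ) :
    IsPreconnected {v : ℂ | v ∈ cquad j ∧ v ≠ 0 ∧ ‖v‖ < r} := by
  have : {v : ℂ | v ∈ cquad j ∧ v ≠ 0 ∧ ‖v‖ < r} = (fun t : ℝ × ℝ => (t.1 : ℂ) *
      (Complex.exp (t.2 * Complex.I) * Complex.I ^ (j : ℕ))) '' (Ioo 0 r ×ˢ Icc 0 (Real.pi / 2)) := by
    have hI : ∀ j : ℕ, (-Complex.I) ^ j * Complex.I ^ j = 1 := fun j => by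
      rw [← mul_pow]; simp
    ext v
    constructor
    · rintro ⟨h1, h2, h3⟩
      obtain ⟨h4, h5⟩ := rotate_mem h1
      have hn : ‖v * (-Complex.I) ^ (j : ℕ)‖ = ‖v‖ := by simp
      refine ⟨(‖v‖, Complex.arg (v * (-Complex.I) ^ (j : ℕ))), ⟨⟨norm_pos_iff.2 h2, h3⟩, ?_⟩, ?_⟩
      · exact ⟨Complex.arg_nonneg_iff.2 h5, Complex.arg_le_pi_div_two_iff.2 (Or.inl h4)⟩
      · simp only
        have := Complex.norm_mul_exp_arg_mul_I (v * (-Complex.I) ^ (j : ℕ))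
        rw [hn] at this
        rw [← mul_assoc, this, mul_assoc, hI, mul_one]
    · rintro ⟨⟨a, θ⟩, ⟨h1, h2⟩, rfl⟩
      simp only at h1 h2
      have hc : 0 ≤ Real.cos θ := Real.cos_nonneg_of_neg_pi_div_two_le_of_le (by linarith [h2.1, Real.pi_pos]) h2.2
      have hs : 0 ≤ Real.sin θ := Real.sin_nonneg_of_nonneg_of_le_pi h2.1 (by linarith [h2.2, Real.pi_pos])
      have e : Complex.exp (θ * Complex.I) = ⟨Real.cos θ, Real.sin θ⟩ :=
        Complex.ext (Complex.exp_ofReal_mul_I_re θ) (Complex.exp_ofReal_mul_I_im θ)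
      refine ⟨?_, ?_, ?_⟩
      · simp only [e]
        have hc' := mul_nonneg h1.1.le hc
        have hs' := mul_nonneg h1.1.le hs
        fin_cases j
        · simp [cquad, quadrant]; exact ⟨hc', hs'⟩
        · simp [cquad, quadrant]; exact ⟨hs', hc'⟩
        · simp [cquad, quadrant]; exact ⟨hc', hs'⟩
        · have h3 : Complex.I ^ 3 = -Complex.I := Complex.I_pow_three
          simp [cquad, quadrant, h3]; exact ⟨hs', hc'⟩
      · exact mul_ne_zero (by exact_mod_cast h1.1.ne') (mul_ne_zero (Complex.exp_ne_zero _)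
          (pow_ne_zero _ Complex.I_ne_zero))
      · rw [norm_mul, norm_mul, Complex.norm_exp_ofReal_mul_I, norm_pow, Complex.norm_I, one_pow,
          mul_one, mul_one, Complex.norm_real, Real.norm_eq_abs, abs_of_pos h1.1]
        exact h1.2
  rw [this]
  exact (isPreconnected_Ioo.prod isPreconnected_Icc).image _ (by fun_prop)


/-! ### The sheets of the section -/

theorem IsBirkhoffSection.exists_open_isolating {M : Type*} [MetricSpace M]
    {S : Type*} [TopologicalSpace S] [ChartedSpace (EuclideanHalfSpace 2) S] [CompactSpace S] [T2Space S]
    {φ : Flow ℝ M} {ι : S → M} {γ : Set M} {P : intr S ≃ₜ intr S}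
    (hι : IsBirkhoffSection φ ι) (hγ : γ ∈ boundaryOrbits φ ι) (pA : PseudoAnosovAtlas P) :
    ∃ O : Set M, IsOpen O ∧ γ ⊆ O ∧ O ∩ ι '' bdry S ⊆ γ := by
  let N : componentsOver ι γ → Set S := fun C => (exists_isolating pA C.2).choose
  have hN : ∀ C, IsOpen (N C) ∧ (C : Set S) ⊆ N C ∧ N C ∩ bdry S = C := fun C =>
    (exists_isolating pA C.2).choose_spec
  have hcl : IsClosed (bdry S \ ⋃ C, N C) := isClosed_bdry.sdiff (isOpen_iUnion fun C => (hN C).1)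
  refine ⟨(ι '' (bdry S \ ⋃ C, N C))ᶜ, (hcl.isCompact.image hι.continuous).isClosed.isOpen_compl,
    ?_, ?_⟩
  · rintro q hq ⟨x, hx, rfl⟩
    have hx' : x ∈ ι ⁻¹' γ := hq
    rw [hι.preimage_orbit hγ] at hx'
    obtain ⟨C, hC, hxC⟩ := hx'
    exact hx.2 (mem_iUnion.2 ⟨⟨C, hC⟩, (hN ⟨C, hC⟩).2.1 hxC⟩)
  · rintro _ ⟨hq, x, hx, rfl⟩
    by_contra hcon
    refine hq ⟨x, ⟨hx, fun hxN => hcon ?_⟩, rfl⟩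
    obtain ⟨C, hC⟩ := mem_iUnion.1 hxN
    have h1 : x ∈ (C : Set S) := (hN C).2.2 ▸ ⟨hC, hx⟩
    rw [← hι.image_componentsOver hγ C.2]
    exact ⟨x, h1, rfl⟩

namespace SectionCoord

variable {M : Type*} [MetricSpace M] [CompactSpace M]
  {S : Type*} [TopologicalSpace S] [ChartedSpace (EuclideanHalfSpace 2) S]
  [CompactSpace S] [T2Space S]
  {φ : Flow ℝ M} {ι : S → M} {γ : Set M} {τ : OpenPartialHomeomorph M (ℝ × ℝ × UnitAddCircle)}
  {D : AlmostAnosovData φ ι} (N : SectionCoord D γ τ)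

instance (C : componentsOver ι γ) : NeZero (N.n C) := ⟨(N.n_pos C).ne'⟩

/-- The domain of the flat coordinate. -/
def dom : Set (intr S) := {u | ∃ C, u ∈ (N.ψ C).source}

theorem isOpen_dom : IsOpen N.dom := by
  have : N.dom = ⋃ C, (N.ψ C).source := by
    ext u
    simp [dom]
  rw [this]
  exact isOpen_iUnion fun C => (N.ψ C).open_source

theorem continuousOn_dom : ContinuousOn N.Q N.dom := by
  rintro u ⟨C, hC⟩
  exact ((N.continuousOn C).continuousAt ((N.ψ C).open_source.mem_nhds hC)).continuousWithinAt

theorem ne_zero_of_mem_dom {u : intr S} (hu : u ∈ N.dom) : N.Q u ≠ 0 := by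
  obtain ⟨C, hC⟩ := hu
  exact N.Q_ne_zero hC

theorem norm_lt {u : intr S} (hu : u ∈ N.dom) : ‖N.Q u‖ < N.η := by
  obtain ⟨C, hC⟩ := hu
  have := (N.ψ C).map_source hC
  rw [N.target_eq] at this
  rw [← N.pow_eq C u hC, norm_pow]
  exact this.2

/-- The sheets over a quadrant. -/
abbrev Sheet := Σ C : componentsOver ι γ, ZMod (N.n C)

/-- The inverse of the flat coordinate on a sheet over a quadrant. -/
noncomputable def sec (j : Fin 4) (f : N.Sheet) (v : ℂ) : intr S :=
  (N.ψ f.1).symm ((ZMod.toCircle f.2 : Circle) * quadRoot (N.n f.1) j v)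

variable {N}

theorem sec_aux {j : Fin 4} {f : N.Sheet} {v : ℂ} (hv : v ≠ 0) (hη : ‖v‖ < N.η) :
    ((ZMod.toCircle f.2 : Circle) : ℂ) * quadRoot (N.n f.1) j v ∈ (N.ψ f.1).target := by
  rw [N.target_eq]
  refine ⟨mul_ne_zero (Circle.coe_ne_zero _) (quadRoot_ne_zero (N.n_pos _) j hv), ?_⟩
  rw [norm_mul, Circle.norm_coe, one_mul, ← norm_pow, quadRoot_pow (N.n_pos _)]
  exact hη

theorem sec_mem_source {j : Fin 4} {f : N.Sheet} {v : ℂ} (hv : v ≠ 0) (hη : ‖v‖ < N.η) :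
    N.sec j f v ∈ (N.ψ f.1).source := (N.ψ f.1).map_target (sec_aux hv hη)

theorem sec_mem {j : Fin 4} {f : N.Sheet} {v : ℂ} (hv : v ≠ 0) (hη : ‖v‖ < N.η) :
    N.sec j f v ∈ N.dom := ⟨_, sec_mem_source hv hη⟩

theorem Q_sec {j : Fin 4} {f : N.Sheet} {v : ℂ} (hv : v ≠ 0) (hη : ‖v‖ < N.η) :
    N.Q (N.sec j f v) = v := by
  rw [← N.pow_eq _ _ (sec_mem_source hv hη), sec, (N.ψ f.1).right_inv (sec_aux hv hη), mul_pow,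
    quadRoot_pow (N.n_pos _)]
  have : ((ZMod.toCircle f.2 : Circle) : ℂ) ^ N.n f.1 = 1 := by
    have h : (ZMod.toCircle f.2) ^ N.n f.1 = 1 := by
      rw [← AddChar.map_nsmul_eq_pow]
      simp
    have := congrArg (fun z : Circle => (z : ℂ)) h
    simpa using this
  rw [this, one_mul]

theorem exists_sec_eq {u : intr S} (hu : u ∈ N.dom) (j : Fin 4) : ∃ f, u = N.sec j f (N.Q u) := by
  obtain ⟨C, hC⟩ := hu
  have hQ := N.Q_ne_zero hC
  have hr := quadRoot_ne_zero (N.n_pos C) j hQ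
  have h1 : (N.ψ C u / quadRoot (N.n C) j (N.Q u)) ^ N.n C = 1 := by
    rw [div_pow, N.pow_eq C u hC, quadRoot_pow (N.n_pos C), div_self hQ]
  have h2 : N.ψ C u / quadRoot (N.n C) j (N.Q u) ≠ 0 := div_ne_zero (N.ne_zero hC) hr
  have h3 : Units.mk0 _ h2 ∈ rootsOfUnity (N.n C) ℂ := by
    rw [mem_rootsOfUnity']
    exact h1
  obtain ⟨i, -, hi⟩ := (Complex.mem_rootsOfUnity _ _).1 h3
  have hi' : N.ψ C u / quadRoot (N.n C) j (N.Q u) = ((ZMod.toCircle ((i : ℤ) : ZMod (N.n C)) : Circle) : ℂ) := by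
    rw [ZMod.toCircle_intCast]
    rw [Units.val_mk0] at hi
    rw [← hi]
    congr 1
    push_cast
    ring
  refine ⟨⟨C, ((i : ℤ) : ZMod (N.n C))⟩, ?_⟩
  rw [sec, ← hi', div_mul_cancel₀ _ hr, (N.ψ C).left_inv hC]

theorem sec_injective {j j' : Fin 4} {f g : N.Sheet} {v : ℂ} (hv : v ≠ 0) (hη : ‖v‖ < N.η)
    (hj : ∀ n, quadRoot n j v = quadRoot n j' v)
    (h : N.sec j f v = N.sec j' g v) : f = g := by
  obtain ⟨C, z⟩ := f
  obtain ⟨C', z'⟩ := g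
  have h1 := sec_mem_source (j := j) (f := ⟨C, z⟩) hv hη
  have h2 := sec_mem_source (j := j') (f := ⟨C', z'⟩) hv hη
  rw [← h] at h2
  obtain rfl := N.disjoint C C' _ h1 h2
  have h3 := (N.ψ C).symm.injOn (sec_aux (j := j) (f := ⟨C, z⟩) hv hη)
    (sec_aux (j := j') (f := ⟨C, z'⟩) hv hη) h
  simp only [hj] at h3
  have h4 := mul_right_cancel₀ (quadRoot_ne_zero (N.n_pos C) j' hv) h3
  rw [ZMod.injective_toCircle (Subtype.ext h4)]

theorem continuousOn_sec (j : Fin 4) (f : N.Sheet) :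
    ContinuousOn (N.sec j f) {v | v ∈ cquad j ∧ v ≠ 0 ∧ ‖v‖ < N.η} := by
  refine (N.ψ f.1).continuousOn_symm.comp (continuousOn_const.mul ?_) fun v hv =>
    sec_aux hv.2.1 hv.2.2
  exact (continuousOn_quadRoot _ j).mono fun v hv => ⟨hv.1, hv.2.1⟩

theorem sec_succ {j : Fin 4} (hj : j ≠ 3) (f : N.Sheet) {v : ℂ} (hv : v ≠ 0) (h : v ∈ cquad j)
    (h' : v ∈ cquad (j + 1)) : N.sec (j + 1) f v = N.sec j f v := by
  rw [sec, sec, quadRoot_succ _ hj hv h h']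

/-- The deck transformation of a turn around the orbit. -/
def rot (f : N.Sheet) : N.Sheet := ⟨f.1, f.2 + 1⟩

theorem sec_last (f : N.Sheet) {v : ℂ} (hv : v ≠ 0) (h : v ∈ cquad 3) (h' : v ∈ cquad 0) :
    N.sec 0 (rot f) v = N.sec 3 f v := by
  rw [sec, sec, quadRoot_last _ hv h h', ← mul_assoc]
  have : ((ZMod.toCircle (rot f).2 : Circle) : ℂ) =
      (ZMod.toCircle f.2 : Circle) * Complex.exp (2 * Real.pi * Complex.I * (N.n f.1 : ℂ)⁻¹) := by
    change ((ZMod.toCircle (f.2 + 1 : ZMod (N.n f.1)) : Circle) : ℂ) = _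
    rw [AddChar.map_add_eq_mul, Circle.coe_mul]
    congr 1
    have := ZMod.toCircle_intCast (N := N.n f.1) 1
    rw [Int.cast_one] at this
    rw [this]
    congr 1
    push_cast
    ring
  rw [this]
  rfl

theorem rot_iterate (f : N.Sheet) (m : ℕ) : rot^[m] f = ⟨f.1, f.2 + m⟩ := by
  induction m with
  | zero => simp
  | succ m ih =>
    rw [Function.iterate_succ_apply', ih, rot]
    push_cast
    rw [add_assoc]

theorem rot_iterate_eq_iff (f : N.Sheet) (m : ℕ) : rot^[m] f = f ↔ N.n f.1 ∣ m := by
  rw [rot_iterate, ← ZMod.natCast_eq_zero_iff]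
  constructor
  · intro h
    have := congrArg (fun g : N.Sheet => (g.1, HEq g.2 g.2)) h
    obtain ⟨C, z⟩ := f
    simpa using h
  · intro h
    rw [h, add_zero]

variable [Finite (componentsOver ι γ)]

instance : Finite N.Sheet := by
  have : ∀ C, Finite (ZMod (N.n C)) := fun C => inferInstance
  infer_instance

/-- A continuous map into the part of the section over a quadrant stays on one sheet. -/
theorem exists_sheet_of_preconnected {X : Type*} [TopologicalSpace X] {A : Set X}
    (hA : IsPreconnected A) (hne : A.Nonempty) {g : X → intr S} (hg : ContinuousOn g A) {j : Fin 4}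
    (h : ∀ x ∈ A, g x ∈ N.dom ∧ N.Q (g x) ∈ cquad j) :
    ∃ f, ∀ x ∈ A, g x = N.sec j f (N.Q (g x)) := by
  have hQ : Continuous fun x : A => N.Q (g x) :=
    (N.continuousOn_dom.comp hg fun x hx => (h x hx).1).domRestrict
  have hgA : Continuous fun x : A => g x := hg.domRestrict
  have hcl : ∀ f, IsClosed {x : A | g x = N.sec j f (N.Q (g x))} := fun f => by
    refine isClosed_eq hgA ?_
    refine (continuousOn_sec j f).comp_continuous hQ fun x => ?_
    exact ⟨(h x x.2).2, N.ne_zero_of_mem_dom (h x x.2).1, N.norm_lt (h x x.2).1⟩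
  obtain ⟨x₀, hx₀⟩ := hne
  obtain ⟨f, hf⟩ := exists_sec_eq (h x₀ hx₀).1 j
  have : PreconnectedSpace A := isPreconnected_iff_preconnectedSpace.1 hA
  have hco : {x : A | g x = N.sec j f (N.Q (g x))}ᶜ =
      ⋃ f' : {f' // f' ≠ f}, {x : A | g x = N.sec j f' (N.Q (g x))} := by
    ext x
    have hx := h x x.2
    simp only [mem_compl_iff, mem_ofPred_eq, mem_iUnion]
    constructor
    · intro hne
      obtain ⟨f', hf'⟩ := exists_sec_eq hx.1 j
      exact ⟨⟨f', fun h => hne (h ▸ hf')⟩, hf'⟩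
    · rintro ⟨⟨f', hne⟩, hf'⟩ hcon
      exact hne (sec_injective (N.ne_zero_of_mem_dom hx.1) (N.norm_lt hx.1) (fun _ => rfl)
        (hf'.symm.trans hcon))
  have hclopen : IsClopen {x : A | g x = N.sec j f (N.Q (g x))} := by
    refine ⟨hcl f, ?_⟩
    rw [← isClosed_compl_iff, hco]
    exact isClosed_iUnion_of_finite fun f' => hcl f'
  have huniv := hclopen.eq_univ ⟨⟨x₀, hx₀⟩, hf⟩
  exact ⟨f, fun x hx => (huniv ▸ mem_univ _ : (⟨x, hx⟩ : A) ∈ {x : A | g x = N.sec j f (N.Q (g x))})⟩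

/-- Sheets are locally constant. -/
theorem eventually_sec_eq {u : intr S} (hu : u ∈ N.dom) {j : Fin 4} (hj : N.Q u ∈ cquad j)
    {f : N.Sheet} (hf : u = N.sec j f (N.Q u)) :
    ∀ᶠ u' in 𝓝 u, u' ∈ N.dom ∧ (N.Q u' ∈ cquad j → u' = N.sec j f (N.Q u')) := by
  have hdom := N.isOpen_dom.mem_nhds hu
  have h1 : ∀ f' : {f' // f' ≠ f}, ∀ᶠ u' in 𝓝[{u' | u' ∈ N.dom ∧ N.Q u' ∈ cquad j}] u,
      u' ≠ N.sec j f' (N.Q u') := by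
    intro f'
    have hc : ContinuousWithinAt (fun u' => N.sec j f' (N.Q u'))
        {u' | u' ∈ N.dom ∧ N.Q u' ∈ cquad j} u := by
      have h2 : ContinuousWithinAt (N.sec j f') {v | v ∈ cquad j ∧ v ≠ 0 ∧ ‖v‖ < N.η} (N.Q u) :=
        continuousOn_sec j f' _ ⟨hj, N.ne_zero_of_mem_dom hu, N.norm_lt hu⟩
      exact h2.comp ((N.continuousOn_dom u hu).mono fun u' hu' => hu'.1) fun u' hu' =>
        ⟨hu'.2, N.ne_zero_of_mem_dom hu'.1, N.norm_lt hu'.1⟩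
    have hne : u ≠ N.sec j f' (N.Q u) := fun h3 =>
      f'.2 (sec_injective (N.ne_zero_of_mem_dom hu) (N.norm_lt hu) (fun _ => rfl)
        (h3.symm.trans hf))
    exact (continuousWithinAt_id.prodMk hc).tendsto.eventually
      ((isOpen_ne_fun continuous_fst continuous_snd).mem_nhds hne)
  have h2 := eventually_nhdsWithin_iff.1 (eventually_all.2 h1)
  filter_upwards [h2, hdom] with u' h3 h4
  refine ⟨h4, fun h5 => ?_⟩
  obtain ⟨f', hf'⟩ := exists_sec_eq h4 j
  by_cases h6 : f' = f
  · exact h6 ▸ hf'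
  · exact absurd hf' (h3 ⟨h4, h5⟩ ⟨f', h6⟩)

theorem exists_mem_overlap (j : Fin 4) {r : ℝ} (hr : 0 < r) :
    ∃ v : ℂ, v ∈ cquad j ∧ v ∈ cquad (j + 1) ∧ v ≠ 0 ∧ ‖v‖ < r := by
  have hnorm : ∀ c : ℂ, ‖c‖ = 1 → ((r / 2 : ℝ) : ℂ) * c ≠ 0 ∧ ‖((r / 2 : ℝ) : ℂ) * c‖ < r := by
    intro c hc
    refine ⟨mul_ne_zero (by exact_mod_cast (half_pos hr).ne') (norm_ne_zero_iff.1 (by simp [hc])), ?_⟩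
    rw [norm_mul, hc, mul_one, Complex.norm_real, Real.norm_eq_abs, abs_of_pos (half_pos hr)]
    linarith
  have hr2 : 0 ≤ r / 2 := (half_pos hr).le
  fin_cases j
  · exact ⟨_, by simpa [cquad, quadrant] using hr2, by simpa [cquad, quadrant] using hr2,
      hnorm Complex.I (by simp)⟩
  · exact ⟨_, by simpa [cquad, quadrant] using hr2, by
      change _ ∈ cquad 2
      simpa [cquad, quadrant] using hr2, hnorm (-1) (by simp)⟩
  · exact ⟨_, by simpa [cquad, quadrant] using hr2, by
      change _ ∈ cquad 3
      simpa [cquad, quadrant] using hr2, hnorm (-Complex.I) (by simp)⟩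
  · exact ⟨_, by simpa [cquad, quadrant] using hr2, by
      change _ ∈ cquad 0
      simpa [cquad, quadrant] using hr2, hnorm 1 (by simp)⟩

/-- The first return map permutes the sheets. -/
theorem exists_perm (N : SectionCoord D γ τ) :
    ∃ π : Equiv.Perm N.Sheet, (∀ f, π (rot f) = rot (π f)) ∧ ∃ r > 0, r ≤ N.η ∧
      ∀ j f, ∀ v ∈ cquad j, v ≠ 0 → ‖v‖ < r → ‖linMap D.pA.lam v‖ < N.η ∧
        D.P (N.sec j f v) = N.sec j (π f) (linMap D.pA.lam v) := by
  obtain ⟨r, hr, hrη, hmap⟩ := N.map_mem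
  have hl := D.pA.lam_pos
  have hdom : ∀ j f v, v ≠ 0 → ‖v‖ < r → D.P (N.sec j f v) ∈ N.dom ∧
      N.Q (D.P (N.sec j f v)) = linMap D.pA.lam v := by
    intro j f v hv hvr
    have h1 := sec_mem_source (j := j) (f := f) hv (hvr.trans_le hrη)
    have h2 := Q_sec (j := j) (f := f) hv (hvr.trans_le hrη)
    obtain ⟨C', hC'⟩ := (hmap _ _ h1 (by rwa [h2])).1
    refine ⟨⟨C', hC'⟩, ?_⟩
    rw [N.map_eq _ _ _ h1 hC', h2]
    rfl
  have hπ : ∀ j f, ∃ g, ∀ v ∈ cquad j, v ≠ 0 → ‖v‖ < r →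
      D.P (N.sec j f v) = N.sec j g (linMap D.pA.lam v) := by
    intro j f
    obtain ⟨v₀, hv₀, -, hv₀'⟩ := exists_mem_overlap j hr
    obtain ⟨g, hg⟩ := exists_sheet_of_preconnected (isPreconnected_cquad j r) ⟨v₀, hv₀, hv₀'⟩
      (g := fun v => D.P (N.sec j f v)) (j := j)
      (D.P.continuous.comp_continuousOn ((continuousOn_sec j f).mono fun v hv =>
        ⟨hv.1, hv.2.1, hv.2.2.trans_le hrη⟩)) fun v hv => by
        have := hdom j f v hv.2.1 hv.2.2
        refine ⟨this.1, ?_⟩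
        rw [this.2, linMap_mem hl]
        exact hv.1
    refine ⟨g, fun v h1 h2 h3 => ?_⟩
    have := hg v ⟨h1, h2, h3⟩
    rwa [(hdom j f v h2 h3).2] at this
  choose π hπ using hπ
  have hlin : N.Sheet → ∀ v : ℂ, v ≠ 0 → ‖v‖ < r → ‖linMap D.pA.lam v‖ < N.η := by
    intro f v hv hvr
    have := hdom 0 f v hv hvr
    rw [← this.2]
    exact N.norm_lt this.1
  have hsucc : ∀ j, j ≠ 3 → ∀ f, π (j + 1) f = π j f := by
    intro j hj f
    obtain ⟨v, h1, h2, h3, h4⟩ := exists_mem_overlap j hr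
    have e1 := hπ j f v h1 h3 h4
    have e2 := hπ (j + 1) f v h2 h3 h4
    rw [sec_succ hj f h3 h1 h2, sec_succ hj _ (linMap_ne_zero hl h3) ((linMap_mem hl).2 h1)
      ((linMap_mem hl).2 h2), e1] at e2
    exact (sec_injective (linMap_ne_zero hl h3) (hlin f v h3 h4) (fun _ => rfl) e2).symm
  have hlast : ∀ f, π 0 (rot f) = rot (π 3 f) := by
    intro f
    obtain ⟨v, h1, h2, h3, h4⟩ := exists_mem_overlap 3 hr
    have h2 : v ∈ cquad 0 := h2
    have e1 := hπ 3 f v h1 h3 h4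
    have e2 := hπ 0 (rot f) v h2 h3 h4
    rw [sec_last f h3 h1 h2, e1, ← sec_last _ (linMap_ne_zero hl h3) ((linMap_mem hl).2 h1)
      ((linMap_mem hl).2 h2)] at e2
    exact (sec_injective (linMap_ne_zero hl h3) (hlin f v h3 h4) (fun _ => rfl) e2).symm
  have hall : ∀ j f, π j f = π 0 f := by
    have h1 := hsucc 0 (by decide)
    have h2 := hsucc 1 (by decide)
    have h3 := hsucc 2 (by decide)
    intro j f
    fin_cases j
    · rfl
    · exact h1 f
    · exact (h2 f).trans (h1 f)
    · exact (h3 f).trans ((h2 f).trans (h1 f))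
  have hinj : Function.Injective (π 0) := by
    intro f g hfg
    obtain ⟨v, h1, -, h3, h4⟩ := exists_mem_overlap 0 hr
    have e1 := hπ 0 f v h1 h3 h4
    rw [hfg, ← hπ 0 g v h1 h3 h4] at e1
    exact sec_injective h3 (h4.trans_le hrη) (fun _ => rfl) (D.P.injective e1)
  refine ⟨Equiv.ofBijective _ (Finite.injective_iff_bijective.1 hinj), fun f => ?_, r, hr, hrη, ?_⟩
  · simp only [Equiv.ofBijective_apply]
    rw [hlast, hall 3]
  · intro j f v h1 h2 h3
    refine ⟨hlin f v h2 h3, ?_⟩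
    rw [Equiv.ofBijective_apply, hπ j f v h1 h2 h3, hall j]

/-- All sheets are on one cycle of the first return map. -/
theorem sameCycle (N : SectionCoord D γ τ) (hι : IsBirkhoffSection φ ι)
    (hγ : γ ∈ boundaryOrbits φ ι) (hτ : IsSaddleChart φ γ τ) {π : Equiv.Perm N.Sheet} {r : ℝ}
    (hr : 0 < r) (hrη : r ≤ N.η) (hπ : ∀ f, ∀ v ∈ cquad 0, v ≠ 0 → ‖v‖ < r →
      ‖linMap D.pA.lam v‖ < N.η ∧ D.P (N.sec 0 f v) = N.sec 0 (π f) (linMap D.pA.lam v))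
    (f g : N.Sheet) : π.SameCycle f g := by
  classical
  obtain ⟨δr, hδr, -, hnear⟩ := N.near r hr
  obtain ⟨δb, hδb, -, hback⟩ := D.exists_box_backward hι hγ hτ (isOpen_saddleBox (τ := τ) δr)
    (hτ.subset_saddleBox hδr)
  obtain ⟨δf, hδf, -, hfwd⟩ := D.exists_box_forward hι hγ hτ τ.open_source hτ.orbit_subset
  obtain ⟨δg, hδg, -, hback'⟩ := D.exists_box_backward hι hγ hτ (isOpen_saddleBox (τ := τ) δf)
    (hτ.subset_saddleBox hδf)
  obtain ⟨Oi, hOi, hγi, hisol⟩ := hι.exists_open_isolating hγ D.pA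
  obtain ⟨δi, hδi, hδi1, hδi'⟩ := hτ.exists_saddleBox_subset hOi hγi
  obtain ⟨δ, hδ, hδ1, hδi'', hδb', hδg'⟩ : ∃ δ, 0 < δ ∧ δ < 1 ∧ δ ≤ δi ∧ δ ≤ δb ∧ δ ≤ δg := by
    refine ⟨min δi (min δb δg), by positivity, ?_, ?_, ?_, ?_⟩
    · exact (min_le_left _ _).trans_lt hδi1
    · exact min_le_left _ _
    · exact (min_le_right _ _).trans (min_le_left _ _)
    · exact (min_le_right _ _).trans (min_le_right _ _)
  -- the open quadrant of a box
  let B : Set M := τ.symm '' (Ioo 0 δ ×ˢ Ioo 0 δ ×ˢ univ)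
  have hBt : Ioo 0 δ ×ˢ Ioo 0 δ ×ˢ (univ : Set UnitAddCircle) ⊆ τ.target := by
    rintro ⟨x, y, z⟩ ⟨hx, hy, -⟩
    simp only at hx hy
    rw [hτ.mem_target]
    simp only [abs_of_pos hx.1, abs_of_pos hy.1]
    exact ⟨hx.2.trans hδ1, hy.2.trans hδ1⟩
  have hB : ∀ q, q ∈ B ↔ q ∈ saddleBox τ δ ∧ 0 < (τ q).1 ∧ 0 < (τ q).2.1 := by
    intro q
    constructor
    · rintro ⟨v, hv, rfl⟩
      rw [saddleBox, mem_ofPred_eq, τ.right_inv (hBt hv)]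
      obtain ⟨⟨h1, h2⟩, ⟨h3, h4⟩, -⟩ := hv
      exact ⟨⟨τ.map_target (hBt ⟨⟨h1, h2⟩, ⟨h3, h4⟩, mem_univ _⟩), by rwa [abs_of_pos h1],
        by rwa [abs_of_pos h3]⟩, h1, h3⟩
    · rintro ⟨⟨h1, h2, h3⟩, h4, h5⟩
      rw [abs_of_pos h4] at h2
      rw [abs_of_pos h5] at h3
      exact ⟨τ q, ⟨⟨h4, h2⟩, ⟨h5, h3⟩, mem_univ _⟩, τ.left_inv h1⟩
  have hBpre : IsPreconnected B :=
    (isPreconnected_Ioo.prod (isPreconnected_Ioo.prod isPreconnected_univ)).image _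
      (τ.continuousOn_symm.mono hBt)
  -- the classes
  let A : Set N.Sheet → Set (intr S) := fun K => {u | u ∈ N.dom ∧ ‖N.Q u‖ < r ∧ 0 < (N.Q u).re ∧
    0 < (N.Q u).im ∧ ∃ f ∈ K, u = N.sec 0 f (N.Q u)}
  have hpos : ∀ v : ℂ, 0 < v.re → 0 < v.im → v ∈ cquad 0 := fun v h1 h2 => ⟨h1.le, h2.le⟩
  have hA : ∀ K, IsOpen (A K) := by
    intro K
    rw [isOpen_iff_mem_nhds]
    rintro u ⟨h1, h2, h3, h4, f, hfK, hf⟩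
    have hc : ContinuousAt N.Q u := (N.continuousOn_dom).continuousAt (N.isOpen_dom.mem_nhds h1)
    filter_upwards [eventually_sec_eq h1 (hpos _ h3 h4) hf,
      hc.norm.eventually (gt_mem_nhds h2),
      (Complex.continuous_re.continuousAt.comp hc).eventually (lt_mem_nhds h3),
      (Complex.continuous_im.continuousAt.comp hc).eventually (lt_mem_nhds h4)] with u' h5 h6 h7 h8
    exact ⟨h5.1, h6, h7, h8, f, hfK, h5.2 (hpos _ h7 h8)⟩
  let O : Set N.Sheet → Set M := fun K =>
    (fun a : intr S × ℝ => D.pt a.1 a.2) '' (A K ×ˢ Ioo (-1 : ℝ) 1)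
  have hO : ∀ K, IsOpen (O K) := fun K => D.isOpenMap_pt hι _ ((hA K).prod isOpen_Ioo)
  have hcov : ∀ q ∈ B, ∃ f, q ∈ O {f} := by
    intro q hq
    obtain ⟨h1, h2, h3⟩ := (hB q).1 hq
    obtain ⟨u, t, ht, rfl⟩ := D.exists_rep (q := q) fun hmem => h2.ne'
        ((hτ.mem_orbit_iff q h1.1).1 (hisol ⟨hδi' (saddleBox_mono hδi'' h1), hmem⟩)).1
    have ht' : t ∈ Icc (0 : ℝ) 1 := ⟨ht.1, ht.2.le⟩
    obtain ⟨C, hC, hur⟩ := hnear u (hback u t ht' (saddleBox_mono hδb' h1))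
    obtain ⟨-, a, ha, b, hb, hx, hy⟩ := hfwd u (hback' u t ht' (saddleBox_mono hδg' h1)) t ht'
    rw [hx] at h2
    rw [hy] at h3
    have h4 : 0 < (N.Q u).re := by
      have := N.sign_re C u hC
      rw [sign_pos ((mul_pos_iff_of_pos_left ha).1 h2)] at this
      exact sign_eq_one_iff.1 this
    have h5 : 0 < (N.Q u).im := by
      have := N.sign_im C u hC
      rw [sign_pos ((mul_pos_iff_of_pos_left hb).1 h3)] at this
      exact sign_eq_one_iff.1 this
    obtain ⟨f, hf⟩ := exists_sec_eq (N := N) ⟨C, hC⟩ 0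
    exact ⟨f, (u, t), ⟨⟨⟨C, hC⟩, hur, h4, h5, f, rfl, hf⟩, by linarith [ht.1], ht.2⟩, rfl⟩
  have hstep : ∀ u f g, u ∈ A {f} → D.P u ∈ A {g} → g = π f := by
    rintro u f g ⟨h1, h2, h3, h4, f', rfl, hf⟩ ⟨h1', h2', h3', h4', g', rfl, hg⟩
    obtain ⟨hlt, e⟩ := hπ f' (N.Q u) (hpos _ h3 h4) (N.ne_zero_of_mem_dom h1) h2
    rw [← hf] at e
    have hne := linMap_ne_zero D.pA.lam_pos (N.ne_zero_of_mem_dom h1)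
    have hQ : N.Q (D.P u) = linMap D.pA.lam (N.Q u) := by
      rw [e, Q_sec hne hlt]
    rw [hQ, e] at hg
    exact (sec_injective hne hlt (fun _ => rfl) hg).symm
  have hsame : ∀ u f g, u ∈ A {f} → u ∈ A {g} → f = g := by
    rintro u f g ⟨h1, h2, h3, h4, f', rfl, hf⟩ ⟨-, -, -, -, g', rfl, hg⟩
    exact sec_injective (N.ne_zero_of_mem_dom h1) (N.norm_lt h1) (fun _ => rfl) (hf.symm.trans hg)
  have hdis : ∀ q f g, q ∈ O {f} → q ∈ O {g} → π.SameCycle f g := by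
    rintro q f g ⟨⟨u, t⟩, ⟨hu, ht⟩, rfl⟩ ⟨⟨u', t'⟩, ⟨hu', ht'⟩, he⟩
    obtain ⟨k, hk1, hk2⟩ := D.pt_eq_pt.1 he
    simp only at ht ht' hu hu' hk1 hk2
    have h1 : (k : ℝ) < 2 := by linarith [ht.1, ht'.2]
    have h2 : (-2 : ℝ) < k := by linarith [ht.2, ht'.1]
    have h3 : k < 2 := by exact_mod_cast h1
    have h4 : -2 < k := by exact_mod_cast h2
    obtain rfl | rfl | rfl : k = -1 ∨ k = 0 ∨ k = 1 := by omega
    · have h5 : D.P u = u' := by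
        rw [hk1, zpow_neg, zpow_one]
        exact D.P.apply_symm_apply u'
      have := hstep u f g hu (h5 ▸ hu')
      exact ⟨1, by rw [this, zpow_one]⟩
    · have h5 : u = u' := hk1
      rw [hsame u f g hu (h5 ▸ hu')]
    · have h5 : u = D.P u' := hk1
      have := hstep u' g f hu' (h5 ▸ hu)
      exact ⟨-1, by rw [this, zpow_neg, zpow_one]; exact π.symm_apply_apply g⟩
  have hne : ∀ f, ∃ q ∈ B, q ∈ O {f} := by
    intro f
    obtain ⟨ρ, hρ, himg⟩ := N.image (saddleBox τ δ) (isOpen_saddleBox δ) (hτ.subset_saddleBox hδ)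
    have hm : 0 < min ρ r := lt_min hρ hr
    let v : ℂ := ((min ρ r / 2 : ℝ) : ℂ) * Complex.exp ((Real.pi / 4 : ℝ) * Complex.I)
    have hvn : ‖v‖ < min ρ r := by
      simp only [v]
      rw [norm_mul, Complex.norm_exp_ofReal_mul_I, mul_one, Complex.norm_real, Real.norm_eq_abs,
        abs_of_pos (half_pos hm)]
      linarith
    have hre : 0 < v.re := by
      simp only [v]
      rw [Complex.re_ofReal_mul, Complex.exp_ofReal_mul_I_re, Real.cos_pi_div_four]
      positivity
    have him : 0 < v.im := by
      simp only [v]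
      rw [Complex.im_ofReal_mul, Complex.exp_ofReal_mul_I_im, Real.sin_pi_div_four]
      positivity
    have hv0 : v ≠ 0 := fun h => by rw [h] at hre; exact lt_irrefl _ hre
    have hvr := hvn.trans_le (min_le_right _ _)
    have hvη := hvr.trans_le hrη
    have hs := sec_mem_source (j := 0) (f := f) hv0 hvη
    have hQ := Q_sec (j := 0) (f := f) hv0 hvη
    refine ⟨ι (N.sec 0 f v), (hB _).2 ⟨himg _ _ hs (by rw [hQ]; exact hvn.trans_le (min_le_left _ _)),
      ?_, ?_⟩, (N.sec 0 f v, 0), ⟨⟨sec_mem hv0 hvη, ?_⟩, by norm_num⟩, D.pt_zero _⟩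
    · have := N.sign_re _ _ hs
      rw [hQ, sign_pos hre] at this
      exact sign_eq_one_iff.1 this.symm
    · have := N.sign_im _ _ hs
      rw [hQ, sign_pos him] at this
      exact sign_eq_one_iff.1 this.symm
    · rw [hQ]
      exact ⟨hvr, hre, him, f, rfl, rfl⟩
  have hOU : ∀ K, O K = ⋃ f ∈ K, O {f} := by
    intro K
    ext q
    simp only [mem_iUnion, exists_prop]
    constructor
    · rintro ⟨a, ⟨⟨h1, h2, h3, h4, f, hf, h5⟩, h6⟩, rfl⟩
      exact ⟨f, hf, a, ⟨⟨h1, h2, h3, h4, f, rfl, h5⟩, h6⟩, rfl⟩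
    · rintro ⟨f, hf, a, ⟨⟨h1, h2, h3, h4, f', rfl, h5⟩, h6⟩, rfl⟩
      exact ⟨a, ⟨⟨h1, h2, h3, h4, f', hf, h5⟩, h6⟩, rfl⟩
  by_contra hcon
  obtain ⟨q₁, hq₁, hq₁'⟩ := hne f
  obtain ⟨q₂, hq₂, hq₂'⟩ := hne g
  obtain ⟨q, hq, hqf, hqg⟩ := hBpre (O {h | π.SameCycle f h}) (O {h | ¬ π.SameCycle f h})
    (hO _) (hO _) (fun q hq => by
      obtain ⟨h, hh⟩ := hcov q hq
      rw [mem_union, hOU {h | π.SameCycle f h}, hOU {h | ¬ π.SameCycle f h}]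
      by_cases hc : π.SameCycle f h
      · exact Or.inl (mem_iUnion₂.2 ⟨h, hc, hh⟩)
      · exact Or.inr (mem_iUnion₂.2 ⟨h, hc, hh⟩))
    ⟨q₁, hq₁, by rw [hOU]; exact mem_iUnion₂.2 ⟨f, Equiv.Perm.SameCycle.refl _ _, hq₁'⟩⟩
    ⟨q₂, hq₂, by rw [hOU]; exact mem_iUnion₂.2 ⟨g, hcon, hq₂'⟩⟩
  rw [hOU] at hqf hqg
  obtain ⟨h₁, hh₁, hq1⟩ := mem_iUnion₂.1 hqf
  obtain ⟨h₂, hh₂, hq2⟩ := mem_iUnion₂.1 hqg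
  exact hh₂ (Equiv.Perm.SameCycle.trans hh₁ (hdis q _ _ hq1 hq2))

end SectionCoord


/-! ### Cyclic labels of the sheets -/

section Labels

variable {M : Type*} [MetricSpace M] [CompactSpace M]
  {S : Type*} [TopologicalSpace S] [ChartedSpace (EuclideanHalfSpace 2) S]
  [CompactSpace S] [T2Space S]
  {φ : Flow ℝ M} {ι : S → M} {γ : Set M} {τ : OpenPartialHomeomorph M (ℝ × ℝ × UnitAddCircle)}
  {D : AlmostAnosovData φ ι}

/-- The sheets over the quadrants, labelled modulo `K` so that the first return map adds `1` to the
label and a turn around the orbit adds `c`. -/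
structure SheetCoord (N : SectionCoord D γ τ) (K : ℕ) (c : ℤ) where
  K_pos : 0 < K
  sec : Fin 4 → ℤ → ℂ → intr S
  r : ℝ
  r_pos : 0 < r
  r_le : r ≤ N.η
  sec_eq_iff : ∀ j k k' v, v ≠ 0 → ‖v‖ < N.η → (sec j k v = sec j k' v ↔ k ≡ k' [ZMOD K])
  sec_mem : ∀ j k v, v ≠ 0 → ‖v‖ < N.η → sec j k v ∈ N.dom
  Q_sec : ∀ j k v, v ≠ 0 → ‖v‖ < N.η → N.Q (sec j k v) = v
  exists_sec : ∀ u ∈ N.dom, ∀ j, ∃ k, u = sec j k (N.Q u)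
  continuousOn_sec : ∀ j k, ContinuousOn (sec j k) {v | v ∈ cquad j ∧ v ≠ 0 ∧ ‖v‖ < N.η}
  eventually_sec : ∀ j k, ∀ u ∈ N.dom, N.Q u ∈ cquad j → u = sec j k (N.Q u) →
    ∀ᶠ u' in 𝓝 u, u' ∈ N.dom ∧ (N.Q u' ∈ cquad j → u' = sec j k (N.Q u'))
  map_sec : ∀ j k, ∀ v ∈ cquad j, v ≠ 0 → ‖v‖ < r → ‖linMap D.pA.lam v‖ < N.η ∧
    D.P (sec j k v) = sec j (k + 1) (linMap D.pA.lam v)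
  sec_succ : ∀ j, j ≠ 3 → ∀ k v, v ≠ 0 → v ∈ cquad j → v ∈ cquad (j + 1) →
    sec (j + 1) k v = sec j k v
  sec_last : ∀ k v, v ≠ 0 → v ∈ cquad 3 → v ∈ cquad 0 → sec 0 (k + c) v = sec 3 k v

namespace SectionCoord

/-- The deck transformation `rot` as a permutation. -/
def rotPerm (N : SectionCoord D γ τ) : Equiv.Perm N.Sheet :=
  Equiv.sigmaCongrRight fun _ => Equiv.addRight 1

theorem exists_sheetCoord (N : SectionCoord D γ τ) (hι : IsBirkhoffSection φ ι)
    (hγ : γ ∈ boundaryOrbits φ ι) (hτ : IsSaddleChart φ γ τ) {n : ℕ} (hn : ∃ C, N.n C = n) :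
    ∃ c : ℤ, Nonempty (SheetCoord N (n * numComponents ι γ) (numComponents ι γ * c)) := by
  have hfin := hι.finite_componentsOver hγ hτ D.pA
  obtain ⟨π, hrot, r, hr, hrη, hπ⟩ := N.exists_perm
  have hcyc : ∀ f g, π.SameCycle f g := fun f g =>
    N.sameCycle hι hγ hτ hr hrη (fun f v h1 h2 h3 => hπ 0 f v h1 h2 h3) f g
  have hcomm : Commute π N.rotPerm := Equiv.ext fun f => hrot f
  have hzp : ∀ (i : ℤ) f, (π ^ i) (rot f) = rot ((π ^ i) f) := fun i f =>
    Equiv.congr_fun (hcomm.zpow_left i).eq f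
  have hzpi : ∀ (i : ℤ) (m : ℕ) f, (π ^ i) (rot^[m] f) = rot^[m] ((π ^ i) f) := by
    intro i m f
    induction m with
    | zero => rfl
    | succ m ih => rw [Function.iterate_succ_apply', hzp, ih, Function.iterate_succ_apply']
  have hdvd : ∀ f g : N.Sheet, N.n g.1 ∣ N.n f.1 := by
    intro f g
    obtain ⟨i, rfl⟩ := hcyc f g
    rw [← rot_iterate_eq_iff, ← hzpi, (rot_iterate_eq_iff f _).2 dvd_rfl]
  have hall : ∀ C, N.n C = n := by
    obtain ⟨C₀, hC₀⟩ := hn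
    intro C
    rw [← hC₀]
    exact Nat.dvd_antisymm (hdvd ⟨C₀, 0⟩ ⟨C, 0⟩) (hdvd ⟨C, 0⟩ ⟨C₀, 0⟩)
  obtain ⟨C₀, hC₀⟩ := hn
  let f₀ : N.Sheet := ⟨C₀, 0⟩
  obtain ⟨c, hc⟩ := hcyc f₀ (rot f₀)
  have hft : Fintype N.Sheet := Fintype.ofFinite _
  have hcard : (Finset.univ : Finset N.Sheet).card = n * numComponents ι γ := by
    have hft' : Fintype (componentsOver ι γ) := Fintype.ofFinite _
    rw [Finset.card_univ, ← Nat.card_eq_fintype_card, Nat.card_sigma]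
    simp only [Nat.card_zmod, hall, Finset.sum_const, smul_eq_mul, Finset.card_univ]
    rw [← Nat.card_eq_fintype_card, Nat.card_coe_set_eq, mul_comm]
    rfl
  have hon : π.IsCycleOn (↑(Finset.univ : Finset N.Sheet)) := by
    rw [Finset.coe_univ]
    exact ⟨⟨fun _ _ => mem_univ _, π.injective.injOn, fun y _ => ⟨π.symm y, mem_univ _, π.apply_symm_apply y⟩⟩, fun x _ y _ => hcyc x y⟩
  have hn0 : 0 < n := by rw [← hall C₀]; exact N.n_pos C₀
  have hpow : ∀ j : ℕ, (π ^ (c * j)) f₀ = rot^[j] f₀ := by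
    intro j
    induction j with
    | zero => simp
    | succ j ih =>
      rw [Nat.cast_succ, mul_add, mul_one, add_comm, zpow_add, Equiv.Perm.mul_apply, ih,
        hzpi, hc, Function.iterate_succ_apply]
  have hdvd' : (n * numComponents ι γ : ℤ) ∣ n * c := by
    have h1 : (π ^ (c * n)) f₀ = (π ^ (0 : ℤ)) f₀ := by
      rw [hpow, zpow_zero, (rot_iterate_eq_iff f₀ _).2 (by rw [hall])]
      rfl
    rw [hon.zpow_apply_eq_zpow_apply (Finset.mem_univ f₀), hcard, Int.modEq_zero_iff_dvd] at h1
    rw [mul_comm (n : ℤ) c]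
    exact_mod_cast h1
  obtain ⟨c', rfl⟩ : (numComponents ι γ : ℤ) ∣ c :=
    Int.dvd_of_mul_dvd_mul_left (by exact_mod_cast hn0.ne') hdvd'
  refine ⟨c', ⟨⟨?_, fun j k v => N.sec j ((π ^ k) f₀) v, r, hr, hrη, ?_, ?_, ?_, ?_, ?_, ?_, ?_, ?_, ?_⟩⟩⟩
  · rw [← hcard]
    exact Finset.card_pos.2 ⟨f₀, Finset.mem_univ _⟩
  · intro j k k' v hv hη
    rw [← hcard, ← hon.zpow_apply_eq_zpow_apply (Finset.mem_univ f₀)]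
    exact ⟨fun h => sec_injective hv hη (fun _ => rfl) h, fun h => by rw [h]⟩
  · exact fun j k v hv hη => sec_mem hv hη
  · exact fun j k v hv hη => Q_sec hv hη
  · intro u hu j
    obtain ⟨f, hf⟩ := exists_sec_eq hu j
    obtain ⟨k, rfl⟩ := hcyc f₀ f
    exact ⟨k, hf⟩
  · exact fun j k => continuousOn_sec j _
  · exact fun j k u hu hj hk => eventually_sec_eq hu hj hk
  · intro j k v h1 h2 h3
    obtain ⟨h4, h5⟩ := hπ j ((π ^ k) f₀) v h1 h2 h3
    refine ⟨h4, h5.trans ?_⟩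
    rw [add_comm, zpow_add, zpow_one]
    rfl
  · exact fun j hj k v hv h h' => N.sec_succ hj _ hv h h'
  · intro k v hv h h'
    rw [← sec_last _ hv h h', zpow_add, Equiv.Perm.mul_apply, hc, hzp]

end SectionCoord

end Labels


/-! ### Radial homeomorphisms -/

section Radial

/-- An increasing homeomorphism of the line that takes `s` to `b₁` and is the identity outside
`[b₀, s₁]`. -/
theorem exists_orderIso_contraction {b₀ b₁ s s₁ : ℝ} (h1 : b₀ < b₁) (h2 : b₁ < s) (h3 : s < s₁) :
    ∃ f : ℝ ≃o ℝ, (∀ t ≤ b₀, f t = t) ∧ f s = b₁ ∧ ∀ t, s₁ ≤ t → f t = t := by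
  obtain ⟨p, hp⟩ : ∃ p, p * (s - b₀) = b₁ - b₀ :=
    ⟨(b₁ - b₀) / (s - b₀), div_mul_cancel₀ _ (by linarith)⟩
  obtain ⟨q, hq⟩ : ∃ q, q * (s₁ - s) = s₁ - b₁ :=
    ⟨(s₁ - b₁) / (s₁ - s), div_mul_cancel₀ _ (by linarith)⟩
  have hp0 : 0 < p := pos_of_mul_pos_left (by rw [hp]; linarith) (by linarith : 0 ≤ s - b₀)
  have hp1 : p < 1 := by
    by_contra! h
    nlinarith [mul_nonneg (sub_nonneg.2 h) (by linarith : (0 : ℝ) ≤ s - b₀)]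
  have hq1 : 1 < q := by
    by_contra! h
    nlinarith [mul_nonneg (sub_nonneg.2 h) (by linarith : (0 : ℝ) ≤ s₁ - s)]
  set g : ℝ → ℝ := fun t => min t (max (b₁ + p * (t - s)) (b₁ + q * (t - s))) with hg
  have hmono : StrictMono g := by
    intro t t' h
    refine min_lt_min h (max_lt_max ?_ ?_)
    · nlinarith
    · nlinarith
  have hcont : Continuous g := by fun_prop
  have hlo : ∀ t ≤ b₀, g t = t := by
    intro t ht
    refine min_eq_left (le_max_of_le_left ?_)
    nlinarith [mul_nonneg (sub_nonneg.2 hp1.le) (sub_nonneg.2 ht)]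
  have hhi : ∀ t, s₁ ≤ t → g t = t := by
    intro t ht
    refine min_eq_left (le_max_of_le_right ?_)
    nlinarith [mul_nonneg (sub_nonneg.2 hq1.le) (sub_nonneg.2 ht)]
  have hsurj : Function.Surjective g := by
    refine hcont.surjective (tendsto_id.congr' ?_) (tendsto_id.congr' ?_)
    · exact (eventually_ge_atTop s₁).mono fun t ht => (hhi t ht).symm
    · exact (eventually_le_atBot b₀).mono fun t ht => (hlo t ht).symm
  refine ⟨hmono.orderIsoOfSurjective g hsurj, hlo, ?_, hhi⟩
  change min s (max (b₁ + p * (s - s)) (b₁ + q * (s - s))) = b₁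
  simp [h2.le]

variable {E : Type*} [NormedAddCommGroup E] [NormedSpace ℝ E]

/-- The radial map whose effect on norms is `f`. -/
noncomputable def radial (f : ℝ ≃o ℝ) (v : E) : E := (f ‖v‖ / ‖v‖) • v

variable {f : ℝ ≃o ℝ} {b : ℝ}

theorem orderIso_symm_eq (hf : ∀ t ≤ b, f t = t) : ∀ t ≤ b, f.symm t = t := fun t ht => by
  rw [OrderIso.symm_apply_eq, hf t ht]

theorem orderIso_pos (hb : 0 < b) (hf : ∀ t ≤ b, f t = t) {t : ℝ} (ht : 0 < t) : 0 < f t := by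
  have := f.strictMono ht
  rwa [hf 0 hb.le] at this

theorem radial_eq_self (v : E) (hv : f ‖v‖ = ‖v‖) : radial f v = v := by
  by_cases h : v = 0
  · simp [radial, h]
  · rw [radial, hv, div_self (norm_ne_zero_iff.2 h), one_smul]

theorem norm_radial (hb : 0 < b) (hf : ∀ t ≤ b, f t = t) (v : E) : ‖radial f v‖ = f ‖v‖ := by
  by_cases h : v = 0
  · simp [radial, h, hf 0 hb.le]
  · have h1 := norm_pos_iff.2 h
    have h2 := orderIso_pos hb hf h1
    rw [radial, norm_smul, Real.norm_of_nonneg (by positivity), div_mul_cancel₀ _ h1.ne']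

theorem radial_symm_radial (hb : 0 < b) (hf : ∀ t ≤ b, f t = t) (v : E) :
    radial f.symm (radial f v) = v := by
  by_cases h : v = 0
  · simp [radial, h]
  · have h1 := norm_pos_iff.2 h
    have h2 := orderIso_pos hb hf h1
    rw [radial, norm_radial hb hf, OrderIso.symm_apply_apply, radial, smul_smul,
      div_mul_div_cancel₀ h2.ne', div_self h1.ne', one_smul]

theorem continuous_radial (hb : 0 < b) (hf : ∀ t ≤ b, f t = t) :
    Continuous (radial f : E → E) := by
  refine continuous_iff_continuousAt.2 fun v => ?_
  by_cases h : v = 0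
  · subst h
    refine continuousAt_id.congr ?_
    filter_upwards [Metric.ball_mem_nhds (0 : E) hb] with w hw
    exact (radial_eq_self w (hf _ (mem_ball_zero_iff.1 hw).le)).symm
  · exact ((f.continuous.continuousAt.comp continuous_norm.continuousAt).div
      continuous_norm.continuousAt (norm_ne_zero_iff.2 h)).smul continuousAt_id

/-- The radial map as a homeomorphism. -/
noncomputable def radialHomeomorph (hb : 0 < b) (hf : ∀ t ≤ b, f t = t) : E ≃ₜ E where
  toFun := radial f
  invFun := radial f.symm
  left_inv := radial_symm_radial hb hf
  right_inv v := by
    simpa using radial_symm_radial (f := f.symm) hb (orderIso_symm_eq hf) v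
  continuous_toFun := continuous_radial hb hf
  continuous_invFun := continuous_radial hb (orderIso_symm_eq hf)

end Radial

/-! ### Monotone unions of tubular neighbourhoods -/

section MonotoneUnion

variable {X A : Type*} [TopologicalSpace X] [T2Space X] [TopologicalSpace A]

open Classical in
/-- A homeomorphism of `A` supported in the compact set `C`, transported by the open embedding
`g`. -/
theorem exists_homeomorph_extend {g : A → X} (hg : IsOpenEmbedding g) (k : A ≃ₜ A) {C : Set A}
    (hC : IsCompact C) (hk : ∀ a ∉ C, k a = a) :
    ∃ κ : X ≃ₜ X, (∀ a, κ (g a) = g (k a)) ∧ ∀ x ∉ g '' C, κ x = x := by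
  have hcont : ∀ k : A ≃ₜ A, (∀ a ∉ C, k a = a) → ∃ κ : X → X, Continuous κ ∧
      (∀ a, κ (g a) = g (k a)) ∧ (∀ x ∉ g '' C, κ x = x) := by
    intro k hk
    let κ : X → X := fun x => if h : ∃ a, g a = x then g (k h.choose) else x
    have h1 : ∀ a, κ (g a) = g (k a) := by
      intro a
      have h : ∃ a', g a' = g a := ⟨a, rfl⟩
      simp only [κ, dif_pos h]
      rw [hg.injective h.choose_spec]
    have h2 : ∀ x ∉ g '' C, κ x = x := by
      intro x hx
      by_cases h : ∃ a, g a = x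
      · obtain ⟨a, rfl⟩ := h
        rw [h1, hk a fun ha => hx ⟨a, ha, rfl⟩]
      · simp only [κ, dif_neg h]
    refine ⟨κ, continuous_iff_continuousAt.2 fun x => ?_, h1, h2⟩
    by_cases h : ∃ a, g a = x
    · obtain ⟨a, rfl⟩ := h
      rw [← hg.continuousAt_iff]
      have : κ ∘ g = g ∘ k := funext h1
      rw [this]
      exact (hg.continuous.comp k.continuous).continuousAt
    · have hcl : IsClosed (g '' C) := (hC.image hg.continuous).isClosed
      refine continuousAt_id.congr ?_
      filter_upwards [hcl.isOpen_compl.mem_nhds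
        (show x ∈ (g '' C)ᶜ from fun ⟨a, _, ha⟩ => h ⟨a, ha⟩)] with y hy
      exact (h2 y hy).symm
  have hk' : ∀ a ∉ C, k.symm a = a := fun a ha => by rw [k.symm_apply_eq, hk a ha]
  obtain ⟨κ, hκ, h1, h2⟩ := hcont k hk
  obtain ⟨κ', hκ', h1', h2'⟩ := hcont k.symm hk'
  have key : ∀ (k : A ≃ₜ A) (κ κ' : X → X), (∀ a, κ (g a) = g (k a)) →
      (∀ x ∉ g '' C, κ x = x) → (∀ a, κ' (g a) = g (k.symm a)) → (∀ x ∉ g '' C, κ' x = x) →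
      ∀ x, κ' (κ x) = x := by
    intro k κ κ' h1 h2 h1' h2' x
    by_cases h : x ∈ g '' C
    · obtain ⟨a, -, rfl⟩ := h
      rw [h1, h1', k.symm_apply_apply]
    · rw [h2 x h, h2' x h]
  exact ⟨⟨⟨κ, κ', key k κ κ' h1 h2 h1' h2', key k.symm κ' κ h1' h2' h1 h2⟩, hκ, hκ'⟩, h1, h2⟩

variable {E Z : Type*} [NormedAddCommGroup E] [NormedSpace ℝ E] [ProperSpace E]
  [TopologicalSpace Z] [CompactSpace Z]

theorem isCompact_tube (r : ℝ) : IsCompact {a : E × Z | ‖a.1‖ ≤ r} := by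
  have : {a : E × Z | ‖a.1‖ ≤ r} = Metric.closedBall (0 : E) r ×ˢ univ := by
    ext a
    simp
  rw [this]
  exact (isCompact_closedBall _ _).prod isCompact_univ

theorem exists_tube_subset {V : Set (E × Z)} (hV : IsOpen V) (h0 : ∀ z, ((0 : E), z) ∈ V) :
    ∃ ρ > 0, ∀ a : E × Z, ‖a.1‖ ≤ ρ → a ∈ V := by
  obtain ⟨A, B, hA, -, h0A, hB, hAB⟩ := generalized_tube_lemma (s := {(0 : E)}) (t := (univ : Set Z))
    isCompact_singleton isCompact_univ hV (by rintro ⟨x, z⟩ ⟨hx, -⟩; obtain rfl := hx; exact h0 z)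
  obtain ⟨ρ, hρ, h⟩ := Metric.isOpen_iff.1 hA 0 (h0A rfl)
  refine ⟨ρ / 2, by positivity, fun a ha => hAB ⟨h ?_, hB (mem_univ _)⟩⟩
  rw [mem_ball_zero_iff]
  linarith

/-- A tube can be enlarged, without changing it on a given compact part, so as to contain a given
compact set, provided that a neighbourhood of its core can. -/
theorem exists_larger_tube {g₀ : E × Z → X}
    (hH : ∀ N : Set X, IsOpen N → (∀ z, g₀ (0, z) ∈ N) → ∀ C : Set X, IsCompact C →
      ∃ H : X ≃ₜ X, (∃ N' : Set X, IsOpen N' ∧ (∀ z, g₀ (0, z) ∈ N') ∧ ∀ x ∈ N', H x = x) ∧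
        C ⊆ H '' N)
    {g : E × Z → X} (hg : IsOpenEmbedding g) (hgg : ∀ z, g (0, z) = g₀ (0, z)) {r : ℝ}
    (hr : 0 < r) {C : Set X} (hC : IsCompact C) :
    ∃ g' : E × Z → X, IsOpenEmbedding g' ∧ (∀ a, ‖a.1‖ ≤ r → g' a = g a) ∧ C ⊆ range g' := by
  have hT := isCompact_tube (E := E) (Z := Z) (r + 1)
  obtain ⟨H, ⟨N', hN', hcore, hid⟩, hsub⟩ := hH (range g) hg.isOpen_range
    (fun z => ⟨_, hgg z⟩) (C ∪ g '' {a | ‖a.1‖ ≤ r + 1}) (hC.union (hT.image hg.continuous))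
  obtain ⟨ρ, hρ, hρN⟩ := exists_tube_subset (hN'.preimage hg.continuous)
    (fun z => by rw [mem_preimage, hgg]; exact hcore z)
  have hρ' : min ρ (r / 2) < r := (min_le_right _ _).trans_lt (by linarith)
  have hρ0 : 0 < min ρ (r / 2) := lt_min hρ (by linarith)
  obtain ⟨f, hf0, hfr, hf1⟩ := exists_orderIso_contraction (half_lt_self hρ0) hρ' (lt_add_one r)
  set k : E × Z ≃ₜ E × Z := (radialHomeomorph (half_pos hρ0) hf0).prodCongr (Homeomorph.refl Z)
    with hk
  have hk1 : ∀ a, k a = (radial f a.1, a.2) := fun a => rfl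
  have hknorm : ∀ a, ‖(k a).1‖ = f ‖a.1‖ := fun a => norm_radial (half_pos hρ0) hf0 a.1
  have hksupp : ∀ a ∉ {a : E × Z | ‖a.1‖ ≤ r + 1}, k a = a := by
    intro a ha
    rw [hk1, radial_eq_self a.1 (hf1 _ (not_le.1 ha).le)]
  obtain ⟨κ, hκ1, hκ2⟩ := exists_homeomorph_extend hg k.symm hT
    (fun a ha => by rw [k.symm_apply_eq, hksupp a ha])
  refine ⟨fun a => κ (H (g (k a))), κ.isOpenEmbedding.comp (H.isOpenEmbedding.comp
    (hg.comp k.isOpenEmbedding)), ?_, ?_⟩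
  · intro a ha
    have h1 : ‖(k a).1‖ ≤ ρ := by
      rw [hknorm]
      exact (f.monotone ha).trans (hfr.trans_le (min_le_left _ _))
    change κ (H (g (k a))) = g a
    rw [hid _ (hρN _ h1), hκ1, k.symm_apply_apply]
  · intro x hx
    have h1 : κ.symm x ∈ C ∪ g '' {a | ‖a.1‖ ≤ r + 1} := by
      by_cases h : κ.symm x ∈ g '' {a | ‖a.1‖ ≤ r + 1}
      · exact Or.inr h
      · have := hκ2 _ h
        rw [κ.apply_symm_apply] at this
        rw [← this]
        exact Or.inl hx
    obtain ⟨_, ⟨a, rfl⟩, ha⟩ := hsub h1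
    refine ⟨k.symm a, ?_⟩
    change κ (H (g (k (k.symm a)))) = x
    rw [k.apply_symm_apply, ha, κ.apply_symm_apply]

theorem exists_surjective_tube [WeaklyLocallyCompactSpace X] [SigmaCompactSpace X]
    {g₀ : E × Z → X} (hg₀ : IsOpenEmbedding g₀)
    (hH : ∀ N : Set X, IsOpen N → (∀ z, g₀ (0, z) ∈ N) → ∀ C : Set X, IsCompact C →
      ∃ H : X ≃ₜ X, (∃ N' : Set X, IsOpen N' ∧ (∀ z, g₀ (0, z) ∈ N') ∧ ∀ x ∈ N', H x = x) ∧
        C ⊆ H '' N) :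
    ∃ g : E × Z → X, IsOpenEmbedding g ∧ Function.Surjective g ∧ ∀ z, g (0, z) = g₀ (0, z) := by
  let G := {g : E × Z → X // IsOpenEmbedding g ∧ ∀ z, g (0, z) = g₀ (0, z)}
  let e : CompactExhaustion X := default
  have hstep : ∀ (i : ℕ) (g : G), ∃ g' : G, (∀ a : E × Z, ‖a.1‖ ≤ (i : ℝ) + 1 → g'.1 a = g.1 a) ∧
      (e i ⊆ range g.1 → ∀ a, g.1 a ∈ e i → g'.1 a = g.1 a) ∧ e (i + 1) ⊆ range g'.1 := by
    rintro i ⟨g, hg, hgg⟩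
    obtain ⟨B, hB⟩ : ∃ B : ℝ, e i ⊆ range g → ∀ a, g a ∈ e i → ‖a.1‖ ≤ B := by
      by_cases h : e i ⊆ range g
      · obtain ⟨B, hB⟩ := ((hg.isInducing.isCompact_preimage' (e.isCompact i) h).image
          continuous_fst.norm).bddAbove
        exact ⟨B, fun _ a ha => hB ⟨a, ha, rfl⟩⟩
      · exact ⟨0, fun h' => absurd h' h⟩
    obtain ⟨g', h1, h2, h3⟩ := exists_larger_tube hH hg hgg (r := max ((i : ℝ) + 1) B)
      (lt_max_of_lt_left (by positivity)) (e.isCompact (i + 1))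
    exact ⟨⟨g', h1, fun z => by rw [h2 _ (by simp; left; positivity), hgg]⟩,
      fun a ha => h2 a (le_max_of_le_left ha), fun h a ha => h2 a (le_max_of_le_right (hB h a ha)),
      h3⟩
  choose next hnext1 hnext2 hnext3 using hstep
  let s : ℕ → G := fun i => Nat.rec ⟨g₀, hg₀, fun _ => rfl⟩ next i
  have hs : ∀ i, s (i + 1) = next i (s i) := fun i => rfl
  have hstab : ∀ i j : ℕ, i ≤ j → ∀ a : E × Z, ‖a.1‖ ≤ (i : ℝ) + 1 → (s j).1 a = (s i).1 a := by
    intro i j hij a ha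
    induction j, hij using Nat.le_induction with
    | base => rfl
    | succ j hj ih =>
      rw [hs, hnext1 j (s j) a (ha.trans (by gcongr)), ih]
  let g : E × Z → X := fun a => (s ⌈‖a.1‖⌉₊).1 a
  have hgs : ∀ (i : ℕ) (a : E × Z), ‖a.1‖ ≤ i → g a = (s i).1 a := by
    intro i a ha
    refine (hstab _ i (Nat.ceil_le.2 ha) a ?_).symm
    linarith [Nat.le_ceil ‖a.1‖]
  have hnb : ∀ (i : ℕ) (a : E × Z), ‖a.1‖ < i → ∀ᶠ b in 𝓝 a, g b = (s i).1 b := by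
    intro i a ha
    filter_upwards [(continuous_fst.norm.isOpen_preimage _ isOpen_Iio).mem_nhds
      (show a ∈ (fun x : E × Z => ‖x.1‖) ⁻¹' Iio (i : ℝ) from ha)] with b hb
    exact hgs i b (le_of_lt hb)
  have hinj : Function.Injective g := by
    intro a b hab
    obtain ⟨i, hi⟩ := exists_nat_ge (max ‖a.1‖ ‖b.1‖)
    rw [hgs i a ((le_max_left _ _).trans hi), hgs i b ((le_max_right _ _).trans hi)] at hab
    exact (s i).2.1.injective hab
  have hcont : Continuous g := by
    refine continuous_iff_continuousAt.2 fun a => ?_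
    obtain ⟨i, hi⟩ := exists_nat_gt ‖a.1‖
    exact (s i).2.1.continuous.continuousAt.congr (EventuallyEq.symm (hnb i a hi))
  have hopen : IsOpenMap g := by
    refine isOpenMap_iff_nhds_le.2 fun a => ?_
    obtain ⟨i, hi⟩ := exists_nat_gt ‖a.1‖
    rw [hgs i a hi.le, Filter.map_congr (hnb i a hi)]
    exact (s i).2.1.isOpenMap.nhds_le a
  refine ⟨g, IsOpenEmbedding.of_continuous_injective_isOpenMap hcont hinj hopen, ?_, ?_⟩
  · intro x
    obtain ⟨i, hi⟩ := e.exists_mem x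
    have hi' := e.subset (Nat.le_succ i) hi
    obtain ⟨a, ha⟩ := hnext3 i (s i) hi'
    have hrange : ∀ j, i + 1 ≤ j → e j ⊆ range (s j).1 := by
      intro j hj
      obtain ⟨j, rfl⟩ := Nat.exists_eq_add_of_le' (Nat.le_trans (Nat.le_add_left 1 i) hj)
      exact hnext3 j (s j)
    have hj : ∀ j, i + 1 ≤ j → (s j).1 a = x := by
      intro j hj
      induction j, hj using Nat.le_induction with
      | base => exact ha
      | succ j hj ih =>
        rw [hs, hnext2 j (s j) (hrange j hj) a (by
          rw [ih]; exact e.subset (by omega) hi), ih]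
    obtain ⟨j, hja⟩ := exists_nat_ge ‖a.1‖
    exact ⟨a, by rw [hgs (max j (i + 1)) a (hja.trans (by simp)), hj _ (le_max_right _ _)]⟩
  · intro z
    exact (s _).2.2 z

end MonotoneUnion


/-! ### The linear flow -/

/-- The flow `(x, y) ↦ (l ^ t x, l ^ (-t) y)`. -/
noncomputable def flowMap (l t : ℝ) (v : ℂ) : ℂ := linMap (l ^ t) v

section FlowMap

variable {l : ℝ}

theorem flowMap_zero (v : ℂ) : flowMap l 0 v = v := by
  simp [flowMap, linMap]

theorem flowMap_one (v : ℂ) : flowMap l 1 v = linMap l v := by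
  simp [flowMap]

theorem flowMap_add (hl : 0 < l) (s t : ℝ) (v : ℂ) :
    flowMap l s (flowMap l t v) = flowMap l (s + t) v := by
  rw [flowMap, flowMap, linMap_mul, flowMap, Real.rpow_add hl]

theorem flowMap_mem (hl : 0 < l) {t : ℝ} {v : ℂ} {j : Fin 4} :
    flowMap l t v ∈ cquad j ↔ v ∈ cquad j := linMap_mem (Real.rpow_pos_of_pos hl t)

theorem flowMap_ne_zero (hl : 0 < l) {t : ℝ} {v : ℂ} (hv : v ≠ 0) : flowMap l t v ≠ 0 :=
  linMap_ne_zero (Real.rpow_pos_of_pos hl t) hv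

theorem continuous_flowMap (hl : 0 < l) : Continuous fun a : ℝ × ℂ => flowMap l a.1 a.2 := by
  have h : Continuous fun a : ℝ × ℂ => l ^ a.1 := continuous_const.rpow continuous_fst
    fun _ => Or.inl hl.ne'
  have h' : Continuous fun a : ℝ × ℂ => (l ^ a.1)⁻¹ := h.inv₀ fun _ =>
    (Real.rpow_pos_of_pos hl _).ne'
  unfold flowMap linMap
  simp only [Complex.mk_eq_add_mul_I]
  fun_prop

theorem norm_linMap_le {l b : ℝ} (hl : 0 < l) (h1 : l ≤ b) (h2 : l⁻¹ ≤ b) (v : ℂ) :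
    ‖linMap l v‖ ≤ b * ‖v‖ := by
  have hb : 0 < b := hl.trans_le h1
  have h3 : l ^ 2 ≤ b ^ 2 := pow_le_pow_left₀ hl.le h1 2
  have h4 : l⁻¹ ^ 2 ≤ b ^ 2 := pow_le_pow_left₀ (inv_pos.2 hl).le h2 2
  refine le_of_sq_le_sq ?_ (by positivity)
  rw [mul_pow, Complex.sq_norm, Complex.sq_norm, Complex.normSq_apply, Complex.normSq_apply, linMap]
  simp only
  nlinarith [mul_le_mul_of_nonneg_right h3 (sq_nonneg v.re),
    mul_le_mul_of_nonneg_right h4 (sq_nonneg v.im)]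

theorem norm_flowMap_lt (hl : 0 < l) (hl1 : l < 1) {r t : ℝ} (ht : |t| ≤ 2) {v : ℂ}
    (hv : ‖v‖ < l ^ 2 * r) : ‖flowMap l t v‖ < r := by
  have h1 : ‖flowMap l t v‖ ≤ (l ^ 2)⁻¹ * ‖v‖ := by
    refine norm_linMap_le (Real.rpow_pos_of_pos hl t) ?_ ?_ v
    · rw [← Real.rpow_natCast, ← Real.rpow_neg hl.le]
      exact Real.rpow_le_rpow_of_exponent_ge hl hl1.le (by push_cast; linarith [(abs_le.1 ht).1])
    · rw [← Real.rpow_natCast, ← Real.rpow_neg hl.le, ← Real.rpow_neg hl.le]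
      exact Real.rpow_le_rpow_of_exponent_ge hl hl1.le (by push_cast; linarith [(abs_le.1 ht).2])
  refine h1.trans_lt ?_
  rw [inv_mul_lt_iff₀ (by positivity)]
  exact hv

end FlowMap

/-! ### Coordinates in the quadrants of the tube -/

section Tube

variable {M : Type*} [MetricSpace M] [CompactSpace M]
  {S : Type*} [TopologicalSpace S] [ChartedSpace (EuclideanHalfSpace 2) S]
  [CompactSpace S] [T2Space S]
  {φ : Flow ℝ M} {ι : S → M} {γ : Set M} {τ : OpenPartialHomeomorph M (ℝ × ℝ × UnitAddCircle)}
  {D : AlmostAnosovData φ ι} {N : SectionCoord D γ τ} {K : ℕ} {c : ℤ}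

namespace SheetCoord

variable (C : SheetCoord N K c)

/-- The point of the `j`-th quadrant of the tube with flat coordinate `v` and height `s`. -/
noncomputable def par (j : Fin 4) (v : ℂ) (s : ℝ) : M :=
  D.pt (C.sec j ⌊s⌋ (flowMap D.pA.lam (-Int.fract s) v)) (Int.fract s)

/-- The radius of the parametrized tube. -/
def rad (C : SheetCoord N K c) : ℝ := D.pA.lam ^ 2 * (D.pA.lam ^ 2 * C.r)

theorem rad_pos : 0 < C.rad := by
  have := D.pA.lam_pos
  have := C.r_pos
  unfold rad
  positivity

theorem norm_lt_of_lt_rad {t : ℝ} (ht : |t| ≤ 2) {v : ℂ} (hv : ‖v‖ < C.rad) :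
    ‖flowMap D.pA.lam t v‖ < D.pA.lam ^ 2 * C.r :=
  norm_flowMap_lt D.pA.lam_pos D.pA.lam_lt_one ht hv

theorem norm_lt_r {t : ℝ} (ht : |t| ≤ 2) {v : ℂ} (hv : ‖v‖ < C.rad) :
    ‖flowMap D.pA.lam t v‖ < C.r := by
  refine (C.norm_lt_of_lt_rad ht hv).trans_le ?_
  have h1 : D.pA.lam ^ 2 ≤ 1 := pow_le_one₀ D.pA.lam_pos.le D.pA.lam_lt_one.le
  nlinarith [C.r_pos]

theorem norm_lt_η {t : ℝ} (ht : |t| ≤ 2) {v : ℂ} (hv : ‖v‖ < C.rad) :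
    ‖flowMap D.pA.lam t v‖ < N.η := (C.norm_lt_r ht hv).trans_le C.r_le

/-- The domain of the parametrization of the `j`-th quadrant. -/
def pdom (C : SheetCoord N K c) (j : Fin 4) : Set ℂ := {v | v ∈ cquad j ∧ v ≠ 0 ∧ ‖v‖ < C.rad}

variable {C}

theorem par_eq {j : Fin 4} {v : ℂ} (hv : v ∈ C.pdom j) {s : ℝ} {k : ℤ}
    (hk : s - k ∈ Icc (-1 : ℝ) 2) :
    C.par j v s = D.pt (C.sec j k (flowMap D.pA.lam (k - s) v)) (s - k) := by
  obtain ⟨hvj, hv0, hvr⟩ := hv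
  have step : ∀ k : ℤ, |(k : ℝ) - s| ≤ 2 →
      D.pt (C.sec j k (flowMap D.pA.lam (k - s) v)) (s - k) =
        D.pt (C.sec j (k + 1) (flowMap D.pA.lam ((k + 1 : ℤ) - s) v)) (s - (k + 1 : ℤ)) := by
    intro k hk
    obtain ⟨-, h⟩ := C.map_sec j k _ ((flowMap_mem D.pA.lam_pos).2 hvj)
      (flowMap_ne_zero D.pA.lam_pos hv0) (C.norm_lt_r hk hvr)
    rw [← D.pt_map, h, ← flowMap_one, flowMap_add D.pA.lam_pos]
    rw [show (1 : ℝ) + (k - s) = ((k + 1 : ℤ) : ℝ) - s by push_cast; ring,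
      show s - k - 1 = s - ((k + 1 : ℤ) : ℝ) by push_cast; ring]
  have h0 : C.par j v s = D.pt (C.sec j ⌊s⌋ (flowMap D.pA.lam (⌊s⌋ - s) v)) (s - ⌊s⌋) := by
    rw [par, Int.fract, neg_sub]
  rw [h0]
  have h1 := Int.floor_le s
  have h2 := Int.lt_floor_add_one s
  have h3 : k - 1 ≤ ⌊s⌋ := by rw [Int.le_floor]; push_cast; linarith [hk.1]
  have h4 : ⌊s⌋ ≤ k + 2 := by
    have : (⌊s⌋ : ℝ) ≤ k + 2 := by linarith [hk.2]
    exact_mod_cast this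
  obtain h | h | h | h : ⌊s⌋ = k - 1 ∨ ⌊s⌋ = k ∨ ⌊s⌋ = k + 1 ∨ ⌊s⌋ = k + 1 + 1 := by omega
  · have := step (k - 1) (by rw [← h, abs_le]; constructor <;> linarith)
    rw [h, this, sub_add_cancel]
  · rw [h]
  · rw [h, ← step k (by rw [abs_le]; constructor <;> linarith [hk.1, hk.2])]
  · rw [h, ← step (k + 1) (by rw [abs_le]; push_cast; constructor <;> linarith [hk.1, hk.2]),
      ← step k (by rw [abs_le]; constructor <;> linarith [hk.1, hk.2])]

theorem pt_eq_par {j : Fin 4} {u : intr S} {k : ℤ} (hk : u = C.sec j k (N.Q u)) {t : ℝ}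
    (ht : t ∈ Icc (-1 : ℝ) 2) (hv : flowMap D.pA.lam t (N.Q u) ∈ C.pdom j) :
    D.pt u t = C.par j (flowMap D.pA.lam t (N.Q u)) (t + k) := by
  rw [par_eq hv (k := k) (by simpa using ht), flowMap_add D.pA.lam_pos, sub_add_cancel_right,
    neg_add_cancel, flowMap_zero, ← hk, add_sub_cancel_right]

theorem abs_neg_fract_le (s : ℝ) : |-Int.fract s| ≤ 2 := by
  rw [abs_neg, abs_of_nonneg (Int.fract_nonneg s)]
  linarith [Int.fract_lt_one s]

/-- The canonical representative of a point of the tube. -/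
theorem par_rep {j : Fin 4} {v : ℂ} (hv : v ∈ C.pdom j) (s : ℝ) :
    ∃ u ∈ N.dom, ∃ t ∈ Ico (0 : ℝ) 1, D.pt u t = C.par j v s ∧ flowMap D.pA.lam t (N.Q u) = v ∧
      u = C.sec j ⌊s⌋ (N.Q u) ∧ t = Int.fract s := by
  have h0 := flowMap_ne_zero (t := -Int.fract s) D.pA.lam_pos hv.2.1
  have h1 := C.norm_lt_η (abs_neg_fract_le s) hv.2.2
  refine ⟨_, C.sec_mem j ⌊s⌋ _ h0 h1, Int.fract s, ⟨Int.fract_nonneg s, Int.fract_lt_one s⟩, rfl,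
    ?_, ?_, rfl⟩
  · rw [C.Q_sec _ _ _ h0 h1, flowMap_add D.pA.lam_pos, add_neg_cancel, flowMap_zero]
  · rw [C.Q_sec _ _ _ h0 h1]

theorem par_left_unique {j j' : Fin 4} {v v' : ℂ} (hv : v ∈ C.pdom j) (hv' : v' ∈ C.pdom j')
    {s s' : ℝ} (h : C.par j v s = C.par j' v' s') : v = v' := by
  obtain ⟨u, -, t, ht, h1, h2, -, -⟩ := par_rep hv s
  obtain ⟨u', -, t', ht', h1', h2', -, -⟩ := par_rep hv' s'
  obtain ⟨rfl, rfl⟩ := D.rep_unique ht ht' (h1.trans (h.trans h1'.symm))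
  rw [← h2, h2']

theorem par_eq_par_iff {j : Fin 4} {v : ℂ} (hv : v ∈ C.pdom j) {s s' : ℝ} :
    C.par j v s = C.par j v s' ↔ ∃ i : ℤ, s' = s + i * K := by
  constructor
  · intro h
    obtain ⟨u, hu, t, ht, h1, h2, h3, h4⟩ := par_rep hv s
    obtain ⟨u', hu', t', ht', h1', h2', h3', h4'⟩ := par_rep hv s'
    obtain ⟨rfl, rfl⟩ := D.rep_unique ht ht' (h1.trans (h.trans h1'.symm))
    have h5 := (C.sec_eq_iff j ⌊s⌋ ⌊s'⌋ _ (N.ne_zero_of_mem_dom hu) (N.norm_lt hu)).1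
      (h3.symm.trans h3')
    obtain ⟨i, hi⟩ := h5.dvd
    refine ⟨i, ?_⟩
    have h6 : (⌊s'⌋ : ℝ) - ⌊s⌋ = K * i := by exact_mod_cast hi
    have h7 := Int.floor_add_fract s
    have h8 := Int.floor_add_fract s'
    rw [← h4] at h7
    rw [← h4'] at h8
    linarith
  · rintro ⟨i, rfl⟩
    have h0 := flowMap_ne_zero (t := -Int.fract s) D.pA.lam_pos hv.2.1
    have h1 := C.norm_lt_η (abs_neg_fract_le s) hv.2.2
    have h2 : s + i * K = s + ((i * K : ℤ) : ℝ) := by push_cast; ring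
    rw [par, par, h2, Int.fract_add_intCast, Int.floor_add_intCast]
    congr 1
    exact (C.sec_eq_iff j _ _ _ h0 h1).2 (Int.modEq_iff_dvd.2 ⟨i, by ring⟩)

theorem par_add (j : Fin 4) {v : ℂ} (hv : v ∈ C.pdom j) (s : ℝ) : C.par j v (s + K) = C.par j v s :=
  ((par_eq_par_iff hv).2 ⟨1, by simp⟩).symm

theorem par_succ {j : Fin 4} (hj : j ≠ 3) {v : ℂ} (hv : v ∈ C.pdom j) (hv' : v ∈ C.pdom (j + 1))
    (s : ℝ) : C.par (j + 1) v s = C.par j v s := by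
  rw [par, par, C.sec_succ j hj _ _ (flowMap_ne_zero D.pA.lam_pos hv.2.1)
    ((flowMap_mem D.pA.lam_pos).2 hv.1) ((flowMap_mem D.pA.lam_pos).2 hv'.1)]

theorem par_last {v : ℂ} (hv : v ∈ C.pdom 3) (hv' : v ∈ C.pdom 0) (s : ℝ) :
    C.par 0 v (s + c) = C.par 3 v s := by
  rw [par, par, Int.fract_add_intCast, Int.floor_add_intCast,
    C.sec_last _ _ (flowMap_ne_zero D.pA.lam_pos hv.2.1)
    ((flowMap_mem D.pA.lam_pos).2 hv.1) ((flowMap_mem D.pA.lam_pos).2 hv'.1)]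

theorem par_change {j j' : Fin 4} {v : ℂ} (hv : v ∈ C.pdom j) (hv' : v ∈ C.pdom j') (s : ℝ) :
    ∃ i : ℤ, C.par j v s = C.par j' v (s + i) := by
  obtain ⟨u, hu, t, ht, h1, h2, h3, h4⟩ := par_rep hv s
  obtain ⟨k, hk⟩ := C.exists_sec u hu j'
  refine ⟨k - ⌊s⌋, ?_⟩
  rw [← h1, pt_eq_par hk ⟨by linarith [ht.1], by linarith [ht.2]⟩ (by rwa [h2]), h2, h4]
  congr 1
  push_cast
  linarith [Int.floor_add_fract s]

theorem par_mem_range_iff {j : Fin 4} {v : ℂ} {s : ℝ} : C.par j v s ∈ range ι ↔ ∃ k : ℤ, s = k := by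
  rw [par, D.pt_mem_range_iff]
  constructor
  · rintro ⟨k, hk⟩
    exact ⟨⌊s⌋ + k, by push_cast; linarith [Int.floor_add_fract s]⟩
  · rintro ⟨k, rfl⟩
    exact ⟨0, by simp⟩

theorem par_int {j : Fin 4} {v : ℂ} (k : ℤ) : C.par j v k = ι (C.sec j k v) := by
  rw [par, Int.fract_intCast, Int.floor_intCast, neg_zero, flowMap_zero, D.pt_zero]

theorem par_notMem {j : Fin 4} {v : ℂ} {s : ℝ} : C.par j v s ∉ ι '' bdry S := D.pt_notMem _ _

theorem continuousOn_par (j : Fin 4) :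
    ContinuousOn (fun a : ℂ × ℝ => C.par j a.1 a.2) (C.pdom j ×ˢ univ) := by
  rintro ⟨v, s⟩ ⟨hv, -⟩
  have hv' : v ∈ C.pdom j := hv
  set k := ⌊s⌋ with hk
  have h1 : ContinuousWithinAt (fun a : ℂ × ℝ =>
      D.pt (C.sec j k (flowMap D.pA.lam (k - a.2) a.1)) (a.2 - k)) (C.pdom j ×ˢ univ) (v, s) := by
    have h2 : ContinuousWithinAt (fun a : ℂ × ℝ => flowMap D.pA.lam (k - a.2) a.1)
        (C.pdom j ×ˢ univ ∩ (Prod.snd ⁻¹' Ioo (s - 1) (s + 1))) (v, s) :=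
      (ContinuousAt.comp (g := fun a : ℝ × ℂ => flowMap D.pA.lam a.1 a.2)
        (f := fun a : ℂ × ℝ => ((k : ℝ) - a.2, a.1)) (continuous_flowMap D.pA.lam_pos).continuousAt
        (by fun_prop)).continuousWithinAt
    have h3 : ContinuousWithinAt (C.sec j k) {v | v ∈ cquad j ∧ v ≠ 0 ∧ ‖v‖ < N.η}
        (flowMap D.pA.lam (k - s) v) := by
      refine C.continuousOn_sec j k _ ⟨(flowMap_mem D.pA.lam_pos).2 hv'.1,
        flowMap_ne_zero D.pA.lam_pos hv'.2.1, C.norm_lt_η ?_ hv'.2.2⟩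
      rw [abs_le]
      constructor <;> linarith [Int.floor_le s, Int.lt_floor_add_one s]
    have h4 := ContinuousWithinAt.comp (g := C.sec j k)
      (f := fun a : ℂ × ℝ => flowMap D.pA.lam (k - a.2) a.1) (x := (v, s)) h3 h2 (by
      rintro ⟨w, s'⟩ ⟨⟨hw, -⟩, hs'⟩
      have hs' : s' ∈ Ioo (s - 1) (s + 1) := hs'
      refine ⟨(flowMap_mem D.pA.lam_pos).2 hw.1, flowMap_ne_zero D.pA.lam_pos hw.2.1,
        C.norm_lt_η ?_ hw.2.2⟩
      rw [abs_le]
      constructor <;> linarith [Int.floor_le s, Int.lt_floor_add_one s, hs'.1, hs'.2])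
    rw [continuousWithinAt_inter ((isOpen_Ioo.preimage continuous_snd).mem_nhds
      (show s ∈ Ioo (s - 1) (s + 1) from ⟨by linarith, by linarith⟩))] at h4
    exact ContinuousAt.comp_continuousWithinAt
      (g := fun a : intr S × ℝ => D.pt a.1 a.2) D.continuous_pt.continuousAt
      (h4.prodMk (continuousWithinAt_snd.sub continuousWithinAt_const))
  refine h1.congr_of_eventuallyEq ?_ (par_eq hv' ⟨?_, ?_⟩)
  · have : ∀ᶠ a : ℂ × ℝ in 𝓝 (v, s), a.2 ∈ Ioo ((k : ℝ) - 1) (k + 2) :=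
      (isOpen_Ioo.preimage continuous_snd).mem_nhds
        (show s ∈ Ioo ((k : ℝ) - 1) (k + 2) from
          ⟨by linarith [Int.floor_le s], by linarith [Int.lt_floor_add_one s]⟩)
    filter_upwards [this.filter_mono nhdsWithin_le_nhds, self_mem_nhdsWithin] with a ha ha'
    exact par_eq ha'.1 ⟨by linarith [ha.1], by linarith [ha.2]⟩
  · linarith [Int.floor_le s]
  · linarith [Int.lt_floor_add_one s]

theorem eq_of_pt_eq_par {u : intr S} (hu : u ∈ N.dom) {t : ℝ} (ht : t ∈ Icc (-1 : ℝ) 2)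
    (hr : ‖flowMap D.pA.lam t (N.Q u)‖ < C.rad) {j : Fin 4} {v : ℂ} (hv : v ∈ C.pdom j) {s : ℝ}
    (h : C.par j v s = D.pt u t) : flowMap D.pA.lam t (N.Q u) = v := by
  obtain ⟨j', hj'⟩ := exists_mem_cquad (N.Q u)
  obtain ⟨k, hk⟩ := C.exists_sec _ hu j'
  have hm : flowMap D.pA.lam t (N.Q u) ∈ C.pdom j' := ⟨(flowMap_mem D.pA.lam_pos).2 hj',
    flowMap_ne_zero D.pA.lam_pos (N.ne_zero_of_mem_dom hu), hr⟩
  rw [pt_eq_par hk ht hm] at h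
  exact (par_left_unique hv hm h).symm

/-- Points near a point of the tube have nearby coordinates. -/
theorem eventually_quadrant (hι : IsBirkhoffSection φ ι) {j₀ : Fin 4} {v : ℂ} {s₀ : ℝ}
    (hv : v ∈ C.pdom j₀) (j : Fin 4) {p : M → Prop}
    (h : v ∈ C.pdom j → ∀ s, C.par j v s = C.par j₀ v s₀ →
      ∀ᶠ a in 𝓝[C.pdom j ×ˢ univ] (v, s), p (C.par j a.1 a.2)) :
    ∀ᶠ q in 𝓝 (C.par j₀ v s₀), (∃ w ∈ C.pdom j, ∃ s, C.par j w s = q) → p q := by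
  obtain ⟨u, hu, t, ht, h1, h2, h3, h4⟩ := par_rep hv s₀
  rw [← h1]
  have hcQ : ContinuousAt N.Q u := N.continuousOn_dom.continuousAt (N.isOpen_dom.mem_nhds hu)
  have hcv : ContinuousAt (fun a : intr S × ℝ => flowMap D.pA.lam a.2 (N.Q a.1)) (u, t) :=
    ContinuousAt.comp (g := fun a : ℝ × ℂ => flowMap D.pA.lam a.1 a.2)
      (f := fun a : intr S × ℝ => (a.2, N.Q a.1)) (continuous_flowMap D.pA.lam_pos).continuousAt
      (continuousAt_snd.prodMk (ContinuousAt.comp (g := N.Q) (f := Prod.fst) (x := (u, t)) hcQ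
        continuousAt_fst))
  have hdom : ∀ᶠ a : intr S × ℝ in 𝓝 (u, t), a.1 ∈ N.dom :=
    (N.isOpen_dom.preimage continuous_fst).mem_nhds (show u ∈ N.dom from hu)
  have htI : ∀ᶠ a : intr S × ℝ in 𝓝 (u, t), a.2 ∈ Ioo (-1 : ℝ) 2 :=
    (isOpen_Ioo.preimage continuous_snd).mem_nhds
      (show t ∈ Ioo (-1 : ℝ) 2 from ⟨by linarith [ht.1], by linarith [ht.2]⟩)
  have hrad : ∀ᶠ a : intr S × ℝ in 𝓝 (u, t), ‖flowMap D.pA.lam a.2 (N.Q a.1)‖ < C.rad :=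
    hcv.norm.eventually_lt continuousAt_const (by simp only [h2]; exact hv.2.2)
  have hpd : ∀ᶠ a : intr S × ℝ in 𝓝 (u, t), (∃ w ∈ C.pdom j, ∃ s, C.par j w s = D.pt a.1 a.2) →
      flowMap D.pA.lam a.2 (N.Q a.1) ∈ C.pdom j := by
    filter_upwards [hdom, htI, hrad] with a ha1 ha2 ha3
    rintro ⟨w, hw, s, hs⟩
    rwa [eq_of_pt_eq_par ha1 ⟨ha2.1.le, ha2.2.le⟩ ha3 hw hs]
  have key : ∀ᶠ a : intr S × ℝ in 𝓝 (u, t), (∃ w ∈ C.pdom j, ∃ s, C.par j w s = D.pt a.1 a.2) →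
      p (D.pt a.1 a.2) := by
    by_cases hj : v ∈ cquad j
    · have hvj : v ∈ C.pdom j := ⟨hj, hv.2⟩
      obtain ⟨k, hk⟩ := C.exists_sec u hu j
      have hpt : D.pt u t = C.par j v (t + k) := by
        rw [pt_eq_par hk ⟨by linarith [ht.1], by linarith [ht.2]⟩ (by rwa [h2]), h2]
      have h5 := h hvj (t + k) (hpt.symm.trans h1)
      have hc : ContinuousAt (fun a : intr S × ℝ => (flowMap D.pA.lam a.2 (N.Q a.1), a.2 + k))
          (u, t) := hcv.prodMk (by fun_prop)
      rw [eventually_nhdsWithin_iff] at h5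
      have h6 := hc.eventually (by simpa only [h2] using h5)
      have h7 : ∀ᶠ a : intr S × ℝ in 𝓝 (u, t), N.Q a.1 ∈ cquad j → a.1 = C.sec j k (N.Q a.1) := by
        have := C.eventually_sec j k u hu (by rwa [← flowMap_mem D.pA.lam_pos, h2]) hk
        exact (continuousAt_fst.eventually this).mono fun a ha => ha.2
      filter_upwards [htI, hpd, h6, h7] with a ha2 ha3 ha4 ha5 hex
      have hm := ha3 hex
      rw [pt_eq_par (ha5 ((flowMap_mem D.pA.lam_pos).1 hm.1)) ⟨ha2.1.le, ha2.2.le⟩ hm]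
      exact ha4 ⟨hm, mem_univ _⟩
    · have h5 : ∀ᶠ a : intr S × ℝ in 𝓝 (u, t), flowMap D.pA.lam a.2 (N.Q a.1) ∉ cquad j :=
        hcv.eventually ((isClosed_cquad j).isOpen_compl.mem_nhds (by simpa only [h2, mem_compl_iff] using hj))
      filter_upwards [h5, hpd] with a ha1 ha2 hex
      exact absurd (ha2 hex).1 ha1
  exact (D.isOpenMap_pt hι).nhds_le (u, t) key

theorem eventually_mem (hι : IsBirkhoffSection φ ι) {j₀ : Fin 4} {v : ℂ} {s₀ : ℝ}
    (hv : v ∈ C.pdom j₀) {ε : ℝ} (hε : ‖v‖ < ε) :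
    ∀ᶠ q in 𝓝 (C.par j₀ v s₀), ∃ j, ∃ w ∈ C.pdom j, ‖w‖ < ε ∧ ∃ s, C.par j w s = q := by
  obtain ⟨u, hu, t, ht, h1, h2, h3, h4⟩ := par_rep hv s₀
  rw [← h1]
  have hcQ : ContinuousAt N.Q u := N.continuousOn_dom.continuousAt (N.isOpen_dom.mem_nhds hu)
  have hcv : ContinuousAt (fun a : intr S × ℝ => flowMap D.pA.lam a.2 (N.Q a.1)) (u, t) :=
    ContinuousAt.comp (g := fun a : ℝ × ℂ => flowMap D.pA.lam a.1 a.2)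
      (f := fun a : intr S × ℝ => (a.2, N.Q a.1)) (continuous_flowMap D.pA.lam_pos).continuousAt
      (continuousAt_snd.prodMk (ContinuousAt.comp (g := N.Q) (f := Prod.fst) (x := (u, t)) hcQ
        continuousAt_fst))
  have hdom : ∀ᶠ a : intr S × ℝ in 𝓝 (u, t), a.1 ∈ N.dom :=
    (N.isOpen_dom.preimage continuous_fst).mem_nhds (show u ∈ N.dom from hu)
  have htI : ∀ᶠ a : intr S × ℝ in 𝓝 (u, t), a.2 ∈ Ioo (-1 : ℝ) 2 :=
    (isOpen_Ioo.preimage continuous_snd).mem_nhds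
      (show t ∈ Ioo (-1 : ℝ) 2 from ⟨by linarith [ht.1], by linarith [ht.2]⟩)
  have hrad : ∀ᶠ a : intr S × ℝ in 𝓝 (u, t), ‖flowMap D.pA.lam a.2 (N.Q a.1)‖ < min C.rad ε :=
    hcv.norm.eventually_lt continuousAt_const (by simp only [h2]; exact lt_min hv.2.2 hε)
  refine (D.isOpenMap_pt hι).nhds_le (u, t) (Filter.mem_map.2 ?_)
  filter_upwards [hdom, htI, hrad] with a ha1 ha2 ha3
  obtain ⟨j', hj'⟩ := exists_mem_cquad (N.Q a.1)
  obtain ⟨k, hk⟩ := C.exists_sec _ ha1 j'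
  have hm : flowMap D.pA.lam a.2 (N.Q a.1) ∈ C.pdom j' := ⟨(flowMap_mem D.pA.lam_pos).2 hj',
    flowMap_ne_zero D.pA.lam_pos (N.ne_zero_of_mem_dom ha1), ha3.trans_le (min_le_left _ _)⟩
  exact ⟨j', _, hm, ha3.trans_le (min_le_right _ _), _, (pt_eq_par hk ⟨ha2.1.le, ha2.2.le⟩ hm).symm⟩

end SheetCoord

end Tube


theorem isOpenMap_height {K : ℕ} (hK : 0 < K) :
    IsOpenMap fun a : ℂ × ℝ => (a.1, ((a.2 / K : ℝ) : UnitAddCircle)) := by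
  have hK' : (K : ℝ) ≠ 0 := by exact_mod_cast hK.ne'
  have h : IsOpenMap fun s : ℝ => ((s / K : ℝ) : UnitAddCircle) := by
    have h1 := (QuotientAddGroup.isOpenMap_coe (G := ℝ) (N := AddSubgroup.zmultiples (1 : ℝ))).comp
      (Homeomorph.mulRight₀ (K : ℝ)⁻¹ (inv_ne_zero hK')).isOpenMap
    convert h1 using 2
    exact congrArg _ (div_eq_mul_inv _ _)
  exact IsOpenMap.id.prodMap h

/-- A continuous function on a preconnected set whose values are torsion is constant. -/
theorem eq_of_nsmul_eq_zero {X : Type*} [TopologicalSpace X] {s : Set X} (hs : IsPreconnected s)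
    {f : X → UnitAddCircle} (hf : ContinuousOn f s) {n : ℕ} (hn : 0 < n)
    (h : ∀ x ∈ s, n • f x = 0) {x y : X} (hx : x ∈ s) (hy : y ∈ s) : f x = f y := by
  have hfin : {z : UnitAddCircle | n • z = 0}.Finite := by
    have : {z : UnitAddCircle | n • z = 0} ⊆
        (fun k : ℕ => ((k / n : ℝ) : UnitAddCircle)) '' (Finset.range n : Set ℕ) := by
      intro z hz
      induction z using QuotientAddGroup.induction_on with | H a => ?_
      have hz' : ((n * a : ℝ) : UnitAddCircle) = ((0 : ℝ) : UnitAddCircle) := by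
        rw [← nsmul_eq_mul]
        exact hz
      obtain ⟨k, hk⟩ := coe_eq_coe_iff_int.1 hz'
      have hn' : (n : ℤ) ≠ 0 := by exact_mod_cast hn.ne'
      have h0 := Int.emod_nonneg k hn'
      refine ⟨(k % n).toNat, ?_, ?_⟩
      · simp only [Finset.coe_range, mem_Iio]
        have := Int.emod_lt_of_pos k (show (0 : ℤ) < n by exact_mod_cast hn)
        omega
      · refine coe_eq_coe_iff_int.2 ⟨-(k / n), ?_⟩
        have h1 : (((k % n).toNat : ℕ) : ℝ) = ((k % n : ℤ) : ℝ) := by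
          exact_mod_cast Int.toNat_of_nonneg h0
        have h2 : ((k % n : ℤ) : ℝ) + n * ((k / n : ℤ) : ℝ) = k := by
          exact_mod_cast Int.emod_add_mul_ediv k n
        have hn2 : (n : ℝ) ≠ 0 := by exact_mod_cast hn.ne'
        rw [h1]
        push_cast
        field_simp
        linarith
    exact ((Finset.range n).finite_toSet.image _).subset this
  exact hs.constant_of_mapsTo hfin.isDiscrete hf h hx hy

section Tube

variable {M : Type*} [MetricSpace M] [CompactSpace M]
  {S : Type*} [TopologicalSpace S] [ChartedSpace (EuclideanHalfSpace 2) S]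
  [CompactSpace S] [T2Space S]
  {φ : Flow ℝ M} {ι : S → M} {γ : Set M} {τ : OpenPartialHomeomorph M (ℝ × ℝ × UnitAddCircle)}
  {D : AlmostAnosovData φ ι} {N : SectionCoord D γ τ} {K : ℕ} {c : ℤ}

namespace SheetCoord

variable (C : SheetCoord N K c)

/-- The tube of radius `ε`. -/
def tube (ε : ℝ) : Set M :=
  γ ∪ {q | ∃ j, ∃ v ∈ C.pdom j, ‖v‖ < ε ∧ ∃ s, C.par j v s = q}

open Classical in
/-- The coordinates on a quadrant of the tube. -/
noncomputable def coord (j : Fin 4) (q : M) : ℂ × UnitAddCircle :=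
  if h : ∃ a : ℂ × ℝ, a.1 ∈ C.pdom j ∧ C.par j a.1 a.2 = q then
    (h.choose.1, ((h.choose.2 / K : ℝ) : UnitAddCircle)) else 0

variable {C}

theorem coord_par {j : Fin 4} {v : ℂ} (hv : v ∈ C.pdom j) (s : ℝ) :
    C.coord j (C.par j v s) = (v, ((s / K : ℝ) : UnitAddCircle)) := by
  have h : ∃ a : ℂ × ℝ, a.1 ∈ C.pdom j ∧ C.par j a.1 a.2 = C.par j v s := ⟨(v, s), hv, rfl⟩
  have hK : (K : ℝ) ≠ 0 := by exact_mod_cast C.K_pos.ne'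
  rw [coord, dif_pos h]
  obtain ⟨h1, h2⟩ := h.choose_spec
  have h3 := par_left_unique h1 hv h2
  rw [h3] at h2
  obtain ⟨i, hi⟩ := (par_eq_par_iff hv).1 h2
  refine Prod.ext h3 (coe_eq_coe_iff_int.2 ⟨-i, ?_⟩)
  have hi' : h.choose.2 = s - i * K := by linarith
  rw [hi']
  push_cast
  field_simp
  ring

theorem par_eq_of_coe_eq {j : Fin 4} {v : ℂ} (hv : v ∈ C.pdom j) {s s' : ℝ}
    (h : ((s / K : ℝ) : UnitAddCircle) = ((s' / K : ℝ) : UnitAddCircle)) :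
    C.par j v s = C.par j v s' := by
  have hK : (K : ℝ) ≠ 0 := by exact_mod_cast C.K_pos.ne'
  obtain ⟨i, hi⟩ := coe_eq_coe_iff_int.1 h
  refine (par_eq_par_iff hv).2 ⟨-i, ?_⟩
  push_cast
  field_simp at hi
  linarith

theorem continuousAt_coord (hι : IsBirkhoffSection φ ι) {j : Fin 4} {v : ℂ} (hv : v ∈ C.pdom j)
    (s : ℝ) : ContinuousWithinAt (C.coord j) {q | ∃ w ∈ C.pdom j, ∃ s, C.par j w s = q}
      (C.par j v s) := by
  intro A hA
  refine Filter.mem_map.2 (eventually_nhdsWithin_iff.2 (eventually_quadrant hι hv j ?_))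
  intro _ s' hs'
  rw [← hs', coord_par hv] at hA
  have hc : ContinuousAt (fun a : ℂ × ℝ => (a.1, ((a.2 / K : ℝ) : UnitAddCircle))) (v, s') :=
    continuousAt_fst.prodMk
      ((AddCircle.continuous_mk' (1 : ℝ)).continuousAt.comp (by fun_prop))
  filter_upwards [(hc.eventually_mem hA).filter_mono nhdsWithin_le_nhds, self_mem_nhdsWithin]
    with a ha ha'
  rw [coord_par ha'.1]
  exact ha

theorem isEmbedding_coord (hι : IsBirkhoffSection φ ι) (j : Fin 4) {A : Set M}
    (hA : A ⊆ {q | ∃ w ∈ C.pdom j, ∃ s, C.par j w s = q}) :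
    IsEmbedding fun q : A => C.coord j q := by
  refine ⟨isInducing_iff_nhds.2 fun q => le_antisymm ?_ ?_, ?_⟩
  · refine map_le_iff_le_comap.1 (?_ : Tendsto (fun q : A => C.coord j q) (𝓝 q) (𝓝 (C.coord j q)))
    obtain ⟨w, hw, s, hs⟩ := hA q.2
    have := (continuousAt_coord hι hw s).mono hA
    rw [hs] at this
    exact (continuousWithinAt_iff_continuousAt_domRestrict _ q.2).1 this
  · intro V hV
    obtain ⟨v, hv, s, hs⟩ := hA q.2
    rw [nhds_subtype_eq_comap, mem_comap] at hV
    obtain ⟨V', hV', hVV'⟩ := hV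
    rw [← hs] at hV'
    have h1 := (continuousOn_par (C := C) j (v, s) ⟨hv, mem_univ _⟩).eventually_mem hV'
    rw [eventually_nhdsWithin_iff] at h1
    have h2 := (isOpenMap_height C.K_pos).image_mem_nhds h1
    refine mem_comap.2 ⟨_, by rw [← hs, coord_par hv]; exact h2, ?_⟩
    rintro q' ⟨a, ha, ha'⟩
    refine hVV' ?_
    obtain ⟨v', hv', s', hs'⟩ := hA q'.2
    simp only [← hs', coord_par hv'] at ha'
    obtain ⟨h3, h4⟩ := Prod.ext_iff.1 ha'
    simp only at h3 h4
    subst h3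
    have h5 := ha ⟨hv', mem_univ _⟩
    rw [par_eq_of_coe_eq hv' h4] at h5
    rw [mem_preimage, ← hs']
    exact h5
  · rintro ⟨q, hq⟩ ⟨q', hq'⟩ h
    obtain ⟨v, hv, s, rfl⟩ := hA hq
    obtain ⟨v', hv', s', rfl⟩ := hA hq'
    simp only [coord_par hv, coord_par hv'] at h
    obtain ⟨rfl, h4⟩ := Prod.ext_iff.1 h
    exact Subtype.ext (par_eq_of_coe_eq hv h4)

variable (C) in
/-- The tube of radius `ε` lies in `O`, and its quadrants are those of the saddle chart. -/
structure IsAdapted (ε : ℝ) (O : Set M) : Prop where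
  pos : 0 < ε
  le : ε ≤ C.rad
  mem : ∀ j, ∀ v ∈ C.pdom j, ‖v‖ < ε → ∀ s, C.par j v s ∈ O ∩ τ.source
  quadrant_iff : ∀ j, ∀ v ∈ C.pdom j, ‖v‖ < ε → ∀ s i,
    ((τ (C.par j v s)).1, (τ (C.par j v s)).2.1) ∈ quadrant i ↔ v ∈ cquad i

theorem exists_isAdapted (hι : IsBirkhoffSection φ ι) (hγ : γ ∈ boundaryOrbits φ ι)
    (hτ : IsSaddleChart φ γ τ) {O : Set M} (hO : IsOpen O) (hγO : γ ⊆ O) :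
    ∃ ε, C.IsAdapted ε O := by
  obtain ⟨δ, h0, h1, h⟩ := D.exists_box_forward hι hγ hτ (hO.inter τ.open_source)
    (subset_inter hγO hτ.orbit_subset)
  obtain ⟨ρ, hρ, hρδ⟩ := N.image _ (isOpen_saddleBox (τ := τ) δ) (hτ.subset_saddleBox h0)
  have hl := D.pA.lam_pos
  have key : ∀ j, ∀ v ∈ C.pdom j, ‖v‖ < min C.rad (D.pA.lam ^ 2 * ρ) → ∀ s, ∃ u ∈ N.dom,
      ∃ t, D.pt u t = C.par j v s ∧ flowMap D.pA.lam t (N.Q u) = v ∧ D.pt u t ∈ O ∩ τ.source ∧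
      ∃ a > 0, ∃ b > 0, (τ (D.pt u t)).1 = a * (τ (ι u)).1 ∧
        (τ (D.pt u t)).2.1 = b * (τ (ι u)).2.1 := by
    intro j v hv hr s
    obtain ⟨u, hu, t, ht, h2, h3, -, -⟩ := par_rep hv s
    have h4 : ‖N.Q u‖ < ρ := by
      have h5 : N.Q u = flowMap D.pA.lam (-t) v := by
        rw [← h3, flowMap_add hl, neg_add_cancel, flowMap_zero]
      rw [h5]
      refine norm_flowMap_lt hl D.pA.lam_lt_one ?_ (hr.trans_le (min_le_right _ _))
      rw [abs_neg, abs_of_nonneg ht.1]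
      linarith [ht.2]
    obtain ⟨Ci, hC⟩ := hu
    exact ⟨u, ⟨Ci, hC⟩, t, h2, h3, h u (hρδ Ci u hC h4) t ⟨ht.1, ht.2.le⟩⟩
  refine ⟨min C.rad (D.pA.lam ^ 2 * ρ), lt_min C.rad_pos (by positivity), min_le_left _ _, ?_, ?_⟩
  · intro j v hv hr s
    obtain ⟨u, -, t, h2, -, h3, -⟩ := key j v hv hr s
    rwa [← h2]
  · intro j v hv hr s i
    obtain ⟨u, ⟨Ci, hC⟩, t, h2, h3, -, a, ha, b, hb, h4, h5⟩ := key j v hv hr s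
    rw [← h2, ← h3, flowMap_mem hl]
    have hs1 : SignType.sign (τ (D.pt u t)).1 = SignType.sign (N.Q u).re := by
      rw [h4, sign_mul, sign_pos ha, one_mul, N.sign_re Ci u hC]
    have hs2 : SignType.sign (τ (D.pt u t)).2.1 = SignType.sign (N.Q u).im := by
      rw [h5, sign_mul, sign_pos hb, one_mul, N.sign_im Ci u hC]
    exact ⟨fun h => cquad_of_sign (v := ⟨_, _⟩) h hs1.symm hs2.symm,
      fun h => cquad_of_sign (w := ⟨_, _⟩) h hs1 hs2⟩

theorem par_notMem_orbit (hι : IsBirkhoffSection φ ι) (hγ : γ ∈ boundaryOrbits φ ι)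
    {j : Fin 4} {v : ℂ} {s : ℝ} : C.par j v s ∉ γ := fun h =>
  par_notMem (hι.orbit_subset_image hγ h)

theorem tube_inter (hι : IsBirkhoffSection φ ι) (hγ : γ ∈ boundaryOrbits φ ι) (ε : ℝ) :
    C.tube ε ∩ ι '' bdry S = γ := by
  refine Subset.antisymm ?_ fun q hq => ⟨Or.inl hq, hι.orbit_subset_image hγ hq⟩
  rintro q ⟨hq | ⟨j, v, hv, hr, s, rfl⟩, hq'⟩
  · exact hq
  · exact absurd hq' par_notMem

theorem exists_saddleBox_subset_tube (hι : IsBirkhoffSection φ ι) (hγ : γ ∈ boundaryOrbits φ ι)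
    (hτ : IsSaddleChart φ γ τ) {ε : ℝ} (hε : 0 < ε) :
    ∃ δ, 0 < δ ∧ δ < 1 ∧ saddleBox τ δ ⊆ C.tube ε := by
  have hl := D.pA.lam_pos
  have hr0 : 0 < D.pA.lam ^ 2 * min C.rad ε := by
    have := lt_min C.rad_pos hε
    positivity
  obtain ⟨δ₁, hδ₁, -, hnear⟩ := N.near _ hr0
  obtain ⟨δ₂, hδ₂, h21, hback⟩ := D.exists_box_backward hι hγ hτ (isOpen_saddleBox (τ := τ) δ₁)
    (hτ.subset_saddleBox hδ₁)
  obtain ⟨O', hO', hγO', hiso⟩ := hι.exists_open_isolating hγ D.pA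
  obtain ⟨δ₃, hδ₃, -, hsub⟩ := hτ.exists_saddleBox_subset hO' hγO'
  refine ⟨min δ₂ δ₃, lt_min hδ₂ hδ₃, (min_le_left _ _).trans_lt h21, fun q hq => ?_⟩
  by_cases hqγ : q ∈ γ
  · exact Or.inl hqγ
  have hqb : q ∉ ι '' bdry S := fun h =>
    hqγ (hiso ⟨hsub (saddleBox_mono (min_le_right _ _) hq), h⟩)
  obtain ⟨u, t, ht, rfl⟩ := D.exists_rep hqb
  obtain ⟨Ci, hC, hQ⟩ := hnear u (hback u t ⟨ht.1, ht.2.le⟩ (saddleBox_mono (min_le_left _ _) hq))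
  have hu : u ∈ N.dom := ⟨Ci, hC⟩
  have h1 : ‖flowMap D.pA.lam t (N.Q u)‖ < min C.rad ε := by
    refine norm_flowMap_lt hl D.pA.lam_lt_one ?_ hQ
    rw [abs_of_nonneg ht.1]
    linarith [ht.2]
  obtain ⟨j, hj⟩ := exists_mem_cquad (N.Q u)
  obtain ⟨k, hk⟩ := C.exists_sec u hu j
  have hm : flowMap D.pA.lam t (N.Q u) ∈ C.pdom j := ⟨(flowMap_mem hl).2 hj,
    flowMap_ne_zero hl (N.ne_zero_of_mem_dom hu), h1.trans_le (min_le_left _ _)⟩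
  exact Or.inr ⟨j, _, hm, h1.trans_le (min_le_right _ _), _,
    (pt_eq_par hk ⟨by linarith [ht.1], by linarith [ht.2]⟩ hm).symm⟩

theorem isOpen_tube (hι : IsBirkhoffSection φ ι) (hγ : γ ∈ boundaryOrbits φ ι)
    (hτ : IsSaddleChart φ γ τ) {ε : ℝ} (hε : 0 < ε) : IsOpen (C.tube ε) := by
  rw [isOpen_iff_mem_nhds]
  rintro q (hq | ⟨j, v, hv, hr, s, rfl⟩)
  · obtain ⟨δ, h0, -, h⟩ := exists_saddleBox_subset_tube (C := C) hι hγ hτ hε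
    exact mem_of_superset ((isOpen_saddleBox δ).mem_nhds (hτ.subset_saddleBox h0 hq)) h
  · exact mem_of_superset (eventually_mem hι hv hr) fun q hq => Or.inr hq

theorem IsAdapted.tube_subset {ε : ℝ} {O : Set M} (h : C.IsAdapted ε O)
    (hτ : IsSaddleChart φ γ τ) (hγO : γ ⊆ O) : C.tube ε ⊆ O ∩ τ.source := by
  rintro q (hq | ⟨j, v, hv, hr, s, rfl⟩)
  · exact ⟨hγO hq, hτ.orbit_subset hq⟩
  · exact h.mem j v hv hr s

theorem IsAdapted.mem_puncturedQuadrant_iff {ε : ℝ} {O : Set M} (h : C.IsAdapted ε O)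
    (hι : IsBirkhoffSection φ ι) (hγ : γ ∈ boundaryOrbits φ ι) {i : Fin 4} {q : M} :
    q ∈ puncturedQuadrant τ (C.tube ε) γ i ↔ ∃ v ∈ C.pdom i, ‖v‖ < ε ∧ ∃ s, C.par i v s = q := by
  constructor
  · rintro ⟨⟨hq1, hq2⟩, hq3⟩
    obtain ⟨j, v, hv, hr, s, rfl⟩ := hq1.resolve_left hq3
    have h1 : v ∈ C.pdom i := ⟨(h.quadrant_iff j v hv hr s i).1 hq2, hv.2⟩
    obtain ⟨k, hk⟩ := par_change hv h1 s
    exact ⟨v, h1, hr, _, hk.symm⟩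
  · rintro ⟨v, hv, hr, s, rfl⟩
    exact ⟨⟨Or.inr ⟨i, v, hv, hr, s, rfl⟩, (h.quadrant_iff i v hv hr s i).2 hv.1⟩,
      par_notMem_orbit hι hγ⟩

end SheetCoord

end Tube


/-! ### The affine charts -/

section Smooth

variable {F : Type*} [NormedAddCommGroup F] [NormedSpace ℝ F]
  {X : Type*} [TopologicalSpace X] [ChartedSpace F X]

theorem mem_maximalAtlas_restrOpen_transHomeomorph [IsManifold 𝓘(ℝ, F) ∞ X]
    {f : OpenPartialHomeomorph X F} (hf : f ∈ atlas F X) {B : Set X} (hB : IsOpen B) (G : F ≃ₜ F)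
    (hG : ContDiff ℝ ∞ G) (hG' : ContDiff ℝ ∞ G.symm) :
    (f.restrOpen B hB).transHomeomorph G ∈ IsManifold.maximalAtlas 𝓘(ℝ, F) ∞ X := by
  have hm := IsManifold.subset_maximalAtlas (I := 𝓘(ℝ, F)) (n := ∞) hf
  refine OpenPartialHomeomorph.mem_maximalAtlas_of_contMDiffOn _ ?_ ?_
  · exact hG.contMDiff.comp_contMDiffOn ((contMDiffOn_of_mem_maximalAtlas hm).mono fun x hx => hx.1)
  · exact (contMDiffOn_symm_of_mem_maximalAtlas hm).comp hG'.contMDiff.contMDiffOn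
      fun x hx => hx.1

theorem mfderiv_apply_mfderiv [IsManifold 𝓘(ℝ, F) ∞ X] {ξ : OpenPartialHomeomorph X F}
    (hξ : ξ ∈ IsManifold.maximalAtlas 𝓘(ℝ, F) ∞ X) {σ : ℝ → X} {q : X} (h0 : σ 0 = q)
    (hq : q ∈ ξ.source) {w : ℝ → F} {w' : F} (hw : HasDerivAt w w' 0)
    (h : ∀ᶠ s in 𝓝 0, σ s ∈ ξ.source ∧ ξ (σ s) = w s) :
    (mfderiv 𝓘(ℝ, F) 𝓘(ℝ, F) ξ q : F → F)
      ((mfderiv 𝓘(ℝ, ℝ) 𝓘(ℝ, F) σ 0 : ℝ → F) (1 : ℝ)) = w' := by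
  subst h0
  have hw0 : w 0 = ξ (σ 0) := h.self_of_nhds.2.symm
  have hξd : MDifferentiableAt 𝓘(ℝ, F) 𝓘(ℝ, F) ξ (σ 0) :=
    (contMDiffAt_of_mem_maximalAtlas hξ hq).mdifferentiableAt (by simp)
  have hξs : MDifferentiableAt 𝓘(ℝ, F) 𝓘(ℝ, F) ξ.symm (w 0) := by
    rw [hw0]
    exact (contMDiffAt_symm_of_mem_maximalAtlas hξ (ξ.map_source hq)).mdifferentiableAt (by simp)
  have hwd : MDifferentiableAt 𝓘(ℝ, ℝ) 𝓘(ℝ, F) w 0 := hw.differentiableAt.mdifferentiableAt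
  have hσ : MDifferentiableAt 𝓘(ℝ, ℝ) 𝓘(ℝ, F) σ 0 := by
    refine (hξs.comp (0 : ℝ) hwd).congr_of_eventuallyEq ?_
    filter_upwards [h] with s hs
    rw [Function.comp_apply, ← hs.2, ξ.left_inv hs.1]
  have h1 := mfderiv_comp (0 : ℝ) hξd hσ
  have h2 : mfderiv 𝓘(ℝ, ℝ) 𝓘(ℝ, F) (ξ ∘ σ) 0 = mfderiv 𝓘(ℝ, ℝ) 𝓘(ℝ, F) w 0 :=
    EventuallyEq.mfderiv_eq (h.mono fun s hs => hs.2)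
  have h3 : (mfderiv 𝓘(ℝ, ℝ) 𝓘(ℝ, F) w 0 : ℝ → F) (1 : ℝ) = w' := by
    rw [mfderiv_eq_fderiv, hw.hasFDerivAt.fderiv]
    exact one_smul ℝ w'
  have h4 := congrArg (fun L : ℝ →L[ℝ] F => L (1 : ℝ)) (h1.symm.trans h2)
  exact h4.trans h3

/-- The straightening `(x, y, t) ↦ (± l ^ t (x - a), ± l ^ (-t) (y - b), (t + k) / K)`. -/
noncomputable def straighten (l : ℝ) {ε δ : ℝ} (hε : ε * ε = 1) (hδ : δ * δ = 1)
    (a b k : ℝ) {K : ℝ} (hK : K ≠ 0) : ℝ × ℝ × ℝ ≃ₜ ℝ × ℝ × ℝ where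
  toFun v := (Real.exp (Real.log l * v.2.2) * (ε * (v.1 - a)),
    Real.exp (-Real.log l * v.2.2) * (δ * (v.2.1 - b)), (v.2.2 + k) / K)
  invFun v := (ε * (Real.exp (-Real.log l * (K * v.2.2 - k)) * v.1) + a,
    δ * (Real.exp (Real.log l * (K * v.2.2 - k)) * v.2.1) + b, K * v.2.2 - k)
  left_inv v := by
    have h1 : K * ((v.2.2 + k) / K) - k = v.2.2 := by field_simp; ring
    have h2 : Real.exp (-Real.log l * v.2.2) * Real.exp (Real.log l * v.2.2) = 1 := by
      rw [← Real.exp_add]; simp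
    simp only [h1]
    refine Prod.ext ?_ (Prod.ext ?_ rfl)
    · linear_combination (v.1 - a) * hε + (v.1 - a) * ε * ε * h2
    · linear_combination (v.2.1 - b) * hδ + (v.2.1 - b) * δ * δ * h2
  right_inv v := by
    set T := K * v.2.2 - k with hT
    have h1 : (T + k) / K = v.2.2 := by rw [hT]; field_simp; ring
    have h2 : Real.exp (-Real.log l * T) * Real.exp (Real.log l * T) = 1 := by
      rw [← Real.exp_add]; simp
    refine Prod.ext ?_ (Prod.ext ?_ h1)
    · simp only
      linear_combination v.1 * hε + v.1 * ε * ε * h2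
    · simp only
      linear_combination v.2.1 * hδ + v.2.1 * δ * δ * h2
  continuous_toFun := by fun_prop
  continuous_invFun := by fun_prop

end Smooth

section Tube

variable {M : Type*} [MetricSpace M] [CompactSpace M]
  {S : Type*} [TopologicalSpace S] [ChartedSpace (EuclideanHalfSpace 2) S]
  [CompactSpace S] [T2Space S]
  {φ : Flow ℝ M} {ι : S → M} {γ : Set M} {τ : OpenPartialHomeomorph M (ℝ × ℝ × UnitAddCircle)}
  {D : AlmostAnosovData φ ι} {N : SectionCoord D γ τ} {K : ℕ} {c : ℤ}

theorem AlmostAnosovData.pt_eq_val {q : D.Space} {a : intr S × ℝ}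
    (h : D.toSusp q = Susp.mk D.P a) : D.pt a.1 a.2 = D.val q := by
  have : D.toSusp.symm (Susp.mk D.P a) = q := by rw [← h, Homeomorph.symm_apply_apply]
  exact congrArg D.val this

theorem AlmostAnosovData.toSusp_eq_iff {q : D.Space} {a : intr S × ℝ} :
    D.toSusp q = Susp.mk D.P a ↔ D.pt a.1 a.2 = D.val q := by
  refine ⟨AlmostAnosovData.pt_eq_val, fun h => ?_⟩
  have h1 : D.toSusp.symm (Susp.mk D.P a) = q := Subtype.ext h
  rw [← h1, Homeomorph.apply_symm_apply]

theorem flowMap_eq_exp {l : ℝ} (hl : 0 < l) (t : ℝ) (v : ℂ) :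
    flowMap l t v = ⟨Real.exp (Real.log l * t) * v.re, Real.exp (-Real.log l * t) * v.im⟩ := by
  rw [flowMap, linMap, Real.rpow_def_of_pos hl, ← Real.exp_neg, neg_mul]

namespace SheetCoord

variable {C : SheetCoord N K c}

/-- `Θ i`, the affine coordinates on a quadrant of the tube, with values in `ℝ² × ℝ/ℤ`. -/
noncomputable def chart (C : SheetCoord N K c) (i : Fin 4) (q : M) : ℝ × ℝ × UnitAddCircle :=
  ((C.coord i q).1.re, (C.coord i q).1.im, (C.coord i q).2)

theorem exists_affine_chart {i : Fin 4} {p n : ℕ} (hK : K = n * p) {A : Set M}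
    (hA : ∀ q ∈ A, ∃ v ∈ C.pdom i, ∃ s, C.par i v s = q) {q : D.Space} (hq : D.val q ∈ A) :
    ∃ ξ ∈ IsManifold.maximalAtlas 𝓘(ℝ, ℝ × ℝ × ℝ) ∞ D.Space, q ∈ ξ.source ∧
      ∀ q' ∈ ξ.source, D.val q' ∈ A → C.chart i (D.val q') = toCyl (ξ q') ∧
        mfderiv 𝓘(ℝ, ℝ × ℝ × ℝ) 𝓘(ℝ, ℝ × ℝ × ℝ) ξ q' (D.vectorField q') =
          affineField D.pA.lam p n (ξ q') := by
  have hl := D.pA.lam_pos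
  have hK0 : (K : ℝ) ≠ 0 := by exact_mod_cast C.K_pos.ne'
  obtain ⟨v, hv, s, hs⟩ := hA _ hq
  obtain ⟨u, hu, t, ht, h1, h2, h3, h4⟩ := par_rep hv s
  set k := ⌊s⌋
  have hqut : D.toSusp q = Susp.mk D.P (u, t) := AlmostAnosovData.toSusp_eq_iff.2 (h1.trans hs)
  obtain ⟨e, he, hue⟩ := D.pA.cover u
  obtain ⟨Ci, hCi⟩ := hu
  obtain ⟨ε, δ, a, b, hε, hδ, haff⟩ := N.affine Ci u hCi e he hue
  have hu : u ∈ N.dom := ⟨Ci, hCi⟩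
  have hε2 : ε * ε = 1 := by rcases hε with rfl | rfl <;> norm_num
  have hδ2 : δ * δ = 1 := by rcases hδ with rfl | rfl <;> norm_num
  have hcQ : ContinuousAt N.Q u := N.continuousOn_dom.continuousAt (N.isOpen_dom.mem_nhds hu)
  have hcv : ContinuousAt (fun a : intr S × ℝ => flowMap D.pA.lam a.2 (N.Q a.1)) (u, t) :=
    ContinuousAt.comp (g := fun a : ℝ × ℂ => flowMap D.pA.lam a.1 a.2)
      (f := fun a : intr S × ℝ => (a.2, N.Q a.1)) (continuous_flowMap D.pA.lam_pos).continuousAt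
      (continuousAt_snd.prodMk (ContinuousAt.comp (g := N.Q) (f := Prod.fst) (x := (u, t)) hcQ
        continuousAt_fst))
  have hrad : ∀ᶠ a : intr S × ℝ in 𝓝 (u, t), ‖flowMap D.pA.lam a.2 (N.Q a.1)‖ < C.rad :=
    hcv.norm.eventually_lt continuousAt_const (by simp only [h2]; exact hv.2.2)
  have htI : ∀ᶠ a : intr S × ℝ in 𝓝 (u, t), a.2 ∈ Ioo (t - 1 / 2) (t + 1 / 2) :=
    (isOpen_Ioo.preimage continuous_snd).mem_nhds
      (show t ∈ Ioo (t - 1 / 2) (t + 1 / 2) from ⟨by linarith, by linarith⟩)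
  have hsec := C.eventually_sec i k u hu (by rw [← flowMap_mem hl (t := t), h2]; exact hv.1) h3
  have hgood := (((continuousAt_fst (p := (u, t))).eventually
    ((hsec.and haff).and (e.open_source.mem_nhds hue))).and hrad).and htI
  obtain ⟨B₀, hgood, hB₀, hmem⟩ := mem_nhds_iff.1 hgood
  have hBopen : IsOpen (D.toSusp ⁻¹' (Susp.mk D.P '' B₀)) :=
    (Susp.isOpenMap_mk D.P _ hB₀).preimage D.toSusp.continuous
  let f := D.flowBox e (u, t)
  let G := straighten D.pA.lam hε2 hδ2 a b k hK0
  let ξ := (f.restrOpen _ hBopen).transHomeomorph G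
  have hfa : f ∈ atlas (ℝ × ℝ × ℝ) D.Space := ⟨e, he, (u, t), rfl⟩
  have hξm : ξ ∈ IsManifold.maximalAtlas 𝓘(ℝ, ℝ × ℝ × ℝ) ∞ D.Space := by
    refine mem_maximalAtlas_restrOpen_transHomeomorph hfa hBopen G ?_ ?_
    · change ContDiff ℝ ∞ fun v : ℝ × ℝ × ℝ => (Real.exp (Real.log D.pA.lam * v.2.2) *
        (ε * (v.1 - a)), Real.exp (-Real.log D.pA.lam * v.2.2) * (δ * (v.2.1 - b)), (v.2.2 + k) / K)
      fun_prop
    · change ContDiff ℝ ∞ fun v : ℝ × ℝ × ℝ => (ε * (Real.exp (-Real.log D.pA.lam *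
        (K * v.2.2 - k)) * v.1) + a, δ * (Real.exp (Real.log D.pA.lam * (K * v.2.2 - k)) * v.2.1) + b,
        K * v.2.2 - k)
      fun_prop
  have hξ : ∀ a ∈ B₀, ∀ q' : D.Space, D.toSusp q' = Susp.mk D.P a → q' ∈ ξ.source ∧
      ξ q' = ((flowMap D.pA.lam a.2 (N.Q a.1)).re, (flowMap D.pA.lam a.2 (N.Q a.1)).im,
        (a.2 + k) / K) := by
    intro x hx q' hq'
    obtain ⟨⟨⟨⟨-, h5⟩, h6⟩, -⟩, h7⟩ := hgood hx
    refine ⟨⟨D.mem_flowBox_source.2 ⟨x, hq', h6, h7⟩, x, hx, hq'.symm⟩, ?_⟩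
    change G (f q') = _
    rw [show f q' = _ from D.flowBox_apply hq' h7, h5, flowMap_eq_exp hl]
    refine Prod.ext ?_ (Prod.ext ?_ rfl)
    · change Real.exp (Real.log D.pA.lam * x.2) * (ε * (ε * (1 * (N.Q x.1).re) + a - a)) = _
      simp only
      linear_combination (Real.exp (Real.log D.pA.lam * x.2) * (N.Q x.1).re) * hε2
    · change Real.exp (-Real.log D.pA.lam * x.2) * (δ * (δ * (1⁻¹ * (N.Q x.1).im) + b - b)) = _
      simp only [inv_one]
      linear_combination (Real.exp (-Real.log D.pA.lam * x.2) * (N.Q x.1).im) * hδ2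
  refine ⟨ξ, hξm, (hξ _ hmem q hqut).1, fun q' hq' hqA => ?_⟩
  obtain ⟨x, hx, hxq⟩ : D.toSusp q' ∈ Susp.mk D.P '' B₀ := hq'.2
  obtain ⟨hqs, hqe⟩ := hξ x hx q' hxq.symm
  constructor
  · obtain ⟨⟨⟨⟨⟨h5, h6⟩, -⟩, -⟩, h7⟩, h8⟩ := hgood hx
    have h9 : x.2 ∈ Icc (-1 : ℝ) 2 := ⟨by linarith [ht.1, h8.1], by linarith [ht.2, h8.2]⟩
    have h10 := AlmostAnosovData.pt_eq_val hxq.symm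
    obtain ⟨w, hw, s', hs'⟩ := hA _ hqA
    have h11 := eq_of_pt_eq_par h5 h9 h7 hw (hs'.trans h10.symm)
    have h12 : N.Q x.1 ∈ cquad i := by
      rw [← flowMap_mem hl (t := x.2), h11]
      exact hw.1
    rw [← h10, pt_eq_par (h6 h12) h9 (by rwa [h11]), chart, coord_par (by rwa [h11]), hqe]
    rfl
  · have hσ : ∀ s, D.toSusp (D.flow s q') = Susp.mk D.P (x.1, x.2 + s) := by
      intro s
      rw [AlmostAnosovData.flow, Homeomorph.apply_symm_apply, ← hxq]
      rfl
    have hev : ∀ᶠ s : ℝ in 𝓝 0, (x.1, x.2 + s) ∈ B₀ := by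
      have hc : ContinuousAt (fun s : ℝ => (x.1, x.2 + s)) 0 := by fun_prop
      exact hc.eventually (hB₀.mem_nhds (by simpa using hx))
    set X := (N.Q x.1).re
    set Y := (N.Q x.1).im
    have hw : HasDerivAt (fun s : ℝ => (Real.exp (Real.log D.pA.lam * (x.2 + s)) * X,
        Real.exp (-Real.log D.pA.lam * (x.2 + s)) * Y, (x.2 + s + k) / K))
        (affineField D.pA.lam p n (ξ q')) 0 := by
      have key : ∀ l Z : ℝ, HasDerivAt (fun s : ℝ => Real.exp (l * (x.2 + s)) * Z)
          (l * (Real.exp (l * x.2) * Z)) 0 := by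
        intro l Z
        have h5 : HasDerivAt (fun s : ℝ => l * (x.2 + s)) l 0 := by
          simpa using ((hasDerivAt_id (0 : ℝ)).const_add x.2).const_mul l
        have := (h5.exp.mul_const Z)
        simp only [add_zero] at this
        exact this.congr_deriv (by ring)
      have h5 : HasDerivAt (fun s : ℝ => (x.2 + s + k) / K) (1 / ((n : ℝ) * p)) 0 := by
        have := ((((hasDerivAt_id (0 : ℝ)).const_add x.2).add_const (k : ℝ)).div_const (K : ℝ))
        rw [hK] at this ⊢
        push_cast at this ⊢
        exact this
      rw [hqe, flowMap_eq_exp hl]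
      exact (key _ X).prodMk ((key _ Y).prodMk h5)
    refine mfderiv_apply_mfderiv hξm (σ := fun s => D.flow s q') (D.flow_zero q') hqs hw ?_
    filter_upwards [hev] with s hs
    obtain ⟨h5, h6⟩ := hξ _ hs _ (hσ s)
    refine ⟨h5, h6.trans ?_⟩
    rw [flowMap_eq_exp hl]

end SheetCoord

end Tube


/-! ### The section and the glueing in the affine charts -/

/-- The disk of radius `ε`. -/
def disk (ε : ℝ) : Set (ℝ × ℝ) := {w | ‖(⟨w.1, w.2⟩ : ℂ)‖ < ε}

theorem isOpen_disk (ε : ℝ) : IsOpen (disk ε) := by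
  refine isOpen_lt ?_ continuous_const
  simp only [Complex.mk_eq_add_mul_I]
  fun_prop

theorem zero_mem_disk {ε : ℝ} (hε : 0 < ε) : (0, 0) ∈ disk ε := by
  change ‖(⟨0, 0⟩ : ℂ)‖ < ε
  rw [show (⟨0, 0⟩ : ℂ) = 0 from rfl, norm_zero]
  exact hε

theorem mem_halfAxis_iff {v : ℂ} {i : Fin 4} :
    (v.re, v.im) ∈ halfAxis i ↔ v ∈ cquad i ∧ v ∈ cquad (i + 1) ∧ v ≠ 0 := by
  have h0 : v ≠ 0 ↔ ¬ (v.re = 0 ∧ v.im = 0) := by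
    rw [ne_eq, Complex.ext_iff]
    rfl
  rw [h0]
  fin_cases i
  · change v.re = 0 ∧ 0 < v.im ↔ (0 ≤ v.re ∧ 0 ≤ v.im) ∧ (v.re ≤ 0 ∧ 0 ≤ v.im) ∧ _
    constructor
    · rintro ⟨h1, h2⟩
      exact ⟨⟨h1.ge, h2.le⟩, ⟨h1.le, h2.le⟩, fun h => h2.ne' h.2⟩
    · rintro ⟨⟨h1, h2⟩, ⟨h3, -⟩, h4⟩
      have h5 := le_antisymm h3 h1
      exact ⟨h5, lt_of_le_of_ne h2 fun h => h4 ⟨h5, h.symm⟩⟩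
  · change v.re < 0 ∧ v.im = 0 ↔ (v.re ≤ 0 ∧ 0 ≤ v.im) ∧ (v.re ≤ 0 ∧ v.im ≤ 0) ∧ _
    constructor
    · rintro ⟨h1, h2⟩
      exact ⟨⟨h1.le, h2.ge⟩, ⟨h1.le, h2.le⟩, fun h => h1.ne h.1⟩
    · rintro ⟨⟨h1, h2⟩, ⟨-, h3⟩, h4⟩
      have h5 := le_antisymm h3 h2
      exact ⟨lt_of_le_of_ne h1 fun h => h4 ⟨h, h5⟩, h5⟩
  · change v.re = 0 ∧ v.im < 0 ↔ (v.re ≤ 0 ∧ v.im ≤ 0) ∧ (0 ≤ v.re ∧ v.im ≤ 0) ∧ _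
    constructor
    · rintro ⟨h1, h2⟩
      exact ⟨⟨h1.le, h2.le⟩, ⟨h1.ge, h2.le⟩, fun h => h2.ne h.2⟩
    · rintro ⟨⟨h1, h2⟩, ⟨h3, -⟩, h4⟩
      have h5 := le_antisymm h1 h3
      exact ⟨h5, lt_of_le_of_ne h2 fun h => h4 ⟨h5, h⟩⟩
  · change 0 < v.re ∧ v.im = 0 ↔ (0 ≤ v.re ∧ v.im ≤ 0) ∧ (0 ≤ v.re ∧ 0 ≤ v.im) ∧ _
    constructor
    · rintro ⟨h1, h2⟩
      exact ⟨⟨h1.le, h2.le⟩, ⟨h1.le, h2.ge⟩, fun h => h1.ne' h.1⟩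
    · rintro ⟨⟨h1, h2⟩, ⟨-, h3⟩, h4⟩
      have h5 := le_antisymm h2 h3
      exact ⟨lt_of_le_of_ne h1 fun h => h4 ⟨h.symm, h5⟩, h5⟩

section Tube

variable {M : Type*} [MetricSpace M] [CompactSpace M]
  {S : Type*} [TopologicalSpace S] [ChartedSpace (EuclideanHalfSpace 2) S]
  [CompactSpace S] [T2Space S]
  {φ : Flow ℝ M} {ι : S → M} {γ : Set M} {τ : OpenPartialHomeomorph M (ℝ × ℝ × UnitAddCircle)}
  {D : AlmostAnosovData φ ι} {N : SectionCoord D γ τ} {K : ℕ} {c : ℤ}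

namespace SheetCoord

variable {C : SheetCoord N K c} {ε : ℝ} {O : Set M}

theorem chart_par {i : Fin 4} {v : ℂ} (hv : v ∈ C.pdom i) (s : ℝ) :
    C.chart i (C.par i v s) = (v.re, v.im, ((s / K : ℝ) : UnitAddCircle)) := by
  rw [chart, coord_par hv]

theorem IsAdapted.pdom_mem (hA : C.IsAdapted ε O) {i : Fin 4} {w : ℝ × ℝ}
    (h : w ∈ (disk ε ∩ quadrant i) \ {(0, 0)}) : (⟨w.1, w.2⟩ : ℂ) ∈ C.pdom i := by
  refine ⟨h.1.2, fun h0 => h.2 ?_, h.1.1.trans_le hA.le⟩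
  exact Prod.ext (congrArg Complex.re h0) (congrArg Complex.im h0)

theorem mem_disk_of_pdom {i : Fin 4} {v : ℂ} (hv : v ∈ C.pdom i) (hr : ‖v‖ < ε) :
    (v.re, v.im) ∈ (disk ε ∩ quadrant i) \ {(0, 0)} :=
  ⟨⟨hr, hv.1⟩, fun h => hv.2.1 (Complex.ext (congrArg Prod.fst h) (congrArg Prod.snd h))⟩

theorem exists_height (C : SheetCoord N K c) (z : UnitAddCircle) :
    ∃ s : ℝ, ((s / K : ℝ) : UnitAddCircle) = z := by
  have hK0 : (K : ℝ) ≠ 0 := by exact_mod_cast C.K_pos.ne'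
  induction z using QuotientAddGroup.induction_on with | H a => ?_
  exact ⟨a * K, by rw [mul_div_cancel_right₀ _ hK0]⟩

theorem IsAdapted.isEmbedding_chart (hA : C.IsAdapted ε O) (hι : IsBirkhoffSection φ ι)
    (hγ : γ ∈ boundaryOrbits φ ι) (i : Fin 4) :
    IsEmbedding fun q : puncturedQuadrant τ (C.tube ε) γ i => C.chart i q := by
  have h := isEmbedding_coord (C := C) hι i (A := puncturedQuadrant τ (C.tube ε) γ i)
    (fun q hq => by
      obtain ⟨v, hv, -, s, hs⟩ := (hA.mem_puncturedQuadrant_iff hι hγ).1 hq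
      exact ⟨v, hv, s, hs⟩)
  exact (((Complex.equivRealProdCLM.toHomeomorph.prodCongr (Homeomorph.refl UnitAddCircle)).trans
    (Homeomorph.prodAssoc ℝ ℝ UnitAddCircle)).isEmbedding).comp h

theorem IsAdapted.image_chart (hA : C.IsAdapted ε O) (hι : IsBirkhoffSection φ ι)
    (hγ : γ ∈ boundaryOrbits φ ι) (i : Fin 4) :
    C.chart i '' puncturedQuadrant τ (C.tube ε) γ i =
      {v | (v.1, v.2.1) ∈ (disk ε ∩ quadrant i) \ {(0, 0)}} := by
  ext w
  constructor
  · rintro ⟨q, hq, rfl⟩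
    obtain ⟨v, hv, hr, s, rfl⟩ := (hA.mem_puncturedQuadrant_iff hι hγ).1 hq
    rw [chart_par hv]
    exact mem_disk_of_pdom hv hr
  · intro hw
    obtain ⟨s, hs⟩ := C.exists_height w.2.2
    have hv := hA.pdom_mem hw
    refine ⟨_, (hA.mem_puncturedQuadrant_iff hι hγ).2 ⟨_, hv, hw.1.1, s, rfl⟩, ?_⟩
    rw [chart_par hv, hs]

theorem height_eq_iff {p n : ℕ} (C : SheetCoord N K c) (hK : K = n * p) (s : ℝ) (k : ℕ) :
    ((s / K : ℝ) : UnitAddCircle) = (((k : ℝ) / ((n : ℝ) * (p : ℝ)) : ℝ) : UnitAddCircle) ↔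
      ∃ i : ℤ, s = k + i * K := by
  have hK0 : (K : ℝ) ≠ 0 := by exact_mod_cast C.K_pos.ne'
  rw [show (n : ℝ) * p = K by rw [hK]; push_cast; rfl, coe_eq_coe_iff_int]
  refine exists_congr fun i => ?_
  rw [div_add' _ _ _ hK0, div_left_inj' hK0]

theorem exists_height_of_int {p n : ℕ} (C : SheetCoord N K c) (hK : K = n * p) (k : ℤ) :
    ∃ k' < n * p, (((k : ℝ) / K : ℝ) : UnitAddCircle) =
      (((k' : ℝ) / ((n : ℝ) * (p : ℝ)) : ℝ) : UnitAddCircle) := by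
  have hK0 : (K : ℤ) ≠ 0 := by exact_mod_cast C.K_pos.ne'
  have h0 := Int.emod_nonneg k hK0
  have h1 := Int.emod_lt_of_pos k (show (0 : ℤ) < K by exact_mod_cast C.K_pos)
  refine ⟨(k % K).toNat, by rw [← hK]; omega, (C.height_eq_iff hK _ _).2 ⟨k / K, ?_⟩⟩
  have h2 : (((k % K).toNat : ℕ) : ℝ) = ((k % K : ℤ) : ℝ) := by
    exact_mod_cast Int.toNat_of_nonneg h0
  rw [h2]
  exact_mod_cast (by rw [mul_comm]; exact (Int.emod_add_mul_ediv k K).symm :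
    k = k % K + k / K * K)

theorem IsAdapted.mem_range_iff (hA : C.IsAdapted ε O) (hι : IsBirkhoffSection φ ι)
    (hγ : γ ∈ boundaryOrbits φ ι) {p n : ℕ} (hK : K = n * p) (i : Fin 4) :
    ∀ q ∈ puncturedQuadrant τ (C.tube ε) γ i, q ∈ range ι ↔ ∃ k < n * p, (C.chart i q).2.2 =
      ((((k : ℝ) / ((n : ℝ) * (p : ℝ)) : ℝ)) : UnitAddCircle) := by
  intro q hq
  obtain ⟨v, hv, hr, s, rfl⟩ := (hA.mem_puncturedQuadrant_iff hι hγ).1 hq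
  rw [par_mem_range_iff, chart_par hv]
  constructor
  · rintro ⟨k, rfl⟩
    exact C.exists_height_of_int hK k
  · rintro ⟨k, -, hk⟩
    obtain ⟨i, hi⟩ := (C.height_eq_iff hK _ _).1 hk
    exact ⟨k + i * K, by rw [hi]; push_cast; rfl⟩

theorem IsAdapted.image_component (hA : C.IsAdapted ε O) (hι : IsBirkhoffSection φ ι)
    (hγ : γ ∈ boundaryOrbits φ ι) {p n : ℕ} (hK : K = n * p) (i : Fin 4) :
    ∀ q ∈ range ι ∩ puncturedQuadrant τ (C.tube ε) γ i, ∃ k < n * p,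
      C.chart i '' connectedComponentIn (range ι ∩ puncturedQuadrant τ (C.tube ε) γ i) q =
        {v | (v.1, v.2.1) ∈ (disk ε ∩ quadrant i) \ {(0, 0)} ∧
          v.2.2 = ((((k : ℝ) / ((n : ℝ) * (p : ℝ)) : ℝ)) : UnitAddCircle)} := by
  intro q hq
  obtain ⟨v, hv, hr, s, rfl⟩ := (hA.mem_puncturedQuadrant_iff hι hγ).1 hq.2
  obtain ⟨k, rfl⟩ := par_mem_range_iff.1 hq.1
  obtain ⟨k', hk', hkk⟩ := C.exists_height_of_int hK k
  refine ⟨k', hk', ?_⟩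
  set R := range ι ∩ puncturedQuadrant τ (C.tube ε) γ i with hR
  have hmem : ∀ w ∈ C.pdom i, ‖w‖ < ε → C.par i w k ∈ R := fun w hw hwr =>
    ⟨par_mem_range_iff.2 ⟨k, rfl⟩, (hA.mem_puncturedQuadrant_iff hι hγ).2 ⟨w, hw, hwr, _, rfl⟩⟩
  ext w
  constructor
  · rintro ⟨q', hq', rfl⟩
    have hsub := connectedComponentIn_subset R (C.par i v k)
    have hfc : ContinuousOn (fun q => (C.coord i q).2)
        (connectedComponentIn R (C.par i v k)) := by
      intro q'' hq''
      obtain ⟨w, hw, -, s, rfl⟩ := (hA.mem_puncturedQuadrant_iff hι hγ).1 (hsub hq'').2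
      refine continuous_snd.continuousAt.comp_continuousWithinAt
        ((continuousAt_coord hι hw s).mono fun q''' h''' => ?_)
      obtain ⟨w, hw, -, s, hs⟩ := (hA.mem_puncturedQuadrant_iff hι hγ).1 (hsub h''').2
      exact ⟨w, hw, s, hs⟩
    have htor : ∀ q'' ∈ connectedComponentIn R (C.par i v k), K • (C.coord i q'').2 = 0 := by
      intro q'' hq''
      have h1 := hsub hq''
      obtain ⟨w, hw, -, s, rfl⟩ := (hA.mem_puncturedQuadrant_iff hι hγ).1 h1.2
      obtain ⟨l, rfl⟩ := par_mem_range_iff.1 h1.1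
      have hK0 : (K : ℝ) ≠ 0 := by exact_mod_cast C.K_pos.ne'
      rw [coord_par hw, ← AddCircle.coe_nsmul, nsmul_eq_mul, mul_div_cancel₀ _ hK0]
      exact coe_eq_coe_iff_int.2 ⟨l, by simp⟩
    have heq := eq_of_nsmul_eq_zero isPreconnected_connectedComponentIn hfc C.K_pos htor hq'
      (mem_connectedComponentIn hq)
    obtain ⟨w, hw, hwr, s, rfl⟩ := (hA.mem_puncturedQuadrant_iff hι hγ).1 (hsub hq').2
    simp only [coord_par hw, coord_par hv] at heq
    rw [chart_par hw]
    exact ⟨mem_disk_of_pdom hw hwr, heq.trans hkk⟩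
  · rintro ⟨h1, h2⟩
    obtain ⟨w', hw'⟩ : ∃ w' : ℂ, w' = ⟨w.1, w.2.1⟩ := ⟨_, rfl⟩
    have hw : w' ∈ C.pdom i := hw' ▸ hA.pdom_mem h1
    have hwε : ‖w'‖ < ε := hw' ▸ h1.1.1
    have hc : ContinuousOn (fun v : ℂ => C.par i v k) {v | v ∈ cquad i ∧ v ≠ 0 ∧ ‖v‖ < ε} :=
      ContinuousOn.comp (g := fun a : ℂ × ℝ => C.par i a.1 a.2) (f := fun v : ℂ => (v, (k : ℝ)))
        (t := C.pdom i ×ˢ univ) (continuousOn_par i) (by fun_prop)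
        fun v hv => ⟨⟨hv.1, hv.2.1, hv.2.2.trans_le hA.le⟩, mem_univ _⟩
    have hpre := (isPreconnected_cquad i ε).image _ hc
    have hsub : (fun v : ℂ => C.par i v k) '' {v | v ∈ cquad i ∧ v ≠ 0 ∧ ‖v‖ < ε} ⊆ R := by
      rintro _ ⟨v', hv', rfl⟩
      exact hmem v' ⟨hv'.1, hv'.2.1, hv'.2.2.trans_le hA.le⟩ hv'.2.2
    have hcc := hpre.subset_connectedComponentIn (mem_image_of_mem _ ⟨hv.1, hv.2.1, hr⟩) hsub
    refine ⟨C.par i w' k, hcc (mem_image_of_mem _ ⟨hw.1, hw.2.1, hwε⟩), ?_⟩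
    rw [chart_par hw, hw']
    exact Prod.ext rfl (Prod.ext rfl (hkk.trans h2.symm))

theorem IsAdapted.isometry (hA : C.IsAdapted ε O) (hι : IsBirkhoffSection φ ι)
    (hγ : γ ∈ boundaryOrbits φ ι) (i : Fin 4) :
    ∀ e ∈ D.pA.charts, ∀ u ∈ e.source, ι u ∈ puncturedQuadrant τ (C.tube ε) γ i →
      ∃ V ∈ 𝓝 u, ∀ u₁ ∈ V, ∀ u₂ ∈ V, ι u₁ ∈ puncturedQuadrant τ (C.tube ε) γ i →
        ι u₂ ∈ puncturedQuadrant τ (C.tube ε) γ i →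
        ((C.chart i (ι u₁)).1 - (C.chart i (ι u₂)).1) ^ 2 +
          ((C.chart i (ι u₁)).2.1 - (C.chart i (ι u₂)).2.1) ^ 2 =
          ((e u₁).1 - (e u₂).1) ^ 2 + ((e u₁).2 - (e u₂).2) ^ 2 := by
  have key : ∀ u : intr S, ι u ∈ puncturedQuadrant τ (C.tube ε) γ i → u ∈ N.dom ∧
      (C.chart i (ι u)).1 = (N.Q u).re ∧ (C.chart i (ι u)).2.1 = (N.Q u).im := by
    intro u hu
    obtain ⟨v, hv, hr, s, hs⟩ := (hA.mem_puncturedQuadrant_iff hι hγ).1 hu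
    obtain ⟨k, rfl⟩ := par_mem_range_iff.1 ⟨_, hs.symm⟩
    have hu' : C.sec i k v = u := by
      rw [par_int, ← D.pt_zero, ← D.pt_zero] at hs
      exact (D.rep_unique ⟨le_rfl, one_pos⟩ ⟨le_rfl, one_pos⟩ hs).1
    have hη : ‖v‖ < N.η := by simpa [flowMap_zero] using C.norm_lt_η (t := 0) (by simp) hv.2.2
    rw [← hs, chart_par hv, ← hu', C.Q_sec _ _ _ hv.2.1 hη]
    exact ⟨C.sec_mem _ _ _ hv.2.1 hη, rfl, rfl⟩
  intro e he u hue hu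
  obtain ⟨⟨Ci, hCi⟩, -⟩ := key u hu
  obtain ⟨ε', δ', a, b, hε, hδ, haff⟩ := N.affine Ci u hCi e he hue
  refine ⟨_, haff, fun u₁ h₁ u₂ h₂ hu₁ hu₂ => ?_⟩
  obtain ⟨-, h3, h4⟩ := key u₁ hu₁
  obtain ⟨-, h5, h6⟩ := key u₂ hu₂
  rw [h3, h4, h5, h6, show e u₁ = _ from h₁, show e u₂ = _ from h₂]
  have hε2 : ε' ^ 2 = 1 := by rcases hε with rfl | rfl <;> norm_num
  have hδ2 : δ' ^ 2 = 1 := by rcases hδ with rfl | rfl <;> norm_num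
  simp only [inv_one]
  linear_combination -((N.Q u₁).re - (N.Q u₂).re) ^ 2 * hε2 -
    ((N.Q u₁).im - (N.Q u₂).im) ^ 2 * hδ2

theorem IsAdapted.glue (hA : C.IsAdapted ε O) (hι : IsBirkhoffSection φ ι)
    (hγ : γ ∈ boundaryOrbits φ ι) {a : ℝ}
    (ha : (((c : ℝ) / K : ℝ) : UnitAddCircle) = (a : UnitAddCircle)) (i : Fin 4) :
    C.chart i '' (puncturedQuadrant τ (C.tube ε) γ i ∩ puncturedQuadrant τ (C.tube ε) γ (i + 1)) =
        {v | (v.1, v.2.1) ∈ disk ε ∩ halfAxis i} ∧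
      C.chart (i + 1) '' (puncturedQuadrant τ (C.tube ε) γ i ∩
        puncturedQuadrant τ (C.tube ε) γ (i + 1)) = {v | (v.1, v.2.1) ∈ disk ε ∩ halfAxis i} ∧
      ∀ q ∈ puncturedQuadrant τ (C.tube ε) γ i ∩ puncturedQuadrant τ (C.tube ε) γ (i + 1),
        C.chart (i + 1) q = ((C.chart i q).1, (C.chart i q).2.1, (C.chart i q).2.2 +
          ((if i = 3 then a else 0 : ℝ) : UnitAddCircle)) := by
  set B := puncturedQuadrant τ (C.tube ε) γ i ∩ puncturedQuadrant τ (C.tube ε) γ (i + 1)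
  have hB : ∀ q ∈ B, ∃ v ∈ C.pdom i, v ∈ C.pdom (i + 1) ∧ ‖v‖ < ε ∧ ∃ s, C.par i v s = q := by
    rintro q ⟨h1, h2⟩
    obtain ⟨v, hv, hr, s, rfl⟩ := (hA.mem_puncturedQuadrant_iff hι hγ).1 h1
    obtain ⟨v', hv', hr', s', hs'⟩ := (hA.mem_puncturedQuadrant_iff hι hγ).1 h2
    obtain rfl := par_left_unique hv' hv hs'
    exact ⟨v', hv, hv', hr, s, rfl⟩
  have hB' : ∀ v ∈ C.pdom i, v ∈ C.pdom (i + 1) → ‖v‖ < ε → ∀ s, C.par i v s ∈ B := by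
    intro v hv hv' hr s
    obtain ⟨k, hk⟩ := par_change hv hv' s
    exact ⟨(hA.mem_puncturedQuadrant_iff hι hγ).2 ⟨v, hv, hr, s, rfl⟩,
      (hA.mem_puncturedQuadrant_iff hι hγ).2 ⟨v, hv', hr, _, hk.symm⟩⟩
  have hglue : ∀ q ∈ B, C.chart (i + 1) q = ((C.chart i q).1, (C.chart i q).2.1,
      (C.chart i q).2.2 + ((if i = 3 then a else 0 : ℝ) : UnitAddCircle)) := by
    intro q hq
    obtain ⟨v, hv, hv', hr, s, rfl⟩ := hB q hq
    rw [chart_par hv]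
    by_cases hi : i = 3
    · subst hi
      have h30 : (3 + 1 : Fin 4) = 0 := rfl
      rw [h30] at hv' ⊢
      rw [← par_last hv hv', chart_par hv', if_pos rfl, ← ha]
      refine Prod.ext rfl (Prod.ext rfl ?_)
      rw [← AddCircle.coe_add, add_div]
    · rw [← par_succ hi hv hv', chart_par hv', if_neg hi]
      simp
  have himage : C.chart i '' B = {v | (v.1, v.2.1) ∈ disk ε ∩ halfAxis i} := by
    ext w
    constructor
    · rintro ⟨q, hq, rfl⟩
      obtain ⟨v, hv, hv', hr, s, rfl⟩ := hB q hq
      rw [chart_par hv]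
      exact ⟨hr, mem_halfAxis_iff.2 ⟨hv.1, hv'.1, hv.2.1⟩⟩
    · rintro ⟨h1, h2⟩
      obtain ⟨h3, h4, h5⟩ := mem_halfAxis_iff (v := ⟨w.1, w.2.1⟩).1 h2
      obtain ⟨s, hs⟩ := C.exists_height w.2.2
      have hr : ‖(⟨w.1, w.2.1⟩ : ℂ)‖ < C.rad := h1.trans_le hA.le
      exact ⟨_, hB' _ ⟨h3, h5, hr⟩ ⟨h4, h5, hr⟩ h1 s, by rw [chart_par ⟨h3, h5, hr⟩, hs]⟩
  refine ⟨himage, ?_, hglue⟩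
  set b : UnitAddCircle := ((if i = 3 then a else 0 : ℝ) : UnitAddCircle)
  have h1 : C.chart (i + 1) '' B = (fun v : ℝ × ℝ × UnitAddCircle => (v.1, v.2.1, v.2.2 + b)) ''
      (C.chart i '' B) := by
    rw [image_image]
    exact image_congr hglue
  rw [h1, himage]
  ext w
  constructor
  · rintro ⟨v, hv, rfl⟩
    exact hv
  · intro hw
    exact ⟨(w.1, w.2.1, w.2.2 - b), hw, by simp⟩

end SheetCoord

end Tube


/-! ### Lifts over convex sets -/

theorem locallyPathConnectedSpace_of_convex {E : Type*} [NormedAddCommGroup E] [NormedSpace ℝ E]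
    {J : Set E} (hJ : Convex ℝ J) : LocallyPathConnectedSpace J := by
  refine LocallyPathConnectedSpace.of_bases (p := fun _ r => 0 < r)
    (s := fun x r => (Subtype.val ⁻¹' (Metric.ball (x : E) r ∩ J) : Set J)) (fun x => ?_) ?_
  · have h := (Metric.nhds_basis_ball (x := (x : E))).comap (Subtype.val : J → E)
    rw [← nhds_subtype_eq_comap] at h
    exact h.congr (fun _ => Iff.rfl) fun r _ => ext fun y => ⟨fun h => ⟨h, y.2⟩, fun h => h.1⟩
  · intro x r hr
    refine IsPathConnected.preimage_coe ?_ inter_subset_right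
    exact ((convex_ball _ _).inter hJ).isPathConnected ⟨x, Metric.mem_ball_self hr, x.2⟩

theorem exists_real_lift_of_convex {E : Type*} [NormedAddCommGroup E] [NormedSpace ℝ E]
    {J : Set E} (hJ : Convex ℝ J) (hne : J.Nonempty) {f : E → UnitAddCircle}
    (hf : ContinuousOn f J) :
    ∃ F : E → ℝ, ContinuousOn F J ∧ ∀ v ∈ J, (F v : UnitAddCircle) = f v := by
  obtain ⟨a, ha⟩ := hne
  have := locallyPathConnectedSpace_of_convex hJ
  have := hJ.contractibleSpace ⟨a, ha⟩
  obtain ⟨r, hr⟩ := QuotientAddGroup.mk_surjective (f a)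
  obtain ⟨F, ⟨-, hF⟩, -⟩ := (AddCircle.isCoveringMap_coe (1 : ℝ)).existsUnique_continuousMap_lifts
    (A := J) ⟨J.domRestrict f, hf.domRestrict⟩ ⟨a, ha⟩ r hr
  classical
  refine ⟨fun v => if h : v ∈ J then F ⟨v, h⟩ else 0, ?_, ?_⟩
  · rw [continuousOn_iff_continuous_domRestrict]
    refine F.continuous.congr fun v => ?_
    simp
  · intro v hv
    simp only [dif_pos hv]
    exact congrFun hF ⟨v, hv⟩

theorem cquad_opposite {v : ℂ} {j : Fin 4} (h : v ∈ cquad j) (h' : v ∈ cquad (j + 2)) : v = 0 := by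
  fin_cases j
  · exact Complex.ext (le_antisymm h'.1 h.1) (le_antisymm h'.2 h.2)
  · exact Complex.ext (le_antisymm h.1 h'.1) (le_antisymm h'.2 h.2)
  · exact Complex.ext (le_antisymm h.1 h'.1) (le_antisymm h.2 h'.2)
  · exact Complex.ext (le_antisymm h'.1 h.1) (le_antisymm h.2 h'.2)

theorem exp_mem_cquad {x : ℝ} (h0 : 0 ≤ x) (h1 : x ≤ Real.pi / 2) (j : Fin 4) :
    Complex.exp (x * Complex.I) * Complex.I ^ (j : ℕ) ∈ cquad j := by
  have hc : 0 ≤ Real.cos x := Real.cos_nonneg_of_mem_Icc ⟨by linarith, h1⟩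
  have hs : 0 ≤ Real.sin x := Real.sin_nonneg_of_nonneg_of_le_pi h0 (by linarith [Real.pi_pos])
  have hz : Complex.exp (x * Complex.I) = ⟨Real.cos x, Real.sin x⟩ := by
    rw [Complex.exp_mul_I, Complex.mk_eq_add_mul_I]
    push_cast
    rfl
  rw [hz]
  have hI3 : Complex.I ^ 3 = -Complex.I := Complex.I_pow_three
  fin_cases j
  · change (⟨Real.cos x, Real.sin x⟩ : ℂ) * Complex.I ^ 0 ∈ cquad 0
    rw [pow_zero, mul_one]
    exact ⟨hc, hs⟩
  · change (⟨Real.cos x, Real.sin x⟩ : ℂ) * Complex.I ^ 1 ∈ cquad 1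
    rw [pow_one]
    exact ⟨by simpa using hs, by simpa using hc⟩
  · change (⟨Real.cos x, Real.sin x⟩ : ℂ) * Complex.I ^ 2 ∈ cquad 2
    rw [Complex.I_sq]
    exact ⟨by simpa using hc, by simpa using hs⟩
  · change (⟨Real.cos x, Real.sin x⟩ : ℂ) * Complex.I ^ 3 ∈ cquad 3
    rw [hI3]
    exact ⟨by simpa using hs, by simpa using hc⟩

theorem toCircle_coe_eq (s : ℝ) : ((AddCircle.toCircle (s : UnitAddCircle) : Circle) : ℂ) =
    Complex.exp ((2 * Real.pi * s : ℝ) * Complex.I) := by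
  rw [AddCircle.toCircle_apply_mk, Circle.coe_exp]
  simp

theorem toCircle_mem_cquad (j : Fin 4) {s : ℝ} (h0 : (j : ℕ) / 4 ≤ s) (h1 : s ≤ ((j : ℕ) + 1) / 4) :
    ((AddCircle.toCircle (s : UnitAddCircle) : Circle) : ℂ) ∈ cquad j := by
  have hpi := Real.pi_pos
  have h2 : ((AddCircle.toCircle (s : UnitAddCircle) : Circle) : ℂ) =
      Complex.exp ((2 * Real.pi * (s - (j : ℕ) / 4) : ℝ) * Complex.I) * Complex.I ^ (j : ℕ) := by
    have hI : Complex.I ^ (j : ℕ) = Complex.exp ((j : ℕ) * (Real.pi / 2 * Complex.I)) := by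
      rw [Complex.exp_nat_mul, Complex.exp_pi_div_two_mul_I]
    rw [toCircle_coe_eq, hI, ← Complex.exp_add]
    congr 1
    push_cast
    ring
  rw [h2]
  refine exp_mem_cquad ?_ ?_ j
  · have : 0 ≤ s - (j : ℕ) / 4 := by linarith
    positivity
  · nlinarith

section Tube

variable {M : Type*} [MetricSpace M] [CompactSpace M]
  {S : Type*} [TopologicalSpace S] [ChartedSpace (EuclideanHalfSpace 2) S]
  [CompactSpace S] [T2Space S]
  {φ : Flow ℝ M} {ι : S → M} {γ : Set M} {τ : OpenPartialHomeomorph M (ℝ × ℝ × UnitAddCircle)}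
  {D : AlmostAnosovData φ ι} {N : SectionCoord D γ τ} {K : ℕ} {c : ℤ}

/-- The box of size `δ` around `0 × ℝ/ℤ`, without its core. -/
def puncturedBox (δ : ℝ) : Set (ℝ × ℝ × UnitAddCircle) :=
  {w | |w.1| < δ ∧ |w.2.1| < δ ∧ ¬ (w.1 = 0 ∧ w.2.1 = 0)}

theorem IsSaddleChart.mem_target_of_puncturedBox (hτ : IsSaddleChart φ γ τ) {δ : ℝ} (hδ : δ ≤ 1)
    {w : ℝ × ℝ × UnitAddCircle} (hw : w ∈ puncturedBox δ) : w ∈ τ.target :=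
  hτ.mem_target.2 ⟨hw.1.trans_le hδ, hw.2.1.trans_le hδ⟩

theorem IsSaddleChart.symm_mem_of_puncturedBox (hτ : IsSaddleChart φ γ τ) {δ : ℝ} (hδ : δ ≤ 1)
    {w : ℝ × ℝ × UnitAddCircle} (hw : w ∈ puncturedBox δ) :
    τ.symm w ∈ saddleBox τ δ ∧ τ.symm w ∉ γ := by
  have h := hτ.mem_target_of_puncturedBox hδ hw
  have h1 := τ.map_target h
  refine ⟨⟨h1, ?_⟩, fun h2 => ?_⟩
  · rw [τ.right_inv h]
    exact ⟨hw.1, hw.2.1⟩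
  · have := (hτ.mem_orbit_iff _ h1).1 h2
    rw [τ.right_inv h] at this
    exact hw.2.2 this

theorem IsSaddleChart.mem_puncturedBox (hτ : IsSaddleChart φ γ τ) {δ : ℝ} {q : M}
    (hq : q ∈ saddleBox τ δ) (hqγ : q ∉ γ) : τ q ∈ puncturedBox δ :=
  ⟨hq.2.1, hq.2.2, fun h => hqγ ((hτ.mem_orbit_iff q hq.1).2 h)⟩

theorem puncturedBox_scale {δ δ' κ : ℝ} (hκ : 0 < κ) (h : κ * δ ≤ δ') {w : ℝ × ℝ × UnitAddCircle}
    (hw : w ∈ puncturedBox δ) : (κ * w.1, κ * w.2.1, w.2.2) ∈ puncturedBox δ' := by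
  refine ⟨?_, ?_, ?_⟩
  · rw [abs_mul, abs_of_pos hκ]
    exact (mul_lt_mul_of_pos_left hw.1 hκ).trans_le h
  · rw [abs_mul, abs_of_pos hκ]
    exact (mul_lt_mul_of_pos_left hw.2.1 hκ).trans_le h
  · rintro ⟨h1, h2⟩
    exact hw.2.2 ⟨(mul_eq_zero.1 h1).resolve_left hκ.ne', (mul_eq_zero.1 h2).resolve_left hκ.ne'⟩

theorem circle_mem_puncturedBox {δ : ℝ} (hδ : 0 < δ) (a b : UnitAddCircle) :
    (δ * (((AddCircle.toCircle a : Circle) : ℂ).re / 2),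
      δ * (((AddCircle.toCircle a : Circle) : ℂ).im / 2), b) ∈ puncturedBox δ := by
  have h1 := Complex.abs_re_le_norm ((AddCircle.toCircle a : Circle) : ℂ)
  have h2 := Complex.abs_im_le_norm ((AddCircle.toCircle a : Circle) : ℂ)
  rw [Circle.norm_coe] at h1 h2
  refine puncturedBox_scale (δ := 1) (w := (_, _, b)) hδ (by linarith) ⟨?_, ?_, ?_⟩
  · rw [abs_div, abs_two]
    linarith
  · rw [abs_div, abs_two]
    linarith
  · rintro ⟨h3, h4⟩
    refine toCircle_ne_zero a (Complex.ext ?_ ?_)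
    · simpa using h3
    · simpa using h4

namespace SheetCoord

variable (C : SheetCoord N K c)

open Classical in
/-- `n` times the height in the tube. -/
noncomputable def multHeight (n : ℕ) (q : M) : UnitAddCircle :=
  if h : ∃ j, ∃ v ∈ C.pdom j, ∃ s, C.par j v s = q then n • (C.coord h.choose q).2 else 0

variable {C} {n : ℕ}

theorem nsmul_coord_succ (hdvd : (K : ℤ) ∣ n * c) {j : Fin 4} {v : ℂ} (hv : v ∈ C.pdom j)
    (hv' : v ∈ C.pdom (j + 1)) {s : ℝ} :
    n • (C.coord j (C.par j v s)).2 = n • (C.coord (j + 1) (C.par j v s)).2 := by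
  have hK0 : (K : ℝ) ≠ 0 := by exact_mod_cast C.K_pos.ne'
  by_cases hj : j = 3
  · subst hj
    have h30 : (3 + 1 : Fin 4) = 0 := rfl
    rw [h30] at hv' ⊢
    rw [coord_par hv, ← par_last hv hv', coord_par hv', ← AddCircle.coe_nsmul, ← AddCircle.coe_nsmul]
    obtain ⟨i, hi⟩ := hdvd
    have hi' : (n : ℝ) * c = K * i := by exact_mod_cast hi
    refine coe_eq_coe_iff_int.2 ⟨-i, ?_⟩
    simp only [nsmul_eq_mul]
    push_cast
    field_simp
    linarith
  · rw [coord_par hv, ← par_succ hj hv hv', coord_par hv']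

theorem nsmul_coord_eq (hdvd : (K : ℤ) ∣ n * c) {j j' : Fin 4} {v : ℂ} (hv : v ∈ C.pdom j)
    (hv' : v ∈ C.pdom j') {s : ℝ} :
    n • (C.coord j (C.par j v s)).2 = n • (C.coord j' (C.par j v s)).2 := by
  obtain ⟨d, rfl⟩ : ∃ d, j' = j + d := ⟨j' - j, by abel⟩
  obtain rfl | rfl | rfl | rfl : d = 0 ∨ d = 1 ∨ d = 2 ∨ d = 3 := by
    fin_cases d <;> simp
  · rw [add_zero]
  · exact nsmul_coord_succ hdvd hv hv'
  · exact absurd (cquad_opposite hv.1 hv'.1) hv.2.1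
  · obtain ⟨i, hi⟩ := par_change hv hv' s
    have hj : j + 3 + 1 = j := by
      rw [add_assoc]
      exact add_zero j
    have h := nsmul_coord_succ hdvd (s := s + i) hv' (by rwa [hj])
    rw [hj, ← hi] at h
    exact h.symm

theorem multHeight_par (hdvd : (K : ℤ) ∣ n * c) {j : Fin 4} {v : ℂ} (hv : v ∈ C.pdom j) (s : ℝ) :
    C.multHeight n (C.par j v s) = n • (C.coord j (C.par j v s)).2 := by
  have h : ∃ j', ∃ v' ∈ C.pdom j', ∃ s', C.par j' v' s' = C.par j v s := ⟨j, v, hv, s, rfl⟩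
  rw [multHeight, dif_pos h]
  obtain ⟨v', hv', s', hs'⟩ := h.choose_spec
  obtain rfl := par_left_unique hv' hv hs'
  exact (nsmul_coord_eq hdvd hv hv').symm

theorem continuousAt_multHeight (hdvd : (K : ℤ) ∣ n * c) (hι : IsBirkhoffSection φ ι) {j : Fin 4}
    {v : ℂ} (hv : v ∈ C.pdom j) (s : ℝ) : ContinuousAt (C.multHeight n) (C.par j v s) := by
  intro A hA
  have key : ∀ j', ∀ᶠ q in 𝓝 (C.par j v s), (∃ w ∈ C.pdom j', ∃ s, C.par j' w s = q) →
      C.multHeight n q ∈ A := by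
    intro j'
    refine eventually_quadrant hι hv j' fun hv' s' hs' => ?_
    rw [← hs', multHeight_par hdvd hv', coord_par hv'] at hA
    have hc : ContinuousAt (fun a : ℂ × ℝ => n • ((a.2 / K : ℝ) : UnitAddCircle)) (v, s') :=
      ((AddCircle.continuous_mk' (1 : ℝ)).continuousAt.comp
        (f := fun a : ℂ × ℝ => a.2 / (K : ℝ)) (by fun_prop)).const_smul n
    filter_upwards [(hc.eventually_mem hA).filter_mono nhdsWithin_le_nhds, self_mem_nhdsWithin]
      with a ha ha'
    rw [multHeight_par hdvd ha'.1, coord_par ha'.1]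
    exact ha
  refine Filter.mem_map.2 ?_
  filter_upwards [eventually_all.2 key, eventually_mem (s₀ := s) hι hv hv.2.2] with q h1 h2
  obtain ⟨j', w, hw, -, hs⟩ := h2
  exact h1 j' ⟨w, hw, hs⟩

variable {ε δ : ℝ} {O : Set M}

theorem continuousOn_multHeight_box (hdvd : (K : ℤ) ∣ n * c) (hι : IsBirkhoffSection φ ι)
    (hτ : IsSaddleChart φ γ τ) (hδ : δ ≤ 1) (hsub : saddleBox τ δ ⊆ C.tube ε) :
    ContinuousOn (fun w => C.multHeight n (τ.symm w)) (puncturedBox δ) := by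
  intro w hw
  obtain ⟨h1, h2⟩ := hτ.symm_mem_of_puncturedBox hδ hw
  obtain ⟨j, v, hv, -, s, hs⟩ := (hsub h1).resolve_left h2
  have h3 := continuousAt_multHeight hdvd hι hv s
  rw [hs] at h3
  exact (h3.comp (τ.continuousAt_symm (hτ.mem_target_of_puncturedBox hδ hw))).continuousWithinAt

/-- The height on a torus around the orbit. -/
noncomputable def torusHeight (C : SheetCoord N K c) (n : ℕ) (δ : ℝ)
    (a : UnitAddCircle × UnitAddCircle) : UnitAddCircle :=
  C.multHeight n (τ.symm (δ * (((AddCircle.toCircle a.1 : Circle) : ℂ).re / 2),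
      δ * (((AddCircle.toCircle a.1 : Circle) : ℂ).im / 2), a.2))

theorem continuous_torusHeight (hdvd : (K : ℤ) ∣ n * c) (hι : IsBirkhoffSection φ ι)
    (hτ : IsSaddleChart φ γ τ) (hδ0 : 0 < δ) (hδ : δ ≤ 1) (hsub : saddleBox τ δ ⊆ C.tube ε) :
    Continuous (C.torusHeight n δ) := by
  have hc := continuous_toCircle_coe
  have h1 : Continuous fun s : UnitAddCircle => ((AddCircle.toCircle s : Circle) : ℂ).re :=
    Complex.continuous_re.comp hc
  have h2 : Continuous fun s : UnitAddCircle => ((AddCircle.toCircle s : Circle) : ℂ).im :=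
    Complex.continuous_im.comp hc
  refine (continuousOn_multHeight_box hdvd hι hτ hδ hsub).comp_continuous
    (f := fun a : UnitAddCircle × UnitAddCircle =>
      (δ * (((AddCircle.toCircle a.1 : Circle) : ℂ).re / 2),
        δ * (((AddCircle.toCircle a.1 : Circle) : ℂ).im / 2), a.2)) ?_
    fun a => circle_mem_puncturedBox hδ0 a.1 a.2
  have h1' := h1.comp (continuous_fst (X := UnitAddCircle) (Y := UnitAddCircle))
  have h2' := h2.comp (continuous_fst (X := UnitAddCircle) (Y := UnitAddCircle))
  exact ((h1'.div_const 2).const_mul δ).prodMk (((h2'.div_const 2).const_mul δ).prodMk continuous_snd)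

theorem nsmul_multHeight_section (hdvd : (K : ℤ) ∣ n * c) (hι : IsBirkhoffSection φ ι)
    (hγ : γ ∈ boundaryOrbits φ ι) {u : intr S} (hu : ι u ∈ C.tube ε) :
    K • C.multHeight n (ι u) = 0 := by
  have hK0 : (K : ℝ) ≠ 0 := by exact_mod_cast C.K_pos.ne'
  obtain ⟨j, v, hv, -, s, hs⟩ := hu.resolve_left fun h =>
    hι.interior_compl u u.2 (hι.orbit_subset_image hγ h)
  obtain ⟨k, rfl⟩ := par_mem_range_iff.1 ⟨_, hs.symm⟩
  rw [← hs, multHeight_par hdvd hv, coord_par hv, smul_comm, ← AddCircle.coe_nsmul, nsmul_eq_mul,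
    mul_div_cancel₀ _ hK0, show ((k : ℝ) : UnitAddCircle) = 0 from
      coe_eq_coe_iff_int.2 ⟨k, by simp⟩, smul_zero]

/-- The section does not meet a curve along which the height is constant: the degrees of the height
on the torus satisfy one relation. -/
theorem degree_relation (hdvd : (K : ℤ) ∣ n * c) (hι : IsBirkhoffSection φ ι)
    (hγ : γ ∈ boundaryOrbits φ ι) (hτ : IsSaddleChart φ γ τ) {m : ℤ}
    (hnm : HasLinkingMultiplicity ι γ τ n m) (hδ0 : 0 < δ) (hδ : δ ≤ 1)
    (hsub : saddleBox τ δ ⊆ C.tube ε) {a b : ℤ}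
    (ha : HasDegree (fun s => C.torusHeight n δ (s, 0)) a)
    (hb : HasDegree (fun s => C.torusHeight n δ (0, s)) b) : n * a + m * b = 0 := by
  obtain ⟨_, _, hloop⟩ := N.exists_collar_loop hι hγ hτ hnm
  obtain ⟨u, hu, hbox, htr⟩ := hloop δ hδ0
  have hE := continuousOn_multHeight_box hdvd hι hτ hδ hsub
  let G : M → UnitAddCircle := fun q =>
    C.multHeight n (τ.symm (δ * (τ q).1, δ * (τ q).2.1, (τ q).2.2))
  have hone : ∀ q ∈ τ.source \ γ, τ q ∈ puncturedBox 1 := fun q hq =>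
    hτ.mem_puncturedBox ⟨hq.1, hτ.mem_target.1 (τ.map_source hq.1)⟩ hq.2
  have hG : ContinuousOn G (τ.source \ γ) := by
    refine hE.comp (f := fun q => (δ * (τ q).1, δ * (τ q).2.1, (τ q).2.2)) ?_
      fun q hq => puncturedBox_scale hδ0 (by rw [mul_one]) (hone q hq)
    have h1 := τ.continuousOn.mono (sdiff_subset (s := τ.source) (t := γ))
    exact (h1.fst.const_mul δ).prodMk ((h1.snd.fst.const_mul δ).prodMk h1.snd.snd)
  have hmodel : HasDegree (G ∘ modelLoop τ n m) (n * a + m * b) := by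
    have h := HasDegree.of_torus (continuous_torusHeight hdvd hι hτ hδ0 hδ hsub) ha hb n m
    convert h using 2 with s
    have h1 : ((AddCircle.toCircle ((n : ℤ) • s) : Circle) : ℂ) =
        ((AddCircle.toCircle s : Circle) : ℂ) ^ n := by
      rw [natCast_zsmul, AddCircle.toCircle_nsmul]
      simp
    simp only [G, Function.comp_apply, torusHeight, modelLoop, τ.right_inv (modelLoop_mem hτ n m s),
      h1]
  have h1 := htr G hG _ hmodel
  have hwc : Continuous fun s => τ (ι (u s)) :=
    τ.continuousOn.comp_continuous (hι.continuous.comp (continuous_subtype_val.comp hu))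
      fun s => (hbox s).1.1
  have hnγ : ∀ s, ι (u s) ∉ γ := fun s h =>
    hι.interior_compl _ (u s).2 (hι.orbit_subset_image hγ h)
  have hκ : ∀ θ : unitInterval, 0 < 1 - (θ : ℝ) * (1 - δ) ∧ 1 - (θ : ℝ) * (1 - δ) ≤ 1 := by
    intro θ
    have := mul_le_mul_of_nonneg_right θ.2.2 (sub_nonneg.2 hδ)
    have := mul_nonneg θ.2.1 (sub_nonneg.2 hδ)
    constructor <;> linarith
  have hF : Continuous fun x : unitInterval × UnitAddCircle =>
      C.multHeight n (τ.symm ((1 - (x.1 : ℝ) * (1 - δ)) * (τ (ι (u x.2))).1,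
        (1 - (x.1 : ℝ) * (1 - δ)) * (τ (ι (u x.2))).2.1, (τ (ι (u x.2))).2.2)) := by
    refine hE.comp_continuous (f := fun x : unitInterval × UnitAddCircle =>
      ((1 - (x.1 : ℝ) * (1 - δ)) * (τ (ι (u x.2))).1,
        (1 - (x.1 : ℝ) * (1 - δ)) * (τ (ι (u x.2))).2.1, (τ (ι (u x.2))).2.2)) ?_ fun x => ?_
    · have h2 := hwc.comp (continuous_snd (X := unitInterval) (Y := UnitAddCircle))
      have h3 : Continuous fun x : unitInterval × UnitAddCircle => 1 - (x.1 : ℝ) * (1 - δ) := by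
        fun_prop
      exact (h3.mul h2.fst).prodMk ((h3.mul h2.snd.fst).prodMk h2.snd.snd)
    · refine puncturedBox_scale (hκ x.1).1 ?_ (hτ.mem_puncturedBox (hbox x.2).1 (hnγ x.2))
      nlinarith [(hκ x.1).2]
  have h2 : HasDegree (fun s => C.multHeight n (ι (u s))) (n * a + m * b) := by
    have h3 := HasDegree.of_unitInterval hF (a := 1) (b := 0) (d := n * a + m * b) (by
      simpa [G, Function.comp_def] using h1)
    simpa [τ.left_inv (hbox _).1.1] using h3
  have h3 : ∀ s, C.multHeight n (ι (u s)) = C.multHeight n (ι (u 0)) := fun s =>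
    eq_of_nsmul_eq_zero (X := UnitAddCircle) (f := fun s => C.multHeight n (ι (u s)))
      isPreconnected_univ h2.continuous.continuousOn C.K_pos
      (fun s _ => nsmul_multHeight_section hdvd hι hγ (hsub (hbox s).1)) (mem_univ s) (mem_univ 0)
  exact h2.unique (by simpa only [h3] using hasDegree_const _)

/-- The monodromy of the height around the orbit. -/
theorem degree_meridian (hA : C.IsAdapted ε O) (hn : 0 < n) (hdvd : (K : ℤ) ∣ n * c)
    (hι : IsBirkhoffSection φ ι) (hγ : γ ∈ boundaryOrbits φ ι) (hτ : IsSaddleChart φ γ τ)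
    (hδ0 : 0 < δ) (hδ : δ ≤ 1) (hsub : saddleBox τ δ ⊆ C.tube ε) {a : ℤ}
    (ha : HasDegree (fun s => C.torusHeight n δ (s, 0)) a) :
    (((c : ℝ) / K : ℝ) : UnitAddCircle) = ((-(a : ℝ) / n : ℝ) : UnitAddCircle) := by
  obtain ⟨g, hg, hgE, hg1⟩ := ha
  have hn0 : (n : ℝ) ≠ 0 := by exact_mod_cast hn.ne'
  let q : ℝ → M := fun s => τ.symm (δ * (((AddCircle.toCircle (s : UnitAddCircle) : Circle) : ℂ).re / 2),
      δ * (((AddCircle.toCircle (s : UnitAddCircle) : Circle) : ℂ).im / 2), 0)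
  have hqpb := fun s : ℝ => circle_mem_puncturedBox hδ0 (s : UnitAddCircle) 0
  have hqc : Continuous q := by
    refine τ.continuousOn_symm.comp_continuous ?_ fun s =>
      hτ.mem_target_of_puncturedBox hδ (hqpb s)
    have hc := continuous_toCircle_coe.comp (AddCircle.continuous_mk' (1 : ℝ))
    have h1 := Complex.continuous_re.comp hc
    have h2 := Complex.continuous_im.comp hc
    exact ((h1.div_const 2).const_mul δ).prodMk
      (((h2.div_const 2).const_mul δ).prodMk continuous_const)
  have hquad : ∀ (j : Fin 4) (s : ℝ), (j : ℕ) / 4 ≤ s → s ≤ ((j : ℕ) + 1) / 4 →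
      q s ∈ puncturedQuadrant τ (C.tube ε) γ j := by
    intro j s h0 h1
    obtain ⟨h2, h3⟩ := hτ.symm_mem_of_puncturedBox hδ (hqpb s)
    refine ⟨⟨hsub h2, ?_⟩, h3⟩
    have h4 := toCircle_mem_cquad j h0 h1
    have h5 : ∀ x : ℝ, SignType.sign (δ * (x / 2)) = SignType.sign x := by
      intro x
      rw [show δ * (x / 2) = (δ / 2) * x by ring, sign_mul, sign_pos (by positivity), one_mul]
    rw [τ.right_inv (hτ.mem_target_of_puncturedBox hδ (hqpb s))]
    exact cquad_of_sign (w := ⟨_, _⟩) h4 (h5 _) (h5 _)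
  have hD : ∀ j : Fin 4, ((C.coord j (q ((j : ℕ) / 4))).2 - ((g ((j : ℕ) / 4) / n : ℝ) : UnitAddCircle)) =
      (C.coord j (q (((j : ℕ) + 1) / 4))).2 - ((g (((j : ℕ) + 1) / 4) / n : ℝ) : UnitAddCircle) := by
    intro j
    have h34 : ((j : ℕ) : ℝ) / 4 ≤ ((j : ℕ) + 1) / 4 := by linarith
    refine eq_of_nsmul_eq_zero (s := Icc (((j : ℕ) : ℝ) / 4) (((j : ℕ) + 1) / 4))
      (f := fun s => (C.coord j (q s)).2 - ((g s / n : ℝ) : UnitAddCircle)) isPreconnected_Icc ?_ hn ?_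
      (left_mem_Icc.2 h34) (right_mem_Icc.2 h34)
    · refine ContinuousOn.sub ?_ ((AddCircle.continuous_mk' (1 : ℝ)).comp
        (hg.div_const _)).continuousOn
      refine continuous_snd.comp_continuousOn ?_
      intro s hs
      obtain ⟨v, hv, -, t, ht⟩ := (hA.mem_puncturedQuadrant_iff hι hγ).1 (hquad j s hs.1 hs.2)
      have h1 := continuousAt_coord hι hv t
      rw [ht] at h1
      refine h1.comp hqc.continuousWithinAt fun s' hs' => ?_
      obtain ⟨v, hv, -, t, ht⟩ := (hA.mem_puncturedQuadrant_iff hι hγ).1 (hquad j s' hs'.1 hs'.2)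
      exact ⟨v, hv, t, ht⟩
    · intro s hs
      obtain ⟨v, hv, -, t, ht⟩ := (hA.mem_puncturedQuadrant_iff hι hγ).1 (hquad j s hs.1 hs.2)
      have h1 : (g s : UnitAddCircle) = C.multHeight n (q s) := hgE s
      rw [← ht, multHeight_par hdvd hv, ht] at h1
      rw [nsmul_sub, ← h1, ← AddCircle.coe_nsmul, nsmul_eq_mul, mul_div_cancel₀ _ hn0, sub_self]
  have hglue : ∀ i : Fin 4, ∀ s, q s ∈ puncturedQuadrant τ (C.tube ε) γ i →
      q s ∈ puncturedQuadrant τ (C.tube ε) γ (i + 1) → (C.coord (i + 1) (q s)).2 =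
        (C.coord i (q s)).2 + ((if i = 3 then (c : ℝ) / K else 0 : ℝ) : UnitAddCircle) :=
    fun i s h1 h2 => congrArg (fun v : ℝ × ℝ × UnitAddCircle => v.2.2)
      ((hA.glue hι hγ rfl i).2.2 (q s) ⟨h1, h2⟩)
  have hstep : ∀ i : Fin 4, i ≠ 3 → (C.coord (i + 1) (q (((i : ℕ) + 1) / 4))).2 =
      (C.coord i (q (((i : ℕ) + 1) / 4))).2 := by
    intro i hi
    have hi' : (((i + 1 : Fin 4) : ℕ) : ℝ) = (i : ℕ) + 1 := by
      fin_cases i <;> simp at hi ⊢ <;> norm_num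
    have := hglue i (((i : ℕ) + 1) / 4) (hquad i _ (by linarith) le_rfl)
      (hquad (i + 1) _ (by rw [hi']) (by rw [hi']; linarith))
    rwa [if_neg hi, AddCircle.coe_zero, add_zero] at this
  have hq1 : q 1 = q 0 := by
    have : ((1 : ℝ) : UnitAddCircle) = ((0 : ℝ) : UnitAddCircle) :=
      coe_eq_coe_iff_int.2 ⟨1, by simp⟩
    simp only [q, this]
  have hlast := hglue 3 0 (by
    rw [← hq1]
    exact hquad 3 1 (by norm_num) (by norm_num)) (hquad 0 0 (by norm_num) (by norm_num))
  have hD' : ∀ (j : Fin 4) (x y : ℝ), x = (j : ℕ) / 4 → y = ((j : ℕ) + 1) / 4 →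
      (C.coord j (q x)).2 - ((g x / n : ℝ) : UnitAddCircle) =
      (C.coord j (q y)).2 - ((g y / n : ℝ) : UnitAddCircle) := by
    rintro j x y rfl rfl
    exact hD j
  have hstep' : ∀ (i : Fin 4) (x : ℝ), i ≠ 3 → x = ((i : ℕ) + 1) / 4 →
      (C.coord (i + 1) (q x)).2 = (C.coord i (q x)).2 := by
    rintro i x hi rfl
    exact hstep i hi
  have e0 := hD' 0 0 (1 / 4) (by norm_num) (by norm_num)
  have e1 := hD' 1 (1 / 4) (1 / 2) (by norm_num) (by norm_num)
  have e2 := hD' 2 (1 / 2) (3 / 4) (by norm_num) (by norm_num)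
  have e3 := hD' 3 (3 / 4) 1 (by norm_num) (by norm_num)
  have s0 : (C.coord 1 (q (1 / 4))).2 = (C.coord 0 (q (1 / 4))).2 :=
    hstep' 0 (1 / 4) (by decide) (by norm_num)
  have s1 : (C.coord 2 (q (1 / 2))).2 = (C.coord 1 (q (1 / 2))).2 :=
    hstep' 1 (1 / 2) (by decide) (by norm_num)
  have s2 : (C.coord 3 (q (3 / 4))).2 = (C.coord 2 (q (3 / 4))).2 :=
    hstep' 2 (3 / 4) (by decide) (by norm_num)
  rw [if_pos rfl] at hlast
  have hlast' : (C.coord 0 (q 0)).2 = (C.coord 3 (q 0)).2 + (((c : ℝ) / K : ℝ) : UnitAddCircle) :=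
    hlast
  rw [← s0, e1, ← s1, e2, ← s2, e3, hq1, hlast', sub_eq_sub_iff_add_eq_add, add_assoc] at e0
  have h1 := add_left_cancel e0
  rw [← eq_sub_iff_add_eq] at h1
  rw [h1, ← AddCircle.coe_sub]
  congr 1
  have := hg1 0
  rw [zero_add] at this
  rw [this]
  ring

end SheetCoord

end Tube


/-! ### The degree of the height along the orbit -/

/-- The closed quadrant of size `δ`, without its vertex. -/
def corner (δ : ℝ) : Set (ℝ × ℝ) := {w | 0 ≤ w.1 ∧ 0 ≤ w.2 ∧ w.1 < δ ∧ w.2 < δ ∧ 0 < w.1 + w.2}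

theorem convex_corner (δ : ℝ) : Convex ℝ (corner δ) := by
  have h1 : IsLinearMap ℝ fun w : ℝ × ℝ => w.1 := ⟨fun _ _ => rfl, fun _ _ => rfl⟩
  have h2 : IsLinearMap ℝ fun w : ℝ × ℝ => w.2 := ⟨fun _ _ => rfl, fun _ _ => rfl⟩
  have h3 : IsLinearMap ℝ fun w : ℝ × ℝ => w.1 + w.2 :=
    ⟨fun _ _ => by simp only [Prod.fst_add, Prod.snd_add]; ring,
      fun _ _ => by simp only [Prod.smul_fst, Prod.smul_snd, smul_eq_mul]; ring⟩
  exact (convex_halfSpace_ge h1 0).inter ((convex_halfSpace_ge h2 0).inter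
    ((convex_halfSpace_lt h1 δ).inter ((convex_halfSpace_lt h2 δ).inter (convex_halfSpace_gt h3 0))))

theorem corner_mem_puncturedBox {δ : ℝ} {w : ℝ × ℝ} (hw : w ∈ corner δ) (s : UnitAddCircle) :
    (w.1, w.2, s) ∈ puncturedBox δ := by
  obtain ⟨h1, h2, h3, h4, h5⟩ := hw
  refine ⟨by rwa [abs_of_nonneg h1], by rwa [abs_of_nonneg h2], ?_⟩
  rintro ⟨h6, h7⟩
  simp only at h6 h7
  linarith

section Tube

variable {M : Type*} [MetricSpace M] [CompactSpace M]
  {S : Type*} [TopologicalSpace S] [ChartedSpace (EuclideanHalfSpace 2) S]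
  [CompactSpace S] [T2Space S]
  {φ : Flow ℝ M} {ι : S → M} {γ : Set M} {τ : OpenPartialHomeomorph M (ℝ × ℝ × UnitAddCircle)}
  {D : AlmostAnosovData φ ι} {N : SectionCoord D γ τ} {K : ℕ} {c : ℤ}

namespace SheetCoord

variable {C : SheetCoord N K c} {n : ℕ} {ε δ : ℝ} {O : Set M}

/-- The height increases along the orbits. -/
theorem height_mono {q : M} {t : ℝ} (ht : 0 ≤ t)
    (hq : ∀ s ∈ Icc 0 t, ∃ v ∈ C.pdom 0, ∃ σ, C.par 0 v σ = φ s q) {f : ℝ → ℝ}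
    (hf : ContinuousOn f (Icc 0 t))
    (hfz : ∀ s ∈ Icc 0 t, (f s : UnitAddCircle) = (C.coord 0 (φ s q)).2) : f 0 ≤ f t := by
  have hK0 : (0 : ℝ) < K := by exact_mod_cast C.K_pos
  have hcl : IsClosed ({s | f 0 ≤ f s} ∩ Icc 0 t) := by
    have := isClosed_Icc.isClosed_le (continuousOn_const (c := f 0)) hf
    convert this using 1
    ext s
    exact and_comm
  have h0s : (0 : ℝ) ∈ {s | f 0 ≤ f s} := le_refl (f 0)
  refine hcl.Icc_subset_of_forall_mem_nhdsWithin h0s ?_ (right_mem_Icc.2 ht)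
  rintro x ⟨hx0, hx⟩
  have hxI : x ∈ Icc 0 t := Ico_subset_Icc_self hx
  obtain ⟨v, hv, σ, hσ⟩ := hq x hxI
  obtain ⟨u, hu, t₀, ht₀, h1, h2, h3, -⟩ := par_rep hv σ
  set k := ⌊σ⌋
  obtain ⟨h, -, hh⟩ := D.exists_time u
  let T : ℝ → ℝ := fun y => h.symm (y - x + h t₀)
  have hTx : T x = t₀ := by simp [T]
  have hTc : Continuous T := h.symm.continuous.comp (by fun_prop)
  have hTpt : ∀ y, D.pt u (T y) = φ y q := by
    intro y
    rw [hh, OrderIso.apply_symm_apply, φ.map_add, ← hh, h1, hσ, ← φ.map_add, sub_add_cancel]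
  have hTI : ∀ᶠ y in 𝓝 x, T y ∈ Ioo (-1 : ℝ) 2 :=
    hTc.continuousAt.eventually_mem (isOpen_Ioo.mem_nhds (by
      rw [hTx]
      exact ⟨by linarith [ht₀.1], by linarith [ht₀.2]⟩))
  have hTr : ∀ᶠ y in 𝓝 x, ‖flowMap D.pA.lam (T y) (N.Q u)‖ < C.rad := by
    have hc : Continuous fun y => flowMap D.pA.lam (T y) (N.Q u) :=
      (continuous_flowMap D.pA.lam_pos).comp (hTc.prodMk continuous_const)
    exact hc.norm.continuousAt.eventually_lt continuousAt_const (by rw [hTx, h2]; exact hv.2.2)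
  have hz : ∀ᶠ y in 𝓝 x, y ∈ Icc 0 t → (f y : UnitAddCircle) = (((T y + k) / K : ℝ) : UnitAddCircle) := by
    filter_upwards [hTI, hTr] with y hy1 hy2 hy
    have hm : flowMap D.pA.lam (T y) (N.Q u) ∈ C.pdom 0 :=
      ⟨(flowMap_mem D.pA.lam_pos).2 ((flowMap_mem D.pA.lam_pos (t := t₀)).1 (h2 ▸ hv.1)),
        flowMap_ne_zero D.pA.lam_pos (N.ne_zero_of_mem_dom hu), hy2⟩
    rw [hfz y hy, ← hTpt, pt_eq_par h3 ⟨hy1.1.le, hy1.2.le⟩ hm, coord_par hm]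
  have hzx := hz.self_of_nhds hxI
  have hsmall : ∀ᶠ y in 𝓝[Icc 0 t] x, |(f y - f x) - ((T y + k) / K - (T x + k) / K)| < 1 := by
    have hc : ContinuousWithinAt (fun y => |(f y - f x) - ((T y + k) / K - (T x + k) / K)|)
        (Icc 0 t) x :=
      (((hf x hxI).sub continuousWithinAt_const).sub
        ((((hTc.continuousWithinAt (s := Icc 0 t)).add continuousWithinAt_const).div_const _).sub
          continuousWithinAt_const)).abs
    exact Filter.Tendsto.eventually_lt hc tendsto_const_nhds (by simp)
  have hnb : Icc 0 t ∈ 𝓝[>] x :=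
    mem_of_superset (Ioo_mem_nhdsGT hx.2) fun y hy => ⟨hx.1.trans hy.1.le, hy.2.le⟩
  have hle : 𝓝[>] x ≤ 𝓝[Icc 0 t] x := by
    rw [nhdsWithin, nhdsWithin]
    exact le_inf inf_le_left (le_principal_iff.2 hnb)
  filter_upwards [hz.filter_mono nhdsWithin_le_nhds, hsmall.filter_mono hle, hnb,
    self_mem_nhdsWithin] with y hy1 hy2 hy3 hy4
  obtain ⟨i, hi⟩ := coe_eq_coe_iff_int.1 (hy1 hy3)
  obtain ⟨i', hi'⟩ := coe_eq_coe_iff_int.1 hzx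
  have h5 : (f y - f x) - ((T y + k) / K - (T x + k) / K) = ((i - i' : ℤ) : ℝ) := by
    push_cast
    linarith
  rw [h5] at hy2
  have h6 : i - i' = 0 := by
    have : |i - i'| < 1 := by exact_mod_cast hy2
    exact Int.abs_lt_one_iff.1 this
  rw [h6, Int.cast_zero] at h5
  have h7 : T x < T y := h.symm.strictMono (by
    have : x < y := hy4
    linarith)
  have h8 : (T x + k) / K ≤ (T y + k) / K := by gcongr
  change f 0 ≤ f y
  have hx0' : f 0 ≤ f x := hx0
  linarith

/-- The height over a quadrant, in the saddle coordinates. -/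
noncomputable def cornerHeight (C : SheetCoord N K c) (a : (ℝ × ℝ) × UnitAddCircle) : UnitAddCircle :=
  (C.coord 0 (τ.symm (a.1.1, a.1.2, a.2))).2

theorem corner_mem (hA : C.IsAdapted ε O) (hι : IsBirkhoffSection φ ι)
    (hγ : γ ∈ boundaryOrbits φ ι) (hτ : IsSaddleChart φ γ τ) (hδ : δ ≤ 1)
    (hsub : saddleBox τ δ ⊆ C.tube ε) {w : ℝ × ℝ} (hw : w ∈ corner δ) (s : UnitAddCircle) :
    ∃ v ∈ C.pdom 0, ‖v‖ < ε ∧ ∃ σ, C.par 0 v σ = τ.symm (w.1, w.2, s) := by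
  obtain ⟨h1, h2⟩ := hτ.symm_mem_of_puncturedBox hδ (corner_mem_puncturedBox hw s)
  refine (hA.mem_puncturedQuadrant_iff hι hγ).1 ⟨⟨hsub h1, ?_⟩, h2⟩
  rw [τ.right_inv (hτ.mem_target_of_puncturedBox hδ (corner_mem_puncturedBox hw s))]
  exact ⟨hw.1, hw.2.1⟩

theorem continuousOn_cornerHeight (hA : C.IsAdapted ε O) (hι : IsBirkhoffSection φ ι)
    (hγ : γ ∈ boundaryOrbits φ ι) (hτ : IsSaddleChart φ γ τ) (hδ : δ ≤ 1)
    (hsub : saddleBox τ δ ⊆ C.tube ε) : ContinuousOn C.cornerHeight (corner δ ×ˢ univ) := by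
  rintro ⟨w, s⟩ ⟨hw, -⟩
  obtain ⟨v, hv, -, σ, hσ⟩ := corner_mem hA hι hγ hτ hδ hsub hw s
  have h1 := continuousAt_coord hι hv σ
  rw [hσ] at h1
  have h2 : ContinuousAt (fun a : (ℝ × ℝ) × UnitAddCircle => τ.symm (a.1.1, a.1.2, a.2)) (w, s) :=
    ContinuousAt.comp (g := τ.symm) (f := fun a : (ℝ × ℝ) × UnitAddCircle => (a.1.1, a.1.2, a.2))
      (τ.continuousAt_symm (hτ.mem_target_of_puncturedBox hδ (corner_mem_puncturedBox hw s)))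
      (by fun_prop)
  refine continuous_snd.continuousAt.comp_continuousWithinAt
    (ContinuousWithinAt.comp (g := C.coord 0)
      (f := fun a : (ℝ × ℝ) × UnitAddCircle => τ.symm (a.1.1, a.1.2, a.2))
      (t := {q | ∃ w ∈ C.pdom 0, ∃ s, C.par 0 w s = q}) (x := (w, s)) h1 h2.continuousWithinAt ?_)
  rintro ⟨w', s'⟩ ⟨hw', -⟩
  obtain ⟨v, hv, -, σ, hσ⟩ := corner_mem hA hι hγ hτ hδ hsub hw' s'
  exact ⟨v, hv, σ, hσ⟩

/-- The core of a quadrant of the tube, as a loop. -/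
theorem exists_par_loop {v : ℂ} (hv : v ∈ C.pdom 0) :
    ∃ l : UnitAddCircle → M, Continuous l ∧ (∀ s : ℝ, l s = C.par 0 v (s * K)) := by
  have hper : Function.Periodic (fun s : ℝ => C.par 0 v (s * K)) 1 := fun s => by
    simp only [add_mul, one_mul]
    exact par_add 0 hv _
  refine ⟨hper.lift, ?_, fun s => hper.lift_coe s⟩
  refine (QuotientAddGroup.isQuotientMap_mk (N := AddSubgroup.zmultiples (1 : ℝ))).continuous_iff.2 ?_
  refine Continuous.congr (f := fun s : ℝ => C.par 0 v (s * K)) ?_ fun s => (hper.lift_coe s).symm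
  exact (continuousOn_par (C := C) 0).comp_continuous (f := fun s : ℝ => (v, s * (K : ℝ)))
    (by fun_prop) fun s => ⟨hv, mem_univ _⟩

theorem isUnit_degree_corner (hA : C.IsAdapted ε O) (hι : IsBirkhoffSection φ ι)
    (hγ : γ ∈ boundaryOrbits φ ι) (hτ : IsSaddleChart φ γ τ) (hδ0 : 0 < δ) (hδ : δ ≤ 1)
    (hsub : saddleBox τ δ ⊆ C.tube ε) {w : ℝ × ℝ} (hw : w ∈ corner δ) {e : ℤ}
    (he : HasDegree (fun s => C.cornerHeight (w, s)) e) : e = 1 ∨ e = -1 := by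
  obtain ⟨ε', hA'⟩ := exists_isAdapted (C := C) hι hγ hτ (isOpen_saddleBox δ) (hτ.subset_saddleBox hδ0)
  have hK0 : (K : ℝ) ≠ 0 := by exact_mod_cast C.K_pos.ne'
  have hnorm : ‖((ε' / 2 : ℝ) : ℂ)‖ < ε' := by
    rw [Complex.norm_real, Real.norm_of_nonneg (half_pos hA'.pos).le]
    exact half_lt_self hA'.pos
  have hv : ((ε' / 2 : ℝ) : ℂ) ∈ C.pdom 0 := by
    refine ⟨⟨?_, ?_⟩, ?_, hnorm.trans_le hA'.le⟩
    · rw [Complex.ofReal_re]; exact (half_pos hA'.pos).le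
    · rw [Complex.ofReal_im]
    · exact_mod_cast (half_pos hA'.pos).ne'
  obtain ⟨l, hl, hls⟩ := exists_par_loop hv
  have hmem : ∀ s, l s ∈ saddleBox τ δ ∧ ((τ (l s)).1, (τ (l s)).2.1) ∈ corner δ := by
    intro s
    induction s using QuotientAddGroup.induction_on with | H s => ?_
    have hls := hls s
    change l (s : UnitAddCircle) = _ at hls
    change l (s : UnitAddCircle) ∈ _ ∧ _
    have h1 := (hA'.mem 0 _ hv hnorm (s * K)).1
    have h2 := (hA'.quadrant_iff 0 _ hv hnorm (s * K) 0).2 hv.1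
    rw [hls]
    refine ⟨h1, h2.1, h2.2, (le_abs_self _).trans_lt h1.2.1, (le_abs_self _).trans_lt h1.2.2, ?_⟩
    have h3 : C.par 0 ((ε' / 2 : ℝ) : ℂ) (s * K) ∉ γ := par_notMem_orbit hι hγ
    rw [hτ.mem_orbit_iff _ h1.1] at h3
    by_contra! h4
    have h5 : 0 ≤ (τ (C.par 0 ((ε' / 2 : ℝ) : ℂ) (s * K))).1 := h2.1
    have h6 : 0 ≤ (τ (C.par 0 ((ε' / 2 : ℝ) : ℂ) (s * K))).2.1 := h2.2
    exact h3 ⟨by linarith, by linarith⟩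
  have hτl : Continuous fun s => τ (l s) :=
    τ.continuousOn.comp_continuous hl fun s => (hmem s).1.1
  obtain ⟨d, hd⟩ := exists_hasDegree_of_continuous hτl.snd.snd
  have h1 := HasDegree.of_loop (convex_corner δ) (continuousOn_cornerHeight hA hι hγ hτ hδ hsub) hw he
    (hτl.fst.prodMk hτl.snd.fst) (fun s => (hmem s).2) hd
  have h2 : ∀ s, C.cornerHeight (((τ (l s)).1, (τ (l s)).2.1), (τ (l s)).2.2) = s := by
    intro s
    change (C.coord 0 (τ.symm (τ (l s)))).2 = s
    rw [τ.left_inv (hmem s).1.1]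
    induction s using QuotientAddGroup.induction_on with | H s => ?_
    rw [hls, coord_par hv, mul_div_cancel_right₀ _ hK0]
  simp only [h2] at h1
  exact Int.isUnit_iff.1 (IsUnit.of_mul_eq_one d (h1.unique hasDegree_id))

theorem degree_corner (hA : C.IsAdapted ε O) (hι : IsBirkhoffSection φ ι)
    (hns : ∀ x, ∃ t, φ t x ≠ x) (hγ : γ ∈ boundaryOrbits φ ι) (hτ : IsSaddleChart φ γ τ)
    (hδ0 : 0 < δ) (hδ : δ ≤ 1) (hsub : saddleBox τ δ ⊆ C.tube ε) :
    HasDegree (fun s => C.cornerHeight ((δ / 2, 0), s)) 1 := by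
  set a := δ / 2 with ha
  have ha0 : 0 < a := half_pos hδ0
  have haδ : a < δ := half_lt_self hδ0
  have hH := continuousOn_cornerHeight hA hι hγ hτ hδ hsub
  have hw : (a, (0 : ℝ)) ∈ corner δ := ⟨ha0.le, le_rfl, haδ, hδ0, by simpa using ha0⟩
  obtain ⟨e, he⟩ := exists_hasDegree_of_continuous (f := fun s => C.cornerHeight ((a, 0), s))
    (hH.comp_continuous (by fun_prop) fun s => ⟨hw, mem_univ _⟩)
  obtain rfl | rfl := isUnit_degree_corner hA hι hγ hτ hδ0 hδ hsub hw he
  · exact he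
  exfalso
  obtain ⟨F, hF, hFz⟩ := exists_real_lift_of_convex (E := (ℝ × ℝ) × ℝ)
    ((convex_corner δ).prod (convex_univ (E := ℝ))) ⟨((a, 0), 0), hw, mem_univ _⟩
    (f := fun x => C.cornerHeight (x.1, (x.2 : UnitAddCircle)))
    (hH.comp (continuous_fst.prodMk ((AddCircle.continuous_mk' (1 : ℝ)).comp
      continuous_snd)).continuousOn fun x hx => ⟨hx.1, mem_univ _⟩)
  have hF1 : ∀ w ∈ corner δ, ∀ s, F (w, s + 1) = F (w, s) - 1 := by
    intro w' hw' s
    obtain ⟨g, hg, hgz, hg1⟩ := HasDegree.of_convex (convex_corner δ) hH hw hw' he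
    have hFc : Continuous fun s : ℝ => F (w', s) :=
      hF.comp_continuous (by fun_prop) fun s => ⟨hw', mem_univ _⟩
    obtain ⟨k, hk⟩ := exists_int_const hFc hg fun s => by rw [hFz _ ⟨hw', mem_univ _⟩, hgz]
    rw [hk, hk, hg1]
    push_cast
    ring
  have hFn : ∀ w ∈ corner δ, ∀ s, ∀ j : ℕ, F (w, s + j) = F (w, s) - j := by
    intro w hw s j
    induction j with
    | zero => simp
    | succ j ih =>
      push_cast
      rw [← add_assoc, hF1 w hw, ih]
      ring
  have hbd : ∀ A : Set (ℝ × ℝ), IsCompact A → A ⊆ corner δ → ∃ B, ∀ w ∈ A, ∀ s ∈ Icc (0 : ℝ) 1,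
      |F (w, s)| ≤ B := by
    intro A hA hAc
    obtain ⟨B, hB⟩ := (hA.prod (isCompact_Icc (a := (0 : ℝ)) (b := 1))).exists_bound_of_continuousOn
      (hF.mono (prod_mono hAc (subset_univ _)))
    exact ⟨B, fun w hw s hs => hB (w, s) ⟨hw, hs⟩⟩
  obtain ⟨B₁, hB₁⟩ := hbd ({a} ×ˢ Icc 0 a) (isCompact_singleton.prod isCompact_Icc) (by
    rintro ⟨x, y⟩ ⟨rfl, hy⟩
    exact ⟨ha0.le, hy.1, haδ, hy.2.trans_lt haδ, by have := hy.1; simp only at this ⊢; linarith⟩)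
  obtain ⟨B₂, hB₂⟩ := hbd (Icc 0 a ×ˢ {a}) (isCompact_Icc.prod isCompact_singleton) (by
    rintro ⟨x, y⟩ ⟨hx, rfl⟩
    exact ⟨hx.1, ha0.le, hx.2.trans_lt haδ, haδ, by have := hx.1; simp only at this ⊢; linarith⟩)
  have hB1 : 0 ≤ B₁ := (abs_nonneg _).trans (hB₁ (a, 0) ⟨rfl, le_rfl, ha0.le⟩ 0 (by simp))
  have hB2 : 0 ≤ B₂ := (abs_nonneg _).trans (hB₂ (a, a) ⟨⟨ha0.le, le_rfl⟩, rfl⟩ 0 (by simp))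
  obtain ⟨α, hα, β, hβ, horb⟩ := hτ.orbits
  set L := B₁ + B₂ + 2 with hL
  set y₀ := a * Real.exp (-(β * L)) with hy₀
  have hy0 : 0 < y₀ := by positivity
  have hy1 : y₀ < a := by
    have : Real.exp (-(β * L)) < 1 := Real.exp_lt_one_iff.2 (by
      have : 0 < β * L := by positivity
      linarith)
    nlinarith
  have hqc : ((a, y₀) : ℝ × ℝ) ∈ corner δ :=
    ⟨ha0.le, hy0.le, haδ, hy1.trans haδ, by simp only; linarith⟩
  have hqt := hτ.mem_target_of_puncturedBox hδ (corner_mem_puncturedBox hqc 0)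
  set q := τ.symm (a, y₀, 0) with hq
  have hτq : τ q = (a, y₀, 0) := τ.right_inv hqt
  obtain ⟨t, ht, hst, hta⟩ := hτ.passage hns (τ.map_target hqt) (by rw [← hq, hτq]; exact hy0.ne')
    (a := a) (by linarith) (by rw [← hq, hτq]; simp only; rw [abs_of_pos hy0]; exact hy1.le)
  rw [← hq] at hst hta
  have ht0 : 0 < t := by
    refine lt_of_le_of_ne ht fun h => ?_
    rw [← h, φ.map_zero_apply, hτq] at hta
    simp only at hta
    rw [abs_of_pos hy0] at hta
    linarith
  obtain ⟨h, h0, hhc, hhm, hh⟩ := horb q t ht0 fun s hs => (hst s hs).1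
  have hform : ∀ s ∈ Icc 0 t, τ (φ s q) =
      (Real.exp (-α * h s) * a, Real.exp (β * h s) * y₀, ((h s : ℝ) : UnitAddCircle)) := by
    intro s hs
    rw [hh s hs, hτq, linearSaddle, zero_add]
  have hcor : ∀ s ∈ Icc 0 t, (Real.exp (-α * h s) * a, Real.exp (β * h s) * y₀) ∈ corner δ := by
    intro s hs
    obtain ⟨-, h1, h2⟩ := hst s hs
    rw [hform s hs, hτq] at h1
    rw [hform s hs] at h2
    have p1 : 0 < Real.exp (-α * h s) * a := by positivity
    have p2 : 0 < Real.exp (β * h s) * y₀ := by positivity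
    simp only [abs_of_pos p1, abs_of_pos p2, abs_of_pos ha0] at h1 h2
    exact ⟨p1.le, p2.le, h1.trans_lt haδ, h2.trans_lt haδ, by simp only; linarith⟩
  have hsymm : ∀ s ∈ Icc 0 t, τ.symm (Real.exp (-α * h s) * a, Real.exp (β * h s) * y₀,
      ((h s : ℝ) : UnitAddCircle)) = φ s q := by
    intro s hs
    rw [← hform s hs, τ.left_inv (hst s hs).1]
  have hmono := height_mono (C := C) (q := q) ht (fun s hs => by
      obtain ⟨v, hv, -, σ, hσ⟩ := corner_mem hA hι hγ hτ hδ hsub (hcor s hs)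
        ((h s : ℝ) : UnitAddCircle)
      exact ⟨v, hv, σ, hσ.trans (hsymm s hs)⟩)
    (f := fun s => F ((Real.exp (-α * h s) * a, Real.exp (β * h s) * y₀), h s)) ?_ ?_
  · have h0I : (0 : ℝ) ∈ Icc 0 t := ⟨le_rfl, ht⟩
    have htI : t ∈ Icc 0 t := ⟨ht, le_rfl⟩
    have hT : h t = L := by
      rw [hform t htI] at hta
      simp only at hta
      rw [abs_of_pos (by positivity), hy₀, mul_left_comm, ← Real.exp_add] at hta
      have h1 : Real.exp (β * h t + -(β * L)) = 1 := by
        have := mul_left_cancel₀ ha0.ne' (hta.trans (mul_one a).symm)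
        exact this
      rw [Real.exp_eq_one_iff] at h1
      exact mul_left_cancel₀ hβ.ne' (by linarith)
    have hyt : Real.exp (β * h t) * y₀ = a := by
      have := hta
      rw [hform t htI] at this
      simp only at this
      rwa [abs_of_pos (by positivity)] at this
    have hxt := (hcor t htI).1
    have hxt' : Real.exp (-α * h t) * a ≤ a := by
      obtain ⟨-, h1, -⟩ := hst t htI
      rw [hform t htI, hτq] at h1
      simp only [abs_of_pos ha0] at h1
      exact (le_abs_self _).trans h1
    simp only [h0, mul_zero, Real.exp_zero, one_mul] at hmono
    rw [hyt] at hmono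
    have hL0 : 0 ≤ h t := by rw [hT]; positivity
    have e1 := hFn _ (by have := hcor t htI; rwa [hyt] at this) (h t - ⌊h t⌋₊) ⌊h t⌋₊
    rw [sub_add_cancel] at e1
    have e2 := (abs_le.1 (hB₂ (Real.exp (-α * h t) * a, a) ⟨⟨hxt, hxt'⟩, rfl⟩ (h t - ⌊h t⌋₊)
      ⟨by linarith [Nat.floor_le hL0], by linarith [Nat.lt_floor_add_one (h t)]⟩)).2
    have e3 := (abs_le.1 (hB₁ (a, y₀) ⟨rfl, hy0.le, hy1.le⟩ 0 (by simp))).1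
    have e4 := Nat.lt_floor_add_one (h t)
    rw [hT] at e4 e1 e2 hmono
    linarith
  · refine hF.comp (f := fun s => ((Real.exp (-α * h s) * a, Real.exp (β * h s) * y₀), h s)) ?_
      fun s hs => ⟨hcor s hs, mem_univ _⟩
    exact (((Real.continuous_exp.comp_continuousOn (hhc.const_smul (-α))).mul
      continuousOn_const).prodMk ((Real.continuous_exp.comp_continuousOn (hhc.const_smul β)).mul
      continuousOn_const)).prodMk hhc
  · intro s hs
    rw [hFz _ ⟨hcor s hs, mem_univ _⟩, cornerHeight]
    rw [hsymm s hs]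

/-- The degree of the height along the orbit. -/
theorem degree_longitude (hA : C.IsAdapted ε O) (hdvd : (K : ℤ) ∣ n * c)
    (hι : IsBirkhoffSection φ ι) (hns : ∀ x, ∃ t, φ t x ≠ x) (hγ : γ ∈ boundaryOrbits φ ι)
    (hτ : IsSaddleChart φ γ τ) (hδ0 : 0 < δ) (hδ : δ ≤ 1) (hsub : saddleBox τ δ ⊆ C.tube ε) :
    HasDegree (fun s => C.torusHeight n δ (0, s)) n := by
  have h := (degree_corner hA hι hns hγ hτ hδ0 hδ hsub).nsmul n
  rw [mul_one] at h
  convert h using 2 with s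
  have h1 : ((AddCircle.toCircle (0 : UnitAddCircle) : Circle) : ℂ) = 1 := by simp
  obtain ⟨v, hv, -, σ, hσ⟩ := corner_mem hA hι hγ hτ hδ hsub (w := (δ / 2, 0))
    ⟨by positivity, le_rfl, half_lt_self hδ0, hδ0, by simpa using hδ0⟩ s
  rw [torusHeight, cornerHeight, h1]
  simp only [Complex.one_re, Complex.one_im, zero_div, mul_zero, mul_one_div]
  simp only at hσ
  rw [← hσ, multHeight_par hdvd hv]

/-- The monodromy of the height is determined by the multiplicity. -/
theorem monodromy_eq (hdvd : (K : ℤ) ∣ n * c) (hι : IsBirkhoffSection φ ι)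
    (hns : ∀ x, ∃ t, φ t x ≠ x) (hγ : γ ∈ boundaryOrbits φ ι) (hτ : IsSaddleChart φ γ τ) {m : ℤ}
    (hnm : HasLinkingMultiplicity ι γ τ n m) (hA : C.IsAdapted ε O) :
    (((c : ℝ) / K : ℝ) : UnitAddCircle) = ((m / n : ℝ) : UnitAddCircle) := by
  obtain ⟨δ, hδ0, hδ, hsub⟩ := exists_saddleBox_subset_tube (C := C) hι hγ hτ hA.pos
  have hn : 0 < n := hnm.1
  obtain ⟨a, ha⟩ := exists_hasDegree_of_continuous (f := fun s => C.torusHeight n δ (s, 0))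
    ((continuous_torusHeight hdvd hι hτ hδ0 hδ.le hsub).comp (by fun_prop))
  have h1 := degree_relation hdvd hι hγ hτ hnm hδ0 hδ.le hsub ha
    (degree_longitude hA hdvd hι hns hγ hτ hδ0 hδ.le hsub)
  have h2 : a = -m := by
    have h3 : (n : ℤ) * (a + m) = 0 := by linarith
    have h4 := (mul_eq_zero.1 h3).resolve_left (by exact_mod_cast hn.ne')
    linarith
  rw [degree_meridian hA hn hdvd hι hγ hτ hδ0 hδ.le hsub ha, h2]
  push_cast
  rw [neg_neg]

end SheetCoord

end Tube


section Tubular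

variable {M : Type*} [MetricSpace M] [CompactSpace M]
  {S : Type*} [TopologicalSpace S] [ChartedSpace (EuclideanHalfSpace 2) S]
  [CompactSpace S] [T2Space S]
  {φ : Flow ℝ M} {ι : S → M} {γ : Set M} {τ : OpenPartialHomeomorph M (ℝ × ℝ × UnitAddCircle)}
  {D : AlmostAnosovData φ ι} {N : SectionCoord D γ τ} {K : ℕ} {c : ℤ}

/-! ### A tubular neighbourhood in a saddle chart -/

/-- The box of a saddle chart, as an image of `ℝ² × ℝ/ℤ`. -/
theorem IsSaddleChart.exists_boxEmbedding (hτ : IsSaddleChart φ γ τ) {δ : ℝ} (hδ0 : 0 < δ)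
    (hδ : δ ≤ 1) :
    ∃ g : (ℝ × ℝ) × UnitAddCircle → M, IsOpenEmbedding g ∧ (∀ a, g a ∈ saddleBox τ δ) ∧
      (fun z => g (0, z)) '' univ = γ := by
  let e : (ℝ × ℝ) × UnitAddCircle → ℝ × ℝ × UnitAddCircle :=
    fun a => (Homeomorph.prodAssoc ℝ ℝ UnitAddCircle)
      (OpenPartialHomeomorph.univBall (0 : ℝ × ℝ) δ a.1, a.2)
  have hb : IsOpenEmbedding (OpenPartialHomeomorph.univBall (0 : ℝ × ℝ) δ : ℝ × ℝ → ℝ × ℝ) :=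
    OpenPartialHomeomorph.isOpenEmbedding _ (OpenPartialHomeomorph.univBall_source _ _)
  have he : IsOpenEmbedding e :=
    (Homeomorph.prodAssoc ℝ ℝ UnitAddCircle).isOpenEmbedding.comp (hb.prodMap IsOpenEmbedding.id)
  have hball : ∀ a, |(e a).1| < δ ∧ |(e a).2.1| < δ := by
    intro a
    have h1 := (OpenPartialHomeomorph.univBall (0 : ℝ × ℝ) δ).map_source (x := a.1) (by simp)
    rw [OpenPartialHomeomorph.univBall_target _ hδ0, mem_ball_zero_iff, Prod.norm_def,
      max_lt_iff] at h1
    exact h1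
  have ht : ∀ a, e a ∈ τ.target := fun a => hτ.mem_target.2
    ⟨(hball a).1.trans_le hδ, (hball a).2.trans_le hδ⟩
  have h0 : ∀ z, e (0, z) = (0, 0, z) := by
    intro z
    simp only [e, OpenPartialHomeomorph.univBall_apply_zero]
    rfl
  refine ⟨fun a => τ.symm (e a), ?_, fun a => ⟨τ.map_target (ht a), ?_⟩, ?_⟩
  · refine ((he.toOpenPartialHomeomorph e).trans τ.symm).isOpenEmbedding ?_
    ext a
    simpa using ht a
  · rw [τ.right_inv (ht a)]
    exact hball a
  · rw [hτ.eq_image, image_univ]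
    ext q
    constructor
    · rintro ⟨z, rfl⟩
      exact ⟨e (0, z), by rw [h0]; exact ⟨rfl, rfl⟩, rfl⟩
    · rintro ⟨⟨x, y, z⟩, ⟨rfl, rfl⟩, rfl⟩
      exact ⟨z, by simp only [h0]⟩

namespace SheetCoord

variable {C : SheetCoord N K c} {ε : ℝ} {O : Set M}

/-! ### Radial homeomorphisms of the tube -/

theorem par_congr_succ {j : Fin 4} {v w : ℂ} (hv : v ∈ C.pdom j) (hv' : v ∈ C.pdom (j + 1))
    (hw : w ∈ C.pdom j) (hw' : w ∈ C.pdom (j + 1)) {s s' : ℝ}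
    (h : C.par j v s = C.par (j + 1) v s') : C.par j w s = C.par (j + 1) w s' := by
  by_cases hj : j = 3
  · subst hj
    have h30 : (3 + 1 : Fin 4) = 0 := rfl
    rw [h30] at hv' hw' h ⊢
    rw [← par_last hv hv', par_eq_par_iff hv'] at h
    rw [← par_last hw hw', par_eq_par_iff hw']
    exact h
  · rw [← par_succ hj hv hv', par_eq_par_iff hv'] at h
    rw [← par_succ hj hw hw', par_eq_par_iff hw']
    exact h

theorem par_congr {j j' : Fin 4} {v w : ℂ} (hv : v ∈ C.pdom j) (hv' : v ∈ C.pdom j')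
    (hw : w ∈ C.pdom j) (hw' : w ∈ C.pdom j') {s s' : ℝ}
    (h : C.par j v s = C.par j' v s') : C.par j w s = C.par j' w s' := by
  obtain ⟨d, rfl⟩ : ∃ d, j' = j + d := ⟨j' - j, by abel⟩
  obtain rfl | rfl | rfl | rfl : d = 0 ∨ d = 1 ∨ d = 2 ∨ d = 3 := by
    fin_cases d <;> simp
  · rw [add_zero, par_eq_par_iff hv] at h
    rwa [add_zero, par_eq_par_iff hw]
  · exact par_congr_succ hv hv' hw hw' h
  · exact absurd (cquad_opposite hv.1 hv'.1) hv.2.1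
  · have hj : j + 3 + 1 = j := by
      rw [add_assoc]
      exact add_zero j
    have := par_congr_succ (s := s') (s' := s) hv' (by rwa [hj]) hw' (by rwa [hj])
      (by rw [hj]; exact h.symm)
    rw [hj] at this
    exact this.symm

open Classical in
/-- The radial map of the tube given by `f`. -/
noncomputable def radialMap (C : SheetCoord N K c) (f : ℝ ≃o ℝ) (q : M) : M :=
  if h : ∃ a : Fin 4 × ℂ × ℝ, a.2.1 ∈ C.pdom a.1 ∧ C.par a.1 a.2.1 a.2.2 = q then
    C.par h.choose.1 (radial f h.choose.2.1) h.choose.2.2 else q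

variable {f : ℝ ≃o ℝ} {b s₁ : ℝ}

theorem radial_mem_pdom (hb : 0 < b) (hf : ∀ t ≤ b, f t = t) (hs : s₁ ≤ C.rad)
    (hf' : ∀ t, s₁ ≤ t → f t = t) {j : Fin 4} {v : ℂ} (hv : v ∈ C.pdom j) :
    radial f v ∈ C.pdom j := by
  have h1 := norm_pos_iff.2 hv.2.1
  have h2 : 0 < f ‖v‖ / ‖v‖ := div_pos (orderIso_pos hb hf h1) h1
  have h3 : ‖radial f v‖ < C.rad := by
    rw [norm_radial hb hf, ← hf' _ hs]
    exact f.strictMono hv.2.2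
  refine ⟨?_, smul_ne_zero h2.ne' hv.2.1, h3⟩
  refine cquad_of_sign hv.1 ?_ ?_
  · rw [radial, Complex.smul_re, smul_eq_mul, sign_mul, sign_pos h2, one_mul]
  · rw [radial, Complex.smul_im, smul_eq_mul, sign_mul, sign_pos h2, one_mul]

theorem radialMap_par (hb : 0 < b) (hf : ∀ t ≤ b, f t = t) (hs : s₁ ≤ C.rad)
    (hf' : ∀ t, s₁ ≤ t → f t = t) {j : Fin 4} {v : ℂ} (hv : v ∈ C.pdom j) (s : ℝ) :
    C.radialMap f (C.par j v s) = C.par j (radial f v) s := by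
  have h : ∃ a : Fin 4 × ℂ × ℝ, a.2.1 ∈ C.pdom a.1 ∧ C.par a.1 a.2.1 a.2.2 = C.par j v s :=
    ⟨(j, v, s), hv, rfl⟩
  rw [radialMap, dif_pos h]
  obtain ⟨h1, h2⟩ := h.choose_spec
  have h3 := par_left_unique h1 hv h2
  rw [h3] at h1 h2 ⊢
  exact par_congr h1 hv (radial_mem_pdom hb hf hs hf' h1) (radial_mem_pdom hb hf hs hf' hv) h2

theorem radialMap_of_notMem {q : M} (hq : ∀ j, ∀ v ∈ C.pdom j, ∀ s, C.par j v s ≠ q) :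
    C.radialMap f q = q := by
  rw [radialMap, dif_neg]
  rintro ⟨a, ha, h⟩
  exact hq _ _ ha _ h

theorem radialMap_orbit (hι : IsBirkhoffSection φ ι) (hγ : γ ∈ boundaryOrbits φ ι) {q : M}
    (hq : q ∈ γ) : C.radialMap f q = q :=
  radialMap_of_notMem fun _ _ _ _ h => par_notMem_orbit hι hγ (h ▸ hq)

theorem radialMap_mem_tube (hι : IsBirkhoffSection φ ι) (hγ : γ ∈ boundaryOrbits φ ι) (hb : 0 < b)
    (hf : ∀ t ≤ b, f t = t) (hs : s₁ ≤ C.rad) (hf' : ∀ t, s₁ ≤ t → f t = t) {r : ℝ} {q : M}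
    (hq : q ∈ C.tube r) : C.radialMap f q ∈ C.tube (f r) := by
  obtain hq | ⟨j, v, hv, hr, s, rfl⟩ := hq
  · rw [radialMap_orbit hι hγ hq]
    exact Or.inl hq
  · rw [radialMap_par hb hf hs hf' hv]
    refine Or.inr ⟨j, _, radial_mem_pdom hb hf hs hf' hv, ?_, s, rfl⟩
    rw [norm_radial hb hf]
    exact f.strictMono hr

theorem radialMap_eq_self (hb : 0 < b) (hι : IsBirkhoffSection φ ι) (hγ : γ ∈ boundaryOrbits φ ι)
    (hf : ∀ t ≤ b, f t = t) (hs : s₁ ≤ C.rad) (hf' : ∀ t, s₁ ≤ t → f t = t) {q : M}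
    (hq : q ∈ C.tube b) : C.radialMap f q = q := by
  obtain hq | ⟨j, v, hv, hr, s, rfl⟩ := hq
  · exact radialMap_orbit hι hγ hq
  · rw [radialMap_par hb hf hs hf' hv, radial_eq_self _ (hf _ hr.le)]

theorem radialMap_symm (hι : IsBirkhoffSection φ ι) (hγ : γ ∈ boundaryOrbits φ ι) (hb : 0 < b)
    (hf : ∀ t ≤ b, f t = t) (hs : s₁ ≤ C.rad) (hf' : ∀ t, s₁ ≤ t → f t = t) {r : ℝ} {q : M}
    (hq : q ∈ C.tube r) : C.radialMap f.symm (C.radialMap f q) = q := by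
  obtain hq | ⟨j, v, hv, hr, s, rfl⟩ := hq
  · rw [radialMap_orbit hι hγ hq, radialMap_orbit hι hγ hq]
  · rw [radialMap_par hb hf hs hf' hv, radialMap_par hb (orderIso_symm_eq hf) hs
      (fun t ht => by rw [OrderIso.symm_apply_eq, hf' t ht]) (radial_mem_pdom hb hf hs hf' hv),
      radial_symm_radial hb hf]

theorem continuousAt_radialMap (hι : IsBirkhoffSection φ ι) (hγ : γ ∈ boundaryOrbits φ ι)
    (hτ : IsSaddleChart φ γ τ) (hb : 0 < b)
    (hf : ∀ t ≤ b, f t = t) (hs : s₁ ≤ C.rad) (hf' : ∀ t, s₁ ≤ t → f t = t) {r : ℝ} {q : M}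
    (hq : q ∈ C.tube r) : ContinuousAt (C.radialMap f) q := by
  obtain hq | ⟨j, v, hv, hr, s, rfl⟩ := hq
  · refine continuousAt_id.congr ?_
    filter_upwards [(isOpen_tube hι hγ hτ hb).mem_nhds (show q ∈ C.tube b from Or.inl hq)] with x hx
    exact (radialMap_eq_self hb hι hγ hf hs hf' hx).symm
  · intro A hA
    have key : ∀ j', ∀ᶠ q in 𝓝 (C.par j v s), (∃ w ∈ C.pdom j', ∃ s, C.par j' w s = q) →
        C.radialMap f q ∈ A := by
      intro j'
      refine eventually_quadrant hι hv j' fun hv' s' hs' => ?_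
      rw [← hs', radialMap_par hb hf hs hf' hv'] at hA
      have hc : ContinuousWithinAt (fun a : ℂ × ℝ => C.par j' (radial f a.1) a.2)
          (C.pdom j' ×ˢ univ) (v, s') := by
        refine ContinuousWithinAt.comp (g := fun a : ℂ × ℝ => C.par j' a.1 a.2)
          (f := fun a : ℂ × ℝ => (radial f a.1, a.2)) (t := C.pdom j' ×ˢ univ)
          (continuousOn_par j' _ ⟨radial_mem_pdom hb hf hs hf' hv', mem_univ _⟩) ?_
          fun a ha => ⟨radial_mem_pdom hb hf hs hf' ha.1, mem_univ _⟩
        exact (((continuous_radial hb hf).comp continuous_fst).prodMk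
          continuous_snd).continuousWithinAt
      filter_upwards [hc.eventually_mem hA, self_mem_nhdsWithin] with a ha ha'
      rw [radialMap_par hb hf hs hf' ha'.1]
      exact ha
    refine Filter.mem_map.2 ?_
    filter_upwards [eventually_all.2 key, eventually_mem (s₀ := s) hι hv hv.2.2] with q h1 h2
    obtain ⟨j', w, hw, -, hs⟩ := h2
    exact h1 j' ⟨w, hw, hs⟩

/-- A homeomorphism of the tube, fixed near the orbit, that spreads a given neighbourhood of the
orbit over a given compact set. -/
theorem IsAdapted.exists_homeomorph (hA : C.IsAdapted ε O) (hι : IsBirkhoffSection φ ι)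
    (hγ : γ ∈ boundaryOrbits φ ι) (hτ : IsSaddleChart φ γ τ) {V : Set (C.tube ε)} (hV : IsOpen V)
    (hγV : ∀ q : C.tube ε, (q : M) ∈ γ → q ∈ V) {B : Set (C.tube ε)} (hB : IsCompact B) :
    ∃ H : C.tube ε ≃ₜ C.tube ε, (∃ V' : Set (C.tube ε), IsOpen V' ∧
      (∀ q : C.tube ε, (q : M) ∈ γ → q ∈ V') ∧ ∀ x ∈ V', H x = x) ∧ B ⊆ H '' V := by
  obtain ⟨A, hAo, rfl⟩ := isOpen_induced_iff.1 hV
  obtain ⟨b, hb⟩ := exists_isAdapted (C := C) hι hγ hτ hAo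
    (fun q hq => hγV ⟨q, Or.inl hq⟩ hq)
  have hsub := hb.tube_subset hτ (fun q hq => hγV ⟨q, Or.inl hq⟩ hq)
  have hb0 := hb.pos
  have he0 := hA.pos
  set b₁ := min b (ε / 2)
  have hb₁ : 0 < b₁ := lt_min hb0 (by linarith)
  have hb₁ε : b₁ < ε := (min_le_right _ _).trans_lt (by linarith)
  have hmono : ∀ {r r' : ℝ}, r ≤ r' → C.tube r ⊆ C.tube r' := fun h =>
    union_subset_union_right _ fun q ⟨j, v, hv, hr, hs⟩ => ⟨j, v, hv, hr.trans_le h, hs⟩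
  obtain ⟨⟨s, hs⟩, hBs⟩ : ∃ s : Ioo b₁ ε, B ⊆ Subtype.val ⁻¹' (C.tube s : Set M) := by
    have : Nonempty (Ioo b₁ ε) := (nonempty_Ioo.2 hb₁ε).to_subtype
    refine hB.elim_directed_cover _ (fun s => (isOpen_tube hι hγ hτ
      (hb₁.trans s.2.1)).preimage continuous_subtype_val) ?_
      (directed_of_isDirected_le fun s s' h => preimage_mono (hmono h))
    rintro ⟨q, hq⟩ -
    rw [mem_iUnion]
    obtain hq | ⟨j, v, hv, hr, s, rfl⟩ := hq
    · exact ⟨Classical.arbitrary _, Or.inl hq⟩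
    · obtain ⟨t, ht1, ht2⟩ := exists_between (max_lt hb₁ε hr)
      exact ⟨⟨t, (le_max_left _ _).trans_lt ht1, ht2⟩, Or.inr ⟨j, v, hv,
        (le_max_right _ _).trans_lt ht1, s, rfl⟩⟩
  obtain ⟨f, hf, hfs, hf'⟩ := exists_orderIso_contraction (half_lt_self hb₁) hs.1
    (show s < (s + ε) / 2 by linarith [hs.2])
  have hb2 : 0 < b₁ / 2 := half_pos hb₁
  have hrad : (s + ε) / 2 ≤ C.rad := by linarith [hs.2, hA.le]
  have hg : ∀ t ≤ b₁ / 2, f.symm t = t := orderIso_symm_eq hf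
  have hg' : ∀ t, (s + ε) / 2 ≤ t → f.symm t = t := fun t ht => by
    rw [OrderIso.symm_apply_eq, hf' t ht]
  have hmem : ∀ {k : ℝ ≃o ℝ}, (∀ t ≤ b₁ / 2, k t = t) → (∀ t, (s + ε) / 2 ≤ t → k t = t) →
      ∀ q : C.tube ε, C.radialMap k q ∈ C.tube ε := fun {k} hk hk' q => by
    have := radialMap_mem_tube hι hγ hb2 hk hrad hk' q.2
    rwa [hk' ε (by linarith [hs.2])] at this
  have hcont : ∀ {k : ℝ ≃o ℝ} (hk : ∀ t ≤ b₁ / 2, k t = t) (hk' : ∀ t, (s + ε) / 2 ≤ t → k t = t),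
      Continuous fun q : C.tube ε => (⟨C.radialMap k q, hmem hk hk' q⟩ : C.tube ε) :=
    fun hk hk' => Continuous.subtype_mk (continuous_iff_continuousAt.2 fun q =>
      (continuousAt_radialMap hι hγ hτ hb2 hk hrad hk' q.2).comp continuousAt_subtype_val) _
  let H : C.tube ε ≃ₜ C.tube ε :=
    { toFun := fun q => ⟨C.radialMap f.symm q, hmem hg hg' q⟩
      invFun := fun q => ⟨C.radialMap f q, hmem hf hf' q⟩
      left_inv := fun q => Subtype.ext (radialMap_symm hι hγ hb2 hg hrad hg' q.2)
      right_inv := fun q => Subtype.ext (radialMap_symm hι hγ hb2 hf hrad hf' q.2)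
      continuous_toFun := hcont hg hg'
      continuous_invFun := hcont hf hf' }
  refine ⟨H, ⟨Subtype.val ⁻¹' (C.tube (b₁ / 2)),
    (isOpen_tube hι hγ hτ hb2).preimage continuous_subtype_val, fun q hq => Or.inl hq,
    fun q hq => Subtype.ext (radialMap_eq_self hb2 hι hγ hg hrad hg' hq)⟩, fun q hq => ?_⟩
  refine ⟨H.symm q, ?_, H.apply_symm_apply q⟩
  have h1 := radialMap_mem_tube hι hγ hb2 hf hrad hf' (hBs hq)
  rw [hfs] at h1
  exact (hsub (hmono (min_le_left _ _) h1)).1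

/-! ### The tube is a tubular neighbourhood -/

theorem IsAdapted.isTubularNhd (hA : C.IsAdapted ε O) (hι : IsBirkhoffSection φ ι)
    (hγ : γ ∈ boundaryOrbits φ ι) (hτ : IsSaddleChart φ γ τ) : IsTubularNhd (C.tube ε) γ := by
  have hopen : IsOpen (C.tube ε) := isOpen_tube hι hγ hτ hA.pos
  obtain ⟨δ, hδ0, hδ, hsub⟩ := exists_saddleBox_subset_tube (C := C) hι hγ hτ hA.pos
  obtain ⟨g₀, hg₀, hbox, hcore⟩ := hτ.exists_boxEmbedding hδ0 hδ.le
  have : LocallyCompactSpace (C.tube ε) := hopen.locallyCompactSpace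
  have : SigmaCompactSpace (C.tube ε) := inferInstance
  let g₁ : (ℝ × ℝ) × UnitAddCircle → C.tube ε := fun a => ⟨g₀ a, hsub (hbox a)⟩
  have hg₁ : IsOpenEmbedding g₁ :=
    (IsOpenEmbedding.of_comp_iff g₁ hopen.isOpenEmbedding_subtypeVal).1 hg₀
  obtain ⟨g, hg, hgs, hg0⟩ := exists_surjective_tube hg₁ (by
    intro V hV h0 B hB
    obtain ⟨H, ⟨V', hV', h1, h2⟩, h3⟩ := hA.exists_homeomorph hι hγ hτ hV (fun q hq => by
      obtain ⟨z, -, hz⟩ := hcore.ge hq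
      rw [show q = g₁ (0, z) from Subtype.ext hz.symm]
      exact h0 z) hB
    exact ⟨H, ⟨V', hV', fun z => h1 _ (hcore.le (mem_image_of_mem _ (mem_univ z))), h2⟩, h3⟩)
  let G : ℝ × ℝ × UnitAddCircle → M := fun v => g ((v.1, v.2.1), v.2.2)
  have hG : IsOpenEmbedding G := hopen.isOpenEmbedding_subtypeVal.comp
    (hg.comp (Homeomorph.prodAssoc ℝ ℝ UnitAddCircle).symm.isOpenEmbedding)
  have hG0 : ∀ z, G (0, 0, z) = g₀ (0, z) := fun z => congrArg Subtype.val (hg0 z)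
  refine ⟨(hG.toOpenPartialHomeomorph G).symm, ?_, by simp, ?_⟩
  · simp only [OpenPartialHomeomorph.symm_source, IsOpenEmbedding.toOpenPartialHomeomorph_target]
    ext q
    constructor
    · rintro ⟨v, rfl⟩
      exact (g _).2
    · intro hq
      obtain ⟨⟨⟨x, y⟩, z⟩, ha⟩ := hgs ⟨q, hq⟩
      exact ⟨(x, y, z), congrArg Subtype.val ha⟩
  · have hinv : ∀ v, (hG.toOpenPartialHomeomorph G).symm (G v) = v := fun v =>
      (hG.toOpenPartialHomeomorph G).left_inv (by simp)
    ext q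
    constructor
    · intro hq
      refine ⟨Or.inl hq, ?_⟩
      obtain ⟨z, -, rfl⟩ := hcore.ge hq
      change ((hG.toOpenPartialHomeomorph G).symm (g₀ (0, z))).1 = 0 ∧
        ((hG.toOpenPartialHomeomorph G).symm (g₀ (0, z))).2.1 = 0
      rw [← hG0, hinv]
      exact ⟨rfl, rfl⟩
    · rintro ⟨hq, h1, h2⟩
      obtain ⟨⟨⟨x, y⟩, z⟩, ha⟩ := hgs ⟨q, hq⟩
      obtain rfl : G (x, y, z) = q := congrArg Subtype.val ha
      rw [hinv] at h1 h2
      obtain rfl : x = 0 := h1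
      obtain rfl : y = 0 := h2
      rw [hG0]
      exact hcore.le ⟨z, mem_univ _, rfl⟩

end SheetCoord

end Tubular

end BirkhoffNormalForm

theorem mainTheorem7
    {M : Type*} [MetricSpace M] [CompactSpace M] [ChartedSpace (EuclideanSpace ℝ (Fin 3)) M]
    {S : Type*} [TopologicalSpace S] [T2Space S] [CompactSpace S]
    [ChartedSpace (EuclideanHalfSpace 2) S]
    (φ : Flow ℝ M) (hφ : IsTopologicalAnosov φ) (htr : IsTransitive φ)
    (ι : S → M) (hι : IsBirkhoffSection φ ι) (D : AlmostAnosovData φ ι)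
    (γ : Set M) (hγ : γ ∈ boundaryOrbits φ ι)
    (τ : OpenPartialHomeomorph M (ℝ × ℝ × UnitAddCircle)) (hτ : IsSaddleChart φ γ τ)
    (n : ℕ) (m : ℤ) (hnm : HasLinkingMultiplicity ι γ τ n m)
    (p : ℕ) (hp : p = numComponents ι γ)
    (O : Set M) (hO : IsOpen O) (hγO : γ ⊆ O) :
    ∃ (W : Set M) (U : Set (ℝ × ℝ)) (Θ : Fin 4 → M → ℝ × ℝ × UnitAddCircle),
      W ⊆ O ∩ τ.source ∧ IsTubularNhd W γ ∧ W ∩ ι '' bdry S = γ ∧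
      IsOpen U ∧ (0, 0) ∈ U ∧
      -- the charts, and their images
      (∀ i, IsEmbedding (fun q : puncturedQuadrant τ W γ i => Θ i q) ∧
        Θ i '' puncturedQuadrant τ W γ i =
          {v | (v.1, v.2.1) ∈ (U ∩ quadrant i) \ {(0, 0)}}) ∧
      -- the charts are smooth and take the vector field to its normal form
      (∀ i, ∀ q : D.Space, D.val q ∈ puncturedQuadrant τ W γ i →
        ∃ ξ ∈ IsManifold.maximalAtlas 𝓘(ℝ, ℝ × ℝ × ℝ) ∞ D.Space, q ∈ ξ.source ∧
          ∀ q' ∈ ξ.source, D.val q' ∈ puncturedQuadrant τ W γ i →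
            Θ i (D.val q') = toCyl (ξ q') ∧
            mfderiv 𝓘(ℝ, ℝ × ℝ × ℝ) 𝓘(ℝ, ℝ × ℝ × ℝ) ξ q' (D.vectorField q') =
              affineField D.pA.lam p n (ξ q')) ∧
      -- the pieces of the section are the horizontal pieces at the heights `k / (n p)`
      (∀ i, ∀ q ∈ puncturedQuadrant τ W γ i,
        q ∈ range ι ↔ ∃ k < n * p,
          (Θ i q).2.2 = ((((k : ℝ) / ((n : ℝ) * (p : ℝ)) : ℝ)) : UnitAddCircle)) ∧
      (∀ i, ∀ q ∈ range ι ∩ puncturedQuadrant τ W γ i, ∃ k < n * p,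
        Θ i '' connectedComponentIn (range ι ∩ puncturedQuadrant τ W γ i) q =
          {v | (v.1, v.2.1) ∈ (U ∩ quadrant i) \ {(0, 0)} ∧
            v.2.2 = ((((k : ℝ) / ((n : ℝ) * (p : ℝ)) : ℝ)) : UnitAddCircle)}) ∧
      -- and on them the charts are local isometries for the flat metric of the section
      (∀ i, ∀ e ∈ D.pA.charts, ∀ u ∈ e.source, ι u ∈ puncturedQuadrant τ W γ i →
        ∃ V ∈ 𝓝 u, ∀ u₁ ∈ V, ∀ u₂ ∈ V,
          ι u₁ ∈ puncturedQuadrant τ W γ i → ι u₂ ∈ puncturedQuadrant τ W γ i →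
          ((Θ i (ι u₁)).1 - (Θ i (ι u₂)).1) ^ 2 + ((Θ i (ι u₁)).2.1 - (Θ i (ι u₂)).2.1) ^ 2 =
            ((e u₁).1 - (e u₂).1) ^ 2 + ((e u₁).2 - (e u₂).2) ^ 2) ∧
      -- glueing along the common boundaries
      (∀ i, Θ i '' (puncturedQuadrant τ W γ i ∩ puncturedQuadrant τ W γ (i + 1)) =
          {v | (v.1, v.2.1) ∈ U ∩ halfAxis i} ∧
        Θ (i + 1) '' (puncturedQuadrant τ W γ i ∩ puncturedQuadrant τ W γ (i + 1)) =
          {v | (v.1, v.2.1) ∈ U ∩ halfAxis i} ∧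
        ∀ q ∈ puncturedQuadrant τ W γ i ∩ puncturedQuadrant τ W γ (i + 1),
          Θ (i + 1) q = ((Θ i q).1, (Θ i q).2.1, (Θ i q).2.2 +
            ((if i = 3 then (m : ℝ) / (n : ℝ) else 0 : ℝ) : UnitAddCircle))) := by
  subst hp
  obtain ⟨N⟩ := D.nonempty_sectionCoord hι hφ.nonsingular hγ hτ
  obtain ⟨C₀, hC₀, -⟩ := N.exists_collar_loop hι hγ hτ hnm
  obtain ⟨c, ⟨C⟩⟩ := N.exists_sheetCoord hι hγ hτ ⟨C₀, hC₀⟩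
  obtain ⟨ε, hA⟩ := SheetCoord.exists_isAdapted (C := C) hι hγ hτ hO hγO
  have hdvd : ((n * numComponents ι γ : ℕ) : ℤ) ∣ n * (numComponents ι γ * c) :=
    ⟨c, by push_cast; ring⟩
  refine ⟨C.tube ε, disk ε, C.chart, hA.tube_subset hτ hγO, hA.isTubularNhd hι hγ hτ,
    SheetCoord.tube_inter hι hγ ε, isOpen_disk ε, zero_mem_disk hA.pos,
    fun i => ⟨hA.isEmbedding_chart hι hγ i, hA.image_chart hι hγ i⟩,
    fun i q hq => SheetCoord.exists_affine_chart rfl (fun q hq => ?_) hq,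
    hA.mem_range_iff hι hγ rfl, hA.image_component hι hγ rfl, hA.isometry hι hγ,
    hA.glue hι hγ (SheetCoord.monodromy_eq hdvd hι hφ.nonsingular hγ hτ hnm hA)⟩
  obtain ⟨v, hv, -, s, hs⟩ := (hA.mem_puncturedQuadrant_iff hι hγ).1 hq
  exact ⟨v, hv, s, hs⟩
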